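/- Let $n\ge 2$, let $\Gamma$ be a discrete group of isometries of the real hyperbolic space $\mathbb H^n$ (ball model, with boundary at infinity $\mathbb S^{n-1}$), possibly with torsion, such that $M=\Gamma\backslash\mathbb H^n$ has finite volume. Let $\pi$ be the base point projection from $T^1\mathbb H^n$ to $\mathbb H^n$, or from $T^1M=\Gamma\backslash T^1\mathbb H^n$ to $M$; let $v_-,v_+$ be the endpoints at infinity of the geodesic line defined by $v\in T^1\mathbb H^n$; let $\beta_\xi(x,y)=\lim_{t\to+\infty}d(\xi_t,x)-d(\xi_t,y)$ be the Busemann cocycle, where $t\mapsto\xi_t$ is a geodesic ray with endpoint $\xi$; let $\delta$ be the critical exponent of $\Gamma$. Let $(\mu_x)_{x\in\mathbb H^n}$ be a Patterson density for $\Gamma$: finite measures on $\mathbb S^{n-1}$ with support the limit set of $\Gamma$, such that $\gamma_*\mu_x=\mu_{\gamma x}$ for $\gamma\in\Gamma$ and $\frac{d\mu_x}{d\mu_y}(\xi)=e^{-\delta\beta_\xi(x,y)}$. Assume that it is normalised so that $\|\mu_x\|=\operatorname{Vol}(\mathbb S^{n-1})$ for all $x$, where $\|\cdot\|$ is the total mass.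 Fix $x_0\in\mathbb H^n$. **Measures.** The Bowen–Margulis measure on $T^1\mathbb H^n$ is $$d\widetilde m_{\rm BM}(v)=e^{\delta\beta_{v_-}(x_0,\pi(v))+\delta\beta_{v_+}(x_0,\pi(v))}\,d\mu_{x_0}(v_-)\,d\mu_{x_0}(v_+)\,dt$$ in Hopf's parametrisation $v\mapsto(v_-,v_+,t)$ with respect to $x_0$. For a nonempty proper closed convex subset $D$ of $\mathbb H^n$, the outer unit normal bundle $\partial^1_+D$ is the set of $v\in T^1\mathbb H^n$ such that $v_+\notin\partial_\infty D$ and $\pi(v)$ is the closest point to $v_+$ in $D$ (the point of $D$ minimising $y\mapsto\beta_{v_+}(y,x_0)$), and $\partial^1_-D=-\partial^1_+D$. The skinning measure $\widetilde\sigma^\pm_D$ is the measure on $\partial^1_\pm D$ given, in the parametrisation $v\mapsto v_\pm$, by $d\widetilde\sigma^\pm_D(v)=e^{\delta\beta_{v_\pm}(x_0,\pi(v))}\,d\mu_{x_0}(v_\pm)$. For $\mathcal D=(\gamma D)_{\gamma\in\Gamma}$, put $\widetilde\sigma^\pm_{\mathcal D}=\sum_{\gamma\in\Gamma/\Gamma_D}\widetilde\sigma^\pm_{\gamma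 D}$, where $\Gamma_D$ is the stabiliser of $D$ in $\Gamma$. The measures $m_{\rm BM}$ and $\sigma^\pm_{\mathcal D}$ on $T^1M$ are those induced by $\widetilde m_{\rm BM}$ and $\widetilde\sigma^\pm_{\mathcal D}$; here an invariant measure $\widetilde\mu$ induces on the quotient the measure $\mu$ with $\mu(p(A))=\int_A\frac{d\widetilde\mu(x)}{\operatorname{Card}(\Gamma_x)}$ for every Borel set $A$ on which the projection $p$ to the quotient is injective. $\operatorname{Vol}$ denotes Riemannian measures (on a quotient: the measure, or its total mass, with $\operatorname{Vol}(p(A))=\operatorname{Vol}(A)$ for such $A$, without weights). The Liouville measure $\operatorname{Vol}_{T^1\mathbb H^n}$ is the integral over $\mathbb H^n$, for $\operatorname{Vol}_{\mathbb H^n}$, of the spherical measures of the unit tangent spheres, and $\operatorname{Vol}_{T^1M}$ is its quotient measure. The measure $\operatorname{Vol}_{\partial^1_\pm D}$ is the integral over $x\in\partial D$, for $\operatorname{Vol}_{\partial D}$, of the spherical measure on the set $\partial^1_\pm D\cap T^1_x\mathbb H^n$ of outer/inner unit normal vectors at $x$. 1. We have $m_{\rm BM}=2^{n-1}\operatorname{Vol}_{T^1M}$.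 In particular $\|m_{\rm BM}\|=2^{n-1}\operatorname{Vol}(\mathbb S^{n-1})\operatorname{Vol}(M)$ and $\pi_*m_{\rm BM}=2^{n-1}\operatorname{Vol}(\mathbb S^{n-1})\operatorname{Vol}_M$. 2. If $D$ is a horoball in $\mathbb H^n$, then $\widetilde\sigma^\pm_D=2^{n-1}\operatorname{Vol}_{\partial^1_\pm D}$ and $\pi_*\widetilde\sigma^\pm_D=2^{n-1}\operatorname{Vol}_{\partial D}$. If moreover $D$ is centred at a parabolic fixed point of $\Gamma$ and $\mathcal D=(\gamma D)_{\gamma\in\Gamma}$, then $$\|\sigma^\pm_{\mathcal D}\|=2^{n-1}\operatorname{Vol}(\Gamma_D\backslash\partial^1_\pm D)=2^{n-1}(n-1)\operatorname{Vol}(\Gamma_D\backslash D).$$ 3. If $D$ is a (complete) totally geodesic submanifold of $\mathbb H^n$ of dimension $k\in\{1,\dots,n-1\}$, then $\widetilde\sigma^+_D=\widetilde\sigma^-_D=\operatorname{Vol}_{\partial^1_\pm D}$ and $\pi_*\widetilde\sigma^\pm_D=\operatorname{Vol}(\mathbb S^{n-k-1})\operatorname{Vol}_D$. If moreover $\Gamma_D\backslash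 D$ is a properly immersed suborbifold of $M$ of finite volume and $\mathcal D=(\gamma D)_{\gamma\in\Gamma}$, then $$\|\sigma^\pm_{\mathcal D}\|=\operatorname{Vol}(\Gamma_D\backslash\partial^1_\pm D),$$ and, if $m$ is the number of elements of $\Gamma$ that fix $D$ pointwise, $$\|\sigma^\pm_{\mathcal D}\|=\frac1m\operatorname{Vol}(\mathbb S^{n-k-1})\operatorname{Vol}(\Gamma_D\backslash D).$$ -/

import Mathlib

open MeasureTheory Filter Topology
open scoped ENNReal Pointwise

noncomputable section

/-- Euclidean `n`-space. -/
abbrev Euc (n : ℕ) : Type := EuclideanSpace ℝ (Fin n)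

/-- The boundary at infinity of hyperbolic `n`-space: the Euclidean unit sphere of `ℝⁿ`. -/
abbrev Bdry (n : ℕ) : Type := Metric.sphere (0 : Euc n) 1

/-- Real hyperbolic `n`-space (curvature `-1`), in the ball model: the open unit ball of `ℝⁿ`, with
the Riemannian metric `4 |dx|² / (1 - |x|²)²`. -/
structure Hyp (n : ℕ) where
  val : Euc n
  norm_lt : ‖val‖ < 1

namespace Hyp

variable {n : ℕ}

/-- The denominator in Möbius addition. -/
def mobDenom (x u : Euc n) : ℝ := 1 + 2 * inner ℝ x u + ‖x‖ ^ 2 * ‖u‖ ^ 2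

/-- Möbius addition `x ⊕ u` on the ball; `u ↦ x ⊕ u` is the hyperbolic translation of the ball that
sends `0` to `x`, and its differential at `0` is `1 - |x|²` times the identity. -/
def mob (x u : Euc n) : Euc n :=
  (mobDenom x u)⁻¹ • ((1 + 2 * inner ℝ x u + ‖u‖ ^ 2) • x + (1 - ‖x‖ ^ 2) • u)

theorem mobDenom_pos {x u : Euc n} (hx : ‖x‖ < 1) (hu : ‖u‖ < 1) : 0 < mobDenom x u := by
  have h1 : -(‖x‖ * ‖u‖) ≤ inner ℝ x u := (abs_le.mp (abs_real_inner_le_norm x u)).1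
  have h2 : ‖x‖ * ‖u‖ < 1 := by nlinarith [norm_nonneg x, norm_nonneg u]
  unfold mobDenom
  nlinarith [mul_pos (sub_pos.2 h2) (sub_pos.2 h2)]

theorem one_sub_pos {x : Euc n} (hx : ‖x‖ < 1) : 0 < 1 - ‖x‖ ^ 2 := by
  nlinarith [norm_nonneg x]

theorem one_sub_norm_mob {x u : Euc n} (hx : ‖x‖ < 1) (hu : ‖u‖ < 1) :
    1 - ‖mob x u‖ ^ 2 = (1 - ‖x‖ ^ 2) * (1 - ‖u‖ ^ 2) / mobDenom x u := by
  have hD := (mobDenom_pos hx hu).ne'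
  rw [mob, norm_smul, mul_pow, norm_add_sq_real, norm_smul, norm_smul, inner_smul_left,
    inner_smul_right]
  simp only [Real.norm_eq_abs, mul_pow, sq_abs, conj_trivial]
  field_simp
  unfold mobDenom
  ring

theorem norm_mob_sub {x u w : Euc n} (hx : ‖x‖ < 1) (hu : ‖u‖ < 1) (hw : ‖w‖ < 1) :
    ‖mob x u - mob x w‖ ^ 2 =
      (1 - ‖x‖ ^ 2) ^ 2 * ‖u - w‖ ^ 2 / (mobDenom x u * mobDenom x w) := by
  have hD := (mobDenom_pos hx hu).ne'
  have hE := (mobDenom_pos hx hw).ne'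
  rw [norm_sub_sq_real (mob x u), norm_sub_sq_real u w, mob, mob, norm_smul, norm_smul, mul_pow,
    mul_pow, norm_add_sq_real, norm_add_sq_real]
  simp only [norm_smul, inner_smul_left, inner_smul_right, inner_add_left, inner_add_right,
    Real.norm_eq_abs, mul_pow, sq_abs, conj_trivial, real_inner_self_eq_norm_sq,
    real_inner_comm x u]
  field_simp
  unfold mobDenom
  ring

theorem norm_mob_lt {x u : Euc n} (hx : ‖x‖ < 1) (hu : ‖u‖ < 1) : ‖mob x u‖ < 1 := by
  have h := one_sub_norm_mob hx hu
  have : 0 < 1 - ‖mob x u‖ ^ 2 := by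
    rw [h]; exact div_pos (mul_pos (one_sub_pos hx) (one_sub_pos hu)) (mobDenom_pos hx hu)
  nlinarith [norm_nonneg (mob x u)]

/-- `sinh (d(x,y) / 2)`, where `d` is the hyperbolic distance of the ball model. -/
def sinhHalf (x y : Euc n) : ℝ := ‖x - y‖ / √((1 - ‖x‖ ^ 2) * (1 - ‖y‖ ^ 2))

theorem sinhHalf_mob {x u w : Euc n} (hx : ‖x‖ < 1) (hu : ‖u‖ < 1) (hw : ‖w‖ < 1) :
    sinhHalf (mob x u) (mob x w) = sinhHalf u w := by
  have hD := mobDenom_pos hx hu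
  have hE := mobDenom_pos hx hw
  have h1 := one_sub_pos hx
  have h2 := one_sub_pos hu
  have h3 := one_sub_pos hw
  have hn : ‖mob x u - mob x w‖ =
      (1 - ‖x‖ ^ 2) * ‖u - w‖ / √(mobDenom x u * mobDenom x w) := by
    rw [← sq_eq_sq₀ (norm_nonneg _) (by positivity), norm_mob_sub hx hu hw, div_pow, mul_pow,
      Real.sq_sqrt (by positivity)]
  rw [sinhHalf, sinhHalf, one_sub_norm_mob hx hu, one_sub_norm_mob hx hw, hn]
  have : (1 - ‖x‖ ^ 2) * (1 - ‖u‖ ^ 2) / mobDenom x u *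
        ((1 - ‖x‖ ^ 2) * (1 - ‖w‖ ^ 2) / mobDenom x w)
      = (1 - ‖x‖ ^ 2) ^ 2 * ((1 - ‖u‖ ^ 2) * (1 - ‖w‖ ^ 2)) / (mobDenom x u * mobDenom x w) := by
    field_simp
  rw [this, Real.sqrt_div (by positivity), Real.sqrt_mul (sq_nonneg (1 - ‖x‖ ^ 2)),
    Real.sqrt_sq h1.le]
  have := (Real.sqrt_pos.2 (mul_pos hD hE)).ne'
  have := (Real.sqrt_pos.2 (mul_pos h2 h3)).ne'
  field_simp

theorem mob_neg_self (x : Euc n) : mob (-x) x = 0 := by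
  have : (1 + 2 * inner ℝ (-x) x + ‖x‖ ^ 2) • (-x) + (1 - ‖-x‖ ^ 2) • x = 0 := by
    rw [inner_neg_left, real_inner_self_eq_norm_sq, norm_neg, smul_neg, ← neg_smul, ← add_smul]
    convert zero_smul ℝ x using 2
    ring
  rw [mob, this, smul_zero]

theorem arsinh_sinhHalf_le {u w : Euc n} (hu : ‖u‖ < 1) (hw : ‖w‖ < 1) :
    Real.arsinh (sinhHalf u w) ≤ Real.arsinh (sinhHalf u 0) + Real.arsinh (sinhHalf 0 w) := by
  have h2 := one_sub_pos hu
  have h3 := one_sub_pos hw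
  rw [← Real.sinh_le_sinh, Real.sinh_add, Real.sinh_arsinh, Real.sinh_arsinh, Real.sinh_arsinh,
    Real.cosh_arsinh, Real.cosh_arsinh]
  have e1 : sinhHalf u 0 = ‖u‖ / √(1 - ‖u‖ ^ 2) := by simp [sinhHalf]
  have e2 : sinhHalf 0 w = ‖w‖ / √(1 - ‖w‖ ^ 2) := by simp [sinhHalf]
  have c : ∀ a : ℝ, 0 < 1 - a ^ 2 → √(1 + (a / √(1 - a ^ 2)) ^ 2) = 1 / √(1 - a ^ 2) := by
    intro a ha
    rw [div_pow, Real.sq_sqrt ha.le, ← Real.sqrt_one, ← Real.sqrt_div (by norm_num)]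
    congr 1
    rw [Real.sqrt_one]
    field_simp
    ring
  rw [e1, e2, c _ h2, c _ h3, sinhHalf, Real.sqrt_mul h2.le]
  have p2 := Real.sqrt_pos.2 h2
  have p3 := Real.sqrt_pos.2 h3
  have : ‖u‖ / √(1 - ‖u‖ ^ 2) * (1 / √(1 - ‖w‖ ^ 2)) + 1 / √(1 - ‖u‖ ^ 2) * (‖w‖ / √(1 - ‖w‖ ^ 2))
      = (‖u‖ + ‖w‖) / (√(1 - ‖u‖ ^ 2) * √(1 - ‖w‖ ^ 2)) := by field_simp
  rw [this]
  gcongr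
  exact norm_sub_le u w

/-- The Riemannian distance of the ball model: `sinh (d(x,y)/2) = |x - y| / √((1-|x|²)(1-|y|²))`. -/
instance : MetricSpace (Hyp n) where
  dist x y := 2 * Real.arsinh (sinhHalf x.val y.val)
  dist_self x := by simp [sinhHalf]
  dist_comm x y := by simp [sinhHalf, norm_sub_rev, mul_comm]
  dist_triangle x y z := by
    have hy : ‖-y.val‖ < 1 := by rw [norm_neg]; exact y.norm_lt
    have h := arsinh_sinhHalf_le (norm_mob_lt hy x.norm_lt) (norm_mob_lt hy z.norm_lt)
    rw [← mob_neg_self y.val, sinhHalf_mob hy x.norm_lt z.norm_lt,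
      sinhHalf_mob hy x.norm_lt y.norm_lt, sinhHalf_mob hy y.norm_lt z.norm_lt] at h
    linarith
  eq_of_dist_eq_zero {x y} h := by
    have h1 := one_sub_pos x.norm_lt
    have h2 := one_sub_pos y.norm_lt
    have h3 : sinhHalf x.val y.val = 0 := by
      rw [← Real.arsinh_eq_zero_iff]; linarith
    rw [sinhHalf, div_eq_zero_iff] at h3
    rcases h3 with h3 | h3
    · cases x; cases y; congr; exact sub_eq_zero.1 (norm_eq_zero.1 h3)
    · exact absurd h3 (Real.sqrt_pos.2 (mul_pos h1 h2)).ne'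

instance : MeasurableSpace (Hyp n) := borel _
instance : BorelSpace (Hyp n) := ⟨rfl⟩

theorem norm_tanh_smul_lt (t : ℝ) (e : Bdry n) :
    ‖Real.tanh (t / 2) • (e : Euc n)‖ < 1 := by
  rw [norm_smul, norm_eq_of_mem_sphere, mul_one, Real.norm_eq_abs, abs_lt]
  exact Real.tanh_bijOn.mapsTo (Set.mem_univ _)

/-- The unit speed geodesic line `t ↦ x ⊕ tanh(t/2) e`. Its velocity at time `0` is the unit tangent
vector `((1 - |x|²)/2) e` at `x`. As the ball metric is conformal, `e ↦ line x e` identifies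
(isometrically) the Euclidean unit sphere with the unit tangent sphere at `x`. -/
def line (x : Hyp n) (e : Bdry n) (t : ℝ) : Hyp n :=
  ⟨mob x.val (Real.tanh (t / 2) • (e : Euc n)), norm_mob_lt x.norm_lt (norm_tanh_smul_lt t e)⟩

theorem isometry_line (x : Hyp n) (e : Bdry n) : Isometry (line x e) := by
  refine Isometry.of_dist_eq fun s t => ?_
  have key : sinhHalf (Real.tanh (s / 2) • (e : Euc n)) (Real.tanh (t / 2) • (e : Euc n))
      = Real.sinh (|s - t| / 2) := by
    have c : ∀ a : ℝ, 1 - ‖Real.tanh a • (e : Euc n)‖ ^ 2 = 1 / Real.cosh a ^ 2 := by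
      intro a
      have := Real.cosh_pos a
      rw [norm_smul, norm_eq_of_mem_sphere, mul_one, Real.norm_eq_abs, sq_abs,
        Real.tanh_eq_sinh_div_cosh, div_pow]
      field_simp
      linarith [Real.cosh_sq a]
    have p := Real.cosh_pos (s / 2)
    have q := Real.cosh_pos (t / 2)
    rw [sinhHalf, c, c, ← sub_smul, norm_smul, norm_eq_of_mem_sphere, mul_one, Real.norm_eq_abs,
      div_mul_div_comm, one_mul, ← mul_pow, Real.sqrt_div (by norm_num), Real.sqrt_one,
      Real.sqrt_sq (by positivity), Real.tanh_eq_sinh_div_cosh, Real.tanh_eq_sinh_div_cosh,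
      div_sub_div _ _ p.ne' q.ne', mul_comm (Real.cosh (s / 2)) (Real.sinh (t / 2)),
      mul_comm (Real.sinh (t / 2)), ← Real.sinh_sub, abs_div, abs_of_pos (mul_pos p q),
      one_div, div_inv_eq_mul, div_mul_cancel₀ _ (mul_pos p q).ne', Real.abs_sinh]
    congr 1
    rw [← sub_div, abs_div, abs_of_pos (by norm_num : (0:ℝ) < 2)]
  change 2 * Real.arsinh (sinhHalf (mob _ _) (mob _ _)) = _
  rw [sinhHalf_mob x.norm_lt (norm_tanh_smul_lt s e) (norm_tanh_smul_lt t e), key,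
    Real.arsinh_sinh, Real.dist_eq]
  ring

/-- The centre of the ball. -/
def origin : Hyp n := ⟨0, by simp⟩

/-! ### Isometries, unit tangent bundle, points at infinity -/

/-- Isometries act on hyperbolic space. -/
instance : MulAction (Hyp n ≃ᵢ Hyp n) (Hyp n) where
  smul g x := g x
  one_smul _ := rfl
  mul_smul _ _ _ := rfl

/-- A group of isometries is discrete for the topology of pointwise convergence (which, on the
isometry group, is also the compact-open topology). -/
def IsDiscreteGroup (Γ : Subgroup (Hyp n ≃ᵢ Hyp n)) : Prop :=
  @DiscreteTopology Γ (TopologicalSpace.induced (fun g x => (g : Hyp n ≃ᵢ Hyp n) x)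
    (inferInstance : TopologicalSpace (Hyp n → Hyp n)))

variable (n) in
/-- The unit tangent bundle: a unit tangent vector is identified with the (unit speed, parametrised)
geodesic line of which it is the velocity at time `0`. -/
structure UnitTangent where
  toFun : ℝ → Hyp n
  isometry : Isometry toFun

namespace UnitTangent

/-- Pointwise convergence of geodesic lines, which gives the usual topology of the unit tangent
bundle. -/
instance : TopologicalSpace (UnitTangent n) :=
  TopologicalSpace.induced UnitTangent.toFun inferInstance

instance : MeasurableSpace (UnitTangent n) := borel _
instance : BorelSpace (UnitTangent n) := ⟨rfl⟩

/-- The base point projection. -/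
def base (v : UnitTangent n) : Hyp n := v.toFun 0

/-- The antipodal map `v ↦ -v`. -/
def flip (v : UnitTangent n) : UnitTangent n :=
  ⟨fun t => v.toFun (-t), v.isometry.comp (Isometry.of_dist_eq fun s t => by simp)⟩

/-- Isometries act on geodesic lines by postcomposition. -/
instance : MulAction (Hyp n ≃ᵢ Hyp n) (UnitTangent n) where
  smul g v := ⟨fun t => g (v.toFun t), g.isometry.comp v.isometry⟩
  one_smul _ := rfl
  mul_smul _ _ _ := rfl

/-- The unit tangent vector at `x` with Euclidean direction `e`. -/
def ofDir (x : Hyp n) (e : Bdry n) : UnitTangent n := ⟨line x e, isometry_line x e⟩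

theorem nonempty_bdry (v : UnitTangent n) : Nonempty (Bdry n) := by
  have h : (v.toFun 0).val - (v.toFun 1).val ≠ 0 := by
    intro h
    have h1 : v.toFun 0 = v.toFun 1 := by
      cases h0 : v.toFun 0; cases h1 : v.toFun 1
      rw [h0, h1] at h
      congr
      exact sub_eq_zero.1 h
    exact zero_ne_one (v.isometry.injective h1)
  exact ⟨⟨‖(v.toFun 0).val - (v.toFun 1).val‖⁻¹ • ((v.toFun 0).val - (v.toFun 1).val),
    by simp [norm_smul, inv_mul_cancel₀ (norm_ne_zero_iff.2 h)]⟩⟩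

/-- The positive endpoint `v₊`: the limit of `v(t)` in the closed ball as `t → +∞`. -/
def plusEnd (v : UnitTangent n) : Bdry n :=
  @Classical.epsilon _ v.nonempty_bdry fun ξ =>
    Tendsto (fun t => (v.toFun t).val) atTop (𝓝 (ξ : Euc n))

/-- The negative endpoint `v₋`: the limit of `v(t)` as `t → -∞`. -/
def minusEnd (v : UnitTangent n) : Bdry n := v.flip.plusEnd

end UnitTangent

/-- The geodesic ray from the centre of the ball to the point at infinity `ξ`. -/
def ray (ξ : Bdry n) (t : ℝ) : Hyp n := line origin ξ t

/-- The action of an isometry on the boundary at infinity: `g ξ` is the limit of the image under `g`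
of a geodesic ray to `ξ`. -/
def bdryMap (g : Hyp n ≃ᵢ Hyp n) (ξ : Bdry n) : Bdry n :=
  @Classical.epsilon _ ⟨ξ⟩ fun η => Tendsto (fun t => (g (ray ξ t)).val) atTop (𝓝 (η : Euc n))

/-- The Busemann cocycle `β_ξ(x, y) = lim_{t → +∞} d(ρ_ξ(t), x) - d(ρ_ξ(t), y)`. -/
def busemann (ξ : Bdry n) (x y : Hyp n) : ℝ :=
  limUnder atTop fun t : ℝ => dist (ray ξ t) x - dist (ray ξ t) y

/-- The points at infinity of a subset of hyperbolic space. -/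
def bdryAtInfinity (D : Set (Hyp n)) : Set (Bdry n) :=
  {ξ | (ξ : Euc n) ∈ closure (Hyp.val '' D)}

/-! ### Patterson densities -/

/-- The limit set of `Γ`: the accumulation points at infinity of an orbit. -/
def limitSet (Γ : Subgroup (Hyp n ≃ᵢ Hyp n)) : Set (Bdry n) :=
  bdryAtInfinity (MulAction.orbit Γ (origin : Hyp n))

/-- The critical exponent of `Γ`:
`limsup_N (1/N) log #{γ ∈ Γ | N - 1 < d(x, γ x) ≤ N}`, with `x` the centre of the ball. -/
def critExp (Γ : Subgroup (Hyp n ≃ᵢ Hyp n)) : ℝ :=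
  (limsup (fun N : ℕ => ENNReal.log
      ({γ : Γ | (N : ℝ) - 1 < dist (origin : Hyp n) (γ • origin) ∧
        dist (origin : Hyp n) (γ • origin) ≤ N}.encard : ℝ≥0∞) / (N : EReal)) atTop).toReal

/-- A Patterson density for `Γ` and the zero potential, of dimension the critical exponent of `Γ`. -/
structure IsPattersonDensity (Γ : Subgroup (Hyp n ≃ᵢ Hyp n))
    (μ : Hyp n → Measure (Bdry n)) : Prop where
  finite : ∀ x, IsFiniteMeasure (μ x)
  support : ∀ x, (μ x).support = limitSet Γ
  equivariant : ∀ γ ∈ Γ, ∀ x, (μ x).map (bdryMap γ) = μ (γ x)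
  density : ∀ x y, μ x = (μ y).withDensity
    fun ξ => ENNReal.ofReal (Real.exp (-(critExp Γ * busemann ξ x y)))

/-! ### Bowen-Margulis and skinning measures upstairs -/

/-- The time coordinate of Hopf's parametrisation with respect to `x₀`: the signed distance along `v`
from the point of the line closest to `x₀` to the base point of `v`. -/
def hopfTime (x₀ : Hyp n) (v : UnitTangent n) : ℝ :=
  Classical.epsilon fun t : ℝ => ∀ s, dist x₀ (v.toFun (-t)) ≤ dist x₀ (v.toFun s)

/-- Hopf's parametrisation `v ↦ (v₋, v₊, t)`. -/
def hopf (x₀ : Hyp n) (v : UnitTangent n) : (Bdry n × Bdry n) × ℝ :=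
  ((v.minusEnd, v.plusEnd), hopfTime x₀ v)

/-- The Bowen-Margulis measure on the unit tangent bundle of hyperbolic space, with density
`exp (δ β_{v₋}(x₀, π v) + δ β_{v₊}(x₀, π v))` with respect to `dμ_{x₀}(v₋) dμ_{x₀}(v₊) dt` in Hopf's
parametrisation. -/
def bowenMargulis (Γ : Subgroup (Hyp n ≃ᵢ Hyp n)) (μ : Hyp n → Measure (Bdry n)) (x₀ : Hyp n) :
    Measure (UnitTangent n) :=
  ((((μ x₀).prod (μ x₀)).prod volume).comap (hopf x₀)).withDensity fun v =>
    ENNReal.ofReal (Real.exp (critExp Γ * busemann v.minusEnd x₀ v.base +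
      critExp Γ * busemann v.plusEnd x₀ v.base))

/-- The two signs: `plus` for outer, `minus` for inner. -/
inductive Sgn
  | plus
  | minus

/-- The endpoint `v₊` or `v₋`. -/
def endpoint : Sgn → UnitTangent n → Bdry n
  | Sgn.plus, v => v.plusEnd
  | Sgn.minus, v => v.minusEnd

/-- The outer unit normal bundle of (the boundary of) a closed convex set `D`: the `v` for which
`v₊` is not at infinity of `D` and the closest point to `v₊` in `D`, that is the point of `D`
minimising `y ↦ β_{v₊}(y, x₀)` (equivalently `β_{v₊}(y, π v) ≥ 0` on `D`), is the base point of `v`. -/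
def outerNormal (D : Set (Hyp n)) : Set (UnitTangent n) :=
  {v | v.plusEnd ∉ bdryAtInfinity D ∧ v.base ∈ D ∧ ∀ y ∈ D, 0 ≤ busemann v.plusEnd y v.base}

/-- The outer unit normal bundle `∂¹₊D` and the inner one `∂¹₋D = -∂¹₊D`. -/
def normalBundle : Sgn → Set (Hyp n) → Set (UnitTangent n)
  | Sgn.plus, D => outerNormal D
  | Sgn.minus, D => UnitTangent.flip '' outerNormal D

/-- The outer and inner skinning measures of `D` upstairs: in terms of the parametrisation
`v ↦ v_±` of `∂¹_±D`, they have density `exp (δ β_{v_±}(x₀, π v))` with respect to `μ_{x₀}`. They are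
considered as measures on the unit tangent bundle. -/
def skinning (Γ : Subgroup (Hyp n ≃ᵢ Hyp n)) (μ : Hyp n → Measure (Bdry n)) (x₀ : Hyp n)
    (s : Sgn) (D : Set (Hyp n)) : Measure (UnitTangent n) :=
  (((μ x₀).comap fun v : normalBundle s D => endpoint s v.1).withDensity fun v =>
    ENNReal.ofReal (Real.exp (critExp Γ * busemann (endpoint s v.1) x₀ v.1.base))).map Subtype.val

/-- The skinning measure upstairs of the family `(γ D)_{γ ∈ Γ}`: the sum of the skinning measures of
the distinct translates of `D`, which are indexed by `Γ / Γ_D`. -/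
def familySkinning (Γ : Subgroup (Hyp n ≃ᵢ Hyp n)) (μ : Hyp n → Measure (Bdry n)) (x₀ : Hyp n)
    (s : Sgn) (D : Set (Hyp n)) : Measure (UnitTangent n) :=
  Measure.sum fun D' : MulAction.orbit Γ D => skinning Γ μ x₀ s D'.1

/-! ### Measures on quotients -/

section Quotients

variable {G X : Type*} [Group G] [MulAction G X] [MeasurableSpace X]

/-- `m` is the measure induced on `G \ X` by the invariant measure `m'` on `X`: if a Borel set `A` is
mapped injectively to the quotient, then the measure of its image is `∫_A 1/|G_x| dm'(x)`. In other
words, on the set of points with stabiliser of order `k`, the measure `k m` is the one for which the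
projection locally preserves the measure. -/
def IsInducedMeasure (m' : Measure X) (m : Measure (MulAction.orbitRel.Quotient G X)) : Prop :=
  ∀ A : Set X, MeasurableSet A →
    Set.InjOn (fun x => (Quotient.mk'' x : MulAction.orbitRel.Quotient G X)) A →
    m ((fun x => (Quotient.mk'' x : MulAction.orbitRel.Quotient G X)) '' A) =
      ∫⁻ x in A, (Nat.card (MulAction.stabilizer G x) : ℝ≥0∞)⁻¹ ∂m'

variable (G) in
/-- The measure induced on `G \ X` by the invariant measure `m'`. -/
def inducedMeasure (m' : Measure X) : Measure (MulAction.orbitRel.Quotient G X) :=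
  Classical.epsilon fun m => IsInducedMeasure m' m

/-- `m` is the quotient measure of `m'` without weights: if a Borel set is mapped injectively to the
quotient, then its measure is preserved. If `m'` is a Riemannian measure, this is the Riemannian
measure of the quotient orbifold, whether or not some elements of `G` act trivially. -/
def IsQuotientMeasure (m' : Measure X) (m : Measure (MulAction.orbitRel.Quotient G X)) : Prop :=
  ∀ A : Set X, MeasurableSet A →
    Set.InjOn (fun x => (Quotient.mk'' x : MulAction.orbitRel.Quotient G X)) A →
    m ((fun x => (Quotient.mk'' x : MulAction.orbitRel.Quotient G X)) '' A) = m' A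

variable (G) in
/-- The Riemannian measure on `G \ X` coming from the invariant Riemannian measure `m'`. -/
def quotientMeasure (m' : Measure X) : Measure (MulAction.orbitRel.Quotient G X) :=
  Classical.epsilon fun m => IsQuotientMeasure m' m

variable (G) in
/-- The total mass of the Riemannian measure on `G \ X`. -/
def quotientVol (m' : Measure X) : ℝ≥0∞ := quotientMeasure G m' Set.univ

end Quotients

/-- The base point projection `π : T¹M → M`, where `M = Γ \ Hyp n`. -/
def quotientBase (Γ : Subgroup (Hyp n ≃ᵢ Hyp n)) :
    MulAction.orbitRel.Quotient Γ (UnitTangent n) → MulAction.orbitRel.Quotient Γ (Hyp n) :=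
  Quotient.map' UnitTangent.base (by rintro _ v ⟨γ, rfl⟩; exact ⟨γ, rfl⟩)

/-! ### Riemannian measures upstairs -/

/-- The volume of the unit sphere `S^d` of `ℝ^{d+1}`. -/
def sphereVol (d : ℕ) : ℝ≥0∞ := (μHE[d] : Measure (Bdry (d + 1))) Set.univ

/-- The Riemannian measure of a `d`-dimensional submanifold `S` of hyperbolic space, as a measure on
the ambient space: the `d`-dimensional Hausdorff measure of the Riemannian distance, normalised as
usual (so that it is Lebesgue measure on `ℝ^d`), restricted to `S`. -/
def riemVol (d : ℕ) (S : Set (Hyp n)) : Measure (Hyp n) := (μHE[d] : Measure (Hyp n)).restrict S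

/-- The `f`-dimensional spherical measure on the set of the elements of `N` that are unit tangent
vectors at `x`. -/
def fibreVol (f : ℕ) (N : Set (UnitTangent n)) (x : Hyp n) : Measure (UnitTangent n) :=
  ((μHE[f] : Measure (Bdry n)).restrict {e | UnitTangent.ofDir x e ∈ N}).map (UnitTangent.ofDir x)

/-- The Liouville measure: `∫ dVol_{T¹ₓ} dVol(x)`. -/
def liouville : Measure (UnitTangent n) :=
  (riemVol n (Set.univ : Set (Hyp n))).bind (fibreVol (n - 1) Set.univ)

/-- The Riemannian measure of `∂¹_±D` when `∂D` is a submanifold of dimension `d`: the integral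
over `∂D`, for its Riemannian measure, of the spherical measures on the `(n - 1 - d)`-dimensional
spheres `∂¹_±D ∩ T¹ₓ` of unit normal vectors. -/
def normalVol (d : ℕ) (s : Sgn) (D : Set (Hyp n)) : Measure (UnitTangent n) :=
  (riemVol d (frontier D)).bind (fibreVol (n - 1 - d) (normalBundle s D))

/-! ### Horoballs and totally geodesic submanifolds -/

/-- The horoball centred at `ξ` whose boundary contains `p`. -/
def horoball (ξ : Bdry n) (p : Hyp n) : Set (Hyp n) := {x | busemann ξ x p ≤ 0}

/-- `ξ` is a parabolic fixed point of `Γ`: it is fixed by a parabolic element of `Γ`, that is by an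
isometry without fixed point in hyperbolic space and with exactly one fixed point at infinity. -/
def IsParabolicFixedPoint (Γ : Subgroup (Hyp n ≃ᵢ Hyp n)) (ξ : Bdry n) : Prop :=
  ∃ γ ∈ Γ, (∀ x, γ x ≠ x) ∧ ∀ η, bdryMap γ η = η ↔ η = ξ

/-- `D` is a (complete) totally geodesic submanifold of dimension `k`: an isometrically embedded
copy of hyperbolic `k`-space. -/
def IsTotallyGeodesic (k : ℕ) (D : Set (Hyp n)) : Prop :=
  ∃ f : Hyp k → Hyp n, Isometry f ∧ D = Set.range f

/-- The family `(γ D)_{γ ∈ Γ}` is locally finite: a compact set meets finitely many distinct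
translates of `D`. Equivalently, the map `Γ_D \ D → Γ \ Hyp n` is proper. -/
def IsProperlyImmersed (Γ : Subgroup (Hyp n ≃ᵢ Hyp n)) (D : Set (Hyp n)) : Prop :=
  ∀ K : Set (Hyp n), IsCompact K → {D' ∈ MulAction.orbit Γ D | (D' ∩ K).Nonempty}.Finite

end Hyp

end

/-!
All measures in the statement are expressed by explicit densities with respect to Hausdorff measures
of spheres and of hyperbolic space, and these densities are compared. Write `n = m + 1`.

**The density at infinity.** In the ball model the Busemann cocycle is a difference of logarithms of
the Poisson kernel `P(x, ξ) = (1 - ‖x‖ ^ 2) / ‖ξ - x‖ ^ 2` (`Hyp.busemann_eq`), so a Patterson density is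
`P(x, ξ) ^ δ dμ₀(ξ)` with `μ₀` its value at the centre. First, `δ = m` (`Hyp.critExp_eq`): the measure
`dμ_x(v₊) dvol(x)` on the unit tangent bundle is `Γ`-invariant, and has mass
`Vol(S ^ m) * Vol(M)` modulo `Γ`, which is finite and positive; the geodesic flow at time `t` commutes
with `Γ` and multiplies this measure by `exp ((m - δ) * t)`, so this factor is `1`. Second, `μ₀` is the
spherical measure (`Hyp.IsPattersonDensity.eq_visual`): by the normalisation, all Poisson integrals of
`μ₀` are equal to `Vol(S ^ m)`, and by the symmetry `P(r η, ξ) = P(r ξ, η)` one has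
`∫ (∫ P(r ξ, η) ^ m f(η) dη) dμ₀(ξ) = Vol(S ^ m) * ∫ f(η) dη`; as `r` tends to `1` the inner integral
tends to `Vol(S ^ m) * f(ξ)`. Hence the Patterson density consists of the visual measures
`P(x, ξ) ^ m dξ`, which are equivariant under all isometries.

**Coordinates.** Three systems of coordinates are used: the point `Hyp.horo ξ η s` of the geodesic line
from `η` to `ξ` at which `log P(·, ξ) = s`, the endpoints of a unit tangent vector with a time parameter,
and the endpoint of the normal ray that starts at a point of a hyperbolic subspace in a given direction.
In each of them the square of the chordal distance of the sphere, or the square of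
`2 * sinh (d / 2)` for the hyperbolic distance `d`, is an exact sum of products of conformal factors and
squared distances (`Hyp.sinh_dist_horo`, `Hyp.dist_normalEnd_sq`, `Hyp.dist_mobBdry_sq`). Such an
identity gives the change of variables for Hausdorff measures, by a comparison on small sets
(`map_conformal_euclideanHausdorffMeasure`, `map_prod_euclideanHausdorffMeasure`); no derivatives are
needed.

**The measures upstairs.** In terms of the endpoints `η`, `ξ` and of the arc length, the Liouville measure
has density `(2 / ‖η - ξ‖ ^ 2) ^ m` and the Bowen-Margulis measure has density `(4 / ‖η - ξ‖ ^ 2) ^ m`,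
whence the factor `2 ^ m` (`Hyp.bowenMargulis_eq`). The skinning measure of a convex set is the image of
the measure at infinity which is at each `η` the visual measure seen from the point of the convex set
closest to `η` (`Hyp.IsEndParam.skinning_eq`). For a horoball, horospherical coordinates give the
Riemannian measure of the horosphere times `2 ^ m` (`Hyp.skinning_hball`). For a totally geodesic
submanifold, normal coordinates give the product of the Riemannian measure and of the spherical measures
of the normal directions (`Hyp.skinning_totallyGeodesic`).

**The measures downstairs.** A discrete group acts properly, so there are weights: functions `w` with
`∑ γ, w (γ x) = 1` for all `x`. The mass of an induced measure is the integral of any weight, and the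
volume of a quotient is the integral of a weight times the orders of the stabilisers; the mass of a sum
of measures over an orbit is the integral, for one of these, of a weight for its stabiliser
(`Hyp.lintegral_sum_orbit`). So all masses in the statement are integrals over the horosphere or over the
submanifold of the same weight. It remains to compare stabilisers. They are almost everywhere trivial on
hyperbolic space, on its unit tangent bundle, on horospheres and on unit normal bundles, because the
fixed points of a non-trivial isometry are, up to a translation, in a proper linear subspace. On a totally
geodesic submanifold they consist almost everywhere of the elements that fix it pointwise
(`Hyp.ae_stabCard_totallyGeodesic`), whence the inverse of their number. A horoball is foliated by geodesic rays
orthogonal to its boundary, along which the volume element is `exp (-m * s)`; this gives the ratio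
`1 / m` of the volumes of the quotients of the horoball and of its boundary (`Hyp.map_horoProj`).
-/

open MeasureTheory Filter Topology
open scoped ENNReal Pointwise

noncomputable section

/-! ### Measures that are locally almost equal -/

section LocalComparison

/-- An inequality of measures on small measurable sets around each point of `s` holds on all
measurable subsets of `s`: cover by countably many small open sets and make these disjoint. -/
theorem restrict_le_of_locally_le {X : Type*} [TopologicalSpace X] [SecondCountableTopology X]
    [MeasurableSpace X] [OpensMeasurableSpace X] {μ ν : Measure X} {s : Set X}
    (h : ∀ x ∈ s, ∃ U : Set X, IsOpen U ∧ x ∈ U ∧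
      ∀ A ⊆ U ∩ s, MeasurableSet A → μ A ≤ ν A) {A : Set X} (hA : MeasurableSet A) (hAs : A ⊆ s) :
    μ A ≤ ν A := by
  choose! U hUo hxU hU using h
  obtain ⟨t, hts, htc, hst⟩ := TopologicalSpace.countable_cover_nhdsWithin
    (s := s) (f := U) fun x hx => mem_nhdsWithin_of_mem_nhds ((hUo x hx).mem_nhds (hxU x hx))
  rcases A.eq_empty_or_nonempty with rfl | hne
  · simp
  have htne : t.Nonempty := by
    obtain ⟨a, ha⟩ := hne
    obtain ⟨x, hx, -⟩ := Set.mem_iUnion₂.1 (hst (hAs ha))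
    exact ⟨x, hx⟩
  obtain ⟨f, hf⟩ := htc.exists_eq_range htne
  have hft : ∀ i, f i ∈ t := fun i => hf ▸ Set.mem_range_self i
  let W : ℕ → Set X := fun i => A ∩ disjointed (fun i => U (f i)) i
  have hWm : ∀ i, MeasurableSet (W i) := fun i =>
    hA.inter (MeasurableSet.disjointed (fun i => (hUo _ (hts (hft i))).measurableSet) i)
  have hWd : Pairwise (Function.onFun Disjoint W) := fun i j hij =>
    (disjoint_disjointed _ hij).mono Set.inter_subset_right Set.inter_subset_right
  have hAW : A = ⋃ i, W i := by
    rw [← Set.inter_iUnion, iUnion_disjointed, Set.left_eq_inter]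
    intro a ha
    obtain ⟨x, hx, hax⟩ := Set.mem_iUnion₂.1 (hst (hAs ha))
    obtain ⟨i, rfl⟩ : x ∈ Set.range f := hf ▸ hx
    exact Set.mem_iUnion.2 ⟨i, hax⟩
  rw [hAW, measure_iUnion hWd hWm, measure_iUnion hWd hWm]
  refine ENNReal.tsum_le_tsum fun i => hU (f i) (hts (hft i)) _ (fun a ha => ⟨?_, hAs ha.1⟩) (hWm i)
  exact disjointed_subset (fun i => U (f i)) i ha.2

/-- If, near every point of `Ω`, the map `F` multiplies `m` by the constant value of `J` up to a
factor close to `1`, then `F` transports `J m` to `μ`. -/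
theorem map_withDensity_eq_of_locally_comparable {X Z : Type*} [TopologicalSpace X]
    [SecondCountableTopology X] [MeasurableSpace X] [OpensMeasurableSpace X]
    [MeasurableSpace Z] {m : Measure X} {μ : Measure Z} {F : X → Z} {Ω : Set X}
    {J : X → ℝ} (hΩ : MeasurableSet Ω) (hJ : ContinuousOn J Ω) (hJpos : ∀ x ∈ Ω, 0 < J x)
    (hFm : Measurable F) (hFi : Set.InjOn F Ω)
    (hF : ∀ A ⊆ Ω, MeasurableSet A → MeasurableSet (F '' A))
    (h : ∀ x ∈ Ω, ∀ C : ℝ, 1 < C → ∃ U : Set X, IsOpen U ∧ x ∈ U ∧ ∀ A ⊆ U ∩ Ω, MeasurableSet A →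
      μ (F '' A) ≤ ENNReal.ofReal (C * J x) * m A ∧
      ENNReal.ofReal (J x) * m A ≤ ENNReal.ofReal C * μ (F '' A)) :
    ((m.restrict Ω).withDensity fun x => ENNReal.ofReal (J x)).map F = μ.restrict (F '' Ω) := by
  -- the pull-back of `μ` to `Ω`
  let ν : Measure X := (μ.comap fun x : Ω => F x).map Subtype.val
  have hν : ∀ A ⊆ Ω, MeasurableSet A → ν A = μ (F '' A) := by
    intro A hA hAm
    rw [Measure.map_apply measurable_subtype_coe hAm, Measure.comap_apply]
    · congr 1
      ext z
      constructor
      · rintro ⟨x, hx, rfl⟩; exact ⟨x, hx, rfl⟩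
      · rintro ⟨x, hx, rfl⟩; exact ⟨⟨x, hA hx⟩, hx, rfl⟩
    · exact fun x y hxy => Subtype.ext (hFi x.2 y.2 hxy)
    · intro s hs
      have := hF (Subtype.val '' s) (by rintro _ ⟨x, -, rfl⟩; exact x.2) (hΩ.subtype_image hs)
      rwa [Set.image_image] at this
    · exact measurable_subtype_coe hAm
  let κ : Measure X := (m.restrict Ω).withDensity fun x => ENNReal.ofReal (J x)
  have hκ : ∀ A ⊆ Ω, MeasurableSet A → κ A = ∫⁻ x in A, ENNReal.ofReal (J x) ∂m := by
    intro A hA hAm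
    rw [withDensity_apply _ hAm, Measure.restrict_restrict hAm, Set.inter_eq_left.2 hA]
  -- by continuity `J` is constant near each point up to a factor `C`, whence the factor `C * C`
  have key : ∀ A ⊆ Ω, MeasurableSet A → ∀ C : ℝ, 1 < C →
      ν A ≤ (ENNReal.ofReal (C * C)) * κ A ∧ κ A ≤ (ENNReal.ofReal (C * C)) * ν A := by
    intro A hA hAm C hC
    have hC0 : 0 < C := by linarith
    have loc : ∀ x ∈ Ω, ∃ U : Set X, IsOpen U ∧ x ∈ U ∧ ∀ A ⊆ U ∩ Ω, MeasurableSet A →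
        ν A ≤ (ENNReal.ofReal (C * C) • κ) A ∧ κ A ≤ (ENNReal.ofReal (C * C) • ν) A := by
      intro x hx
      obtain ⟨U, hUo, hxU, hU⟩ := h x hx C hC
      have hJx := hJpos x hx
      have e1 : ∀ᶠ y in 𝓝[Ω] x, J x < C * J y :=
        (tendsto_const_nhds.mul (hJ x hx)).eventually (lt_mem_nhds (by nlinarith))
      have e2 : ∀ᶠ y in 𝓝[Ω] x, J y < C * J x :=
        (hJ x hx).eventually (gt_mem_nhds (by nlinarith))
      obtain ⟨V, hVo, hxV, hV⟩ := mem_nhdsWithin.1 (e1.and e2)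
      refine ⟨U ∩ V, hUo.inter hVo, ⟨hxU, hxV⟩, fun B hB hBm => ?_⟩
      have hBΩ : B ⊆ Ω := fun b hb => (hB hb).2
      obtain ⟨h1, h2⟩ := hU B (fun b hb => ⟨(hB hb).1.1, (hB hb).2⟩) hBm
      have hBV : ∀ b ∈ B, J x < C * J b ∧ J b < C * J x := fun b hb =>
        hV ⟨(hB hb).1.2, hBΩ hb⟩
      have k1 : ENNReal.ofReal (J x) * m B ≤ ENNReal.ofReal C * κ B := by
        rw [hκ B hBΩ hBm, ← lintegral_const_mul' _ _ ENNReal.ofReal_ne_top,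
          ← setLIntegral_const]
        refine setLIntegral_mono' hBm fun b hb => ?_
        rw [← ENNReal.ofReal_mul hC0.le]
        exact ENNReal.ofReal_le_ofReal (hBV b hb).1.le
      have k2 : κ B ≤ ENNReal.ofReal C * (ENNReal.ofReal (J x) * m B) := by
        rw [hκ B hBΩ hBm, ← mul_assoc, ← setLIntegral_const]
        refine setLIntegral_mono' hBm fun b hb => ?_
        rw [← ENNReal.ofReal_mul hC0.le]
        exact ENNReal.ofReal_le_ofReal (hBV b hb).2.le
      rw [Measure.smul_apply, Measure.smul_apply, smul_eq_mul, smul_eq_mul, hν B hBΩ hBm,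
        ENNReal.ofReal_mul hC0.le, mul_assoc, mul_assoc]
      constructor
      · rw [ENNReal.ofReal_mul hC0.le, mul_assoc] at h1
        exact h1.trans (by gcongr)
      · exact k2.trans (by gcongr)
    constructor
    · exact restrict_le_of_locally_le (ν := ENNReal.ofReal (C * C) • κ) (s := Ω)
        (fun x hx => by
          obtain ⟨U, h1, h2, h3⟩ := loc x hx
          exact ⟨U, h1, h2, fun B hB hBm => (h3 B hB hBm).1⟩) hAm hA
    · exact restrict_le_of_locally_le (ν := ENNReal.ofReal (C * C) • ν) (s := Ω)
        (fun x hx => by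
          obtain ⟨U, h1, h2, h3⟩ := loc x hx
          exact ⟨U, h1, h2, fun B hB hBm => (h3 B hB hBm).2⟩) hAm hA
  -- let the multiplicative error tend to `1`
  have lim : ∀ a b : ℝ≥0∞, (∀ C : ℝ, 1 < C → a ≤ ENNReal.ofReal (C * C) * b) → a ≤ b := by
    intro a b hab
    have t : Tendsto (fun C : ℝ => ENNReal.ofReal (C * C) * b) (𝓝[>] 1) (𝓝 (1 * b)) := by
      refine ENNReal.Tendsto.mul_const ?_ (Or.inl one_ne_zero)
      have : Continuous fun C : ℝ => ENNReal.ofReal (C * C) :=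
        ENNReal.continuous_ofReal.comp (by fun_prop)
      simpa using (this.tendsto 1).mono_left nhdsWithin_le_nhds
    rw [one_mul] at t
    exact ge_of_tendsto t (eventually_nhdsWithin_of_forall fun C hC => hab C hC)
  have eqA : ∀ A ⊆ Ω, MeasurableSet A → κ A = ν A := fun A hA hAm =>
    le_antisymm (lim _ _ fun C hC => (key A hA hAm C hC).2)
      (lim _ _ fun C hC => (key A hA hAm C hC).1)
  ext B hB
  rw [Measure.map_apply hFm hB, Measure.restrict_apply hB]
  have hs : MeasurableSet (F ⁻¹' B ∩ Ω) := (hFm hB).inter hΩ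
  have : F '' (F ⁻¹' B ∩ Ω) = B ∩ F '' Ω := by
    rw [Set.image_preimage_inter]
  rw [← this, ← hν _ Set.inter_subset_right hs, ← eqA _ Set.inter_subset_right hs]
  change κ _ = κ _
  simp only [κ]
  rw [withDensity_apply _ (hFm hB), withDensity_apply _ hs, Measure.restrict_restrict hs,
    Measure.restrict_restrict (hFm hB), Set.inter_assoc, Set.inter_self]

end LocalComparison

/-! ### Change of variables for Hausdorff measures -/

section AreaFormula

/-- If `g` factors through `f` on `s` by a `C`-Lipschitz map, then `g` has a smaller image in
measure, up to `C ^ d`. No injectivity is assumed: the inequality between distances makes the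
factorisation well defined. -/
theorem euclideanHausdorffMeasure_image_le_image {ι X Z : Type*} [MetricSpace X] [MeasurableSpace X]
    [BorelSpace X] [MetricSpace Z] [MeasurableSpace Z] [BorelSpace Z] {f : ι → X} {g : ι → Z}
    {s : Set ι} {C : ℝ} (hC : 0 ≤ C)
    (h : ∀ a ∈ s, ∀ b ∈ s, dist (g a) (g b) ≤ C * dist (f a) (f b)) (d : ℕ) :
    (μHE[d] : Measure Z) (g '' s) ≤ ENNReal.ofReal (C ^ d) * (μHE[d] : Measure X) (f '' s) := by
  rcases s.eq_empty_or_nonempty with rfl | ⟨a₀, ha₀⟩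
  · simp
  have hex : ∀ x : X, ∃ a : ι, x ∈ f '' s → a ∈ s ∧ f a = x := by
    intro x
    by_cases hx : x ∈ f '' s
    · obtain ⟨a, ha, rfl⟩ := hx
      exact ⟨a, fun _ => ⟨ha, rfl⟩⟩
    · exact ⟨a₀, fun h => absurd h hx⟩
  choose k hk using hex
  have hL : LipschitzOnWith C.toNNReal (g ∘ k) (f '' s) := by
    refine LipschitzOnWith.of_dist_le_mul fun x hx y hy => ?_
    have := h _ (hk x hx).1 _ (hk y hy).1
    rw [(hk x hx).2, (hk y hy).2] at this
    simpa [Real.coe_toNNReal _ hC] using this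
  have hsub : g '' s ⊆ (g ∘ k) '' (f '' s) := by
    rintro _ ⟨b, hb, rfl⟩
    have hfb : f b ∈ f '' s := ⟨b, hb, rfl⟩
    refine ⟨f b, hfb, ?_⟩
    have := h _ (hk _ hfb).1 b hb
    rw [(hk _ hfb).2, dist_self, mul_zero] at this
    exact dist_le_zero.1 this
  have := (measure_mono hsub).trans (hL.hausdorffMeasure_image_le (d := (d : ℝ)) (Nat.cast_nonneg d))
  rw [Measure.euclideanHausdorffMeasure_def, Measure.euclideanHausdorffMeasure_def,
    Measure.smul_apply, Measure.smul_apply, ENNReal.smul_def, ENNReal.smul_def, smul_eq_mul,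
    smul_eq_mul, mul_left_comm]
  gcongr
  rwa [ENNReal.rpow_natCast, ← ENNReal.ofReal, ← ENNReal.ofReal_pow hC] at this

/-- `ψ` is a function of the distance which is equivalent to it at short range. -/
def IsGauge (ψ : ℝ → ℝ) : Prop :=
  ∀ C : ℝ, 1 < C → ∃ δ > 0, ∀ t, 0 ≤ t → t < δ → t ^ 2 ≤ C * ψ t ^ 2 ∧ ψ t ^ 2 ≤ C * t ^ 2

theorem isGauge_id : IsGauge fun t => t :=
  fun C hC => ⟨1, one_pos, fun t _ _ => ⟨by nlinarith [sq_nonneg t], by nlinarith [sq_nonneg t]⟩⟩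

theorem isGauge_sinh : IsGauge fun t => 2 * Real.sinh (t / 2) := by
  intro C hC
  have hc : Tendsto (fun t : ℝ => (t⁻¹ * (2 * Real.sinh (t / 2))) ^ 2) (𝓝[≠] 0) (𝓝 1) := by
    have hd : HasDerivAt (fun t : ℝ => 2 * Real.sinh (t / 2)) 1 0 := by
      have := (((hasDerivAt_id (0 : ℝ)).div_const 2).sinh).const_mul 2
      simpa using this
    have := (hasDerivAt_iff_tendsto_slope_zero.1 hd).pow 2
    simpa using this
  obtain ⟨δ, hδ, h⟩ := Metric.eventually_nhds_iff.1
    (eventually_nhdsWithin_iff.1 (hc.eventually (gt_mem_nhds hC)))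
  refine ⟨δ, hδ, fun t ht htδ => ?_⟩
  have h1 : t / 2 ≤ Real.sinh (t / 2) := Real.self_le_sinh_iff.2 (by linarith)
  constructor
  · nlinarith
  · rcases ht.eq_or_lt with rfl | ht'
    · simp
    have h3 := h (y := t) (by rwa [Real.dist_eq, sub_zero, abs_of_nonneg ht]) ht'.ne'
    calc (2 * Real.sinh (t / 2)) ^ 2 = (t⁻¹ * (2 * Real.sinh (t / 2))) ^ 2 * t ^ 2 := by
          field_simp
      _ ≤ _ := by gcongr

theorem exists_one_lt_pow_le {K : ℝ} (hK : 1 < K) (N : ℕ) : ∃ C : ℝ, 1 < C ∧ C ^ N ≤ K := by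
  have hc : Tendsto (fun t : ℝ => t ^ N) (𝓝[>] 1) (𝓝 1) := by
    have : Continuous fun t : ℝ => t ^ N := by fun_prop
    simpa using (this.tendsto 1).mono_left nhdsWithin_le_nhds
  obtain ⟨C, h1, h2⟩ := ((hc.eventually (gt_mem_nhds hK)).and self_mem_nhdsWithin).exists
  exact ⟨C, h2, h1.le⟩

theorem dist_lt_of_mem_ball_half {W : Type*} [MetricSpace W] {u v w : W} {δ : ℝ}
    (hu : u ∈ Metric.ball w (δ / 2)) (hv : v ∈ Metric.ball w (δ / 2)) : dist u v < δ := by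
  have := dist_triangle_right u v w
  rw [Metric.mem_ball] at hu hv
  linarith

/-- Local form of a change of metric: if `F` satisfies an identity between gauges of distances, then
near `p₀` it almost multiplies the distance by the constant given by the identity at `p₀`. -/
theorem exists_nhds_dist_sq_le {P Z : Type*} [TopologicalSpace P] [MetricSpace Z]
    {X Y : Type*} [MetricSpace X] [MetricSpace Y] {f : P → X} {g : P → Y} {F : P → Z} {Ω : Set P}
    {a b : P → ℝ} {ψX ψY ψZ : ℝ → ℝ} (hψX : IsGauge ψX) (hψY : IsGauge ψY) (hψZ : IsGauge ψZ)
    (hf : Continuous f) (hg : Continuous g) (hF : ContinuousOn F Ω)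
    (ha : ContinuousOn a Ω) (hb : ContinuousOn b Ω)
    (hapos : ∀ p ∈ Ω, 0 < a p) (hbpos : ∀ p ∈ Ω, 0 < b p)
    (h : ∀ p ∈ Ω, ∀ q ∈ Ω, ψZ (dist (F p) (F q)) ^ 2 =
      a p * a q * ψX (dist (f p) (f q)) ^ 2 + b p * b q * ψY (dist (g p) (g q)) ^ 2)
    {p₀ : P} (hp₀ : p₀ ∈ Ω) {C : ℝ} (hC : 1 < C) :
    ∃ U : Set P, IsOpen U ∧ p₀ ∈ U ∧ ∀ p ∈ U ∩ Ω, ∀ q ∈ U ∩ Ω,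
      dist (F p) (F q) ^ 2 ≤
        C ^ 4 * (a p₀ ^ 2 * dist (f p) (f q) ^ 2 + b p₀ ^ 2 * dist (g p) (g q) ^ 2) ∧
      a p₀ ^ 2 * dist (f p) (f q) ^ 2 + b p₀ ^ 2 * dist (g p) (g q) ^ 2 ≤
        C ^ 4 * dist (F p) (F q) ^ 2 := by
  have hC0 : 0 < C := by linarith
  obtain ⟨δX, hδX, hX⟩ := hψX C hC
  obtain ⟨δY, hδY, hY⟩ := hψY C hC
  obtain ⟨δZ, hδZ, hZ⟩ := hψZ C hC
  have ha0 := hapos p₀ hp₀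
  have hb0 := hbpos p₀ hp₀
  have e1 : ∀ᶠ y in 𝓝[Ω] p₀, a p₀ < C * a y :=
    (tendsto_const_nhds.mul (ha p₀ hp₀)).eventually (lt_mem_nhds (by nlinarith))
  have e2 : ∀ᶠ y in 𝓝[Ω] p₀, a y < C * a p₀ :=
    (ha p₀ hp₀).eventually (gt_mem_nhds (by nlinarith))
  have e3 : ∀ᶠ y in 𝓝[Ω] p₀, b p₀ < C * b y :=
    (tendsto_const_nhds.mul (hb p₀ hp₀)).eventually (lt_mem_nhds (by nlinarith))
  have e4 : ∀ᶠ y in 𝓝[Ω] p₀, b y < C * b p₀ :=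
    (hb p₀ hp₀).eventually (gt_mem_nhds (by nlinarith))
  have e5 : ∀ᶠ y in 𝓝[Ω] p₀, f y ∈ Metric.ball (f p₀) (δX / 2) :=
    hf.continuousWithinAt.eventually (Metric.ball_mem_nhds _ (by positivity))
  have e6 : ∀ᶠ y in 𝓝[Ω] p₀, g y ∈ Metric.ball (g p₀) (δY / 2) :=
    hg.continuousWithinAt.eventually (Metric.ball_mem_nhds _ (by positivity))
  have e7 : ∀ᶠ y in 𝓝[Ω] p₀, F y ∈ Metric.ball (F p₀) (δZ / 2) :=
    (hF p₀ hp₀).eventually (Metric.ball_mem_nhds _ (by positivity))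
  obtain ⟨V, hVo, hxV, hV⟩ := mem_nhdsWithin.1
    (e1.and (e2.and (e3.and (e4.and (e5.and (e6.and e7))))))
  refine ⟨V, hVo, hxV, fun p hp q hq => ?_⟩
  obtain ⟨p1, p2, p3, p4, p5, p6, p7⟩ := hV hp
  obtain ⟨q1, q2, q3, q4, q5, q6, q7⟩ := hV hq
  obtain ⟨x1, x2⟩ := hX _ dist_nonneg (dist_lt_of_mem_ball_half p5 q5)
  obtain ⟨y1, y2⟩ := hY _ dist_nonneg (dist_lt_of_mem_ball_half p6 q6)
  obtain ⟨z1, z2⟩ := hZ _ dist_nonneg (dist_lt_of_mem_ball_half p7 q7)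
  rw [h p hp.2 q hq.2] at z1 z2
  have hap := hapos p hp.2
  have haq := hapos q hq.2
  have hbp := hbpos p hp.2
  have hbq := hbpos q hq.2
  have A1 : a p * a q ≤ C ^ 2 * a p₀ ^ 2 := by
    calc a p * a q ≤ (C * a p₀) * (C * a p₀) := by gcongr
      _ = _ := by ring
  have A2 : a p₀ ^ 2 ≤ C ^ 2 * (a p * a q) := by
    calc a p₀ ^ 2 = a p₀ * a p₀ := by ring
      _ ≤ (C * a p) * (C * a q) := by gcongr
      _ = _ := by ring
  have B1 : b p * b q ≤ C ^ 2 * b p₀ ^ 2 := by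
    calc b p * b q ≤ (C * b p₀) * (C * b p₀) := by gcongr
      _ = _ := by ring
  have B2 : b p₀ ^ 2 ≤ C ^ 2 * (b p * b q) := by
    calc b p₀ ^ 2 = b p₀ * b p₀ := by ring
      _ ≤ (C * b p) * (C * b q) := by gcongr
      _ = _ := by ring
  constructor
  · calc _ ≤ _ := z1
      _ ≤ C * (C ^ 2 * a p₀ ^ 2 * (C * dist (f p) (f q) ^ 2) +
          C ^ 2 * b p₀ ^ 2 * (C * dist (g p) (g q) ^ 2)) := by gcongr
      _ = _ := by ring
  · calc a p₀ ^ 2 * dist (f p) (f q) ^ 2 + b p₀ ^ 2 * dist (g p) (g q) ^ 2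
        ≤ C ^ 2 * (a p * a q) * (C * ψX (dist (f p) (f q)) ^ 2) +
          C ^ 2 * (b p * b q) * (C * ψY (dist (g p) (g q)) ^ 2) := by gcongr
      _ = C ^ 3 * (a p * a q * ψX (dist (f p) (f q)) ^ 2 +
          b p * b q * ψY (dist (g p) (g q)) ^ 2) := by ring
      _ ≤ C ^ 3 * (C * dist (F p) (F q) ^ 2) := by gcongr
      _ = _ := by ring

/-- Conformal change of variables: if `F` multiplies distances infinitesimally by `a`, then it
multiplies the `d`-dimensional Hausdorff measure by `a ^ d`. -/
theorem map_conformal_euclideanHausdorffMeasure {X Z : Type*} [MetricSpace X] [PolishSpace X]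
    [MeasurableSpace X] [BorelSpace X] [MetricSpace Z] [MeasurableSpace Z] [BorelSpace Z]
    {F : X → Z} {Ω : Set X} {a : X → ℝ} {ψX ψZ : ℝ → ℝ} (hψX : IsGauge ψX) (hψZ : IsGauge ψZ)
    (hΩ : MeasurableSet Ω) (hFm : Measurable F) (hF : ContinuousOn F Ω) (hFi : Set.InjOn F Ω)
    (ha : ContinuousOn a Ω) (hapos : ∀ p ∈ Ω, 0 < a p)
    (h : ∀ p ∈ Ω, ∀ q ∈ Ω, ψZ (dist (F p) (F q)) ^ 2 = a p * a q * ψX (dist p q) ^ 2) (d : ℕ) :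
    (((μHE[d] : Measure X).restrict Ω).withDensity fun x => ENNReal.ofReal (a x ^ d)).map F =
      (μHE[d] : Measure Z).restrict (F '' Ω) := by
  refine map_withDensity_eq_of_locally_comparable hΩ (ha.pow d) (fun x hx => pow_pos (hapos x hx) d)
    hFm hFi (fun A hA hAm => hAm.image_of_continuousOn_injOn (hF.mono hA) (hFi.mono hA)) ?_
  intro x hx K hK
  obtain ⟨C, hC, hCK⟩ := exists_one_lt_pow_le hK (2 * d)
  have hC0 : 0 < C := by linarith
  have hax := hapos x hx
  obtain ⟨U, hUo, hxU, hU⟩ := exists_nhds_dist_sq_le (f := fun x : X => x) (g := fun _ : X => ())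
    (b := fun _ => 1) hψX isGauge_id hψZ continuous_id continuous_const hF ha continuousOn_const
    hapos (fun _ _ => one_pos) (fun p hp q hq => by simpa using h p hp q hq) hx hC
  refine ⟨U, hUo, hxU, fun A hA _ => ?_⟩
  have l1 : ∀ p ∈ A, ∀ q ∈ A, dist (F p) (F q) ≤ C ^ 2 * a x * dist p q := by
    intro p hp q hq
    have := (hU p (hA hp) q (hA hq)).1
    simp only [dist_self, ne_eq, OfNat.ofNat_ne_zero, not_false_eq_true, zero_pow, mul_zero,
      add_zero] at this
    refine le_of_sq_le_sq ?_ (by positivity)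
    nlinarith
  have l2 : ∀ p ∈ A, ∀ q ∈ A, dist p q ≤ C ^ 2 * (a x)⁻¹ * dist (F p) (F q) := by
    intro p hp q hq
    have := (hU p (hA hp) q (hA hq)).2
    simp only [dist_self, ne_eq, OfNat.ofNat_ne_zero, not_false_eq_true, zero_pow, mul_zero,
      add_zero] at this
    have h2 : a x * dist p q ≤ C ^ 2 * dist (F p) (F q) := by
      refine le_of_sq_le_sq ?_ (by positivity)
      nlinarith
    rw [mul_right_comm, ← div_eq_mul_inv, le_div_iff₀ hax]
    linarith
  have m1 := euclideanHausdorffMeasure_image_le_image (f := fun x : X => x) (by positivity) l1 d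
  have m2 := euclideanHausdorffMeasure_image_le_image (g := fun x : X => x) (by positivity) l2 d
  rw [Set.image_id'] at m1 m2
  have hCd : (C ^ 2) ^ d ≤ K := by rwa [← pow_mul]
  constructor
  · refine m1.trans ?_
    gcongr
    rw [mul_pow]
    gcongr
  · calc ENNReal.ofReal (a x ^ d) * (μHE[d] : Measure X) A
        ≤ ENNReal.ofReal (a x ^ d) *
          (ENNReal.ofReal ((C ^ 2 * (a x)⁻¹) ^ d) * (μHE[d] : Measure Z) (F '' A)) := by gcongr
      _ = ENNReal.ofReal ((C ^ 2) ^ d) * (μHE[d] : Measure Z) (F '' A) := by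
        rw [← mul_assoc, ← ENNReal.ofReal_mul (by positivity)]
        congr 2
        rw [mul_pow, mul_left_comm, ← mul_pow (a x), mul_inv_cancel₀ hax.ne', one_pow, mul_one]
      _ ≤ _ := by gcongr

end AreaFormula

/-! ### Hausdorff measures and products -/

section ProductFormula

/-- A metric space is locally Euclidean of dimension `p`, in the metric sense, if near each of its
points it is almost isometric to a subset of Euclidean space. The charts are restrictions of
continuous maps defined on the whole space. -/
def IsLocallyEuclidean (p : ℕ) (X : Type*) [MetricSpace X] : Prop :=
  ∀ x : X, ∀ C : ℝ, 1 < C → ∃ φ : X → Euc p, Continuous φ ∧ ∃ U : Set X, IsOpen U ∧ x ∈ U ∧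
    ∀ y ∈ U, ∀ z ∈ U, dist y z ≤ C * dist (φ y) (φ z) ∧ dist (φ y) (φ z) ≤ C * dist y z

theorem isLocallyEuclidean_real : IsLocallyEuclidean 1 ℝ := by
  intro x C hC
  refine ⟨fun t => EuclideanSpace.single 0 t, ?_, Set.univ, isOpen_univ, trivial, fun y _ z _ => ?_⟩
  · exact (Isometry.of_dist_eq fun s t => PiLp.dist_single_same 2 (fun _ => ℝ) 0 s t).continuous
  · rw [PiLp.dist_single_same]
    have := dist_nonneg (x := y) (y := z)
    constructor <;> nlinarith

theorem euclideanHausdorffMeasure_one_real : (μHE[1] : Measure ℝ) = volume := by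
  have := InnerProductSpace.euclideanHausdorffMeasure_eq_volume (V := ℝ)
  rwa [Module.finrank_self] at this

variable {X Y Z : Type*} [MetricSpace X] [MeasurableSpace X] [BorelSpace X]
  [MetricSpace Y] [MeasurableSpace Y] [BorelSpace Y]
  [MetricSpace Z] [MeasurableSpace Z] [BorelSpace Z]

/-- Charts almost preserve Hausdorff measures. -/
theorem chart_measure_le {p : ℕ} {φ : X → Euc p} {U : Set X} {C : ℝ} (hC : 1 < C)
    (h : ∀ y ∈ U, ∀ z ∈ U, dist y z ≤ C * dist (φ y) (φ z) ∧ dist (φ y) (φ z) ≤ C * dist y z)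
    {A : Set X} (hA : A ⊆ U) :
    (μHE[p] : Measure X) A ≤ ENNReal.ofReal (C ^ p) * volume (φ '' A) ∧
      volume (φ '' A) ≤ ENNReal.ofReal (C ^ p) * (μHE[p] : Measure X) A := by
  rw [← EuclideanSpace.euclideanHausdorffMeasure_eq_volume]
  have m1 := euclideanHausdorffMeasure_image_le_image (f := φ) (g := fun x : X => x) (s := A)
    (by linarith : 0 ≤ C) (fun a ha b hb => (h a (hA ha) b (hA hb)).1) p
  have m2 := euclideanHausdorffMeasure_image_le_image (g := φ) (f := fun x : X => x) (s := A)
    (by linarith : 0 ≤ C) (fun a ha b hb => (h a (hA ha) b (hA hb)).2) p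
  rw [Set.image_id'] at m1 m2
  exact ⟨m1, m2⟩

theorem IsLocallyEuclidean.isLocallyFiniteMeasure {p : ℕ} (hX : IsLocallyEuclidean p X) :
    IsLocallyFiniteMeasure (μHE[p] : Measure X) := by
  refine ⟨fun x => ?_⟩
  obtain ⟨φ, hφ, U, hUo, hxU, hU⟩ := hX x 2 (by norm_num)
  refine ⟨U ∩ φ ⁻¹' Metric.ball (φ x) 1, (hUo.inter (Metric.isOpen_ball.preimage hφ)).mem_nhds
    ⟨hxU, Metric.mem_ball_self one_pos⟩, ?_⟩
  refine (chart_measure_le (by norm_num) hU Set.inter_subset_left).1.trans_lt ?_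
  refine ENNReal.mul_lt_top ENNReal.ofReal_lt_top
    ((measure_mono ?_).trans_lt (measure_ball_lt_top (x := φ x) (r := 1)))
  rintro _ ⟨y, hy, rfl⟩
  exact hy.2

theorem IsLocallyEuclidean.sigmaFinite {p : ℕ} [SecondCountableTopology X]
    (hX : IsLocallyEuclidean p X) : SigmaFinite (μHE[p] : Measure X) := by
  have := hX.isLocallyFiniteMeasure
  infer_instance

omit [MeasurableSpace X] [BorelSpace X] in
theorem injOn_of_chart {p : ℕ} {φ : X → Euc p} {U : Set X} {C : ℝ}
    (h : ∀ y ∈ U, ∀ z ∈ U, dist y z ≤ C * dist (φ y) (φ z) ∧ dist (φ y) (φ z) ≤ C * dist y z) :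
    Set.InjOn φ U := by
  intro y hy z hz hyz
  have := (h y hy z hz).1
  rw [hyz, dist_self, mul_zero] at this
  exact dist_le_zero.1 this

/-- The inequalities `chart_measure_le` as inequalities between measures, which pass to products. -/
theorem chart_map_le {p : ℕ} {φ : X → Euc p} (hφ : Continuous φ) {U : Set X}
    {C : ℝ} (hC : 1 < C)
    (h : ∀ y ∈ U, ∀ z ∈ U, dist y z ≤ C * dist (φ y) (φ z) ∧ dist (φ y) (φ z) ≤ C * dist y z) :
    ((μHE[p] : Measure X).restrict U).map φ ≤
        ENNReal.ofReal (C ^ p) • volume.restrict (φ '' U) ∧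
      volume.restrict (φ '' U) ≤
        ENNReal.ofReal (C ^ p) • ((μHE[p] : Measure X).restrict U).map φ := by
  have key : ∀ B, MeasurableSet B → φ '' (φ ⁻¹' B ∩ U) = B ∩ φ '' U := fun B _ => by
    rw [Set.image_preimage_inter]
  constructor
  · refine Measure.le_iff.2 fun B hB => ?_
    rw [Measure.map_apply hφ.measurable hB, Measure.restrict_apply (hφ.measurable hB),
      Measure.smul_apply, Measure.restrict_apply hB, ← key B hB]
    exact (chart_measure_le hC h Set.inter_subset_right).1
  · refine Measure.le_iff.2 fun B hB => ?_
    rw [Measure.smul_apply, Measure.map_apply hφ.measurable hB,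
      Measure.restrict_apply (hφ.measurable hB), Measure.restrict_apply hB, ← key B hB]
    exact (chart_measure_le hC h Set.inter_subset_right).2

variable [PolishSpace X] [PolishSpace Y]

/-- Products of charts almost transport the product of the Hausdorff measures to the Lebesgue
measure. -/
theorem prod_chart_measure_le {p q : ℕ} (hX : IsLocallyEuclidean p X) (hY : IsLocallyEuclidean q Y)
    {φ : X → Euc p} {ψ : Y → Euc q} (hφ : Continuous φ) (hψ : Continuous ψ) {U : Set X} {V : Set Y}
    {C : ℝ} (hC : 1 < C)
    (h : ∀ y ∈ U, ∀ z ∈ U, dist y z ≤ C * dist (φ y) (φ z) ∧ dist (φ y) (φ z) ≤ C * dist y z)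
    (h' : ∀ y ∈ V, ∀ z ∈ V, dist y z ≤ C * dist (ψ y) (ψ z) ∧ dist (ψ y) (ψ z) ≤ C * dist y z)
    {A : Set (X × Y)} (hA : MeasurableSet A) (hAUV : A ⊆ U ×ˢ V) :
    MeasurableSet (Prod.map φ ψ '' A) ∧
    ((μHE[p] : Measure X).prod (μHE[q] : Measure Y)) A ≤
        ENNReal.ofReal (C ^ (p + q)) * (volume.prod volume) (Prod.map φ ψ '' A) ∧
      (volume.prod volume) (Prod.map φ ψ '' A) ≤ ENNReal.ofReal (C ^ (p + q)) *
        ((μHE[p] : Measure X).prod (μHE[q] : Measure Y)) A := by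
  have := hX.sigmaFinite
  have := hY.sigmaFinite
  have hinj : Set.InjOn (Prod.map φ ψ) (U ×ˢ V) := by
    rintro ⟨x, y⟩ ⟨hx, hy⟩ ⟨x', y'⟩ ⟨hx', hy'⟩ hxy
    exact Prod.ext (injOn_of_chart h hx hx' (congrArg Prod.fst hxy))
      (injOn_of_chart h' hy hy' (congrArg Prod.snd hxy))
  have hc : Continuous (Prod.map φ ψ) := hφ.prodMap hψ
  have hA' : MeasurableSet (Prod.map φ ψ '' A) :=
    hA.image_of_continuousOn_injOn hc.continuousOn (hinj.mono hAUV)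
  have hAeq : A = Prod.map φ ψ ⁻¹' (Prod.map φ ψ '' A) ∩ U ×ˢ V := by
    ext z
    constructor
    · exact fun hz => ⟨⟨z, hz, rfl⟩, hAUV hz⟩
    · rintro ⟨⟨w, hw, hwz⟩, hz⟩
      rwa [← hinj (hAUV hw) hz hwz]
  obtain ⟨a1, a2⟩ := chart_map_le (p := p) hφ hC h
  obtain ⟨b1, b2⟩ := chart_map_le (p := q) hψ hC h'
  set α := ((μHE[p] : Measure X).restrict U).map φ with hα
  set β := ((μHE[q] : Measure Y).restrict V).map ψ with hβ
  have e1 : ((μHE[p] : Measure X).prod (μHE[q] : Measure Y)) A =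
      (α.prod β) (Prod.map φ ψ '' A) := by
    rw [hα, hβ, Measure.map_prod_map _ _ hφ.measurable hψ.measurable, Measure.prod_restrict,
      Measure.map_apply hc.measurable hA', Measure.restrict_apply (hc.measurable hA'), ← hAeq]
  have hCpq : ENNReal.ofReal (C ^ (p + q)) = ENNReal.ofReal (C ^ p) * ENNReal.ofReal (C ^ q) := by
    rw [pow_add, ENNReal.ofReal_mul (by positivity)]
  have hsub : Prod.map φ ψ '' A ⊆ (φ '' U) ×ˢ (ψ '' V) := by
    rintro _ ⟨z, hz, rfl⟩
    exact ⟨⟨z.1, (hAUV hz).1, rfl⟩, ⟨z.2, (hAUV hz).2, rfl⟩⟩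
  have e2 : (volume.prod volume) (Prod.map φ ψ '' A) =
      ((volume.restrict (φ '' U)).prod (volume.restrict (ψ '' V))) (Prod.map φ ψ '' A) := by
    rw [Measure.prod_restrict, Measure.restrict_apply hA', Set.inter_eq_left.2 hsub]
  refine ⟨hA', ?_, ?_⟩
  · rw [e1, e2, hCpq, mul_assoc]
    refine (Measure.prod_mono a1 b1 _).trans_eq ?_
    rw [Measure.prod_smul_left, Measure.prod_smul_right]
    rfl
  · rw [e1, e2, hCpq, mul_assoc]
    refine (Measure.prod_mono a2 b2 _).trans_eq ?_
    rw [Measure.prod_smul_left, Measure.prod_smul_right]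
    rfl

/-- Scaling the two factors of a Euclidean product by `a` and `b`, and passing to the Euclidean norm
on the product. -/
theorem measure_toLp_smul_image {p q : ℕ} {a b : ℝ} (ha : 0 < a) (hb : 0 < b)
    {B : Set (Euc p × Euc q)} (hB : MeasurableSet B) :
    (μHE[p + q] : Measure (WithLp 2 (Euc p × Euc q)))
      ((fun z : Euc p × Euc q => WithLp.toLp 2 (a • z.1, b • z.2)) '' B) =
      ENNReal.ofReal (a ^ p * b ^ q) * (volume.prod volume) B := by
  have hd : Module.finrank ℝ (WithLp 2 (Euc p × Euc q)) = p + q := by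
    rw [(WithLp.linearEquiv 2 ℝ (Euc p × Euc q)).finrank_eq, Module.finrank_prod]
    simp
  have hv : (μHE[p + q] : Measure (WithLp 2 (Euc p × Euc q))) = volume := by
    rw [← hd]; exact InnerProductSpace.euclideanHausdorffMeasure_eq_volume
  let S : Euc p × Euc q → Euc p × Euc q := fun z => (a • z.1, b • z.2)
  have hS : (fun z : Euc p × Euc q => WithLp.toLp 2 (a • z.1, b • z.2)) '' B =
      WithLp.ofLp ⁻¹' (S '' B) := by
    ext w
    constructor
    · rintro ⟨z, hz, rfl⟩
      exact ⟨z, hz, rfl⟩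
    · rintro ⟨z, hz, hzw⟩
      exact ⟨z, hz, congrArg (WithLp.toLp 2) hzw⟩
  have hSB : S '' B = (fun z : Euc p × Euc q => (a⁻¹ • z.1, b⁻¹ • z.2)) ⁻¹' B := by
    ext w
    constructor
    · rintro ⟨z, hz, rfl⟩
      simpa [S, smul_smul, inv_mul_cancel₀ ha.ne', inv_mul_cancel₀ hb.ne'] using hz
    · intro hw
      exact ⟨_, hw, by simp [S, smul_smul, mul_inv_cancel₀ ha.ne', mul_inv_cancel₀ hb.ne']⟩
  have hm : Measurable fun z : Euc p × Euc q => (a⁻¹ • z.1, b⁻¹ • z.2) := by fun_prop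
  rw [hv, hS, (WithLp.volume_preserving_ofLp _ _).measure_preimage
    (by rw [hSB]; exact (hm hB).nullMeasurableSet), hSB]
  have hmap : (volume.prod volume).map (fun z : Euc p × Euc q => (a⁻¹ • z.1, b⁻¹ • z.2)) =
      ENNReal.ofReal (a ^ p * b ^ q) • (volume.prod volume : Measure (Euc p × Euc q)) := by
    have := (Measure.map_prod_map (volume : Measure (Euc p)) (volume : Measure (Euc q))
      (measurable_const_smul a⁻¹) (measurable_const_smul b⁻¹)).symm
    refine this.trans ?_
    rw [Measure.map_addHaar_smul _ (inv_ne_zero ha.ne'),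
      Measure.map_addHaar_smul _ (inv_ne_zero hb.ne')]
    simp only [finrank_euclideanSpace, Fintype.card_fin, inv_pow, inv_inv]
    rw [Measure.prod_smul_left, Measure.prod_smul_right, smul_smul,
      abs_of_pos (pow_pos ha p), abs_of_pos (pow_pos hb q), ENNReal.ofReal_mul (by positivity)]
  change (volume.prod volume) _ = _
  rw [← Measure.map_apply hm hB, hmap]
  rfl

/-- Change of variables from a product: if `F` infinitesimally multiplies distances by `a` in the
direction of the first factor and by `b` in the direction of the second one, and if these directions
stay orthogonal, then it multiplies the product of the Hausdorff measures by `a ^ p * b ^ q`. -/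
theorem map_prod_euclideanHausdorffMeasure {p q : ℕ}
    (hX : IsLocallyEuclidean p X) (hY : IsLocallyEuclidean q Y)
    {F : X × Y → Z} {Ω : Set (X × Y)} {a b : X × Y → ℝ} {ψX ψY ψZ : ℝ → ℝ} (hψX : IsGauge ψX)
    (hψY : IsGauge ψY) (hψZ : IsGauge ψZ)
    (hΩ : MeasurableSet Ω) (hFm : Measurable F) (hF : ContinuousOn F Ω) (hFi : Set.InjOn F Ω)
    (ha : ContinuousOn a Ω) (hb : ContinuousOn b Ω)
    (hapos : ∀ p ∈ Ω, 0 < a p) (hbpos : ∀ p ∈ Ω, 0 < b p)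
    (h : ∀ z ∈ Ω, ∀ w ∈ Ω, ψZ (dist (F z) (F w)) ^ 2 =
      a z * a w * ψX (dist z.1 w.1) ^ 2 + b z * b w * ψY (dist z.2 w.2) ^ 2) :
    ((((μHE[p] : Measure X).prod (μHE[q] : Measure Y)).restrict Ω).withDensity
      fun z => ENNReal.ofReal (a z ^ p * b z ^ q)).map F =
      (μHE[p + q] : Measure Z).restrict (F '' Ω) := by
  refine map_withDensity_eq_of_locally_comparable hΩ ((ha.pow p).mul (hb.pow q))
    (fun x hx => mul_pos (pow_pos (hapos x hx) p) (pow_pos (hbpos x hx) q))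
    hFm hFi (fun A hA hAm => hAm.image_of_continuousOn_injOn (hF.mono hA) (hFi.mono hA)) ?_
  intro z hz K hK
  -- an error `C ^ 3` on distances costs `C ^ (3 * (p + q))` in measure, and the charts of the
  -- factors cost another `C ^ (p + q)`
  obtain ⟨C, hC, hCK⟩ := exists_one_lt_pow_le hK (4 * (p + q))
  have hC0 : 0 < C := by linarith
  have haz := hapos z hz
  have hbz := hbpos z hz
  obtain ⟨W, hWo, hzW, hW⟩ := exists_nhds_dist_sq_le hψX hψY hψZ continuous_fst continuous_snd hF
    ha hb hapos hbpos h hz hC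
  obtain ⟨φ, hφ, U, hUo, hxU, hU⟩ := hX z.1 C hC
  obtain ⟨ψ, hψ, V, hVo, hyV, hV⟩ := hY z.2 C hC
  refine ⟨W ∩ U ×ˢ V, hWo.inter (hUo.prod hVo), ⟨hzW, hxU, hyV⟩, fun A hA hAm => ?_⟩
  have hAW : ∀ w ∈ A, w ∈ W ∩ Ω := fun w hw => ⟨(hA hw).1.1, (hA hw).2⟩
  have hAUV : A ⊆ U ×ˢ V := fun w hw => (hA hw).1.2
  obtain ⟨c0, c1, c2⟩ := prod_chart_measure_le hX hY hφ hψ hC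
    hU hV hAm hAUV
  -- the linear model of `F` in the charts, which compares `F` with the Lebesgue measure
  let T : X × Y → WithLp 2 (Euc p × Euc q) := fun w => WithLp.toLp 2 (a z • φ w.1, b z • ψ w.2)
  have hT : ∀ w w', dist (T w) (T w') ^ 2 =
      a z ^ 2 * dist (φ w.1) (φ w'.1) ^ 2 + b z ^ 2 * dist (ψ w.2) (ψ w'.2) ^ 2 := by
    intro w w'
    rw [WithLp.prod_dist_eq_of_L2, Real.sq_sqrt (by positivity)]
    change dist (a z • φ w.1) (a z • φ w'.1) ^ 2 + dist (b z • ψ w.2) (b z • ψ w'.2) ^ 2 = _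
    rw [dist_smul₀, dist_smul₀, Real.norm_of_nonneg haz.le, Real.norm_of_nonneg hbz.le, mul_pow,
      mul_pow]
  have hTA : (μHE[p + q] : Measure (WithLp 2 (Euc p × Euc q))) (T '' A) =
      ENNReal.ofReal (a z ^ p * b z ^ q) * (volume.prod volume) (Prod.map φ ψ '' A) := by
    rw [← measure_toLp_smul_image haz hbz c0, Set.image_image]
    rfl
  have l1 : ∀ w ∈ A, ∀ w' ∈ A, dist (F w) (F w') ≤ C ^ 3 * dist (T w) (T w') := by
    intro w hw w' hw'
    refine le_of_sq_le_sq ?_ (by positivity)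
    rw [mul_pow, hT]
    have h1 := (hU _ (hAUV hw).1 _ (hAUV hw').1).1
    have h2 := (hV _ (hAUV hw).2 _ (hAUV hw').2).1
    calc _ ≤ C ^ 4 * (a z ^ 2 * dist w.1 w'.1 ^ 2 + b z ^ 2 * dist w.2 w'.2 ^ 2) :=
          (hW w (hAW w hw) w' (hAW w' hw')).1
      _ ≤ C ^ 4 * (a z ^ 2 * (C * dist (φ w.1) (φ w'.1)) ^ 2 +
          b z ^ 2 * (C * dist (ψ w.2) (ψ w'.2)) ^ 2) := by gcongr
      _ = _ := by ring
  have l2 : ∀ w ∈ A, ∀ w' ∈ A, dist (T w) (T w') ≤ C ^ 3 * dist (F w) (F w') := by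
    intro w hw w' hw'
    refine le_of_sq_le_sq ?_ (by positivity)
    rw [mul_pow, hT]
    have h1 := (hU _ (hAUV hw).1 _ (hAUV hw').1).2
    have h2 := (hV _ (hAUV hw).2 _ (hAUV hw').2).2
    calc _ ≤ a z ^ 2 * (C * dist w.1 w'.1) ^ 2 + b z ^ 2 * (C * dist w.2 w'.2) ^ 2 := by gcongr
      _ = C ^ 2 * (a z ^ 2 * dist w.1 w'.1 ^ 2 + b z ^ 2 * dist w.2 w'.2 ^ 2) := by ring
      _ ≤ C ^ 2 * (C ^ 4 * dist (F w) (F w') ^ 2) := by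
          gcongr; exact (hW w (hAW w hw) w' (hAW w' hw')).2
      _ = _ := by ring
  have m1 := euclideanHausdorffMeasure_image_le_image (by positivity) l1 (p + q)
  have m2 := euclideanHausdorffMeasure_image_le_image (by positivity) l2 (p + q)
  rw [hTA] at m1 m2
  have hCd : (C ^ 3) ^ (p + q) * C ^ (p + q) ≤ K := by
    rw [← pow_mul, ← pow_add]
    convert hCK using 2
    ring
  have hCd' : ENNReal.ofReal ((C ^ 3) ^ (p + q)) * ENNReal.ofReal (C ^ (p + q)) ≤
      ENNReal.ofReal K := by
    rw [← ENNReal.ofReal_mul (by positivity)]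
    exact ENNReal.ofReal_le_ofReal hCd
  constructor
  · calc _ ≤ _ := m1
      _ ≤ ENNReal.ofReal ((C ^ 3) ^ (p + q)) * (ENNReal.ofReal (a z ^ p * b z ^ q) *
          (ENNReal.ofReal (C ^ (p + q)) *
            ((μHE[p] : Measure X).prod (μHE[q] : Measure Y)) A)) := by gcongr
      _ = (ENNReal.ofReal ((C ^ 3) ^ (p + q)) * ENNReal.ofReal (C ^ (p + q))) *
          ENNReal.ofReal (a z ^ p * b z ^ q) *
            ((μHE[p] : Measure X).prod (μHE[q] : Measure Y)) A := by ring
      _ ≤ ENNReal.ofReal K * ENNReal.ofReal (a z ^ p * b z ^ q) *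
            ((μHE[p] : Measure X).prod (μHE[q] : Measure Y)) A := by gcongr
      _ = _ := by rw [← ENNReal.ofReal_mul (by linarith)]
  · calc _ ≤ ENNReal.ofReal (a z ^ p * b z ^ q) * (ENNReal.ofReal (C ^ (p + q)) *
          (volume.prod volume) (Prod.map φ ψ '' A)) := by gcongr
      _ = ENNReal.ofReal (C ^ (p + q)) * (ENNReal.ofReal (a z ^ p * b z ^ q) *
          (volume.prod volume) (Prod.map φ ψ '' A)) := by ring
      _ ≤ ENNReal.ofReal (C ^ (p + q)) * (ENNReal.ofReal ((C ^ 3) ^ (p + q)) *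
          (μHE[p + q] : Measure Z) (F '' A)) := by gcongr
      _ = (ENNReal.ofReal ((C ^ 3) ^ (p + q)) * ENNReal.ofReal (C ^ (p + q))) *
          (μHE[p + q] : Measure Z) (F '' A) := by ring
      _ ≤ _ := by gcongr

end ProductFormula

namespace Hyp

variable {n k : ℕ}

/-! ### The ball model: translations, isometries, geodesics -/

theorem mobDenom_pos_of_le {x u : Euc n} (hx : ‖x‖ < 1) (hu : ‖u‖ ≤ 1) : 0 < mobDenom x u := by
  have h1 : -(‖x‖ * ‖u‖) ≤ inner ℝ x u := (abs_le.mp (abs_real_inner_le_norm x u)).1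
  have h2 : ‖x‖ * ‖u‖ < 1 := by nlinarith [norm_nonneg x, norm_nonneg u]
  unfold mobDenom
  nlinarith [mul_pos (sub_pos.2 h2) (sub_pos.2 h2)]

theorem one_sub_norm_mob_of_le {x u : Euc n} (hx : ‖x‖ < 1) (hu : ‖u‖ ≤ 1) :
    1 - ‖mob x u‖ ^ 2 = (1 - ‖x‖ ^ 2) * (1 - ‖u‖ ^ 2) / mobDenom x u := by
  have hD := (mobDenom_pos_of_le hx hu).ne'
  rw [mob, norm_smul, mul_pow, norm_add_sq_real, norm_smul, norm_smul, inner_smul_left,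
    inner_smul_right]
  simp only [Real.norm_eq_abs, mul_pow, sq_abs, conj_trivial]
  field_simp
  unfold mobDenom
  ring

theorem norm_mob_sub_of_le {x u w : Euc n} (hx : ‖x‖ < 1) (hu : ‖u‖ ≤ 1) (hw : ‖w‖ ≤ 1) :
    ‖mob x u - mob x w‖ ^ 2 =
      (1 - ‖x‖ ^ 2) ^ 2 * ‖u - w‖ ^ 2 / (mobDenom x u * mobDenom x w) := by
  have hD := (mobDenom_pos_of_le hx hu).ne'
  have hE := (mobDenom_pos_of_le hx hw).ne'
  rw [norm_sub_sq_real (mob x u), norm_sub_sq_real u w, mob, mob, norm_smul, norm_smul, mul_pow,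
    mul_pow, norm_add_sq_real, norm_add_sq_real]
  simp only [norm_smul, inner_smul_left, inner_smul_right, inner_add_left, inner_add_right,
    Real.norm_eq_abs, mul_pow, sq_abs, conj_trivial, real_inner_self_eq_norm_sq,
    real_inner_comm x u]
  field_simp
  unfold mobDenom
  ring

theorem mob_neg_mob {x u : Euc n} (hx : ‖x‖ < 1) (hu : ‖u‖ ≤ 1) : mob (-x) (mob x u) = u := by
  have hD := (mobDenom_pos_of_le hx hu).ne'
  have hx' : ‖-x‖ < 1 := by rwa [norm_neg]
  have h1 := (one_sub_pos hx).ne'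
  have hi : inner ℝ x (mob x u) =
      ((1 + 2 * inner ℝ x u + ‖u‖ ^ 2) * ‖x‖ ^ 2 + (1 - ‖x‖ ^ 2) * inner ℝ x u) / mobDenom x u := by
    rw [mob, inner_smul_right, inner_add_right, inner_smul_right, inner_smul_right,
      real_inner_self_eq_norm_sq]
    field_simp
  have hm : ‖mob x u‖ ^ 2 = 1 - (1 - ‖x‖ ^ 2) * (1 - ‖u‖ ^ 2) / mobDenom x u := by
    rw [← one_sub_norm_mob_of_le hx hu]; ring
  have hE : mobDenom (-x) (mob x u) = (1 - ‖x‖ ^ 2) ^ 2 / mobDenom x u := by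
    rw [mobDenom, inner_neg_left, norm_neg, hi, hm]
    field_simp
    unfold mobDenom
    ring
  have h2 : 1 + 2 * inner ℝ (-x) (mob x u) + ‖mob x u‖ ^ 2 =
      (1 - ‖x‖ ^ 2) * (1 + 2 * inner ℝ x u + ‖u‖ ^ 2) / mobDenom x u := by
    rw [inner_neg_left, hi, hm]
    field_simp
    unfold mobDenom
    ring
  rw [mob, hE, h2, norm_neg, mob, smul_smul]
  have : ((1 - ‖x‖ ^ 2) * (1 + 2 * inner ℝ x u + ‖u‖ ^ 2) / mobDenom x u) • -x +
      ((1 - ‖x‖ ^ 2) * (mobDenom x u)⁻¹) •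
        ((1 + 2 * inner ℝ x u + ‖u‖ ^ 2) • x + (1 - ‖x‖ ^ 2) • u) =
      ((1 - ‖x‖ ^ 2) ^ 2 / mobDenom x u) • u := by
    module
  rw [this, smul_smul, inv_mul_cancel₀ (by positivity), one_smul]

theorem mob_mob_neg {x u : Euc n} (hx : ‖x‖ < 1) (hu : ‖u‖ ≤ 1) : mob x (mob (-x) u) = u := by
  have := mob_neg_mob (x := -x) (u := u) (by rwa [norm_neg]) hu
  rwa [neg_neg] at this

@[simp] theorem mob_zero (x : Euc n) : mob x 0 = x := by simp [mob, mobDenom]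

@[simp] theorem zero_mob (u : Euc n) : mob 0 u = u := by simp [mob, mobDenom]

theorem continuous_mobDenom : Continuous fun z : Euc n × Euc n => mobDenom z.1 z.2 := by
  unfold mobDenom; fun_prop

theorem continuousAt_mob {z : Euc n × Euc n} (h1 : ‖z.1‖ < 1) (h2 : ‖z.2‖ ≤ 1) :
    ContinuousAt (fun z : Euc n × Euc n => mob z.1 z.2) z := by
  have := (continuous_mobDenom (n := n)).continuousAt (x := z)
  have hD := (mobDenom_pos_of_le h1 h2).ne'
  unfold mob
  fun_prop (disch := exact hD)

theorem one_sub_pos' (x : Hyp n) : 0 < 1 - ‖x.val‖ ^ 2 := one_sub_pos x.norm_lt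

theorem dist_eq (x y : Hyp n) : dist x y = 2 * Real.arsinh (sinhHalf x.val y.val) := rfl

theorem sinh_half_dist (x y : Hyp n) : Real.sinh (dist x y / 2) = sinhHalf x.val y.val := by
  rw [dist_eq, mul_div_cancel_left₀ _ two_ne_zero, Real.sinh_arsinh]

theorem sinh_dist_sq (x y : Hyp n) : (2 * Real.sinh (dist x y / 2)) ^ 2 =
    4 * ‖x.val - y.val‖ ^ 2 / ((1 - ‖x.val‖ ^ 2) * (1 - ‖y.val‖ ^ 2)) := by
  have h1 := one_sub_pos' x
  have h2 := one_sub_pos' y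
  rw [sinh_half_dist, sinhHalf, mul_pow, div_pow, Real.sq_sqrt (by positivity)]
  ring

@[ext] theorem ext {x y : Hyp n} (h : x.val = y.val) : x = y := by
  cases x; cases y; congr

theorem dist_eq_iff {m : ℕ} {x y : Hyp n} {x' y' : Hyp m} :
    dist x y = dist x' y' ↔ ‖x.val - y.val‖ ^ 2 / ((1 - ‖x.val‖ ^ 2) * (1 - ‖y.val‖ ^ 2)) =
      ‖x'.val - y'.val‖ ^ 2 / ((1 - ‖x'.val‖ ^ 2) * (1 - ‖y'.val‖ ^ 2)) := by
  have h1 := sinh_dist_sq x y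
  have h2 := sinh_dist_sq x' y'
  rw [mul_div_assoc] at h1 h2
  constructor
  · intro h
    rw [h] at h1
    linarith
  · intro h
    rw [h, ← h2, sq_eq_sq₀, mul_right_inj' two_ne_zero, Real.sinh_inj] at h1
    · linarith
    all_goals
      refine mul_nonneg zero_le_two (Real.sinh_nonneg_iff.2 (by positivity))

/-- The hyperbolic metric induces the Euclidean topology of the ball. -/
theorem isInducing_val : IsInducing (Hyp.val : Hyp n → Euc n) := by
  rw [isInducing_iff_nhds]
  intro x
  have hx := one_sub_pos' x
  apply le_antisymm
  · rw [← tendsto_iff_comap, tendsto_iff_norm_sub_tendsto_zero]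
    have t : Tendsto (fun y : Hyp n => Real.sinh (dist y x / 2)) (𝓝 x) (𝓝 0) := by
      have : Continuous fun y : Hyp n => Real.sinh (dist y x / 2) := by fun_prop
      simpa using this.tendsto x
    refine squeeze_zero (fun _ => norm_nonneg _) (fun y => ?_) t
    rw [sinh_half_dist, sinhHalf]
    have hy := one_sub_pos' y
    refine le_div_self (norm_nonneg _) (by positivity) ?_
    rw [Real.sqrt_le_iff]
    refine ⟨zero_le_one, ?_⟩
    nlinarith [sq_nonneg ‖x.val‖, sq_nonneg ‖y.val‖]
  · have t : Tendsto (fun y : Hyp n => dist y x) (comap val (𝓝 x.val)) (𝓝 0) := by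
      have hc : ContinuousAt (fun u : Euc n => 2 * Real.arsinh (sinhHalf u x.val)) x.val := by
        unfold sinhHalf
        have : √((1 - ‖x.val‖ ^ 2) * (1 - ‖x.val‖ ^ 2)) ≠ 0 := by positivity
        fun_prop (disch := assumption)
      have h0 : 2 * Real.arsinh (sinhHalf x.val x.val) = 0 := by simp [sinhHalf]
      rw [ContinuousAt, h0] at hc
      exact hc.comp tendsto_comap
    exact tendsto_iff_dist_tendsto_zero.2 t

theorem continuous_val : Continuous (Hyp.val : Hyp n → Euc n) := isInducing_val.continuous

theorem continuous_iff {Y : Type*} [TopologicalSpace Y] {f : Y → Hyp n} :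
    Continuous f ↔ Continuous fun y => (f y).val := isInducing_val.continuous_iff

theorem range_val : Set.range (Hyp.val : Hyp n → Euc n) = Metric.ball 0 1 := by
  ext u
  rw [mem_ball_zero_iff]
  exact ⟨by rintro ⟨x, rfl⟩; exact x.norm_lt, fun h => ⟨⟨u, h⟩, rfl⟩⟩

theorem origin_val : (origin : Hyp n).val = 0 := rfl

theorem sinh_dist_origin_sq (x : Hyp n) : (2 * Real.sinh (dist x origin / 2)) ^ 2 =
    4 * ‖x.val‖ ^ 2 / (1 - ‖x.val‖ ^ 2) := by
  rw [sinh_dist_sq, origin_val]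
  simp

/-- Closed hyperbolic balls around the centre are closed Euclidean balls of radius less than `1`. -/
instance : ProperSpace (Hyp n) := by
  refine ProperSpace.of_seq_closedBall (β := ℕ) (l := atTop) (x := origin) (r := fun i => (i : ℝ))
    tendsto_natCast_atTop_atTop (Eventually.of_forall fun i => ?_)
  rw [isInducing_val.isCompact_iff]
  set s : ℝ := (2 * Real.sinh (i / 2)) ^ 2 with hs
  have hs0 : 0 ≤ s := sq_nonneg _
  have hc : s / (4 + s) < 1 := by rw [div_lt_one (by positivity)]; linarith
  have : val '' Metric.closedBall (origin : Hyp n) i = {u : Euc n | ‖u‖ ^ 2 ≤ s / (4 + s)} := by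
    ext u
    have key : ∀ x : Hyp n, dist x origin ≤ i ↔ ‖x.val‖ ^ 2 ≤ s / (4 + s) := by
      intro x
      have hx := one_sub_pos' x
      have h1 : dist x origin ≤ i ↔ (2 * Real.sinh (dist x origin / 2)) ^ 2 ≤ s := by
        rw [hs, sq_le_sq₀ (mul_nonneg zero_le_two (Real.sinh_nonneg_iff.2 (by positivity)))
          (mul_nonneg zero_le_two (Real.sinh_nonneg_iff.2 (by positivity))),
          mul_le_mul_iff_right₀ two_pos, Real.sinh_le_sinh]
        constructor <;> intro <;> linarith
      rw [h1, sinh_dist_origin_sq, div_le_iff₀ hx, le_div_iff₀ (by positivity)]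
      constructor <;> intro <;> nlinarith
    constructor
    · rintro ⟨x, hx, rfl⟩
      exact (key x).1 hx
    · intro hu
      have hu1 : ‖u‖ < 1 := by
        have : ‖u‖ ^ 2 < 1 := lt_of_le_of_lt hu hc
        nlinarith [norm_nonneg u]
      exact ⟨⟨u, hu1⟩, (key ⟨u, hu1⟩).2 hu, rfl⟩
  rw [this]
  refine Metric.isCompact_of_isClosed_isBounded (isClosed_le (by fun_prop) (by fun_prop)) ?_
  refine (Metric.isBounded_closedBall (x := (0 : Euc n)) (r := 1)).subset fun u hu => ?_
  have hu1 : ‖u‖ ^ 2 < 1 := lt_of_le_of_lt hu hc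
  rw [mem_closedBall_zero_iff]
  nlinarith [norm_nonneg u]

/-- The translation `u ↦ x ⊕ u` of hyperbolic space. -/
def transl (x : Hyp n) : Hyp n ≃ᵢ Hyp n where
  toFun u := ⟨mob x.val u.val, norm_mob_lt x.norm_lt u.norm_lt⟩
  invFun u := ⟨mob (-x.val) u.val, norm_mob_lt (by rw [norm_neg]; exact x.norm_lt) u.norm_lt⟩
  left_inv u := ext (mob_neg_mob x.norm_lt u.norm_lt.le)
  right_inv u := ext (mob_mob_neg x.norm_lt u.norm_lt.le)
  isometry_toFun := Isometry.of_dist_eq fun u w => by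
    rw [dist_eq, dist_eq, sinhHalf_mob x.norm_lt u.norm_lt w.norm_lt]

theorem transl_val (x u : Hyp n) : (transl x u).val = mob x.val u.val := rfl

@[simp] theorem transl_origin (x : Hyp n) : transl x origin = x := ext (mob_zero _)

@[simp] theorem transl_symm_self (x : Hyp n) : (transl x).symm x = origin :=
  ext (mob_neg_self _)

/-- The hyperbolic distances between two points and the centre determine the Euclidean norms and
inner product. -/
theorem inner_eq_of_dist_eq {m : ℕ} {x y : Hyp n} {x' y' : Hyp m} (h : dist x y = dist x' y')
    (hx : dist x origin = dist x' origin) (hy : dist y origin = dist y' origin) :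
    ‖x.val‖ = ‖x'.val‖ ∧ inner ℝ x.val y.val = inner ℝ x'.val y'.val := by
  have aux : ∀ {x : Hyp n} {x' : Hyp m}, dist x origin = dist x' origin →
      ‖x.val‖ ^ 2 = ‖x'.val‖ ^ 2 := by
    intro x x' hx
    have h1 := one_sub_pos' x
    have h2 := one_sub_pos' x'
    rw [dist_eq_iff, origin_val, origin_val] at hx
    simp only [sub_zero, norm_zero, ne_eq, OfNat.ofNat_ne_zero, not_false_eq_true, zero_pow,
      mul_one] at hx
    rw [div_eq_div_iff h1.ne' h2.ne'] at hx
    linarith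
  have e1 := aux hx
  have e2 := aux hy
  refine ⟨(sq_eq_sq₀ (norm_nonneg _) (norm_nonneg _)).1 e1, ?_⟩
  have h1 := one_sub_pos' x'
  have h2 := one_sub_pos' y'
  rw [dist_eq_iff, e1, e2, div_left_inj' (by positivity), norm_sub_sq_real, norm_sub_sq_real,
    e1, e2] at h
  linarith

/-- Isometric embeddings of hyperbolic spaces that preserve the centres of the balls are linear. -/
theorem exists_linearIsometry_of_map_origin {f : Hyp k → Hyp n} (hf : Isometry f)
    (h0 : f origin = origin) : ∃ L : Euc k →ₗᵢ[ℝ] Euc n, ∀ x, (f x).val = L x.val := by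
  have hfo : ∀ x, dist (f x) origin = dist x origin := fun x => by rw [← h0, hf.dist_eq]
  have hin : ∀ x y, inner ℝ (f x).val (f y).val = inner ℝ x.val y.val := fun x y =>
    (inner_eq_of_dist_eq (hf.dist_eq x y) (hfo x) (hfo y)).2
  -- the points `e i / 2` of the ball; inner products are preserved, so twice their images are
  -- orthonormal
  let b : Fin k → Hyp k := fun i => ⟨(2⁻¹ : ℝ) • EuclideanSpace.single i (1 : ℝ), by
    rw [norm_smul]; norm_num⟩
  have hb : Orthonormal ℝ fun i => (2 : ℝ) • (f (b i)).val := by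
    rw [orthonormal_iff_ite]
    intro i j
    rw [inner_smul_left, inner_smul_right, hin, inner_smul_left, inner_smul_right]
    have := (orthonormal_iff_ite.1 (EuclideanSpace.basisFun (Fin k) ℝ).orthonormal) i j
    simp only [EuclideanSpace.basisFun_apply] at this
    rw [this]
    simp
  let v := (EuclideanSpace.basisFun (Fin k) ℝ).toBasis
  let L₀ : Euc k →ₗ[ℝ] Euc n := v.constr ℝ fun i => (2 : ℝ) • (f (b i)).val
  have hv : Orthonormal ℝ v := by
    rw [OrthonormalBasis.coe_toBasis]; exact OrthonormalBasis.orthonormal _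
  have hL₀ : Orthonormal ℝ (L₀ ∘ v) := by
    convert hb with i
    exact v.constr_basis ℝ _ i
  let L := L₀.isometryOfOrthonormal hv hL₀
  have hL : ∀ x : Euc k, L x = ∑ i, x i • ((2 : ℝ) • (f (b i)).val) := by
    intro x
    change L₀ x = _
    rw [Module.Basis.constr_apply_fintype]
    rfl
  refine ⟨L, fun x => ?_⟩
  -- `f x` and `L x` have the same norm, and their inner product is the square of this norm
  rw [← sub_eq_zero, ← norm_eq_zero, ← sq_eq_zero_iff, norm_sub_sq_real, L.norm_map]
  have e1 : ‖(f x).val‖ = ‖x.val‖ := (inner_eq_of_dist_eq (hf.dist_eq x x) (hfo x) (hfo x)).1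
  have e2 : inner ℝ (f x).val (L x.val) = ‖x.val‖ ^ 2 := by
    rw [hL, inner_sum, EuclideanSpace.real_norm_sq_eq]
    refine Finset.sum_congr rfl fun i _ => ?_
    rw [inner_smul_right, inner_smul_right, hin, inner_smul_right,
      EuclideanSpace.inner_single_right]
    simp
    ring
  rw [e1, e2]
  ring

/-- Isometric embeddings of hyperbolic spaces are linear up to translations. -/
theorem exists_linearIsometry {f : Hyp k → Hyp n} (hf : Isometry f) (x : Hyp k) :
    ∃ L : Euc k →ₗᵢ[ℝ] Euc n, ∀ u : Hyp k, (f (transl x u)).val = mob (f x).val (L u.val) := by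
  obtain ⟨L, hL⟩ := exists_linearIsometry_of_map_origin
    (f := fun u => (transl (f x)).symm (f (transl x u)))
    ((transl (f x)).symm.isometry.comp (hf.comp (transl x).isometry)) (by simp)
  refine ⟨L, fun u => ?_⟩
  rw [← hL, ← transl_val, IsometryEquiv.apply_symm_apply]

end Hyp

namespace Hyp

variable {n k : ℕ}

/-! ### Points at infinity -/

theorem tendsto_mob_nhds {x u : Euc n} (hx : ‖x‖ < 1) (hu : ‖u‖ ≤ 1) :
    Tendsto (fun z : Euc n × Euc n => mob z.1 z.2) (𝓝 (x, u)) (𝓝 (mob x u)) :=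
  continuousAt_mob (z := (x, u)) hx hu

theorem tendsto_mob {ι : Type*} {l : Filter ι} {f g : ι → Euc n} {x u : Euc n} (hx : ‖x‖ < 1)
    (hu : ‖u‖ ≤ 1) (hf : Tendsto f l (𝓝 x)) (hg : Tendsto g l (𝓝 u)) :
    Tendsto (fun i => mob (f i) (g i)) l (𝓝 (mob x u)) := by
  have h2 : Tendsto (fun i => (f i, g i)) l (𝓝 (x, u)) := hf.prodMk_nhds hg
  have := (tendsto_mob_nhds hx hu).comp h2
  exact this

theorem norm_bdry (ξ : Bdry n) : ‖(ξ : Euc n)‖ = 1 := norm_eq_of_mem_sphere ξ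

theorem val_ne_bdry (x : Hyp n) (ξ : Bdry n) : (ξ : Euc n) - x.val ≠ 0 := by
  intro h
  have h1 := norm_bdry ξ
  rw [sub_eq_zero.1 h] at h1
  exact absurd h1 x.norm_lt.ne

theorem norm_sub_pos (x : Hyp n) (ξ : Bdry n) : 0 < ‖(ξ : Euc n) - x.val‖ :=
  norm_pos_iff.2 (val_ne_bdry x ξ)

theorem norm_mob_bdry (x : Hyp n) (ξ : Bdry n) : ‖mob x.val (ξ : Euc n)‖ = 1 := by
  have := one_sub_norm_mob_of_le x.norm_lt (norm_bdry ξ).le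
  rw [norm_bdry, one_pow, sub_self, mul_zero, zero_div] at this
  nlinarith [norm_nonneg (mob x.val (ξ : Euc n))]

/-- The action of the translation `u ↦ x ⊕ u` on the boundary at infinity. -/
def mobBdry (x : Hyp n) (ξ : Bdry n) : Bdry n :=
  ⟨mob x.val ξ, mem_sphere_zero_iff_norm.2 (norm_mob_bdry x ξ)⟩

/-- The point opposite to `x` with respect to the centre of the ball. -/
def neg (x : Hyp n) : Hyp n := ⟨-x.val, by rw [norm_neg]; exact x.norm_lt⟩

theorem neg_val (x : Hyp n) : (neg x).val = -x.val := rfl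

theorem mobBdry_val (x : Hyp n) (ξ : Bdry n) : (mobBdry x ξ : Euc n) = mob x.val ξ := rfl

@[simp] theorem mobBdry_neg_mobBdry (x : Hyp n) (ξ : Bdry n) : mobBdry (neg x) (mobBdry x ξ) = ξ :=
  Subtype.ext (mob_neg_mob x.norm_lt (norm_bdry ξ).le)

@[simp] theorem mobBdry_mobBdry_neg (x : Hyp n) (ξ : Bdry n) : mobBdry x (mobBdry (neg x) ξ) = ξ :=
  Subtype.ext (mob_mob_neg x.norm_lt (norm_bdry ξ).le)

@[simp] theorem mobBdry_origin (ξ : Bdry n) : mobBdry origin ξ = ξ := Subtype.ext (zero_mob _)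

theorem continuous_mobBdry : Continuous fun z : Hyp n × Bdry n => mobBdry z.1 z.2 := by
  refine Continuous.subtype_mk (continuous_iff_continuousAt.2 fun z => ?_) _
  exact tendsto_mob z.1.norm_lt (norm_bdry z.2).le
    (continuous_val.comp continuous_fst).continuousAt
    (continuous_subtype_val.comp continuous_snd).continuousAt

theorem continuous_neg : Continuous (neg : Hyp n → Hyp n) :=
  continuous_iff.2 continuous_val.neg

/-- The map induced on unit spheres by a linear isometry. -/
def mapBdry (A : Euc k →ₗᵢ[ℝ] Euc n) (ξ : Bdry k) : Bdry n :=
  ⟨A ξ, by rw [mem_sphere_zero_iff_norm, A.norm_map, norm_bdry]⟩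

theorem mapBdry_val (A : Euc k →ₗᵢ[ℝ] Euc n) (ξ : Bdry k) : (mapBdry A ξ : Euc n) = A ξ := rfl

theorem isometry_mapBdry (A : Euc k →ₗᵢ[ℝ] Euc n) : Isometry (mapBdry A) :=
  Isometry.of_dist_eq fun x y => by
    rw [Subtype.dist_eq, Subtype.dist_eq]; exact A.isometry.dist_eq _ _

theorem mapBdry_neg (A : Euc k →ₗᵢ[ℝ] Euc n) (ξ : Bdry k) : mapBdry A (-ξ) = -mapBdry A ξ :=
  Subtype.ext (A.map_neg _)

theorem tendsto_tanh_half : Tendsto (fun t : ℝ => Real.tanh (t / 2)) atTop (𝓝 1) := by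
  have h : ∀ t : ℝ, Real.tanh (t / 2) = 1 - 2 / (Real.exp t + 1) := by
    intro t
    have h1 : Real.exp t = Real.exp (t / 2) * Real.exp (t / 2) := by
      rw [← Real.exp_add]; ring_nf
    have h2 := Real.exp_pos (t / 2)
    rw [Real.tanh_eq_sinh_div_cosh, Real.sinh_eq, Real.cosh_eq, h1, Real.exp_neg]
    field_simp
    ring
  simp_rw [h]
  have : Tendsto (fun t : ℝ => 2 / (Real.exp t + 1)) atTop (𝓝 0) :=
    tendsto_const_nhds.div_atTop (tendsto_atTop_add_const_right _ _ Real.tendsto_exp_atTop)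
  simpa using (tendsto_const_nhds (x := (1 : ℝ))).sub this

theorem line_val (x : Hyp n) (e : Bdry n) (t : ℝ) :
    (line x e t).val = mob x.val (Real.tanh (t / 2) • (e : Euc n)) := rfl

theorem line_zero (x : Hyp n) (e : Bdry n) : line x e 0 = x := ext (by simp [line_val])

theorem tendsto_line (x : Hyp n) (e : Bdry n) :
    Tendsto (fun t => (line x e t).val) atTop (𝓝 (mobBdry x e : Euc n)) := by
  rw [mobBdry_val]
  refine tendsto_mob x.norm_lt (norm_bdry e).le tendsto_const_nhds ?_
  simpa using tendsto_tanh_half.smul_const (e : Euc n)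

theorem tendsto_ray (ξ : Bdry n) : Tendsto (fun t => (ray ξ t).val) atTop (𝓝 (ξ : Euc n)) := by
  have := tendsto_line origin ξ
  rwa [mobBdry_origin] at this

namespace UnitTangent

@[ext] theorem ext {v w : UnitTangent n} (h : ∀ t, v.toFun t = w.toFun t) : v = w := by
  cases v; cases w; congr; exact funext h

theorem smul_toFun (g : Hyp n ≃ᵢ Hyp n) (v : UnitTangent n) (t : ℝ) :
    (g • v).toFun t = g (v.toFun t) := rfl

theorem flip_toFun (v : UnitTangent n) (t : ℝ) : v.flip.toFun t = v.toFun (-t) := rfl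

@[simp] theorem flip_flip (v : UnitTangent n) : v.flip.flip = v := ext fun t => by
  rw [flip_toFun, flip_toFun, _root_.neg_neg]

@[simp] theorem base_flip (v : UnitTangent n) : v.flip.base = v.base := by
  rw [base, flip_toFun, neg_zero]; rfl

@[simp] theorem base_smul (g : Hyp n ≃ᵢ Hyp n) (v : UnitTangent n) : (g • v).base = g v.base := rfl

theorem flip_smul (g : Hyp n ≃ᵢ Hyp n) (v : UnitTangent n) : (g • v).flip = g • v.flip := rfl

theorem ofDir_toFun (x : Hyp n) (e : Bdry n) (t : ℝ) : (ofDir x e).toFun t = line x e t := rfl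

@[simp] theorem base_ofDir (x : Hyp n) (e : Bdry n) : (ofDir x e).base = x := line_zero x e

theorem flip_ofDir (x : Hyp n) (e : Bdry n) : (ofDir x e).flip = ofDir x (-e) := ext fun t =>
  Hyp.ext (by
    rw [flip_toFun, ofDir_toFun, ofDir_toFun, line_val, line_val, neg_div, Real.tanh_neg]
    simp)

theorem plusEnd_eq_of_tendsto {v : UnitTangent n} {ξ : Bdry n}
    (h : Tendsto (fun t => (v.toFun t).val) atTop (𝓝 (ξ : Euc n))) : v.plusEnd = ξ := by
  have hex : ∃ ξ : Bdry n, Tendsto (fun t => (v.toFun t).val) atTop (𝓝 (ξ : Euc n)) := ⟨ξ, h⟩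
  have := @Classical.epsilon_spec_aux (Bdry n) v.nonempty_bdry
    (fun ξ => Tendsto (fun t => (v.toFun t).val) atTop (𝓝 (ξ : Euc n))) hex
  exact Subtype.ext (tendsto_nhds_unique this h)

@[simp] theorem plusEnd_ofDir (x : Hyp n) (e : Bdry n) : (ofDir x e).plusEnd = mobBdry x e :=
  plusEnd_eq_of_tendsto (tendsto_line x e)

theorem plusEnd_flip (v : UnitTangent n) : v.flip.plusEnd = v.minusEnd := rfl

theorem minusEnd_flip (v : UnitTangent n) : v.flip.minusEnd = v.plusEnd := by
  rw [minusEnd, flip_flip]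

theorem tanh_half_pos : 0 < Real.tanh (1 / 2) := by
  rw [Real.tanh_eq_sinh_div_cosh]
  exact div_pos (Real.sinh_pos_iff.2 (by norm_num)) (Real.cosh_pos _)

theorem ofDir_injective {x y : Hyp n} {e f : Bdry n} (h : ofDir x e = ofDir y f) :
    x = y ∧ e = f := by
  have h1 : x = y := by rw [← base_ofDir x e, h, base_ofDir]
  subst h1
  refine ⟨rfl, ?_⟩
  have := congrArg UnitTangent.plusEnd h
  rw [plusEnd_ofDir, plusEnd_ofDir] at this
  rw [← mobBdry_neg_mobBdry x e, this, mobBdry_neg_mobBdry]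

/-- The Euclidean direction of a unit tangent vector, once its base point is translated to the centre. It
is a unit vector, by `exists_eq_ofDir`. -/
def preDir (v : UnitTangent n) : Euc n :=
  (Real.tanh (1 / 2))⁻¹ • ((transl v.base).symm (v.toFun 1)).val

/-- Every unit tangent vector is determined by its base point and its Euclidean direction. -/
theorem exists_eq_ofDir (v : UnitTangent n) :
    ∃ e : Bdry n, (e : Euc n) = v.preDir ∧ v = ofDir v.base e := by
  obtain ⟨e'⟩ := v.nonempty_bdry
  set x := v.base with hx
  -- the translated geodesic `w` has the same Gram matrix as any standard line through the centre,
  -- so all its points are on the line through `w 1`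
  let w : ℝ → Hyp n := fun t => (transl x).symm (v.toFun t)
  have hw : Isometry w := (transl x).symm.isometry.comp v.isometry
  have hw0 : w 0 = origin := transl_symm_self x
  have hl0 : line origin e' 0 = origin := line_zero _ _
  have key : ∀ s t, ‖(w s).val‖ = ‖(line origin e' s).val‖ ∧
      inner ℝ (w s).val (w t).val = inner ℝ (line origin e' s).val (line origin e' t).val := by
    have h0 : ∀ s, dist (w s) origin = dist (line origin e' s) origin := fun s =>
      calc dist (w s) origin = dist (w s) (w 0) := by rw [hw0]
        _ = dist (line origin e' s) (line origin e' 0) := by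
          rw [hw.dist_eq, (isometry_line _ _).dist_eq]
        _ = _ := by rw [hl0]
    exact fun s t => inner_eq_of_dist_eq
      (by rw [hw.dist_eq, (isometry_line _ _).dist_eq]) (h0 s) (h0 t)
  have hl : ∀ t, (line origin e' t).val = Real.tanh (t / 2) • (e' : Euc n) := fun t => by
    rw [line_val, origin_val, zero_mob]
  have hT := tanh_half_pos
  have hn : ‖v.preDir‖ = 1 := by
    rw [preDir, norm_smul, ← hx]
    change _ * ‖(w 1).val‖ = _
    rw [(key 1 1).1, hl, norm_smul, norm_bdry, Real.norm_of_nonneg hT.le,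
      Real.norm_of_nonneg (by positivity)]
    field_simp
  refine ⟨⟨v.preDir, mem_sphere_zero_iff_norm.2 hn⟩, rfl, ext fun t => ?_⟩
  have hwt : (w t).val = Real.tanh (t / 2) • v.preDir := by
    have hp : v.preDir = (Real.tanh (1 / 2))⁻¹ • (w 1).val := rfl
    rw [← sub_eq_zero, ← norm_eq_zero, ← sq_eq_zero_iff, norm_sub_sq_real, norm_smul, hn,
      inner_smul_right, hp, inner_smul_right, (key t 1).2, (key t 1).1, hl, hl, norm_smul,
      norm_bdry, inner_smul_left, inner_smul_right, real_inner_self_eq_norm_sq, norm_bdry]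
    simp only [Real.norm_eq_abs, mul_one, sq_abs, conj_trivial, one_pow]
    field_simp
    ring
  have : v.toFun t = transl x (w t) := ((transl x).apply_symm_apply _).symm
  rw [this]
  apply Hyp.ext
  rw [transl_val, hwt]
  rfl

end UnitTangent

/-! ### The Poisson kernel and the Busemann cocycle -/

/-- The Poisson kernel of the ball (of the dimension which makes it the exponential of the opposite
of the Busemann cocycle). -/
def poisson (x : Hyp n) (ξ : Bdry n) : ℝ := (1 - ‖x.val‖ ^ 2) / ‖(ξ : Euc n) - x.val‖ ^ 2

theorem poisson_pos (x : Hyp n) (ξ : Bdry n) : 0 < poisson x ξ :=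
  div_pos (one_sub_pos' x) (pow_pos (norm_sub_pos x ξ) 2)

@[simp] theorem poisson_origin (ξ : Bdry n) : poisson origin ξ = 1 := by
  simp [poisson, origin_val]

theorem continuous_poisson : Continuous fun z : Hyp n × Bdry n => poisson z.1 z.2 := by
  unfold poisson
  have h1 : Continuous fun z : Hyp n × Bdry n => z.1.val := continuous_val.comp continuous_fst
  have h2 : Continuous fun z : Hyp n × Bdry n => (z.2 : Euc n) := by fun_prop
  exact (continuous_const.sub (h1.norm.pow 2)).div ((h2.sub h1).norm.pow 2)
    fun z => (pow_pos (norm_sub_pos z.1 z.2) 2).ne'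

/-- The limit defining the Busemann cocycle exists along any family of points which converges to the
point at infinity. -/
theorem tendsto_dist_sub_dist {ι : Type*} {l : Filter ι} {z : ι → Hyp n} {ξ : Bdry n}
    (hz : Tendsto (fun i => (z i).val) l (𝓝 (ξ : Euc n))) (x y : Hyp n) :
    Tendsto (fun i => dist (z i) x - dist (z i) y) l
      (𝓝 (Real.log (poisson y ξ) - Real.log (poisson x ξ))) := by
  -- `E x u / √(1 - |u|²)` is the exponential of `d(u, x) / 2`
  let E : Hyp n → Euc n → ℝ := fun x u => ‖u - x.val‖ / √(1 - ‖x.val‖ ^ 2) +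
    √((1 - ‖u‖ ^ 2) + ‖u - x.val‖ ^ 2 / (1 - ‖x.val‖ ^ 2))
  have hEc : ∀ x, Continuous (E x) := fun x => by
    have h1 := one_sub_pos' x
    have h2 := (Real.sqrt_pos.2 h1).ne'
    have h3 := h1.ne'
    unfold E
    fun_prop (disch := assumption)
  have hEpos : ∀ (x : Hyp n) (u : Hyp n), 0 < E x u.val := fun x u => by
    have h1 := one_sub_pos' x
    have h2 := one_sub_pos' u
    have : 0 < √((1 - ‖u.val‖ ^ 2) + ‖u.val - x.val‖ ^ 2 / (1 - ‖x.val‖ ^ 2)) := by positivity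
    positivity
  have hE : ∀ (x u : Hyp n), dist u x = 2 * Real.log (E x u.val) -
      Real.log (1 - ‖u.val‖ ^ 2) := by
    intro x u
    have h1 := one_sub_pos' x
    have h2 := one_sub_pos' u
    have h1' := Real.sqrt_pos.2 h1
    have h2' := Real.sqrt_pos.2 h2
    have e : Real.log (1 - ‖u.val‖ ^ 2) = 2 * Real.log √(1 - ‖u.val‖ ^ 2) := by
      rw [Real.log_sqrt h2.le]; ring
    rw [e, ← mul_sub, ← Real.log_div (hEpos x u).ne' h2'.ne', dist_eq]
    have : E x u.val / √(1 - ‖u.val‖ ^ 2) =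
        sinhHalf u.val x.val + √(1 + sinhHalf u.val x.val ^ 2) := by
      have e1 : (1 - ‖u.val‖ ^ 2) + ‖u.val - x.val‖ ^ 2 / (1 - ‖x.val‖ ^ 2) =
          (1 - ‖u.val‖ ^ 2) * (1 + sinhHalf u.val x.val ^ 2) := by
        rw [sinhHalf, div_pow, Real.sq_sqrt (by positivity)]
        field_simp
      simp only [E]
      rw [e1, Real.sqrt_mul h2.le, add_div, mul_div_cancel_left₀ _ h2'.ne']
      congr 1
      rw [sinhHalf, Real.sqrt_mul h2.le, div_div, mul_comm]
    rw [this]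
    rfl
  have hEξ : ∀ x : Hyp n, E x (ξ : Euc n) = 2 * (‖(ξ : Euc n) - x.val‖ / √(1 - ‖x.val‖ ^ 2)) := by
    intro x
    have h1 := one_sub_pos' x
    simp only [E]
    rw [norm_bdry, one_pow, sub_self, zero_add, Real.sqrt_div (sq_nonneg _),
      Real.sqrt_sq (norm_nonneg _)]
    ring
  have hlim : ∀ x : Hyp n, Tendsto (fun i => 2 * Real.log (E x (z i).val)) l
      (𝓝 (2 * Real.log 2 - Real.log (poisson x ξ))) := by
    intro x
    have h1 := one_sub_pos' x
    have h2 := norm_sub_pos x ξ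
    have h1' := Real.sqrt_pos.2 h1
    have : 2 * Real.log 2 - Real.log (poisson x ξ) = 2 * Real.log (E x (ξ : Euc n)) := by
      rw [hEξ, Real.log_mul two_ne_zero (by positivity), poisson,
        Real.log_div h1.ne' (by positivity), Real.log_div h2.ne' h1'.ne', Real.log_sqrt h1.le,
        Real.log_pow]
      push_cast
      ring
    rw [this]
    refine Tendsto.const_mul 2 (((hEc x).tendsto _).comp hz |>.log ?_)
    rw [hEξ]
    positivity
  have := (hlim x).sub (hlim y)
  refine (this.congr fun i => ?_).trans_eq ?_
  · rw [hE, hE]; ring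
  · congr 1; ring

/-- The Busemann cocycle is the difference of the logarithms of the Poisson kernel. -/
theorem busemann_eq (ξ : Bdry n) (x y : Hyp n) :
    busemann ξ x y = Real.log (poisson y ξ) - Real.log (poisson x ξ) :=
  (tendsto_dist_sub_dist (tendsto_ray ξ) x y).limUnder_eq

theorem exp_mul_busemann (c : ℝ) (ξ : Bdry n) (x y : Hyp n) :
    Real.exp (c * busemann ξ x y) = (poisson y ξ / poisson x ξ) ^ c := by
  have h1 := poisson_pos x ξ
  have h2 := poisson_pos y ξ
  rw [busemann_eq, ← Real.log_div h2.ne' h1.ne', Real.rpow_def_of_pos (div_pos h2 h1), mul_comm]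

theorem busemann_nonneg_iff (ξ : Bdry n) (x y : Hyp n) :
    0 ≤ busemann ξ x y ↔ poisson x ξ ≤ poisson y ξ := by
  rw [busemann_eq, sub_nonneg, Real.log_le_log_iff (poisson_pos _ _) (poisson_pos _ _)]

theorem busemann_nonpos_iff (ξ : Bdry n) (x y : Hyp n) :
    busemann ξ x y ≤ 0 ↔ poisson y ξ ≤ poisson x ξ := by
  rw [busemann_eq, sub_nonpos, Real.log_le_log_iff (poisson_pos _ _) (poisson_pos _ _)]

/-! ### Isometries at infinity -/

theorem tendsto_transl {ι : Type*} {l : Filter ι} {z : ι → Hyp n} {ξ : Bdry n}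
    (hz : Tendsto (fun i => (z i).val) l (𝓝 (ξ : Euc n))) (x : Hyp n) :
    Tendsto (fun i => (transl x (z i)).val) l (𝓝 (mobBdry x ξ : Euc n)) := by
  rw [mobBdry_val]
  exact tendsto_mob x.norm_lt (norm_bdry ξ).le tendsto_const_nhds hz

/-- Isometric embeddings extend to points at infinity. -/
theorem tendsto_isometry {f : Hyp k → Hyp n} {A : Euc k →ₗᵢ[ℝ] Euc n}
    (hA : ∀ u : Hyp k, (f u).val = mob (f origin).val (A u.val)) {ι : Type*} {l : Filter ι}
    {z : ι → Hyp k} {ξ : Bdry k} (hz : Tendsto (fun i => (z i).val) l (𝓝 (ξ : Euc k))) :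
    Tendsto (fun i => (f (z i)).val) l (𝓝 (mobBdry (f origin) (mapBdry A ξ) : Euc n)) := by
  rw [mobBdry_val, mapBdry_val]
  refine Tendsto.congr (fun i => (hA _).symm) ?_
  exact tendsto_mob (f origin).norm_lt (by rw [A.norm_map, norm_bdry]) tendsto_const_nhds
    ((A.continuous.tendsto _).comp hz)

theorem exists_linearIsometry_origin {f : Hyp k → Hyp n} (hf : Isometry f) :
    ∃ A : Euc k →ₗᵢ[ℝ] Euc n, ∀ u : Hyp k, (f u).val = mob (f origin).val (A u.val) := by
  obtain ⟨A, hA⟩ := exists_linearIsometry hf origin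
  refine ⟨A, fun u => ?_⟩
  rw [← hA u]
  congr 2
  exact ext (zero_mob _).symm

theorem bdryMap_eq_of_tendsto {g : Hyp n ≃ᵢ Hyp n} {ξ η : Bdry n}
    (h : Tendsto (fun t => (g (ray ξ t)).val) atTop (𝓝 (η : Euc n))) : bdryMap g ξ = η := by
  have hex : ∃ η : Bdry n, Tendsto (fun t => (g (ray ξ t)).val) atTop (𝓝 (η : Euc n)) := ⟨η, h⟩
  have := @Classical.epsilon_spec_aux (Bdry n) ⟨ξ⟩
    (fun η => Tendsto (fun t => (g (ray ξ t)).val) atTop (𝓝 (η : Euc n))) hex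
  exact Subtype.ext (tendsto_nhds_unique this h)

theorem bdryMap_eq {g : Hyp n ≃ᵢ Hyp n} {A : Euc n →ₗᵢ[ℝ] Euc n}
    (hA : ∀ u : Hyp n, (g u).val = mob (g origin).val (A u.val)) (ξ : Bdry n) :
    bdryMap g ξ = mobBdry (g origin) (mapBdry A ξ) :=
  bdryMap_eq_of_tendsto (tendsto_isometry (f := g) hA (tendsto_ray ξ))

theorem tendsto_bdryMap (g : Hyp n ≃ᵢ Hyp n) {ι : Type*} {l : Filter ι} {z : ι → Hyp n} {ξ : Bdry n}
    (hz : Tendsto (fun i => (z i).val) l (𝓝 (ξ : Euc n))) :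
    Tendsto (fun i => (g (z i)).val) l (𝓝 (bdryMap g ξ : Euc n)) := by
  obtain ⟨A, hA⟩ := exists_linearIsometry_origin g.isometry
  rw [bdryMap_eq hA]
  exact tendsto_isometry (f := g) hA hz

theorem continuous_bdryMap (g : Hyp n ≃ᵢ Hyp n) : Continuous (bdryMap g) := by
  obtain ⟨A, hA⟩ := exists_linearIsometry_origin g.isometry
  rw [funext fun ξ => bdryMap_eq hA ξ]
  have h : Continuous fun ξ => (g origin, mapBdry A ξ) :=
    continuous_const.prodMk (isometry_mapBdry A).continuous
  have := continuous_mobBdry.comp h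
  exact this

theorem bdryMap_mul (g h : Hyp n ≃ᵢ Hyp n) (ξ : Bdry n) :
    bdryMap (g * h) ξ = bdryMap g (bdryMap h ξ) :=
  by
  have h1 := tendsto_bdryMap h (tendsto_ray ξ)
  have h2 := tendsto_bdryMap g (z := fun t => h (ray ξ t)) h1
  apply bdryMap_eq_of_tendsto
  have : (fun t => ((g * h) (ray ξ t)).val) = fun t => (g (h (ray ξ t))).val := rfl
  rw [this]
  exact h2

@[simp] theorem bdryMap_one (ξ : Bdry n) : bdryMap 1 ξ = ξ := bdryMap_eq_of_tendsto (tendsto_ray ξ)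

@[simp] theorem bdryMap_inv_bdryMap (g : Hyp n ≃ᵢ Hyp n) (ξ : Bdry n) :
    bdryMap g⁻¹ (bdryMap g ξ) = ξ := by rw [← bdryMap_mul, inv_mul_cancel, bdryMap_one]

theorem bdryMap_injective (g : Hyp n ≃ᵢ Hyp n) : Function.Injective (bdryMap g) :=
  Function.LeftInverse.injective (bdryMap_inv_bdryMap g)

theorem bdryMap_transl (x : Hyp n) (ξ : Bdry n) : bdryMap (transl x) ξ = mobBdry x ξ :=
  bdryMap_eq_of_tendsto (tendsto_transl (tendsto_ray ξ) x)

theorem busemann_smul (g : Hyp n ≃ᵢ Hyp n) (ξ : Bdry n) (x y : Hyp n) :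
    busemann (bdryMap g ξ) (g x) (g y) = busemann ξ x y := by
  rw [busemann_eq (bdryMap g ξ), ← (tendsto_dist_sub_dist
    (tendsto_bdryMap g (tendsto_ray ξ)) (g x) (g y)).limUnder_eq, busemann]
  simp only [g.dist_eq]

namespace UnitTangent

theorem tendsto_plusEnd (v : UnitTangent n) :
    Tendsto (fun t => (v.toFun t).val) atTop (𝓝 (v.plusEnd : Euc n)) := by
  obtain ⟨e, -, he⟩ := v.exists_eq_ofDir
  rw [he, plusEnd_ofDir]
  exact tendsto_line _ _

@[simp] theorem plusEnd_smul (g : Hyp n ≃ᵢ Hyp n) (v : UnitTangent n) :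
    (g • v).plusEnd = bdryMap g v.plusEnd :=
  plusEnd_eq_of_tendsto (tendsto_bdryMap g v.tendsto_plusEnd)

@[simp] theorem minusEnd_smul (g : Hyp n ≃ᵢ Hyp n) (v : UnitTangent n) :
    (g • v).minusEnd = bdryMap g v.minusEnd := by
  rw [minusEnd, flip_smul, plusEnd_smul, minusEnd]

/-- A unit tangent vector is determined by its base point and its positive endpoint. -/
theorem ext_of_base_of_plusEnd {v w : UnitTangent n} (h1 : v.base = w.base)
    (h2 : v.plusEnd = w.plusEnd) : v = w := by
  obtain ⟨e, -, he⟩ := v.exists_eq_ofDir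
  obtain ⟨f, -, hf⟩ := w.exists_eq_ofDir
  rw [he, hf, plusEnd_ofDir, plusEnd_ofDir, h1] at h2
  rw [he, hf, h1, ← mobBdry_neg_mobBdry w.base e, h2, mobBdry_neg_mobBdry]

/-- The action of an isometry on the tangent sphere at `x`, in terms of Euclidean directions. -/
theorem exists_smul_ofDir {f : Hyp k → Hyp n} (hf : Isometry f) (x : Hyp k) :
    ∃ A : Euc k →ₗᵢ[ℝ] Euc n, ∀ e t, f (line x e t) = line (f x) (mapBdry A e) t := by
  obtain ⟨A, hA⟩ := exists_linearIsometry hf x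
  refine ⟨A, fun e t => Hyp.ext ?_⟩
  have : line x e t = transl x ⟨Real.tanh (t / 2) • (e : Euc k), norm_tanh_smul_lt t e⟩ := rfl
  rw [this, hA, line_val, mapBdry_val, A.map_smul]

theorem exists_smul_ofDir' (g : Hyp n ≃ᵢ Hyp n) (x : Hyp n) :
    ∃ A : Euc n →ₗᵢ[ℝ] Euc n, ∀ e, g • ofDir x e = ofDir (g x) (mapBdry A e) := by
  obtain ⟨A, hA⟩ := exists_smul_ofDir g.isometry x
  exact ⟨A, fun e => ext fun t => hA e t⟩

/-! ### Topology of the unit tangent bundle -/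

theorem isInducing_toFun : IsInducing (toFun : UnitTangent n → ℝ → Hyp n) := ⟨rfl⟩

theorem continuous_toFun (t : ℝ) : Continuous fun v : UnitTangent n => v.toFun t :=
  (continuous_apply t).comp isInducing_toFun.continuous

theorem continuous_base : Continuous (base : UnitTangent n → Hyp n) := continuous_toFun 0

theorem continuous_ofDir : Continuous fun z : Hyp n × Bdry n => ofDir z.1 z.2 := by
  rw [isInducing_toFun.continuous_iff]
  refine continuous_pi fun t => continuous_iff.2 (continuous_iff_continuousAt.2 fun z => ?_)
  have h2 : Continuous fun z : Hyp n × Bdry n => Real.tanh (t / 2) • (z.2 : Euc n) := by fun_prop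
  exact tendsto_mob z.1.norm_lt (norm_tanh_smul_lt t z.2).le
    (continuous_val.comp continuous_fst).continuousAt h2.continuousAt

theorem continuous_preDir : Continuous (preDir : UnitTangent n → Euc n) := by
  refine continuous_iff_continuousAt.2 fun v => ?_
  have h : Tendsto (fun w : UnitTangent n => mob (-w.base.val) (w.toFun 1).val) (𝓝 v)
      (𝓝 (mob (-v.base.val) (v.toFun 1).val)) :=
    tendsto_mob (by rw [norm_neg]; exact v.base.norm_lt) (v.toFun 1).norm_lt.le
      (continuous_val.comp continuous_base).neg.continuousAt
      (continuous_val.comp (continuous_toFun 1)).continuousAt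
  exact h.const_smul (Real.tanh (1 / 2))⁻¹

/-- The identification of the unit tangent bundle with a product, by the base point and the Euclidean
direction. -/
def homeoProd (n : ℕ) : Hyp n × Bdry n ≃ₜ UnitTangent n where
  toFun z := ofDir z.1 z.2
  invFun v := (v.base, ⟨v.preDir, by obtain ⟨e, he, -⟩ := v.exists_eq_ofDir; rw [← he]; exact e.2⟩)
  left_inv z := by
    obtain ⟨e, he, h⟩ := (ofDir z.1 z.2).exists_eq_ofDir
    refine Prod.ext (base_ofDir _ _) (Subtype.ext ?_)
    rw [(ofDir_injective h).2]
    exact he.symm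
  right_inv v := by
    obtain ⟨e, he, h⟩ := v.exists_eq_ofDir
    refine Eq.trans ?_ h.symm
    exact congrArg (ofDir v.base) (Subtype.ext he.symm)
  continuous_toFun := continuous_ofDir
  continuous_invFun := continuous_base.prodMk (continuous_preDir.subtype_mk _)

instance : PolishSpace (UnitTangent n) :=
  (homeoProd n).symm.isClosedEmbedding.polishSpace

theorem continuous_plusEnd : Continuous (plusEnd : UnitTangent n → Bdry n) := by
  have : (plusEnd : UnitTangent n → Bdry n) =
      (fun z : Hyp n × Bdry n => mobBdry z.1 z.2) ∘ (homeoProd n).symm := by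
    ext1 v
    obtain ⟨z, rfl⟩ := (homeoProd n).surjective v
    rw [Function.comp_apply, Homeomorph.symm_apply_apply]
    exact plusEnd_ofDir _ _
  rw [this]
  exact continuous_mobBdry.comp (homeoProd n).symm.continuous

theorem continuous_flip : Continuous (flip : UnitTangent n → UnitTangent n) := by
  rw [isInducing_toFun.continuous_iff]
  exact continuous_pi fun t => continuous_toFun (-t)

theorem continuous_minusEnd : Continuous (minusEnd : UnitTangent n → Bdry n) :=
  continuous_plusEnd.comp continuous_flip

theorem continuous_smul (g : Hyp n ≃ᵢ Hyp n) : Continuous fun v : UnitTangent n => g • v := by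
  rw [isInducing_toFun.continuous_iff]
  exact continuous_pi fun t => g.continuous.comp (continuous_toFun t)

end UnitTangent

end Hyp

namespace Hyp

variable {n k : ℕ}

/-! ### Horospherical coordinates -/

/-- The denominator in `horoVec`. -/
def horoDenom (ξ η : Bdry n) (y : ℝ) : ℝ := 4 + (2 * y + y ^ 2) * ‖(η : Euc n) - ξ‖ ^ 2

/-- The point on the geodesic line from `η` to `ξ` at which the Poisson kernel of `ξ` is `y`. In the
upper half-space in which `ξ` is at infinity, this is the point at height `y` above the point of the
horizontal hyperplane that corresponds to `η`. -/
def horoVec (ξ η : Bdry n) (y : ℝ) : Euc n :=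
  (horoDenom ξ η y)⁻¹ • ((4 : ℝ) • (η : Euc n) + (y ^ 2 * ‖(η : Euc n) - ξ‖ ^ 2) • (ξ : Euc n))

theorem horoDenom_pos (ξ η : Bdry n) {y : ℝ} (hy : 0 ≤ y) : 0 < horoDenom ξ η y := by
  unfold horoDenom; positivity

theorem norm_bdry_sub_sq (ξ η : Bdry n) :
    ‖(η : Euc n) - ξ‖ ^ 2 = 2 - 2 * inner ℝ (η : Euc n) (ξ : Euc n) := by
  rw [norm_sub_sq_real, norm_bdry, norm_bdry]; ring

theorem norm_bdry_sub_pos {ξ η : Bdry n} (h : η ≠ ξ) : 0 < ‖(η : Euc n) - ξ‖ :=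
  norm_pos_iff.2 (sub_ne_zero.2 fun h' => h (Subtype.ext h'))

theorem norm_horoVec_sq (ξ η : Bdry n) {y : ℝ} (hy : 0 ≤ y) :
    1 - ‖horoVec ξ η y‖ ^ 2 = 4 * y * ‖(η : Euc n) - ξ‖ ^ 2 / horoDenom ξ η y := by
  have hD := (horoDenom_pos ξ η hy).ne'
  rw [horoVec, norm_smul, mul_pow, norm_add_sq_real, norm_smul, norm_smul, inner_smul_left,
    inner_smul_right, norm_bdry, norm_bdry]
  simp only [Real.norm_eq_abs, mul_pow, sq_abs, conj_trivial]
  field_simp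
  have h4 : ‖(η : Euc n) - ξ‖ ^ 4 = (2 - 2 * inner ℝ (η : Euc n) (ξ : Euc n)) ^ 2 := by
    rw [← norm_bdry_sub_sq]; ring
  simp only [horoDenom, norm_bdry_sub_sq, h4]
  ring

theorem norm_horoVec_sub_sq (ξ η η' : Bdry n) {y y' : ℝ} (hy : 0 ≤ y) (hy' : 0 ≤ y') :
    ‖horoVec ξ η y - horoVec ξ η' y'‖ ^ 2 =
      4 * (4 * ‖(η : Euc n) - η'‖ ^ 2 +
        ‖(η : Euc n) - ξ‖ ^ 2 * ‖(η' : Euc n) - ξ‖ ^ 2 * (y - y') ^ 2) /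
        (horoDenom ξ η y * horoDenom ξ η' y') := by
  have hD := (horoDenom_pos ξ η hy).ne'
  have hD' := (horoDenom_pos ξ η' hy').ne'
  have e1 : ‖horoVec ξ η y‖ ^ 2 = 1 - 4 * y * ‖(η : Euc n) - ξ‖ ^ 2 / horoDenom ξ η y := by
    rw [← norm_horoVec_sq ξ η hy]; ring
  have e2 : ‖horoVec ξ η' y'‖ ^ 2 = 1 - 4 * y' * ‖(η' : Euc n) - ξ‖ ^ 2 / horoDenom ξ η' y' := by
    rw [← norm_horoVec_sq ξ η' hy']; ring
  rw [norm_sub_sq_real, e1, e2, horoVec, horoVec]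
  simp only [inner_smul_left, inner_smul_right, inner_add_left, inner_add_right, conj_trivial,
    real_inner_self_eq_norm_sq, norm_bdry]
  field_simp
  simp only [horoDenom, norm_bdry_sub_sq]
  rw [real_inner_comm (ξ : Euc n) (η' : Euc n)]
  ring

theorem norm_sub_horoVec_sq (ξ η η' : Bdry n) {y : ℝ} (hy : 0 ≤ y) :
    ‖(η' : Euc n) - horoVec ξ η y‖ ^ 2 = (4 * ‖(η : Euc n) - η'‖ ^ 2 +
        ‖(η : Euc n) - ξ‖ ^ 2 * ‖(η' : Euc n) - ξ‖ ^ 2 * y ^ 2) / horoDenom ξ η y := by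
  have h := norm_horoVec_sub_sq ξ η η' hy le_rfl
  have h0 : horoVec ξ η' 0 = η' := by
    rw [horoVec, horoDenom]
    simp
  rw [h0] at h
  rw [norm_sub_rev, h, horoDenom, horoDenom]
  have := (horoDenom_pos ξ η hy).ne'
  rw [horoDenom] at this
  field_simp
  ring

theorem norm_sub_horoVec_self_sq (ξ η : Bdry n) {y : ℝ} (hy : 0 ≤ y) :
    ‖(ξ : Euc n) - horoVec ξ η y‖ ^ 2 = 4 * ‖(η : Euc n) - ξ‖ ^ 2 / horoDenom ξ η y := by
  rw [norm_sub_horoVec_sq ξ η ξ hy]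
  simp

open Classical in
/-- The retraction of Euclidean space to the ball that sends all other points to the centre. -/
def toHyp (u : Euc n) : Hyp n := if h : ‖u‖ < 1 then ⟨u, h⟩ else origin

theorem toHyp_val {u : Euc n} (h : ‖u‖ < 1) : (toHyp u).val = u := by
  rw [toHyp, dif_pos h]

theorem measurable_toHyp : Measurable (toHyp : Euc n → Hyp n) := by
  unfold toHyp
  refine Measurable.dite (s := {u : Euc n | ‖u‖ < 1}) (f := fun u => (⟨u.1, u.2⟩ : Hyp n))
    (g := fun _ => origin) ?_ measurable_const (measurableSet_lt measurable_norm measurable_const)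
  have : Continuous fun u : {u : Euc n | ‖u‖ < 1} => (⟨u.1, u.2⟩ : Hyp n) :=
    continuous_iff.2 continuous_subtype_val
  exact this.measurable

/-- Horospherical coordinates centred at `ξ`: the point of the geodesic line from `η` to `ξ` at which
the logarithm of the Poisson kernel of `ξ` is `s`. The value is arbitrary if `η = ξ`. -/
def horo (ξ η : Bdry n) (s : ℝ) : Hyp n := toHyp (horoVec ξ η (Real.exp s))

theorem norm_horoVec_lt {ξ η : Bdry n} (h : η ≠ ξ) {y : ℝ} (hy : 0 < y) : ‖horoVec ξ η y‖ < 1 := by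
  have h1 := norm_horoVec_sq ξ η hy.le
  have h2 : 0 < 4 * y * ‖(η : Euc n) - ξ‖ ^ 2 / horoDenom ξ η y := by
    have := horoDenom_pos ξ η hy.le
    have := norm_bdry_sub_pos h
    positivity
  nlinarith [norm_nonneg (horoVec ξ η y)]

theorem horo_val {ξ η : Bdry n} (h : η ≠ ξ) (s : ℝ) :
    (horo ξ η s).val = horoVec ξ η (Real.exp s) := toHyp_val (norm_horoVec_lt h (Real.exp_pos s))

theorem continuous_horoVec :
    Continuous fun z : Bdry n × Bdry n × ℝ => horoVec z.1 z.2.1 (Real.exp z.2.2) := by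
  have : ∀ z : Bdry n × Bdry n × ℝ, horoDenom z.1 z.2.1 (Real.exp z.2.2) ≠ 0 :=
    fun z => (horoDenom_pos _ _ (Real.exp_pos _).le).ne'
  unfold horoVec
  unfold horoDenom at *
  fun_prop (disch := assumption)

theorem measurable_horo : Measurable fun z : Bdry n × Bdry n × ℝ => horo z.1 z.2.1 z.2.2 :=
  measurable_toHyp.comp continuous_horoVec.measurable

theorem continuousOn_horo (ξ : Bdry n) :
    ContinuousOn (fun z : Bdry n × ℝ => horo ξ z.1 z.2) {z | z.1 ≠ ξ} := by
  rw [isInducing_val.continuousOn_iff]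
  have h : Continuous fun z : Bdry n × ℝ => horoVec ξ z.1 (Real.exp z.2) :=
    continuous_horoVec.comp (continuous_const.prodMk continuous_id)
  exact h.continuousOn.congr fun z hz => horo_val hz z.2

@[simp] theorem poisson_horo {ξ η : Bdry n} (h : η ≠ ξ) (s : ℝ) :
    poisson (horo ξ η s) ξ = Real.exp s := by
  have hy := Real.exp_pos s
  have h1 := norm_bdry_sub_pos h
  have h2 := horoDenom_pos ξ η hy.le
  rw [poisson, horo_val h, norm_horoVec_sq ξ η hy.le, norm_sub_horoVec_self_sq ξ η hy.le]
  field_simp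

theorem poisson_horo' {ξ η : Bdry n} (h : η ≠ ξ) (s : ℝ) (η' : Bdry n) :
    poisson (horo ξ η s) η' = 4 * Real.exp s * ‖(η : Euc n) - ξ‖ ^ 2 / (4 * ‖(η : Euc n) - η'‖ ^ 2 +
        ‖(η : Euc n) - ξ‖ ^ 2 * ‖(η' : Euc n) - ξ‖ ^ 2 * Real.exp s ^ 2) := by
  have hy := Real.exp_pos s
  have h1 := norm_bdry_sub_pos h
  have h2 := horoDenom_pos ξ η hy.le
  rw [poisson, horo_val h, norm_horoVec_sq ξ η hy.le, norm_sub_horoVec_sq ξ η η' hy.le]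
  field_simp

theorem poisson_horo_self {ξ η : Bdry n} (h : η ≠ ξ) (s : ℝ) :
    poisson (horo ξ η s) η = 4 / (Real.exp s * ‖(η : Euc n) - ξ‖ ^ 2) := by
  have hy := Real.exp_pos s
  have h1 := norm_bdry_sub_pos h
  rw [poisson_horo' h]
  simp only [sub_self, norm_zero]
  field_simp
  ring

/-- The hyperbolic distance in horospherical coordinates. -/
theorem sinh_dist_horo {ξ η η' : Bdry n} (h : η ≠ ξ) (h' : η' ≠ ξ) (s s' : ℝ) :
    (2 * Real.sinh (dist (horo ξ η s) (horo ξ η' s') / 2)) ^ 2 =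
      2 * Real.exp (-s) / ‖(η : Euc n) - ξ‖ ^ 2 * (2 * Real.exp (-s') / ‖(η' : Euc n) - ξ‖ ^ 2) *
        dist η η' ^ 2 + (2 * Real.sinh (dist s s' / 2)) ^ 2 := by
  have hy := Real.exp_pos s
  have hy' := Real.exp_pos s'
  have h1 := norm_bdry_sub_pos h
  have h1' := norm_bdry_sub_pos h'
  have h2 := horoDenom_pos ξ η hy.le
  have h2' := horoDenom_pos ξ η' hy'.le
  have e1 : (2 * Real.sinh (dist s s' / 2)) ^ 2 =
      (Real.exp s - Real.exp s') ^ 2 / (Real.exp s * Real.exp s') := by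
    have e2 : (2 * Real.sinh (dist s s' / 2)) ^ 2 = (2 * Real.sinh ((s - s') / 2)) ^ 2 := by
      rw [Real.dist_eq]
      rcases abs_choice (s - s') with h | h <;> rw [h]
      rw [neg_div, Real.sinh_neg]; ring
    have e3 : Real.exp s = Real.exp (s / 2) ^ 2 := by rw [← Real.exp_nat_mul]; ring_nf
    have e4 : Real.exp s' = Real.exp (s' / 2) ^ 2 := by rw [← Real.exp_nat_mul]; ring_nf
    have p := Real.exp_pos (s / 2)
    have p' := Real.exp_pos (s' / 2)
    rw [e2, Real.sinh_eq, show -((s - s') / 2) = s' / 2 - s / 2 by ring, sub_div s s', Real.exp_sub, Real.exp_sub, e3, e4]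
    field_simp
  rw [e1, sinh_dist_sq, horo_val h, horo_val h', norm_horoVec_sub_sq ξ η η' hy.le hy'.le,
    norm_horoVec_sq ξ η hy.le, norm_horoVec_sq ξ η' hy'.le, Subtype.dist_eq, dist_eq_norm,
    Real.exp_neg, Real.exp_neg]
  field_simp
  ring

/-- Horospherical coordinates are surjective. -/
theorem exists_eq_horo (ξ : Bdry n) (x : Hyp n) :
    ∃ η : Bdry n, η ≠ ξ ∧ x = horo ξ η (Real.log (poisson x ξ)) := by
  set r := ‖x.val‖ ^ 2 with hr
  set c := inner ℝ x.val (ξ : Euc n) with hc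
  set w := ‖(ξ : Euc n) - x.val‖ ^ 2 with hw
  have hw0 : 0 < w := pow_pos (norm_sub_pos x ξ) 2
  have hr1 : 0 < 1 - r := one_sub_pos' x
  have hwe : w = 1 + r - 2 * c := by
    rw [hw, norm_sub_sq_real, norm_bdry, real_inner_comm]; ring
  -- the hyperbolic line from `ξ` through `x` is in the plane spanned by `ξ` and `x`; its second
  -- endpoint `η` is the second intersection of the sphere with the line through `ξ` directed by
  -- `v`, which is the solution of `horoVec ξ η y = x`
  set v : Euc n := (2 : ℝ) • x.val - (1 + r) • (ξ : Euc n) with hv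
  have hvξ : inner ℝ v (ξ : Euc n) = -w := by
    rw [hv, inner_sub_left, inner_smul_left, inner_smul_left, real_inner_self_eq_norm_sq, norm_bdry,
      hwe]
    simp only [conj_trivial]
    ring
  set K := ‖v‖ ^ 2 with hK
  have hKe : K = 2 * (1 + r) * w - (1 - r) ^ 2 := by
    rw [hK, hv, norm_sub_sq_real, norm_smul, norm_smul, norm_bdry, inner_smul_left,
      inner_smul_right, hwe]
    simp only [conj_trivial, Real.norm_eq_abs, mul_pow, sq_abs, ← hr, ← hc]
    ring
  have hK0 : 0 < K := by
    refine pow_pos (norm_pos_iff.2 fun h0 => ?_) 2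
    rw [h0, inner_zero_left] at hvξ
    linarith
  have hη1 : ‖(ξ : Euc n) + (2 * w / K) • v‖ ^ 2 = 1 := by
    rw [norm_add_sq_real, norm_smul, inner_smul_right, real_inner_comm, hvξ, norm_bdry, mul_pow,
      ← hK]
    simp only [Real.norm_eq_abs, sq_abs]
    field_simp
    ring
  let η : Bdry n := ⟨(ξ : Euc n) + (2 * w / K) • v, mem_sphere_zero_iff_norm.2
    (by nlinarith [norm_nonneg ((ξ : Euc n) + (2 * w / K) • v)])⟩
  have hηv : (η : Euc n) = (ξ : Euc n) + (2 * w / K) • v := rfl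
  have hq : ‖(η : Euc n) - ξ‖ ^ 2 = 4 * w ^ 2 / K := by
    rw [hηv, add_sub_cancel_left, norm_smul, mul_pow, ← hK]
    simp only [Real.norm_eq_abs, sq_abs]
    field_simp
    ring
  have hne : η ≠ ξ := by
    intro h
    rw [h, sub_self, norm_zero] at hq
    have : 0 < 4 * w ^ 2 / K := by positivity
    rw [← hq] at this
    simp at this
  refine ⟨η, hne, ext ?_⟩
  rw [horo_val hne, Real.exp_log (poisson_pos _ _)]
  have hP : poisson x ξ = (1 - r) / w := rfl
  have hD : horoDenom ξ η (poisson x ξ) = 16 * w / K := by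
    rw [horoDenom, hq, hP]
    field_simp
    rw [hKe]
    ring
  rw [horoVec, hD, hq, hP, hηv]
  have e : (4 : ℝ) • ((ξ : Euc n) + (2 * w / K) • v) +
      (((1 - r) / w) ^ 2 * (4 * w ^ 2 / K)) • (ξ : Euc n) = (16 * w / K) • x.val := by
    have e1 : ((1 - r) / w) ^ 2 * (4 * w ^ 2 / K) = 4 * (1 - r) ^ 2 / K := by
      field_simp
    have e2 : (16 * w / K) • x.val = (4 * (2 * w / K)) • v + (8 * (1 + r) * w / K) • (ξ : Euc n) := by
      rw [hv]
      module
    have e3 : 8 * (1 + r) * w / K = 4 + 4 * (1 - r) ^ 2 / K := by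
      field_simp
      rw [hKe]
      ring
    rw [e1, e2, e3]
    module
  rw [e, smul_smul, inv_mul_cancel₀ (by positivity), one_smul]

theorem horo_injective {ξ η η' : Bdry n} (h : η ≠ ξ) (h' : η' ≠ ξ) {s s' : ℝ}
    (he : horo ξ η s = horo ξ η' s') : η = η' ∧ s = s' := by
  have h1 := norm_bdry_sub_pos h
  have h1' := norm_bdry_sub_pos h'
  have hs : s = s' := Real.exp_injective (by rw [← poisson_horo h s, he, poisson_horo h'])
  subst hs
  refine ⟨?_, rfl⟩
  have := sinh_dist_horo h h' s s
  rw [he, dist_self, dist_self] at this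
  simp only [zero_div, Real.sinh_zero, mul_zero, ne_eq, OfNat.ofNat_ne_zero, not_false_eq_true,
    zero_pow, add_zero] at this
  have hp : 0 < 2 * Real.exp (-s) / ‖(η : Euc n) - ξ‖ ^ 2 *
      (2 * Real.exp (-s) / ‖(η' : Euc n) - ξ‖ ^ 2) := by positivity
  have := (mul_eq_zero.1 this.symm).resolve_left hp.ne'
  exact dist_eq_zero.1 (pow_eq_zero_iff two_ne_zero |>.1 this)

/-! ### Tangent vectors pointing to a point at infinity -/

/-- The unit tangent vector at `x` that points to `ξ`. -/
def toward (x : Hyp n) (ξ : Bdry n) : UnitTangent n := UnitTangent.ofDir x (mobBdry (neg x) ξ)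

@[simp] theorem base_toward (x : Hyp n) (ξ : Bdry n) : (toward x ξ).base = x :=
  UnitTangent.base_ofDir _ _

@[simp] theorem plusEnd_toward (x : Hyp n) (ξ : Bdry n) : (toward x ξ).plusEnd = ξ := by
  rw [toward, UnitTangent.plusEnd_ofDir, mobBdry_mobBdry_neg]

theorem eq_toward (v : UnitTangent n) : v = toward v.base v.plusEnd :=
  UnitTangent.ext_of_base_of_plusEnd (by simp) (by simp)

theorem toward_mobBdry (x : Hyp n) (e : Bdry n) : toward x (mobBdry x e) = UnitTangent.ofDir x e := by
  rw [toward, mobBdry_neg_mobBdry]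

theorem smul_toward (g : Hyp n ≃ᵢ Hyp n) (x : Hyp n) (ξ : Bdry n) :
    g • toward x ξ = toward (g x) (bdryMap g ξ) := by
  rw [eq_toward (g • toward x ξ)]
  simp

theorem continuous_toward : Continuous fun z : Hyp n × Bdry n => toward z.1 z.2 := by
  have h : Continuous fun z : Hyp n × Bdry n => (neg z.1, z.2) :=
    (continuous_neg.comp continuous_fst).prodMk continuous_snd
  have h2 := continuous_mobBdry.comp h
  have h3 := UnitTangent.continuous_ofDir.comp (continuous_fst.prodMk h2)
  exact h3

/-- Horospherical coordinates parametrise geodesic lines with unit speed. -/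
theorem toward_horo_toFun {ξ η : Bdry n} (h : η ≠ ξ) (s t : ℝ) :
    (toward (horo ξ η s) ξ).toFun t = horo ξ η (s + t) := by
  have hiso : Isometry fun t => horo ξ η (s + t) := by
    refine Isometry.of_dist_eq fun t t' => ?_
    have := sinh_dist_horo h h (s + t) (s + t')
    rw [dist_self, zero_pow two_ne_zero, mul_zero, zero_add, dist_add_left,
      sq_eq_sq₀ (mul_nonneg zero_le_two (Real.sinh_nonneg_iff.2 (by positivity)))
      (mul_nonneg zero_le_two (Real.sinh_nonneg_iff.2 (by positivity))),
      mul_right_inj' two_ne_zero, Real.sinh_inj] at this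
    linarith
  -- an isometric embedding of `ℝ` is a geodesic; it ends at `ξ`, as does `toward (horo ξ η s) ξ`
  let v : UnitTangent n := ⟨fun t => horo ξ η (s + t), hiso⟩
  have hv : v.plusEnd = ξ := by
    apply UnitTangent.plusEnd_eq_of_tendsto
    rw [tendsto_iff_norm_sub_tendsto_zero]
    have hq := norm_bdry_sub_pos h
    have e : ∀ t, ‖(v.toFun t).val - (ξ : Euc n)‖ ^ 2 ≤ 4 / (2 * Real.exp (s + t)) := by
      intro t
      have hD := horoDenom_pos ξ η (Real.exp_pos (s + t)).le
      rw [norm_sub_rev]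
      change ‖(ξ : Euc n) - (horo ξ η (s + t)).val‖ ^ 2 ≤ _
      rw [horo_val h, norm_sub_horoVec_self_sq ξ η (Real.exp_pos _).le,
        div_le_div_iff₀ hD (by positivity)]
      unfold horoDenom
      have := Real.exp_pos (s + t)
      have h3 : 0 < Real.exp (s + t) ^ 2 * ‖(η : Euc n) - ξ‖ ^ 2 := by positivity
      nlinarith
    have t1 : Tendsto (fun t => 4 / (2 * Real.exp (s + t))) atTop (𝓝 0) :=
      tendsto_const_nhds.div_atTop ((Real.tendsto_exp_atTop.comp
        (tendsto_atTop_add_const_left _ s tendsto_id)).const_mul_atTop two_pos)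
    have t2 := squeeze_zero (fun _ => sq_nonneg _) e t1
    have t3 := t2.sqrt
    simpa using t3
  have hvb : v.base = horo ξ η s := by
    change horo ξ η (s + 0) = _
    rw [add_zero]
  have := eq_toward v
  rw [hvb, hv] at this
  rw [← this]

theorem minusEnd_toward_horo {ξ η : Bdry n} (h : η ≠ ξ) (s : ℝ) :
    (toward (horo ξ η s) ξ).minusEnd = η := by
  apply UnitTangent.plusEnd_eq_of_tendsto
  simp only [UnitTangent.flip_toFun, toward_horo_toFun h]
  have hc : ContinuousAt (fun y : ℝ => horoVec ξ η y) 0 := by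
    have := (horoDenom_pos ξ η le_rfl).ne'
    unfold horoVec horoDenom at *
    fun_prop (disch := assumption)
  have h0 : horoVec ξ η 0 = η := by
    rw [horoVec, horoDenom]
    simp
  have t1 : Tendsto (fun t : ℝ => Real.exp (s + -t)) atTop (𝓝 0) :=
    Real.tendsto_exp_atBot.comp (tendsto_atBot_add_const_left _ s tendsto_neg_atTop_atBot)
  have t2 := hc.tendsto.comp t1
  rw [h0] at t2
  exact t2.congr fun t => (horo_val h _).symm

theorem exists_eq_toward_horo (v : UnitTangent n) : v.minusEnd ≠ v.plusEnd ∧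
    v = toward (horo v.plusEnd v.minusEnd (Real.log (poisson v.base v.plusEnd))) v.plusEnd := by
  obtain ⟨η, hη, hx⟩ := exists_eq_horo v.plusEnd v.base
  have hv := eq_toward v
  rw [hx] at hv
  have : v.minusEnd = η := by
    exact (congrArg UnitTangent.minusEnd hv).trans (minusEnd_toward_horo hη _)
  rw [this]
  exact ⟨hη, hv⟩

end Hyp

namespace Hyp

variable {n k m : ℕ}

/-! ### Hausdorff measures on hyperbolic space and on spheres -/

/-- The charts are the ball models centred at the points: twice the Euclidean distance is the
hyperbolic one to first order at the centre. -/
theorem isLocallyEuclidean_hyp : IsLocallyEuclidean n (Hyp n) := by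
  intro x K hK
  obtain ⟨C, hC, hCK⟩ := exists_one_lt_pow_le hK 2
  let φ : Hyp n → Euc n := fun y => (2 : ℝ) • ((transl x).symm y).val
  have hφ : Continuous φ := (continuous_val.comp (transl x).symm.continuous).const_smul (2 : ℝ)
  let a : Hyp n → ℝ := fun y => (1 - ‖((transl x).symm y).val‖ ^ 2)⁻¹
  have hv : Continuous fun y : Hyp n => ((transl x).symm y).val :=
    continuous_val.comp (transl x).symm.continuous
  have ha : Continuous a := (continuous_const.sub (hv.norm.pow 2)).inv₀
    fun y => (one_sub_pos' ((transl x).symm y)).ne'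
  obtain ⟨U, hUo, hxU, hU⟩ := exists_nhds_dist_sq_le (Ω := Set.univ) (F := fun y : Hyp n => y)
    (f := φ) (g := fun _ => ()) (a := a) (b := fun _ => 1) isGauge_id isGauge_id isGauge_sinh hφ
    continuous_const continuousOn_id ha.continuousOn continuousOn_const
    (fun y _ => inv_pos.2 (one_sub_pos' _)) (fun _ _ => one_pos) (fun y _ z _ => by
      have h1 := one_sub_pos' ((transl x).symm y)
      have h2 := one_sub_pos' ((transl x).symm z)
      have e : dist (φ y) (φ z) =
          2 * ‖((transl x).symm y).val - ((transl x).symm z).val‖ := by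
        rw [dist_smul₀, Real.norm_two, dist_eq_norm]
      rw [← (transl x).symm.dist_eq, sinh_dist_sq, e]
      simp only [a, dist_self]
      field_simp
      ring) (Set.mem_univ x) hC
  have hax : a x = 1 := by
    simp only [a, transl_symm_self, origin_val]
    simp
  refine ⟨φ, hφ, U, hUo, hxU, fun y hy z hz => ?_⟩
  obtain ⟨h1, h2⟩ := hU y ⟨hy, trivial⟩ z ⟨hz, trivial⟩
  simp only [hax, dist_self, ne_eq, OfNat.ofNat_ne_zero, not_false_eq_true, zero_pow, mul_zero,
    add_zero, one_pow, one_mul] at h1 h2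
  have hC0 : 0 < C := by linarith
  constructor
  · refine (le_of_sq_le_sq (a := dist y z) (b := C ^ 2 * dist (φ y) (φ z)) (by rw [mul_pow]; linarith)
      (by positivity)).trans (by gcongr)
  · refine (le_of_sq_le_sq (a := dist (φ y) (φ z)) (b := C ^ 2 * dist y z)
      (by rw [mul_pow]; linarith) (by positivity)).trans (by gcongr)

/-- The charts are the orthogonal projections to the tangent hyperplanes. -/
theorem isLocallyEuclidean_bdry : IsLocallyEuclidean m (Bdry (m + 1)) := by
  intro ξ C hC
  have hfact : Fact (Module.finrank ℝ (Euc (m + 1)) = m + 1) := ⟨by simp⟩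
  have hξ : (ξ : Euc (m + 1)) ≠ 0 := norm_pos_iff.1 (by rw [norm_bdry]; exact one_pos)
  let b := OrthonormalBasis.fromOrthogonalSpanSingleton (𝕜 := ℝ) m hξ
  let K : Submodule ℝ (Euc (m + 1)) := (ℝ ∙ (ξ : Euc (m + 1)))ᗮ
  let φ : Bdry (m + 1) → Euc m := fun η => b.repr (K.orthogonalProjectionOnto (η : Euc (m + 1)))
  have hφ : Continuous φ := by fun_prop
  have hsplit : ∀ u : Euc (m + 1), ‖u‖ ^ 2 =
      inner ℝ (ξ : Euc (m + 1)) u ^ 2 + ‖K.orthogonalProjectionOnto u‖ ^ 2 := by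
    intro u
    have h1 := Submodule.norm_sq_eq_add_norm_sq_projection u (ℝ ∙ (ξ : Euc (m + 1)))
    rw [h1]
    congr 1
    rw [← Submodule.norm_coe, ← Submodule.starProjection_apply,
      Submodule.starProjection_unit_singleton ℝ (norm_bdry ξ), norm_smul, norm_bdry, mul_one,
      Real.norm_eq_abs, sq_abs]
  have hφd : ∀ η η' : Bdry (m + 1), dist (φ η) (φ η') ^ 2 =
      ‖K.orthogonalProjectionOnto ((η : Euc (m + 1)) - η')‖ ^ 2 := by
    intro η η'
    rw [dist_eq_norm, ← map_sub, b.repr.norm_map, ← map_sub]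
  let t : Bdry (m + 1) → ℝ := fun η => inner ℝ (ξ : Euc (m + 1)) (η : Euc (m + 1))
  have htc : Continuous t := by fun_prop
  have htξ : t ξ = 1 := by simp only [t, real_inner_self_eq_norm_sq, norm_bdry, one_pow]
  have hφt : ∀ η, ‖φ η‖ ^ 2 = 1 - t η ^ 2 := by
    intro η
    have h1 := hsplit η
    rw [norm_bdry] at h1
    rw [b.repr.norm_map]
    linarith
  -- near `ξ` the norms of the projections are small, so that heights vary little
  obtain ⟨ε, hε0, hε1, hε⟩ : ∃ ε : ℝ, 0 < ε ∧ ε ≤ 1 ∧ 1 + ε ^ 2 ≤ C ^ 2 := by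
    refine ⟨min 1 (C - 1), lt_min one_pos (by linarith), min_le_left _ _, ?_⟩
    have h1 : min 1 (C - 1) ≤ C - 1 := min_le_right _ _
    have h0 : 0 < min 1 (C - 1) := lt_min one_pos (by linarith)
    nlinarith
  let U : Set (Bdry (m + 1)) := {η | 1 / 2 < t η ∧ ‖φ η‖ < ε / 2}
  have hUo : IsOpen U := (isOpen_lt continuous_const htc).inter (isOpen_lt hφ.norm continuous_const)
  have hξU : ξ ∈ U := by
    refine ⟨by rw [htξ]; norm_num, ?_⟩
    have := hφt ξ
    rw [htξ, one_pow, sub_self, sq_eq_zero_iff] at this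
    rw [this]
    positivity
  refine ⟨φ, hφ, U, hUo, hξU, fun η hη η' hη' => ?_⟩
  have hd : dist η η' ^ 2 = (t η - t η') ^ 2 + dist (φ η) (φ η') ^ 2 := by
    rw [hφd, Subtype.dist_eq, dist_eq_norm, hsplit, inner_sub_right]
  have h1 : |t η - t η'| ≤ ε * dist (φ η) (φ η') := by
    have e1 : (t η - t η') * (t η + t η') = (‖φ η'‖ - ‖φ η‖) * (‖φ η‖ + ‖φ η'‖) := by
      have := hφt η
      have := hφt η'
      nlinarith
    have e2 : |t η - t η'| ≤ |t η - t η'| * (t η + t η') :=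
      le_mul_of_one_le_right (abs_nonneg _) (by linarith [hη.1, hη'.1])
    have e3 : |t η - t η'| * (t η + t η') = |‖φ η'‖ - ‖φ η‖| * (‖φ η‖ + ‖φ η'‖) := by
      rw [← abs_of_pos (show 0 < t η + t η' by linarith [hη.1, hη'.1]), ← abs_mul, e1, abs_mul,
        abs_of_nonneg (show 0 ≤ ‖φ η‖ + ‖φ η'‖ by positivity)]
    have e4 : |‖φ η'‖ - ‖φ η‖| ≤ dist (φ η) (φ η') := by
      rw [dist_comm, dist_eq_norm]; exact abs_norm_sub_norm_le _ _
    have e5 : ‖φ η‖ + ‖φ η'‖ ≤ ε := by linarith [hη.2, hη'.2]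
    calc _ ≤ _ := e2
      _ = _ := e3
      _ ≤ dist (φ η) (φ η') * ε := by gcongr
      _ = _ := mul_comm _ _
  have h2 : (t η - t η') ^ 2 ≤ ε ^ 2 * dist (φ η) (φ η') ^ 2 := by
    rw [← sq_abs, ← mul_pow]
    gcongr
  constructor
  · refine le_of_sq_le_sq ?_ (by positivity)
    rw [hd, mul_pow]
    nlinarith [sq_nonneg (dist (φ η) (φ η'))]
  · have h3 : dist (φ η) (φ η') ≤ dist η η' :=
      le_of_sq_le_sq (by rw [hd]; nlinarith [sq_nonneg (t η - t η')]) dist_nonneg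
    have := dist_nonneg (x := η) (y := η')
    nlinarith

instance : SigmaFinite (μHE[n] : Measure (Hyp n)) := isLocallyEuclidean_hyp.sigmaFinite

instance : IsFiniteMeasure (μHE[m] : Measure (Bdry (m + 1))) := by
  have := (isLocallyEuclidean_bdry (m := m)).isLocallyFiniteMeasure
  exact CompactSpace.isFiniteMeasure

theorem euclideanHausdorffMeasure_singleton {X : Type*} [MetricSpace X] [MeasurableSpace X]
    [BorelSpace X] (hm : 1 ≤ m) (x : X) : (μHE[m] : Measure X) {x} = 0 := by
  have := Measure.nullSingletonClass_hausdorff X (d := m) (by exact_mod_cast hm)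
  rw [Measure.euclideanHausdorffMeasure_def, Measure.smul_apply, measure_singleton, smul_zero]

/-! ### Volume in horospherical coordinates -/

theorem measurable_horo_right (ξ : Bdry n) : Measurable fun z : Bdry n × ℝ => horo ξ z.1 z.2 := by
  have h : Measurable fun z : Bdry n × ℝ => (ξ, z) := measurable_const.prodMk measurable_id
  have := measurable_horo.comp h
  exact this

theorem measurable_horo_mid (ξ : Bdry n) (s : ℝ) : Measurable fun η : Bdry n => horo ξ η s := by
  have h : Measurable fun η : Bdry n => (η, s) := measurable_id.prodMk measurable_const
  have := (measurable_horo_right ξ).comp h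
  exact this

theorem continuousOn_horo_mid (ξ : Bdry n) (s : ℝ) :
    ContinuousOn (fun η : Bdry n => horo ξ η s) {η | η ≠ ξ} := by
  have h : Continuous fun η : Bdry n => (η, s) := continuous_id.prodMk continuous_const
  have := (continuousOn_horo ξ).comp (s := {η | η ≠ ξ}) h.continuousOn fun η hη => hη
  exact this

theorem continuous_poisson_right (x : Hyp n) : Continuous fun ξ : Bdry n => poisson x ξ := by
  have h : Continuous fun ξ : Bdry n => (x, ξ) := continuous_const.prodMk continuous_id
  have := continuous_poisson.comp h
  exact this

theorem continuous_mobBdry_right (x : Hyp n) : Continuous fun ξ : Bdry n => mobBdry x ξ := by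
  have h : Continuous fun ξ : Bdry n => (x, ξ) := continuous_const.prodMk continuous_id
  have := continuous_mobBdry.comp h
  exact this

/-- The Riemannian measure in horospherical coordinates. The density is that of the upper
half-space: horospheres are scaled by `exp (-s)`, and `2 / ‖η - ξ‖ ^ 2` is the conformal factor of
the stereographic projection from `ξ`. -/
theorem map_horo_eq (ξ : Bdry (m + 1)) :
    ((((μHE[m] : Measure (Bdry (m + 1))).prod (volume : Measure ℝ)).restrict
      {z | z.1 ≠ ξ}).withDensity fun z =>
        ENNReal.ofReal ((2 * Real.exp (-z.2) / ‖(z.1 : Euc (m + 1)) - ξ‖ ^ 2) ^ m)).map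
      (fun z => horo ξ z.1 z.2) = (μHE[m + 1] : Measure (Hyp (m + 1))) := by
  have hΩ : MeasurableSet {z : Bdry (m + 1) × ℝ | z.1 ≠ ξ} :=
    (isOpen_ne_fun continuous_fst continuous_const).measurableSet
  have hne : ∀ z ∈ {z : Bdry (m + 1) × ℝ | z.1 ≠ ξ}, ‖(z.1 : Euc (m + 1)) - ξ‖ ^ 2 ≠ 0 :=
    fun z hz => (pow_pos (norm_bdry_sub_pos hz) 2).ne'
  have key := map_prod_euclideanHausdorffMeasure (isLocallyEuclidean_bdry (m := m))
    isLocallyEuclidean_real (F := fun z : Bdry (m + 1) × ℝ => horo ξ z.1 z.2)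
    (Ω := {z | z.1 ≠ ξ}) (a := fun z => 2 * Real.exp (-z.2) / ‖(z.1 : Euc (m + 1)) - ξ‖ ^ 2)
    (b := fun _ => 1) isGauge_id isGauge_sinh isGauge_sinh hΩ
    (measurable_horo_right ξ) (continuousOn_horo ξ)
    (fun z hz w hw h => Prod.ext (horo_injective hz hw h).1 (horo_injective hz hw h).2)
    (by fun_prop (disch := assumption)) continuousOn_const
    (fun z hz => by have := norm_bdry_sub_pos hz; positivity) (fun _ _ => one_pos)
    (fun z hz w hw => by rw [sinh_dist_horo hz hw]; ring)
  have hsurj : (fun z : Bdry (m + 1) × ℝ => horo ξ z.1 z.2) '' {z | z.1 ≠ ξ} = Set.univ := by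
    refine Set.eq_univ_of_forall fun x => ?_
    obtain ⟨η, hη, hx⟩ := exists_eq_horo ξ x
    exact ⟨(η, _), hη, hx.symm⟩
  rw [hsurj, Measure.restrict_univ, euclideanHausdorffMeasure_one_real] at key
  simpa using key

theorem lintegral_horo (hm : 1 ≤ m) (ξ : Bdry (m + 1)) {f : Hyp (m + 1) → ℝ≥0∞}
    (hf : Measurable f) : ∫⁻ x, f x ∂(μHE[m + 1] : Measure (Hyp (m + 1))) =
    ∫⁻ η : Bdry (m + 1), (∫⁻ s : ℝ,
      ENNReal.ofReal ((2 * Real.exp (-s) / ‖(η : Euc (m + 1)) - ξ‖ ^ 2) ^ m) * f (horo ξ η s))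
        ∂(μHE[m] : Measure (Bdry (m + 1))) := by
  have hF : Measurable fun z : Bdry (m + 1) × ℝ => horo ξ z.1 z.2 :=
    measurable_horo_right ξ
  have hJ : Measurable fun z : Bdry (m + 1) × ℝ =>
      ENNReal.ofReal ((2 * Real.exp (-z.2) / ‖(z.1 : Euc (m + 1)) - ξ‖ ^ 2) ^ m) := by fun_prop
  have hfF : Measurable fun z : Bdry (m + 1) × ℝ => f (horo ξ z.1 z.2) := hf.comp hF
  rw [← map_horo_eq ξ, lintegral_map hf hF, lintegral_withDensity_eq_lintegral_mul _ hJ hfF,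
    Measure.restrict_eq_self_of_ae_mem, lintegral_prod _ (hJ.mul hfF).aemeasurable]
  · rfl
  · rw [ae_iff]
    have : {z : Bdry (m + 1) × ℝ | ¬z ∈ {z : Bdry (m + 1) × ℝ | z.1 ≠ ξ}} = {ξ} ×ˢ Set.univ := by
      ext z
      simp
    rw [this, Measure.prod_prod, euclideanHausdorffMeasure_singleton hm, zero_mul]

theorem image_horo_eq (ξ : Bdry n) (s : ℝ) :
    (fun η => horo ξ η s) '' {η | η ≠ ξ} = {x | poisson x ξ = Real.exp s} := by
  ext x
  constructor
  · rintro ⟨η, hη, rfl⟩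
    exact poisson_horo hη s
  · intro hx
    obtain ⟨η, hη, h⟩ := exists_eq_horo ξ x
    have hx' : poisson x ξ = Real.exp s := hx
    rw [hx', Real.log_exp] at h
    exact ⟨η, hη, h.symm⟩

/-- The Riemannian measure of a horosphere in horospherical coordinates. -/
theorem map_horosphere_eq (ξ : Bdry (m + 1)) (s : ℝ) :
    (((μHE[m] : Measure (Bdry (m + 1))).restrict {η | η ≠ ξ}).withDensity fun η =>
        ENNReal.ofReal ((2 * Real.exp (-s) / ‖(η : Euc (m + 1)) - ξ‖ ^ 2) ^ m)).map
      (fun η => horo ξ η s) =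
      (μHE[m] : Measure (Hyp (m + 1))).restrict {x | poisson x ξ = Real.exp s} := by
  have hne : ∀ η ∈ {η : Bdry (m + 1) | η ≠ ξ}, ‖(η : Euc (m + 1)) - ξ‖ ^ 2 ≠ 0 :=
    fun z hz => (pow_pos (norm_bdry_sub_pos hz) 2).ne'
  rw [← image_horo_eq]
  refine map_conformal_euclideanHausdorffMeasure (F := fun η => horo ξ η s)
    (Ω := {η | η ≠ ξ}) (a := fun η => 2 * Real.exp (-s) / ‖(η : Euc (m + 1)) - ξ‖ ^ 2)
    isGauge_id isGauge_sinh
    (isOpen_ne_fun continuous_id continuous_const).measurableSet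
    (measurable_horo_mid ξ s) (continuousOn_horo_mid ξ s)
    (fun η hη η' hη' h => (horo_injective hη hη' h).1) (by fun_prop (disch := assumption))
    (fun η hη => by have := norm_bdry_sub_pos hη; positivity)
    (fun η hη η' hη' => ?_) m
  rw [sinh_dist_horo hη hη' s s]
  simp

/-! ### Translations and the measure of the sphere -/

theorem mobDenom_neg_bdry (x : Hyp n) (ξ : Bdry n) :
    mobDenom (neg x).val ξ = ‖(ξ : Euc n) - x.val‖ ^ 2 := by
  rw [mobDenom, neg_val, inner_neg_left, norm_neg, norm_sub_sq_real, norm_bdry, real_inner_comm]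
  ring

theorem dist_mobBdry_sq (x : Hyp n) (ξ η : Bdry n) : dist (mobBdry x ξ) (mobBdry x η) ^ 2 =
    (1 - ‖x.val‖ ^ 2) / mobDenom x.val ξ * ((1 - ‖x.val‖ ^ 2) / mobDenom x.val η) *
      dist ξ η ^ 2 := by
  rw [Subtype.dist_eq, Subtype.dist_eq, dist_eq_norm, dist_eq_norm, mobBdry_val, mobBdry_val,
    norm_mob_sub_of_le x.norm_lt (norm_bdry ξ).le (norm_bdry η).le]
  field_simp

/-- The image of the measure of the unit sphere by the translation `x ⊕ ·` has density the power
`m` of the Poisson kernel. -/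
theorem map_mobBdry (x : Hyp (m + 1)) : (μHE[m] : Measure (Bdry (m + 1))).map (mobBdry x) =
    (μHE[m] : Measure (Bdry (m + 1))).withDensity fun ξ => ENNReal.ofReal (poisson x ξ ^ m) := by
  have hc : ∀ x : Hyp (m + 1), Continuous (mobBdry x) := continuous_mobBdry_right
  have key := map_conformal_euclideanHausdorffMeasure (F := mobBdry (neg x))
    (a := fun ξ => poisson x ξ) (Ω := Set.univ)
    isGauge_id isGauge_id MeasurableSet.univ (hc _).measurable (hc _).continuousOn
    (fun ξ _ η _ h => by rw [← mobBdry_mobBdry_neg x ξ, h, mobBdry_mobBdry_neg])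
    (continuous_poisson_right x).continuousOn
    (fun ξ _ => poisson_pos x ξ)
    (fun ξ _ η _ => by
      rw [dist_mobBdry_sq, mobDenom_neg_bdry, mobDenom_neg_bdry, neg_val, norm_neg]; rfl) m
  have himg : mobBdry (neg x) '' Set.univ = Set.univ := by
    rw [Set.image_univ, Set.range_eq_univ]
    exact fun ξ => ⟨mobBdry x ξ, mobBdry_neg_mobBdry x ξ⟩
  rw [himg, Measure.restrict_univ] at key
  have hid : mobBdry x ∘ mobBdry (neg x) = id := funext fun ξ => mobBdry_mobBdry_neg x ξ
  conv_lhs => rw [← key, Measure.map_map (hc _).measurable (hc _).measurable, hid, Measure.map_id]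

theorem lintegral_mobBdry (x : Hyp (m + 1)) {f : Bdry (m + 1) → ℝ≥0∞} (hf : Measurable f) :
    ∫⁻ e, f (mobBdry x e) ∂(μHE[m] : Measure (Bdry (m + 1))) =
      ∫⁻ ξ, ENNReal.ofReal (poisson x ξ ^ m) * f ξ ∂(μHE[m] : Measure (Bdry (m + 1))) := by
  have hc : ∀ x : Hyp (m + 1), Continuous (mobBdry x) := continuous_mobBdry_right
  have hp : Measurable fun ξ : Bdry (m + 1) => ENNReal.ofReal (poisson x ξ ^ m) :=
    ((continuous_poisson_right x).pow m).measurable.ennreal_ofReal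
  rw [← lintegral_map hf (hc x).measurable, map_mobBdry,
    lintegral_withDensity_eq_lintegral_mul _ hp hf]
  rfl

end Hyp

namespace Hyp

variable {n k j m : ℕ}

/-! ### Visual measures -/

/-- The visual measure of the sphere at infinity seen from `x`: the power `m` of the Poisson kernel
times the spherical measure. -/
def visual (x : Hyp (m + 1)) : Measure (Bdry (m + 1)) :=
  (μHE[m] : Measure (Bdry (m + 1))).withDensity fun ξ => ENNReal.ofReal (poisson x ξ ^ m)

theorem measurable_poisson_pow (x : Hyp n) (m : ℕ) :
    Measurable fun ξ : Bdry n => ENNReal.ofReal (poisson x ξ ^ m) :=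
  ((continuous_poisson_right x).pow m).measurable.ennreal_ofReal

theorem map_mobBdry_eq_visual (x : Hyp (m + 1)) :
    (μHE[m] : Measure (Bdry (m + 1))).map (mobBdry x) = visual x := map_mobBdry x

theorem visual_univ (x : Hyp (m + 1)) : visual x Set.univ = sphereVol m := by
  rw [← map_mobBdry_eq_visual,
    Measure.map_apply (continuous_mobBdry_right x).measurable MeasurableSet.univ]
  rfl

instance (x : Hyp (m + 1)) : IsFiniteMeasure (visual x) :=
  ⟨by rw [visual_univ]; exact measure_lt_top _ _⟩

theorem map_mapBdry (A : Euc n →ₗᵢ[ℝ] Euc n) (d : ℕ) :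
    (μHE[d] : Measure (Bdry n)).map (mapBdry A) = (μHE[d] : Measure (Bdry n)) := by
  have hs : Function.Surjective (mapBdry A) := by
    intro ξ
    obtain ⟨u, hu⟩ := (LinearIsometry.toLinearIsometryEquiv A rfl).surjective (ξ : Euc n)
    have hu' : A u = ξ := hu
    refine ⟨⟨u, ?_⟩, Subtype.ext hu'⟩
    rw [mem_sphere_zero_iff_norm, ← A.norm_map, hu', norm_bdry]
  rw [(isometry_mapBdry A).map_euclideanHausdorffMeasure, hs.range_eq, Measure.restrict_univ]

/-- The cocycle property of the Poisson kernel. -/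
theorem poisson_smul (g : Hyp n ≃ᵢ Hyp n) (x : Hyp n) (ξ : Bdry n) :
    poisson (g x) (bdryMap g ξ) = poisson x ξ * poisson (g origin) (bdryMap g ξ) := by
  have h := busemann_smul g ξ x origin
  rw [busemann_eq, busemann_eq, poisson_origin, Real.log_one] at h
  have h1 := poisson_pos (g x) (bdryMap g ξ)
  have h2 := poisson_pos (g origin) (bdryMap g ξ)
  have h3 := poisson_pos x ξ
  refine Real.log_injOn_pos h1 (mul_pos h3 h2) ?_
  rw [Real.log_mul h3.ne' h2.ne']
  linarith

/-- Visual measures are equivariant, since the visual measure at `x` is the image of the spherical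
measure by any isometry that sends the centre to `x`. -/
theorem map_bdryMap_visual (g : Hyp (m + 1) ≃ᵢ Hyp (m + 1)) (x : Hyp (m + 1)) :
    (visual x).map (bdryMap g) = visual (g x) := by
  have hcomp : bdryMap g ∘ mobBdry x = bdryMap (g * transl x) := by
    funext ξ
    rw [bdryMap_mul, bdryMap_transl]
    rfl
  obtain ⟨A, hA⟩ := exists_linearIsometry_origin (g * transl x).isometry
  have hA' : bdryMap (g * transl x) = mobBdry ((g * transl x) origin) ∘ mapBdry A :=
    funext fun ξ => bdryMap_eq hA ξ
  have ho : (g * transl x) origin = g x := by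
    change g (transl x origin) = g x
    rw [transl_origin]
  rw [← map_mobBdry_eq_visual,
    Measure.map_map (continuous_bdryMap g).measurable (continuous_mobBdry_right x).measurable,
    hcomp, hA', ho, ← Measure.map_map (continuous_mobBdry_right (g x)).measurable
      (isometry_mapBdry A).continuous.measurable, map_mapBdry, map_mobBdry_eq_visual]

/-! ### Normal coordinates of a hyperbolic subspace -/

/-- The isometric embedding of hyperbolic spaces induced by a linear isometry. -/
def emb (L : Euc k →ₗᵢ[ℝ] Euc n) (y : Hyp k) : Hyp n :=
  ⟨L y.val, by rw [L.norm_map]; exact y.norm_lt⟩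

theorem emb_val (L : Euc k →ₗᵢ[ℝ] Euc n) (y : Hyp k) : (emb L y).val = L y.val := rfl

theorem isometry_emb (L : Euc k →ₗᵢ[ℝ] Euc n) : Isometry (emb L) :=
  Isometry.of_dist_eq fun x y => by
    rw [dist_eq_iff, emb_val, emb_val, ← map_sub, L.norm_map, L.norm_map, L.norm_map]

/-- The point at infinity of the geodesic ray that starts at the point `y` of the subspace `L` in the
direction `e` of the orthogonal subspace `L'`. -/
def normalEnd (L : Euc k →ₗᵢ[ℝ] Euc n) (L' : Euc j →ₗᵢ[ℝ] Euc n) (z : Hyp k × Bdry j) : Bdry n :=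
  mobBdry (emb L z.1) (mapBdry L' z.2)

theorem continuous_normalEnd (L : Euc k →ₗᵢ[ℝ] Euc n) (L' : Euc j →ₗᵢ[ℝ] Euc n) :
    Continuous (normalEnd L L') := by
  have h : Continuous fun z : Hyp k × Bdry j => (emb L z.1, mapBdry L' z.2) :=
    ((isometry_emb L).continuous.comp continuous_fst).prodMk
      ((isometry_mapBdry L').continuous.comp continuous_snd)
  have := continuous_mobBdry.comp h
  exact this

section

variable {L : Euc k →ₗᵢ[ℝ] Euc n} {L' : Euc j →ₗᵢ[ℝ] Euc n}

theorem normalEnd_val (hLL : ∀ u w, inner ℝ (L u) (L' w) = 0) (z : Hyp k × Bdry j) :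
    (normalEnd L L' z : Euc n) = (1 + ‖z.1.val‖ ^ 2)⁻¹ •
      ((2 : ℝ) • L z.1.val + (1 - ‖z.1.val‖ ^ 2) • L' z.2) := by
  rw [normalEnd, mobBdry_val, mob, mobDenom, mapBdry_val, emb_val, hLL, L.norm_map, L'.norm_map,
    norm_bdry]
  norm_num

theorem inner_normalEnd (hLL : ∀ u w, inner ℝ (L u) (L' w) = 0) (z : Hyp k × Bdry j) (e : Bdry j) :
    inner ℝ (normalEnd L L' z : Euc n) (L' e) =
      (1 - ‖z.1.val‖ ^ 2) / (1 + ‖z.1.val‖ ^ 2) * inner ℝ (z.2 : Euc j) (e : Euc j) := by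
  rw [normalEnd_val hLL, inner_smul_left, inner_add_left, inner_smul_left, inner_smul_left, hLL,
    L'.inner_map_map]
  simp only [conj_trivial]
  ring

/-- The stretching factor of `normalEnd` (see `dist_normalEnd_sq`). -/
def normalFactor (y : Hyp k) : ℝ := (1 - ‖y.val‖ ^ 2) / (1 + ‖y.val‖ ^ 2)

theorem normalFactor_pos (y : Hyp k) : 0 < normalFactor y :=
  div_pos (one_sub_pos' y) (by positivity)

theorem continuous_normalFactor : Continuous (normalFactor : Hyp k → ℝ) := by
  have h := continuous_val (n := k)
  exact (continuous_const.sub (h.norm.pow 2)).div (continuous_const.add (h.norm.pow 2))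
    fun y => by positivity

theorem dist_bdry_sq (ξ η : Bdry n) : dist ξ η ^ 2 = 2 - 2 * inner ℝ (ξ : Euc n) (η : Euc n) := by
  rw [Subtype.dist_eq, dist_eq_norm, norm_bdry_sub_sq]

/-- Normal coordinates at infinity are conformal: they multiply distances, both along the subspace
and along the normal spheres, by the same factor. -/
theorem dist_normalEnd_sq (hLL : ∀ u w, inner ℝ (L u) (L' w) = 0) (z w : Hyp k × Bdry j) :
    dist (normalEnd L L' z) (normalEnd L L' w) ^ 2 =
      normalFactor z.1 * normalFactor w.1 * (2 * Real.sinh (dist z.1 w.1 / 2)) ^ 2 +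
      normalFactor z.1 * normalFactor w.1 * dist z.2 w.2 ^ 2 := by
  have h1 := one_sub_pos' z.1
  have h2 := one_sub_pos' w.1
  have hLL' : ∀ u w, inner ℝ (L' u) (L w) = 0 := fun u w => by rw [real_inner_comm, hLL]
  have hin : inner ℝ (normalEnd L L' z : Euc n) (normalEnd L L' w : Euc n) =
      (1 + ‖z.1.val‖ ^ 2)⁻¹ * (1 + ‖w.1.val‖ ^ 2)⁻¹ * (4 * inner ℝ z.1.val w.1.val +
        (1 - ‖z.1.val‖ ^ 2) * (1 - ‖w.1.val‖ ^ 2) * inner ℝ (z.2 : Euc j) (w.2 : Euc j)) := by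
    rw [normalEnd_val hLL, normalEnd_val hLL]
    simp only [inner_smul_left, inner_smul_right, inner_add_left, inner_add_right, hLL, hLL',
      L.inner_map_map, L'.inner_map_map, conj_trivial]
    ring
  rw [dist_bdry_sq, hin, sinh_dist_sq, dist_bdry_sq, norm_sub_sq_real, normalFactor, normalFactor]
  have h3 : 0 < 1 + ‖z.1.val‖ ^ 2 := by positivity
  have h4 : 0 < 1 + ‖w.1.val‖ ^ 2 := by positivity
  field_simp
  ring

theorem normalEnd_injective (hLL : ∀ u w, inner ℝ (L u) (L' w) = 0) :
    Function.Injective (normalEnd L L') := by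
  intro z w h
  have h1 := dist_normalEnd_sq hLL z w
  rw [h, dist_self, ← mul_add] at h1
  have h2 := mul_pos (normalFactor_pos z.1) (normalFactor_pos w.1)
  have h3 : (2 * Real.sinh (dist z.1 w.1 / 2)) ^ 2 + dist z.2 w.2 ^ 2 = 0 := by
    have := mul_eq_zero.1 (show normalFactor z.1 * normalFactor w.1 * _ = 0 by rw [← h1]; norm_num)
    exact this.resolve_left h2.ne'
  have h4 : dist z.2 w.2 = 0 := by
    have := sq_nonneg (2 * Real.sinh (dist z.1 w.1 / 2))
    have := sq_nonneg (dist z.2 w.2)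
    exact pow_eq_zero_iff two_ne_zero |>.1 (by linarith)
  have h5 : Real.sinh (dist z.1 w.1 / 2) = 0 := by
    rw [h4] at h3
    have := pow_eq_zero_iff two_ne_zero |>.1 (show (2 * Real.sinh (dist z.1 w.1 / 2)) ^ 2 = 0 by
      linarith)
    linarith
  rw [Real.sinh_eq_zero] at h5
  exact Prod.ext (dist_eq_zero.1 (by linarith)) (dist_eq_zero.1 h4)

/-- The Poisson kernel of a normal direction to a hyperbolic subspace decreases along the subspace as
the inverse of the hyperbolic cosine of the distance to the foot. -/
theorem poisson_normalEnd (hLL : ∀ u w, inner ℝ (L u) (L' w) = 0) (y : Hyp k) (z : Hyp k × Bdry j) :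
    poisson (emb L y) (normalEnd L L' z) * (1 + (2 * Real.sinh (dist y z.1 / 2)) ^ 2 / 2) =
      (normalFactor z.1)⁻¹ := by
  have h1 := one_sub_pos' z.1
  have h2 := one_sub_pos' y
  have h3 : 0 < 1 + ‖z.1.val‖ ^ 2 := by positivity
  have h6 := norm_sub_pos (emb L y) (normalEnd L L' z)
  have hd : ‖(normalEnd L L' z : Euc n) - (emb L y).val‖ ^ 2 * (1 + ‖z.1.val‖ ^ 2) =
      (1 + ‖y.val‖ ^ 2) * (1 + ‖z.1.val‖ ^ 2) - 4 * inner ℝ y.val z.1.val := by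
    rw [norm_sub_sq_real, norm_bdry, normalEnd_val hLL, emb_val, inner_smul_left, inner_add_left,
      inner_smul_left, inner_smul_left, L.inner_map_map, real_inner_comm (L y.val), hLL, L.norm_map,
      real_inner_comm y.val]
    simp only [conj_trivial]
    field_simp
    ring
  have hq : 0 < ‖(normalEnd L L' z : Euc n) - (emb L y).val‖ ^ 2 := by positivity
  rw [poisson, sinh_dist_sq, normalFactor, norm_sub_sq_real y.val, emb_val L y, L.norm_map,
    ← emb_val L y]
  rw [inv_div]
  field_simp
  linear_combination (-2) * hd

theorem poisson_normalEnd_self (hLL : ∀ u w, inner ℝ (L u) (L' w) = 0) (z : Hyp k × Bdry j) :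
    poisson (emb L z.1) (normalEnd L L' z) = (normalFactor z.1)⁻¹ := by
  have := poisson_normalEnd hLL z.1 z
  simpa using this

theorem poisson_le_poisson_normalEnd (hLL : ∀ u w, inner ℝ (L u) (L' w) = 0) (y : Hyp k)
    (z : Hyp k × Bdry j) :
    poisson (emb L y) (normalEnd L L' z) ≤ poisson (emb L z.1) (normalEnd L L' z) := by
  rw [poisson_normalEnd_self hLL, ← poisson_normalEnd hLL y z]
  have h := poisson_pos (emb L y) (normalEnd L L' z)
  exact le_mul_of_one_le_right h.le (by have := sq_nonneg (2 * Real.sinh (dist y z.1 / 2)); linarith)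

/-- The foot of a normal ray is the only closest point of the subspace to the end of the ray. -/
theorem eq_of_poisson_le (hLL : ∀ u w, inner ℝ (L u) (L' w) = 0) {y : Hyp k}
    {z : Hyp k × Bdry j}
    (h : poisson (emb L z.1) (normalEnd L L' z) ≤ poisson (emb L y) (normalEnd L L' z)) :
    y = z.1 := by
  rw [poisson_normalEnd_self hLL, ← poisson_normalEnd hLL y z] at h
  have h0 := poisson_pos (emb L y) (normalEnd L L' z)
  have h1 : (2 * Real.sinh (dist y z.1 / 2)) ^ 2 ≤ 0 := by
    by_contra hc
    push Not at hc
    nlinarith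
  have h2 : Real.sinh (dist y z.1 / 2) = 0 := by
    have := pow_eq_zero_iff two_ne_zero |>.1 (le_antisymm h1 (sq_nonneg _))
    linarith
  rw [Real.sinh_eq_zero] at h2
  exact dist_eq_zero.1 (by linarith)

/-- A point at infinity that is not in the subspace is the end of a normal ray. -/
theorem exists_eq_normalEnd (hLL : ∀ u w, inner ℝ (L u) (L' w) = 0) {ξ : Bdry n} {u : Euc k}
    {w : Euc j} (hξ : (ξ : Euc n) = L u + L' w) (hw : w ≠ 0) : ∃ z, ξ = normalEnd L L' z := by
  have hw0 : 0 < ‖w‖ := norm_pos_iff.2 hw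
  have hnorm : ‖u‖ ^ 2 + ‖w‖ ^ 2 = 1 := by
    have h := norm_bdry ξ
    have h2 : ‖(ξ : Euc n)‖ ^ 2 = 1 := by rw [h]; norm_num
    rw [hξ, norm_add_sq_real, hLL, L.norm_map, L'.norm_map] at h2
    linarith
  have hn : ‖(1 + ‖w‖)⁻¹ • u‖ ^ 2 = (1 - ‖w‖) / (1 + ‖w‖) := by
    rw [norm_smul, mul_pow, Real.norm_eq_abs, sq_abs, show ‖u‖ ^ 2 = (1 - ‖w‖) * (1 + ‖w‖) by
      linarith]
    field_simp
  refine ⟨(⟨(1 + ‖w‖)⁻¹ • u, ?_⟩, ⟨‖w‖⁻¹ • w, by simp [norm_smul, hw0.ne']⟩), Subtype.ext ?_⟩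
  · have : ‖(1 + ‖w‖)⁻¹ • u‖ ^ 2 < 1 := by
      rw [hn, div_lt_one (by positivity)]
      linarith
    nlinarith [norm_nonneg ((1 + ‖w‖)⁻¹ • u)]
  · rw [normalEnd_val hLL]
    simp only [hn, hξ, map_smul, smul_add, smul_smul]
    congr 1
    · rw [show (1 + (1 - ‖w‖) / (1 + ‖w‖))⁻¹ * (2 * (1 + ‖w‖)⁻¹) = 1 by field_simp; ring, one_smul]
    · rw [show (1 + (1 - ‖w‖) / (1 + ‖w‖))⁻¹ * ((1 - (1 - ‖w‖) / (1 + ‖w‖)) * ‖w‖⁻¹) = 1 by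
        field_simp; ring, one_smul]

theorem normalEnd_notMem_bdryAtInfinity (hLL : ∀ u w, inner ℝ (L u) (L' w) = 0)
    (z : Hyp k × Bdry j) : normalEnd L L' z ∉ bdryAtInfinity (Set.range (emb L)) := by
  intro h
  have hc : IsClosed {x : Euc n | inner ℝ x (L' z.2) = 0} :=
    isClosed_eq (by fun_prop) continuous_const
  have hs : Hyp.val '' Set.range (emb L) ⊆ {x : Euc n | inner ℝ x (L' z.2) = 0} := by
    rintro _ ⟨_, ⟨y, rfl⟩, rfl⟩
    exact hLL _ _
  have h1 : inner ℝ (normalEnd L L' z : Euc n) (L' z.2) = 0 := closure_minimal hs hc h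
  rw [inner_normalEnd hLL, real_inner_self_eq_norm_sq, norm_bdry] at h1
  have := normalFactor_pos z.1
  rw [normalFactor] at this
  linarith

theorem mem_bdryAtInfinity_emb {ξ : Bdry n} {u : Euc k} (hξ : (ξ : Euc n) = L u) :
    ξ ∈ bdryAtInfinity (Set.range (emb L)) := by
  have hu : ‖u‖ = 1 := by rw [← L.norm_map, ← hξ, norm_bdry]
  let e : Bdry k := ⟨u, by simp [hu]⟩
  have h := tendsto_ray e
  have h2 : Tendsto (fun t => L (ray e t).val) atTop (𝓝 (L u)) :=
    (L.continuous.tendsto u).comp h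
  change (ξ : Euc n) ∈ closure _
  rw [hξ]
  exact mem_closure_of_tendsto h2 (Eventually.of_forall fun t => ⟨_, ⟨_, rfl⟩, rfl⟩)

/-- The outer unit normal bundle of a hyperbolic subspace. -/
theorem outerNormal_range_emb (hLL : ∀ u w, inner ℝ (L u) (L' w) = 0)
    (hsup : ∀ x, ∃ u w, x = L u + L' w) : outerNormal (Set.range (emb L)) =
      Set.range fun z : Hyp k × Bdry j => UnitTangent.ofDir (emb L z.1) (mapBdry L' z.2) := by
  ext v
  constructor
  · rintro ⟨h1, ⟨y, hy⟩, h3⟩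
    obtain ⟨u, w, hξ⟩ := hsup v.plusEnd
    have hw : w ≠ 0 := by
      rintro rfl
      rw [map_zero, add_zero] at hξ
      exact h1 (mem_bdryAtInfinity_emb hξ)
    obtain ⟨z, hz⟩ := exists_eq_normalEnd hLL hξ hw
    have h4 := (busemann_nonneg_iff _ _ _).1 (h3 _ ⟨z.1, rfl⟩)
    rw [← hy, hz] at h4
    have h5 := eq_of_poisson_le hLL h4
    refine ⟨z, UnitTangent.ext_of_base_of_plusEnd ?_ ?_⟩
    · rw [UnitTangent.base_ofDir, ← hy, h5]
    · rw [UnitTangent.plusEnd_ofDir, hz]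
      rfl
  · rintro ⟨z, rfl⟩
    refine ⟨?_, ?_, ?_⟩
    · rw [UnitTangent.plusEnd_ofDir]
      exact normalEnd_notMem_bdryAtInfinity hLL z
    · rw [UnitTangent.base_ofDir]
      exact ⟨_, rfl⟩
    · rintro _ ⟨y, rfl⟩
      rw [busemann_nonneg_iff, UnitTangent.plusEnd_ofDir, UnitTangent.base_ofDir]
      exact poisson_le_poisson_normalEnd hLL y z

end

/-- In normal coordinates of a hyperbolic subspace, the product of the Riemannian measure of the
subspace and of the spherical measure of the normal directions is the measure at infinity which is at
each point the visual measure seen from the foot. -/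
theorem map_normalEnd {L : Euc k →ₗᵢ[ℝ] Euc (k + j + 1)} {L' : Euc (j + 1) →ₗᵢ[ℝ] Euc (k + j + 1)}
    (hLL : ∀ u w, inner ℝ (L u) (L' w) = 0) :
    (((μHE[k] : Measure (Hyp k)).prod (μHE[j] : Measure (Bdry (j + 1)))).withDensity
      fun z => ENNReal.ofReal (normalFactor z.1 ^ (k + j))).map (normalEnd L L') =
      (μHE[k + j] : Measure (Bdry (k + j + 1))).restrict (Set.range (normalEnd L L')) := by
  have hf : Continuous fun z : Hyp k × Bdry (j + 1) => normalFactor z.1 :=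
    continuous_normalFactor.comp continuous_fst
  have key := map_prod_euclideanHausdorffMeasure (isLocallyEuclidean_hyp (n := k))
    (isLocallyEuclidean_bdry (m := j)) (F := normalEnd L L') (Ω := Set.univ)
    (a := fun z => normalFactor z.1) (b := fun z => normalFactor z.1) isGauge_sinh isGauge_id
    isGauge_id MeasurableSet.univ (continuous_normalEnd L L').measurable
    (continuous_normalEnd L L').continuousOn (normalEnd_injective hLL).injOn hf.continuousOn
    hf.continuousOn (fun z _ => normalFactor_pos z.1) (fun z _ => normalFactor_pos z.1)
    (fun z _ w _ => dist_normalEnd_sq hLL z w)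
  rw [Measure.restrict_univ, Set.image_univ] at key
  rw [← key]
  simp only [← pow_add]

end Hyp

namespace Hyp

variable {n k j m : ℕ}

/-! ### Isometries and unit normal bundles -/

theorem bdryMap_mem_bdryAtInfinity (g : Hyp n ≃ᵢ Hyp n) {D : Set (Hyp n)} {ξ : Bdry n}
    (h : ξ ∈ bdryAtInfinity D) : bdryMap g ξ ∈ bdryAtInfinity (g '' D) := by
  obtain ⟨x, hx, hlim⟩ := mem_closure_iff_seq_limit.1 (show (ξ : Euc n) ∈ closure (val '' D) from h)
  choose z hz hzx using hx
  have h1 : Tendsto (fun i => (z i).val) atTop (𝓝 (ξ : Euc n)) := by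
    simpa only [hzx] using hlim
  exact mem_closure_of_tendsto (tendsto_bdryMap g h1)
    (Eventually.of_forall fun i => ⟨_, ⟨_, hz i, rfl⟩, rfl⟩)

theorem inv_image_image (g : Hyp n ≃ᵢ Hyp n) (D : Set (Hyp n)) : (g⁻¹ : Hyp n ≃ᵢ Hyp n) '' (g '' D) = D := by
  rw [Set.image_image]
  have : (fun x => (g⁻¹ : Hyp n ≃ᵢ Hyp n) (g x)) = id := funext fun x => g.symm_apply_apply x
  rw [this, Set.image_id]

theorem bdryMap_mem_bdryAtInfinity_iff (g : Hyp n ≃ᵢ Hyp n) {D : Set (Hyp n)} {ξ : Bdry n} :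
    bdryMap g ξ ∈ bdryAtInfinity (g '' D) ↔ ξ ∈ bdryAtInfinity D := by
  refine ⟨fun h => ?_, bdryMap_mem_bdryAtInfinity g⟩
  have := bdryMap_mem_bdryAtInfinity g⁻¹ h
  rwa [bdryMap_inv_bdryMap, inv_image_image] at this

theorem smul_mem_outerNormal (g : Hyp n ≃ᵢ Hyp n) {D : Set (Hyp n)} {v : UnitTangent n}
    (h : v ∈ outerNormal D) : g • v ∈ outerNormal (g '' D) := by
  obtain ⟨h1, h2, h3⟩ := h
  refine ⟨?_, ?_, ?_⟩
  · rwa [UnitTangent.plusEnd_smul, bdryMap_mem_bdryAtInfinity_iff]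
  · rw [UnitTangent.base_smul]
    exact ⟨_, h2, rfl⟩
  · rintro _ ⟨y, hy, rfl⟩
    rw [UnitTangent.plusEnd_smul, UnitTangent.base_smul, busemann_smul]
    exact h3 y hy

theorem outerNormal_image (g : Hyp n ≃ᵢ Hyp n) (D : Set (Hyp n)) :
    outerNormal (g '' D) = (fun v => g • v) '' outerNormal D := by
  ext v
  constructor
  · intro h
    refine ⟨g⁻¹ • v, ?_, smul_inv_smul g v⟩
    have := smul_mem_outerNormal g⁻¹ h
    rwa [inv_image_image] at this
  · rintro ⟨v, hv, rfl⟩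
    exact smul_mem_outerNormal g hv

/-! ### Skinning measures from a parametrisation by the points at infinity -/

theorem map_withDensity_comp {X Y : Type*} [MeasurableSpace X] [MeasurableSpace Y] (μ : Measure X)
    {f : X → Y} (hf : Measurable f) {h : Y → ℝ≥0∞} (hh : Measurable h) :
    (μ.withDensity fun x => h (f x)).map f = (μ.map f).withDensity h := by
  ext s hs
  rw [Measure.map_apply hf hs, withDensity_apply _ (hf hs), withDensity_apply _ hs,
    setLIntegral_map hs hh hf]

theorem continuous_endpoint (s : Sgn) : Continuous fun v : UnitTangent n => endpoint s v := by
  cases s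
  · exact UnitTangent.continuous_plusEnd
  · exact UnitTangent.continuous_minusEnd

/-- `ν` parametrises the unit normal bundle of `D` by the points at infinity in `Ω`. -/
structure IsEndParam (s : Sgn) (D : Set (Hyp n)) (ν : Bdry n → UnitTangent n) (Ω : Set (Bdry n)) :
    Prop where
  measurable : Measurable ν
  measurableSet : MeasurableSet Ω
  endpoint_eq : ∀ η ∈ Ω, endpoint s (ν η) = η
  normalBundle_eq : normalBundle s D = ν '' Ω

/-- The measure at infinity which is at each point `η` the visual measure seen from the base point
of `ν η`. -/
def visualAlong (ν : Bdry (m + 1) → UnitTangent (m + 1)) (Ω : Set (Bdry (m + 1))) :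
    Measure (Bdry (m + 1)) :=
  ((μHE[m] : Measure (Bdry (m + 1))).restrict Ω).withDensity
    fun η => ENNReal.ofReal (poisson (ν η).base η ^ m)

theorem measurable_poisson_base {ν : Bdry n → UnitTangent n} (hν : Measurable ν) :
    Measurable fun η => poisson (ν η).base η := by
  have hbase : Measurable fun η => (ν η).base := UnitTangent.continuous_base.measurable.comp hν
  have := continuous_poisson.measurable.comp (hbase.prodMk measurable_id)
  exact this

theorem restrict_visual_withDensity {ν : Bdry (m + 1) → UnitTangent (m + 1)}
    {Ω : Set (Bdry (m + 1))} (hν : Measurable ν) (hΩ : MeasurableSet Ω) (x : Hyp (m + 1)) :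
    ((visual x).restrict Ω).withDensity
      (fun η => ENNReal.ofReal ((poisson (ν η).base η / poisson x η) ^ m)) = visualAlong ν Ω := by
  have hh : Measurable fun η => ENNReal.ofReal ((poisson (ν η).base η / poisson x η) ^ m) :=
    (((measurable_poisson_base hν).div
      (continuous_poisson_right x).measurable).pow_const m).ennreal_ofReal
  rw [visual, restrict_withDensity hΩ, ← withDensity_mul _ (measurable_poisson_pow x m) hh,
    visualAlong]
  congr 1
  funext η
  have := poisson_pos x η
  have h2 := poisson_pos (ν η).base η
  simp only [Pi.mul_apply]
  rw [← ENNReal.ofReal_mul (by positivity), div_pow]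
  congr 1
  field_simp

/-- If `ν` parametrises the unit normal bundle of `D` by the points at infinity, then the skinning
measure of `D` is the image by `ν` of the measure at infinity which is at each point the visual
measure seen from the base point of the normal vector. -/
theorem IsEndParam.skinning_eq {Γ : Subgroup (Hyp (m + 1) ≃ᵢ Hyp (m + 1))}
    {μ : Hyp (m + 1) → Measure (Bdry (m + 1))} (hδ : critExp Γ = m) (hμ : ∀ x, μ x = visual x)
    (x₀ : Hyp (m + 1)) {s : Sgn} {D : Set (Hyp (m + 1))} {ν : Bdry (m + 1) → UnitTangent (m + 1)}
    {Ω : Set (Bdry (m + 1))} (h : IsEndParam s D ν Ω) :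
    skinning Γ μ x₀ s D = (visualAlong ν Ω).map ν := by
  obtain ⟨hν, hΩ, hend, hD⟩ := h
  have hinj : Set.InjOn ν Ω := fun η hη η' hη' h => by rw [← hend η hη, h, hend η' hη']
  have hN : MeasurableSet (normalBundle s D) := by
    rw [hD]; exact hΩ.image_of_measurable_injOn hν hinj
  have hNν : ∀ v ∈ normalBundle s D, endpoint s v ∈ Ω ∧ ν (endpoint s v) = v := by
    intro v hv
    rw [hD] at hv
    obtain ⟨η, hη, rfl⟩ := hv
    rw [hend η hη]
    exact ⟨hη, rfl⟩
  have : StandardBorelSpace (normalBundle s D) := hN.standardBorel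
  -- the endpoint map is an isomorphism from the normal bundle to `Ω` with inverse `ν`
  let E : normalBundle s D → Bdry (m + 1) := fun v => endpoint s v.1
  have hEm : Measurable E := (continuous_endpoint s).measurable.comp measurable_subtype_coe
  have hEi : Function.Injective E := fun v w h => Subtype.ext <| by
    rw [← (hNν v.1 v.2).2, ← (hNν w.1 w.2).2]
    exact congrArg ν h
  have hE : MeasurableEmbedding E := hEm.measurableEmbedding hEi
  have hEr : Set.range E = Ω := by
    ext η
    constructor
    · rintro ⟨v, rfl⟩
      exact (hNν v.1 v.2).1
    · intro hη
      exact ⟨⟨ν η, by rw [hD]; exact ⟨η, hη, rfl⟩⟩, hend η hη⟩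
  let h : Bdry (m + 1) → ℝ≥0∞ := fun η =>
    ENNReal.ofReal ((poisson (ν η).base η / poisson x₀ η) ^ m)
  have hh : Measurable h :=
    (((measurable_poisson_base hν).div (continuous_poisson_right x₀).measurable).pow_const m).ennreal_ofReal
  have hdens : (fun v : normalBundle s D => ENNReal.ofReal
      (Real.exp (critExp Γ * busemann (endpoint s v.1) x₀ v.1.base))) = fun v => h (E v) := by
    funext v
    change _ = ENNReal.ofReal _
    rw [hδ, exp_mul_busemann, Real.rpow_natCast, (hNν v.1 v.2).2]
  have hval : (Subtype.val : normalBundle s D → UnitTangent (m + 1)) = ν ∘ E :=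
    funext fun v => (hNν v.1 v.2).2.symm
  have hcomap : ((μ x₀).comap fun v : normalBundle s D => endpoint s v.1) = (μ x₀).comap E := rfl
  rw [skinning, hdens, hcomap, hval, ← Measure.map_map hν hEm, map_withDensity_comp _ hEm hh,
    hE.map_comap, hEr, hμ, ← restrict_visual_withDensity hν hΩ x₀]

theorem endpoint_smul (s : Sgn) (g : Hyp n ≃ᵢ Hyp n) (v : UnitTangent n) :
    endpoint s (g • v) = bdryMap g (endpoint s v) := by
  cases s
  · exact UnitTangent.plusEnd_smul g v
  · exact UnitTangent.minusEnd_smul g v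

theorem normalBundle_image (s : Sgn) (g : Hyp n ≃ᵢ Hyp n) (D : Set (Hyp n)) :
    normalBundle s (g '' D) = (fun v => g • v) '' normalBundle s D := by
  cases s
  · exact outerNormal_image g D
  · change UnitTangent.flip '' outerNormal (g '' D) = _ '' (UnitTangent.flip '' outerNormal D)
    rw [outerNormal_image, Set.image_image, Set.image_image]
    simp only [UnitTangent.flip_smul]

theorem IsEndParam.flip {D : Set (Hyp n)} {ν : Bdry n → UnitTangent n} {Ω : Set (Bdry n)}
    (h : IsEndParam .plus D ν Ω) : IsEndParam .minus D (fun η => (ν η).flip) Ω := by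
  refine ⟨UnitTangent.continuous_flip.measurable.comp h.measurable, h.measurableSet,
    fun η hη => ?_, ?_⟩
  · exact (UnitTangent.minusEnd_flip _).trans (h.endpoint_eq η hη)
  · have h1 : outerNormal D = ν '' Ω := h.normalBundle_eq
    change UnitTangent.flip '' outerNormal D = _
    rw [h1, Set.image_image]

theorem IsEndParam.smul {s : Sgn} {D : Set (Hyp n)} {ν : Bdry n → UnitTangent n}
    {Ω : Set (Bdry n)} (h : IsEndParam s D ν Ω) (g : Hyp n ≃ᵢ Hyp n) :
    IsEndParam s (g '' D) (fun η => g • ν (bdryMap g⁻¹ η)) (bdryMap g '' Ω) := by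
  refine ⟨?_, ?_, ?_, ?_⟩
  · exact (UnitTangent.continuous_smul g).measurable.comp
      (h.measurable.comp (continuous_bdryMap g⁻¹).measurable)
  · exact h.measurableSet.image_of_measurable_injOn (continuous_bdryMap g).measurable
      (bdryMap_injective g).injOn
  · rintro _ ⟨η, hη, rfl⟩
    rw [endpoint_smul, bdryMap_inv_bdryMap, h.endpoint_eq η hη]
  · rw [normalBundle_image, h.normalBundle_eq, Set.image_image, Set.image_image]
    simp only [bdryMap_inv_bdryMap]

/-- Isometries transport `visualAlong`, as they transport visual measures. -/
theorem visualAlong_smul {ν : Bdry (m + 1) → UnitTangent (m + 1)} {Ω : Set (Bdry (m + 1))}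
    (hν : Measurable ν) (hΩ : MeasurableSet Ω) (g : Hyp (m + 1) ≃ᵢ Hyp (m + 1)) :
    visualAlong (fun η => g • ν (bdryMap g⁻¹ η)) (bdryMap g '' Ω) =
      (visualAlong ν Ω).map (bdryMap g) := by
  have hg := (continuous_bdryMap g).measurable
  have hν' : Measurable fun η => g • ν (bdryMap g⁻¹ η) :=
    (UnitTangent.continuous_smul g).measurable.comp
      (hν.comp (continuous_bdryMap g⁻¹).measurable)
  have hΩ' : MeasurableSet (bdryMap g '' Ω) :=
    hΩ.image_of_measurable_injOn hg (bdryMap_injective g).injOn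
  have hh : Measurable fun η => ENNReal.ofReal
      ((poisson (g • ν (bdryMap g⁻¹ η)).base η / poisson (g origin) η) ^ m) :=
    (((measurable_poisson_base hν').div
      (continuous_poisson_right (g origin)).measurable).pow_const m).ennreal_ofReal
  rw [← restrict_visual_withDensity hν hΩ origin, ← restrict_visual_withDensity hν' hΩ' (g origin),
    ← map_bdryMap_visual, Measure.restrict_map hg hΩ',
    Set.preimage_image_eq _ (bdryMap_injective g), ← map_withDensity_comp _ hg hh]
  congr 2
  funext η
  have h1 := poisson_pos (g origin) (bdryMap g η)
  rw [bdryMap_inv_bdryMap, UnitTangent.base_smul, poisson_smul, poisson_origin, div_one,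
    mul_div_assoc, div_self h1.ne', mul_one]

/-- Skinning measures are equivariant under all isometries when the Patterson density is the
density of visual measures. -/
theorem IsEndParam.skinning_image {Γ : Subgroup (Hyp (m + 1) ≃ᵢ Hyp (m + 1))}
    {μ : Hyp (m + 1) → Measure (Bdry (m + 1))} (hδ : critExp Γ = m) (hμ : ∀ x, μ x = visual x)
    (x₀ : Hyp (m + 1)) {s : Sgn} {D : Set (Hyp (m + 1))} {ν : Bdry (m + 1) → UnitTangent (m + 1)}
    {Ω : Set (Bdry (m + 1))} (h : IsEndParam s D ν Ω) (g : Hyp (m + 1) ≃ᵢ Hyp (m + 1)) :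
    skinning Γ μ x₀ s (g '' D) = (skinning Γ μ x₀ s D).map fun v => g • v := by
  rw [(h.smul g).skinning_eq hδ hμ, h.skinning_eq hδ hμ, visualAlong_smul h.measurable
    h.measurableSet, Measure.map_map (UnitTangent.continuous_smul g).measurable h.measurable,
    Measure.map_map (h.smul g).measurable (continuous_bdryMap g).measurable]
  congr 1
  funext η
  simp

end Hyp

namespace Hyp

variable {n k j m : ℕ}

/-! ### Horoballs -/

theorem horoball_eq (ξ : Bdry n) (p : Hyp n) : horoball ξ p = {x | poisson p ξ ≤ poisson x ξ} := by
  ext x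
  exact busemann_nonpos_iff ξ x p

theorem continuous_poisson_left (ξ : Bdry n) : Continuous fun x : Hyp n => poisson x ξ := by
  have h : Continuous fun x : Hyp n => (x, ξ) := continuous_id.prodMk continuous_const
  have := continuous_poisson.comp h
  exact this

/-- The Poisson kernel grows exponentially along geodesics that end at its pole. -/
theorem poisson_toFun (v : UnitTangent n) (t : ℝ) :
    poisson (v.toFun t) v.plusEnd = Real.exp t * poisson v.base v.plusEnd := by
  obtain ⟨h1, h2⟩ := exists_eq_toward_horo v
  generalize v.plusEnd = ξ at h1 h2 ⊢
  generalize v.minusEnd = η at h1 h2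
  generalize Real.log (poisson v.base ξ) = s at h2
  rw [h2, toward_horo_toFun h1, poisson_horo h1, base_toward, poisson_horo h1, ← Real.exp_add,
    add_comm]

/-- The base point of an outer normal vector is on the boundary, as the Poisson kernel of its
positive endpoint increases along the geodesic. -/
theorem base_mem_frontier {D : Set (Hyp n)} {v : UnitTangent n} (hv : v ∈ outerNormal D) :
    v.base ∈ frontier D := by
  rw [frontier_eq_closure_inter_closure]
  refine ⟨subset_closure hv.2.1, ?_⟩
  have hc : Tendsto v.toFun (𝓝[>] 0) (𝓝 v.base) :=
    (v.isometry.continuous.tendsto 0).mono_left nhdsWithin_le_nhds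
  refine mem_closure_of_tendsto hc (eventually_mem_nhdsWithin.mono fun t ht hD => ?_)
  have h1 := (busemann_nonneg_iff _ _ _).1 (hv.2.2 _ hD)
  rw [poisson_toFun] at h1
  have h2 := poisson_pos v.base v.plusEnd
  have h3 : 1 < Real.exp t := Real.one_lt_exp_iff.2 ht
  nlinarith

/-- The only closest point to `η` in the horoball of level `exp s` centred at `ξ` is the point where
the geodesic line from `η` to `ξ` enters it. -/
theorem poisson_le_poisson_horo {ξ η : Bdry n} (h : η ≠ ξ) {s : ℝ} {x : Hyp n}
    (hx : Real.exp s ≤ poisson x ξ) :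
    poisson x η ≤ poisson (horo ξ η s) η ∧
      (poisson (horo ξ η s) η ≤ poisson x η → x = horo ξ η s) := by
  obtain ⟨η', hη', hx'⟩ := exists_eq_horo ξ x
  generalize Real.log (poisson x ξ) = s' at hx'
  subst hx'
  rw [poisson_horo hη'] at hx
  rw [poisson_horo_self h, poisson_horo' hη']
  have hq := norm_bdry_sub_pos h
  have hq' := norm_bdry_sub_pos hη'
  have e1 := Real.exp_pos s
  have e2 := Real.exp_pos s'
  set q := ‖(η : Euc n) - ξ‖
  set q' := ‖(η' : Euc n) - ξ‖
  have hpos : 0 < 4 * ‖(η' : Euc n) - η‖ ^ 2 + q' ^ 2 * q ^ 2 * Real.exp s' ^ 2 := by positivity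
  rw [div_le_div_iff₀ hpos (by positivity), div_le_div_iff₀ (by positivity) hpos]
  have hA : 0 ≤ q' ^ 2 * q ^ 2 * Real.exp s' * (Real.exp s' - Real.exp s) :=
    mul_nonneg (by positivity) (by linarith)
  constructor
  · nlinarith [sq_nonneg ‖(η' : Euc n) - η‖]
  · intro hle
    have h1 : ‖(η' : Euc n) - η‖ ^ 2 = 0 := by nlinarith [sq_nonneg ‖(η' : Euc n) - η‖]
    have h2 : η' = η := Subtype.ext (sub_eq_zero.1 (norm_eq_zero.1 (pow_eq_zero_iff two_ne_zero |>.1 h1)))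
    have h3 : q' ^ 2 * q ^ 2 * Real.exp s' * (Real.exp s' - Real.exp s) = 0 := by
      nlinarith [sq_nonneg ‖(η' : Euc n) - η‖]
    have h4 : Real.exp s' = Real.exp s := by
      have := (mul_eq_zero.1 h3).resolve_left (by positivity)
      linarith
    rw [h2, Real.exp_injective h4]

/-- The horoball centred at `ξ` of the points at which the Poisson kernel is at least `exp s`. -/
def hball (ξ : Bdry n) (s : ℝ) : Set (Hyp n) := {x | Real.exp s ≤ poisson x ξ}

theorem horoball_eq_hball (ξ : Bdry n) (p : Hyp n) :
    horoball ξ p = hball ξ (Real.log (poisson p ξ)) := by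
  rw [horoball_eq, hball, Real.exp_log (poisson_pos p ξ)]

theorem mem_bdryAtInfinity_hball (ξ : Bdry n) (s : ℝ) :
    ξ ∈ bdryAtInfinity (hball ξ s) := by
  have h0 := tendsto_ray ξ
  refine mem_closure_of_tendsto h0 ?_
  filter_upwards [eventually_ge_atTop s] with t ht
  refine ⟨_, ?_, rfl⟩
  have h1 := poisson_toFun (UnitTangent.ofDir origin ξ) t
  have h2 : (UnitTangent.ofDir origin ξ).plusEnd = ξ := by
    rw [UnitTangent.plusEnd_ofDir]
    exact Subtype.ext (by rw [mobBdry_val, origin_val, zero_mob])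
  rw [h2, UnitTangent.base_ofDir, poisson_origin, mul_one] at h1
  change Real.exp s ≤ poisson (ray ξ t) ξ
  have h3 : ray ξ t = (UnitTangent.ofDir origin ξ).toFun t := rfl
  rw [h3, h1]
  exact Real.exp_le_exp.2 ht

theorem eq_of_mem_bdryAtInfinity_hball {ξ η : Bdry n} {s : ℝ} (h : η ∈ bdryAtInfinity (hball ξ s)) :
    η = ξ := by
  have hc : IsClosed {u : Euc n | Real.exp s * ‖(ξ : Euc n) - u‖ ^ 2 ≤ 1 - ‖u‖ ^ 2} :=
    isClosed_le (by fun_prop) (by fun_prop)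
  have hs : val '' hball ξ s ⊆ {u : Euc n | Real.exp s * ‖(ξ : Euc n) - u‖ ^ 2 ≤ 1 - ‖u‖ ^ 2} := by
    rintro _ ⟨x, hx, rfl⟩
    have hx' : Real.exp s ≤ poisson x ξ := hx
    rwa [poisson, le_div_iff₀ (pow_pos (norm_sub_pos x ξ) 2)] at hx'
  have h1 : Real.exp s * ‖(ξ : Euc n) - η‖ ^ 2 ≤ 1 - ‖(η : Euc n)‖ ^ 2 := closure_minimal hs hc h
  rw [norm_bdry, one_pow, sub_self] at h1
  have h2 : ‖(ξ : Euc n) - η‖ ^ 2 ≤ 0 := by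
    have := Real.exp_pos s
    by_contra hcon
    push Not at hcon
    nlinarith
  have h3 := pow_eq_zero_iff two_ne_zero |>.1 (le_antisymm h2 (sq_nonneg _))
  exact (Subtype.ext (sub_eq_zero.1 (norm_eq_zero.1 h3))).symm

/-- The unit normal vector at `x` of the horosphere centred at `ξ` through `x`: it points away from `ξ`
for the outer normal bundle, and towards `ξ` for the inner one. -/
def horoNormal : Sgn → Bdry n → Hyp n → UnitTangent n
  | .plus, ξ, x => (toward x ξ).flip
  | .minus, ξ, x => toward x ξ

theorem base_horoNormal (s : Sgn) (ξ : Bdry n) (x : Hyp n) : (horoNormal s ξ x).base = x := by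
  cases s
  · exact (UnitTangent.base_flip _).trans (base_toward _ _)
  · exact base_toward _ _

theorem smul_horoNormal (s : Sgn) (g : Hyp n ≃ᵢ Hyp n) (ξ : Bdry n) (x : Hyp n) :
    g • horoNormal s ξ x = horoNormal s (bdryMap g ξ) (g x) := by
  cases s
  · change g • (toward x ξ).flip = (toward (g x) (bdryMap g ξ)).flip
    rw [← smul_toward, UnitTangent.flip_smul]
  · exact smul_toward g x ξ

theorem continuous_horoNormal (s : Sgn) (ξ : Bdry n) : Continuous fun x => horoNormal s ξ x := by
  have h : Continuous fun x : Hyp n => (x, ξ) := continuous_id.prodMk continuous_const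
  have h2 := continuous_toward.comp h
  cases s
  · have := UnitTangent.continuous_flip.comp h2
    exact this
  · exact h2

theorem outerNormal_hball (ξ : Bdry n) (s : ℝ) : outerNormal (hball ξ s) =
    (fun η => horoNormal .plus ξ (horo ξ η s)) '' {η | η ≠ ξ} := by
  ext v
  constructor
  · rintro ⟨h1, h2, h3⟩
    have hne : v.plusEnd ≠ ξ := fun h => h1 (by rw [h]; exact mem_bdryAtInfinity_hball ξ s)
    refine ⟨v.plusEnd, hne, ?_⟩
    have h4 := (poisson_le_poisson_horo hne h2).2 ((busemann_nonneg_iff _ _ _).1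
      (h3 _ (show Real.exp s ≤ _ by rw [poisson_horo hne])))
    refine UnitTangent.ext_of_base_of_plusEnd ?_ ?_
    · rw [base_horoNormal, h4]
    · change (toward _ ξ).flip.plusEnd = _
      rw [UnitTangent.plusEnd_flip, minusEnd_toward_horo hne]
  · rintro ⟨η, hη, rfl⟩
    have hη' : η ≠ ξ := hη
    have hp : (horoNormal .plus ξ (horo ξ η s)).plusEnd = η := by
      change (toward _ ξ).flip.plusEnd = _
      rw [UnitTangent.plusEnd_flip, minusEnd_toward_horo hη']
    refine ⟨?_, ?_, ?_⟩
    · rw [hp]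
      exact fun h => hη' (eq_of_mem_bdryAtInfinity_hball h)
    · rw [base_horoNormal]
      exact (poisson_horo hη' s).ge
    · intro y hy
      rw [busemann_nonneg_iff, hp, base_horoNormal]
      exact (poisson_le_poisson_horo hη' hy).1

theorem isEndParam_hball (s : Sgn) (ξ : Bdry n) (t : ℝ) :
    IsEndParam s (hball ξ t) (fun η => horoNormal s ξ (horo ξ η t)) {η | η ≠ ξ} := by
  have hplus : IsEndParam .plus (hball ξ t) (fun η => horoNormal .plus ξ (horo ξ η t))
      {η | η ≠ ξ} := by
    have hcomp := (continuous_horoNormal .plus ξ).measurable.comp (measurable_horo_mid ξ t)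
    refine ⟨hcomp,
      (isOpen_ne_fun continuous_id continuous_const).measurableSet, fun η hη => ?_,
      outerNormal_hball ξ t⟩
    change (toward _ ξ).flip.plusEnd = _
    rw [UnitTangent.plusEnd_flip, minusEnd_toward_horo hη]
  cases s
  · exact hplus
  · have h := hplus.flip
    have he : (fun η => (horoNormal .plus ξ (horo ξ η t)).flip) =
        fun η => horoNormal .minus ξ (horo ξ η t) := funext fun η => UnitTangent.flip_flip _
    rwa [he] at h

theorem frontier_hball (ξ : Bdry n) (s : ℝ) :
    frontier (hball ξ s) = {x | poisson x ξ = Real.exp s} := by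
  refine Set.Subset.antisymm (fun x hx => ?_) fun x hx => ?_
  · exact (frontier_le_subset_eq continuous_const (continuous_poisson_left ξ) hx).symm
  · obtain ⟨η, hη, h⟩ := exists_eq_horo ξ x
    have hx' : poisson x ξ = Real.exp s := hx
    rw [hx', Real.log_exp] at h
    have hv : horoNormal .plus ξ x ∈ outerNormal (hball ξ s) := by
      rw [outerNormal_hball, h]
      exact ⟨η, hη, rfl⟩
    have := base_mem_frontier hv
    rwa [base_horoNormal] at this

/-- The skinning measure of a horoball is carried by the normal vectors of the horosphere. -/
theorem skinning_hball {Γ : Subgroup (Hyp (m + 1) ≃ᵢ Hyp (m + 1))}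
    {μ : Hyp (m + 1) → Measure (Bdry (m + 1))} (hδ : critExp Γ = m) (hμ : ∀ x, μ x = visual x)
    (x₀ : Hyp (m + 1)) (s : Sgn) (ξ : Bdry (m + 1)) (t : ℝ) :
    skinning Γ μ x₀ s (hball ξ t) =
      (2 : ℝ≥0∞) ^ m • (riemVol m (frontier (hball ξ t))).map (horoNormal s ξ) := by
  have h2 : (ENNReal.ofReal (2 ^ m)) = (2 : ℝ≥0∞) ^ m := by
    rw [ENNReal.ofReal_pow (by norm_num)]; norm_num
  have hm := measurable_horo_mid ξ t
  have hd : Measurable fun η : Bdry (m + 1) =>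
      ENNReal.ofReal ((2 * Real.exp (-t) / ‖(η : Euc (m + 1)) - ξ‖ ^ 2) ^ m) := by fun_prop
  have hΩ : MeasurableSet {η : Bdry (m + 1) | η ≠ ξ} :=
    (isOpen_ne_fun continuous_id continuous_const).measurableSet
  rw [(isEndParam_hball s ξ t).skinning_eq hδ hμ, frontier_hball, riemVol, ← map_horosphere_eq,
    Measure.map_map (continuous_horoNormal s ξ).measurable hm, ← Measure.map_smul,
    ← withDensity_smul _ hd, visualAlong]
  congr 1
  refine withDensity_congr_ae ?_
  filter_upwards [ae_restrict_mem hΩ] with η hη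
  have hη' : η ≠ ξ := hη
  have hq := norm_bdry_sub_pos hη'
  rw [base_horoNormal, poisson_horo_self hη']
  simp only [Pi.smul_apply, smul_eq_mul]
  rw [← h2, ← ENNReal.ofReal_mul (by positivity), ← mul_pow, Real.exp_neg]
  congr 2
  field_simp
  norm_num

/-- There is one normal vector at each point of a horosphere, and the `0`-dimensional measure counts
it once. -/
theorem fibreVol_hball (s : Sgn) (ξ : Bdry n) (t : ℝ) {x : Hyp n}
    (hx : x ∈ frontier (hball ξ t)) :
    fibreVol 0 (normalBundle s (hball ξ t)) x = Measure.dirac (horoNormal s ξ x) := by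
  have hn := (isEndParam_hball s ξ t).normalBundle_eq
  obtain ⟨e, he, hxe⟩ := (horoNormal s ξ x).exists_eq_ofDir
  rw [base_horoNormal] at hxe
  rw [frontier_hball] at hx
  have hx' : poisson x ξ = Real.exp t := hx
  have hset : {e | UnitTangent.ofDir x e ∈ normalBundle s (hball ξ t)} = {e} := by
    ext f
    simp only [Set.mem_singleton_iff]
    change UnitTangent.ofDir x f ∈ normalBundle s (hball ξ t) ↔ _
    rw [hn]
    constructor
    · rintro ⟨η, hη, h⟩
      have h1 : horo ξ η t = x := by
        have := congrArg UnitTangent.base h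
        rwa [base_horoNormal, UnitTangent.base_ofDir] at this
      simp only [h1] at h
      exact (UnitTangent.ofDir_injective (hxe.symm.trans h)).2.symm
    · rintro rfl
      obtain ⟨η, hη, h⟩ := exists_eq_horo ξ x
      rw [hx', Real.log_exp] at h
      exact ⟨η, hη, by rw [← hxe]; exact congrArg _ h.symm⟩
  have hcont : Continuous (UnitTangent.ofDir x) := by
    have h : Continuous fun e : Bdry n => (x, e) := continuous_const.prodMk continuous_id
    have := UnitTangent.continuous_ofDir.comp h
    exact this
  rw [fibreVol, hset, Measure.euclideanHausdorffMeasure_zero, Measure.restrict_singleton,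
    Measure.hausdorffMeasure_zero_singleton, one_smul, Measure.map_dirac' hcont.measurable, ← hxe]

theorem normalVol_hball (s : Sgn) (ξ : Bdry (m + 1)) (t : ℝ) :
    normalVol m s (hball ξ t) = (riemVol m (frontier (hball ξ t))).map (horoNormal s ξ) := by
  have hc : MeasurableSet (frontier (hball ξ t)) := isClosed_frontier.measurableSet
  have hae : fibreVol 0 (normalBundle s (hball ξ t)) =ᵐ[riemVol m (frontier (hball ξ t))]
      fun x => Measure.dirac (horoNormal s ξ x) := by
    filter_upwards [ae_restrict_mem hc] with x hx
    exact fibreVol_hball s ξ t hx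
  have hf : m + 1 - 1 - m = 0 := by omega
  rw [normalVol, hf, Measure.bind, Measure.map_congr hae]
  exact Measure.bind_dirac_eq_map _ (continuous_horoNormal s ξ).measurable

theorem map_base_horoNormal (s : Sgn) (ξ : Bdry n) (μ : Measure (Hyp n)) :
    (μ.map (horoNormal s ξ)).map UnitTangent.base = μ := by
  rw [Measure.map_map UnitTangent.continuous_base.measurable (continuous_horoNormal s ξ).measurable]
  have : UnitTangent.base ∘ horoNormal s ξ = id := funext fun x => base_horoNormal s ξ x
  rw [this, Measure.map_id]

/-! ### Sliding a horoball to its boundary -/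

/-- The projection of a point to the horosphere of level `exp t` along the geodesic line to `ξ`. -/
def horoProj (ξ : Bdry n) (t : ℝ) (x : Hyp n) : Hyp n := horo ξ (toward x ξ).minusEnd t

theorem horoProj_horo {ξ η : Bdry n} (h : η ≠ ξ) (s t : ℝ) :
    horoProj ξ t (horo ξ η s) = horo ξ η t := by
  rw [horoProj, minusEnd_toward_horo h]

theorem measurable_horoProj (ξ : Bdry n) (t : ℝ) : Measurable (horoProj ξ t) := by
  have h : Continuous fun x : Hyp n => (x, ξ) := continuous_id.prodMk continuous_const
  have h2 := UnitTangent.continuous_minusEnd.comp (continuous_toward.comp h)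
  have := (measurable_horo_mid ξ t).comp h2.measurable
  exact this

theorem horoProj_eq_toFun (ξ : Bdry n) (t : ℝ) (x : Hyp n) :
    horoProj ξ t x = (toward x ξ).toFun (t - Real.log (poisson x ξ)) := by
  obtain ⟨η, hη, h⟩ := exists_eq_horo ξ x
  generalize Real.log (poisson x ξ) = s at h ⊢
  rw [h, horoProj_horo hη, toward_horo_toFun hη, add_sub_cancel]

/-- An isometry that preserves the horospheres centred at `ξ` commutes with the projections between
them. -/
theorem smul_horoProj (g : Hyp n ≃ᵢ Hyp n) {ξ : Bdry n} (hg : bdryMap g ξ = ξ)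
    (hg' : ∀ x, poisson (g x) ξ = poisson x ξ) (t : ℝ) (x : Hyp n) :
    g (horoProj ξ t x) = horoProj ξ t (g x) := by
  have h := smul_toward g x ξ
  rw [hg] at h
  rw [horoProj_eq_toFun, horoProj_eq_toFun, hg', ← h, UnitTangent.smul_toFun]

/-- The length of the fibre of the projection of a horoball to its boundary, weighted by the
contraction of horospheres. -/
theorem lintegral_exp_Ici (hm : 1 ≤ m) (t : ℝ) :
    ∫⁻ s in Set.Ici t, ENNReal.ofReal (Real.exp (-s) ^ m) =
      (m : ℝ≥0∞)⁻¹ * ENNReal.ofReal (Real.exp (-t) ^ m) := by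
  have hm0 : (0 : ℝ) < m := by exact_mod_cast hm
  have he : ∀ s : ℝ, Real.exp (-s) ^ m = Real.exp (-(m : ℝ) * s) := fun s => by
    rw [← Real.exp_nat_mul]; congr 1; ring
  simp only [he]
  rw [setLIntegral_congr Ioi_ae_eq_Ici.symm, ← ofReal_integral_eq_lintegral_ofReal
    (integrableOn_exp_mul_Ioi (by linarith) t) (Eventually.of_forall fun s => (Real.exp_pos _).le),
    integral_exp_mul_Ioi (by linarith) t]
  rw [← ENNReal.ofReal_natCast, ← ENNReal.ofReal_inv_of_pos hm0,
    ← ENNReal.ofReal_mul (by positivity)]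
  congr 1
  field_simp

/-- A horoball projects to its boundary, along the geodesics to its centre, with fibres of length
`1 / m`, in dimension `m + 1`. -/
theorem map_horoProj (hm : 1 ≤ m) (ξ : Bdry (m + 1)) (t : ℝ) :
    (riemVol (m + 1) (hball ξ t)).map (horoProj ξ t) =
      (m : ℝ≥0∞)⁻¹ • riemVol m (frontier (hball ξ t)) := by
  have hD : MeasurableSet (hball ξ t) :=
    (isClosed_le continuous_const (continuous_poisson_left ξ)).measurableSet
  have hΩ : MeasurableSet {η : Bdry (m + 1) | η ≠ ξ} :=
    (isOpen_ne_fun continuous_id continuous_const).measurableSet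
  have hpr := measurable_horoProj ξ t
  have hho := measurable_horo_mid ξ t
  have haene : ∀ᵐ η ∂(μHE[m] : Measure (Bdry (m + 1))), η ≠ ξ := by
    rw [ae_iff]
    have : {η : Bdry (m + 1) | ¬η ≠ ξ} = {ξ} := by ext; simp
    rw [this, euclideanHausdorffMeasure_singleton hm]
  ext A hA
  have hA' : MeasurableSet (horoProj ξ t ⁻¹' A ∩ hball ξ t) := (hpr hA).inter hD
  have hd : Measurable fun η : Bdry (m + 1) =>
      ENNReal.ofReal ((2 * Real.exp (-t) / ‖(η : Euc (m + 1)) - ξ‖ ^ 2) ^ m) := by fun_prop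
  rw [Measure.map_apply hpr hA, riemVol, Measure.restrict_apply (hpr hA), ← lintegral_indicator_one hA',
    lintegral_horo hm ξ (measurable_one.indicator hA'), Measure.smul_apply, frontier_hball, riemVol,
    ← map_horosphere_eq, Measure.map_apply hho hA, withDensity_apply _ (hho hA),
    ← lintegral_indicator (hho hA), Measure.restrict_eq_self_of_ae_mem (s := {η : Bdry (m + 1) | η ≠ ξ}) haene, smul_eq_mul,
    ← lintegral_const_mul _ (hd.indicator (hho hA))]
  refine lintegral_congr_ae ?_
  filter_upwards [haene] with η hη
  have hq := norm_bdry_sub_pos hη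
  have hmem : ∀ s, horo ξ η s ∈ horoProj ξ t ⁻¹' A ∩ hball ξ t ↔ horo ξ η t ∈ A ∧ t ≤ s := by
    intro s
    rw [Set.mem_inter_iff, Set.mem_preimage, horoProj_horo hη]
    refine and_congr_right fun _ => ?_
    change Real.exp t ≤ poisson (horo ξ η s) ξ ↔ _
    rw [poisson_horo hη, Real.exp_le_exp]
  by_cases hηA : horo ξ η t ∈ A
  · have h1 : ∀ s, ENNReal.ofReal ((2 * Real.exp (-s) / ‖(η : Euc (m + 1)) - ξ‖ ^ 2) ^ m) *
        (horoProj ξ t ⁻¹' A ∩ hball ξ t).indicator 1 (horo ξ η s) =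
        (Set.Ici t).indicator (fun s => ENNReal.ofReal ((2 / ‖(η : Euc (m + 1)) - ξ‖ ^ 2) ^ m) *
          ENNReal.ofReal (Real.exp (-s) ^ m)) s := by
      intro s
      by_cases hs : t ≤ s
      · rw [Set.indicator_of_mem ((hmem s).2 ⟨hηA, hs⟩), Set.indicator_of_mem (show s ∈ Set.Ici t from hs),
          ← ENNReal.ofReal_mul (by positivity), ← mul_pow, Pi.one_apply, mul_one]
        congr 2
        ring
      · rw [Set.indicator_of_notMem (fun h => hs ((hmem s).1 h).2),
          Set.indicator_of_notMem (show s ∉ Set.Ici t from hs), mul_zero]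
    rw [lintegral_congr h1, lintegral_indicator measurableSet_Ici, lintegral_const_mul _ (by fun_prop),
      lintegral_exp_Ici hm, Set.indicator_of_mem (show η ∈ (fun η => horo ξ η t) ⁻¹' A from hηA),
      mul_left_comm, ← ENNReal.ofReal_mul (by positivity), ← mul_pow]
    congr 3
    ring
  · have h1 : ∀ s, ENNReal.ofReal ((2 * Real.exp (-s) / ‖(η : Euc (m + 1)) - ξ‖ ^ 2) ^ m) *
        (horoProj ξ t ⁻¹' A ∩ hball ξ t).indicator 1 (horo ξ η s) = 0 := by
      intro s
      rw [Set.indicator_of_notMem (fun h => hηA ((hmem s).1 h).1), mul_zero]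
    rw [lintegral_congr h1, lintegral_zero,
      Set.indicator_of_notMem (show η ∉ (fun η => horo ξ η t) ⁻¹' A from hηA), mul_zero]

end Hyp

namespace Hyp

variable {n k j m : ℕ}

/-! ### Totally geodesic submanifolds -/

/-- The unit normal vectors of the image by `g` of the subspace `L`, parametrised by their base point
and by their direction in the orthogonal subspace `L'`. -/
def normalVec (g : Hyp n ≃ᵢ Hyp n) (L : Euc k →ₗᵢ[ℝ] Euc n) (L' : Euc j →ₗᵢ[ℝ] Euc n)
    (z : Hyp k × Bdry j) : UnitTangent n :=
  g • UnitTangent.ofDir (emb L z.1) (mapBdry L' z.2)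

theorem continuous_normalVec (g : Hyp n ≃ᵢ Hyp n) (L : Euc k →ₗᵢ[ℝ] Euc n)
    (L' : Euc j →ₗᵢ[ℝ] Euc n) : Continuous (normalVec g L L') := by
  have h : Continuous fun z : Hyp k × Bdry j => (emb L z.1, mapBdry L' z.2) :=
    ((isometry_emb L).continuous.comp continuous_fst).prodMk
      ((isometry_mapBdry L').continuous.comp continuous_snd)
  have h2 := UnitTangent.continuous_ofDir.comp h
  have := (UnitTangent.continuous_smul g).comp h2
  exact this

theorem base_normalVec (g : Hyp n ≃ᵢ Hyp n) (L : Euc k →ₗᵢ[ℝ] Euc n) (L' : Euc j →ₗᵢ[ℝ] Euc n)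
    (z : Hyp k × Bdry j) : (normalVec g L L' z).base = g (emb L z.1) := by
  rw [normalVec, UnitTangent.base_smul, UnitTangent.base_ofDir]

theorem flip_normalVec (g : Hyp n ≃ᵢ Hyp n) (L : Euc k →ₗᵢ[ℝ] Euc n) (L' : Euc j →ₗᵢ[ℝ] Euc n)
    (z : Hyp k × Bdry j) : (normalVec g L L' z).flip = normalVec g L L' (z.1, -z.2) := by
  rw [normalVec, UnitTangent.flip_smul, UnitTangent.flip_ofDir, ← mapBdry_neg]
  rfl

/-- A linear isometry onto the orthogonal complement of the range of `L`. -/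
theorem exists_orthogonal_linearIsometry (L : Euc k →ₗᵢ[ℝ] Euc (k + j)) :
    ∃ L' : Euc j →ₗᵢ[ℝ] Euc (k + j), (∀ u w, inner ℝ (L u) (L' w) = 0) ∧
      ∀ x, ∃ u w, x = L u + L' w := by
  let V : Submodule ℝ (Euc (k + j)) := LinearMap.range L.toLinearMap
  have h1 : Module.finrank ℝ V = k := by
    rw [LinearMap.finrank_range_of_inj L.injective]
    simp
  have h2 : Module.finrank ℝ Vᗮ = j := by
    have := V.finrank_add_finrank_orthogonal
    rw [h1] at this
    simp at this
    exact this
  let b := (stdOrthonormalBasis ℝ Vᗮ).reindex (finCongr h2)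
  let L' : Euc j →ₗᵢ[ℝ] Euc (k + j) := Vᗮ.subtypeₗᵢ.comp b.repr.symm.toLinearIsometry
  refine ⟨L', fun u w => ?_, fun x => ?_⟩
  · exact (Submodule.mem_orthogonal V _).1 (b.repr.symm w).2 _ ⟨u, rfl⟩
  · obtain ⟨y, ⟨u, hu⟩, z, hz, hx⟩ := V.exists_add_mem_mem_orthogonal x
    refine ⟨u, b.repr ⟨z, hz⟩, ?_⟩
    change x = L u + ((b.repr.symm (b.repr ⟨z, hz⟩) : Vᗮ) : Euc (k + j))
    rw [LinearIsometryEquiv.symm_apply_apply, hx]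
    have hu' : L u = y := hu
    rw [hu']

/-- A totally geodesic submanifold is the image by an isometry of a linear subspace of the ball. -/
theorem IsTotallyGeodesic.exists_eq_image {D : Set (Hyp (k + j + 1))} (hD : IsTotallyGeodesic k D) :
    ∃ (g : Hyp (k + j + 1) ≃ᵢ Hyp (k + j + 1)) (L : Euc k →ₗᵢ[ℝ] Euc (k + j + 1))
      (L' : Euc (j + 1) →ₗᵢ[ℝ] Euc (k + j + 1)), (∀ u w, inner ℝ (L u) (L' w) = 0) ∧
      (∀ x, ∃ u w, x = L u + L' w) ∧ D = g '' Set.range (emb L) := by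
  obtain ⟨f, hf, rfl⟩ := hD
  obtain ⟨L, hL⟩ := exists_linearIsometry_origin hf
  obtain ⟨L', h1, h2⟩ := exists_orthogonal_linearIsometry (j := j + 1) L
  refine ⟨transl (f origin), L, L', h1, h2, ?_⟩
  rw [← Set.range_comp]
  congr 1
  funext u
  exact ext (by rw [hL u, Function.comp_apply, transl_val, emb_val])

section

variable {g : Hyp n ≃ᵢ Hyp n} {L : Euc k →ₗᵢ[ℝ] Euc n} {L' : Euc j →ₗᵢ[ℝ] Euc n}

theorem normalBundle_totallyGeodesic (hLL : ∀ u w, inner ℝ (L u) (L' w) = 0)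
    (hsup : ∀ x, ∃ u w, x = L u + L' w) (s : Sgn) :
    normalBundle s (g '' Set.range (emb L)) = Set.range (normalVec g L L') := by
  have hplus : outerNormal (g '' Set.range (emb L)) = Set.range (normalVec g L L') := by
    rw [outerNormal_image, outerNormal_range_emb hLL hsup, ← Set.range_comp]
    rfl
  cases s
  · exact hplus
  · change UnitTangent.flip '' outerNormal _ = _
    rw [hplus, ← Set.range_comp]
    ext v
    constructor
    · rintro ⟨z, rfl⟩
      exact ⟨(z.1, -z.2), (flip_normalVec g L L' z).symm⟩
    · rintro ⟨z, rfl⟩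
      exact ⟨(z.1, -z.2), (flip_normalVec g L L' _).trans (by rw [_root_.neg_neg])⟩

theorem isClosed_image_emb (g : Hyp n ≃ᵢ Hyp n) (L : Euc k →ₗᵢ[ℝ] Euc n) :
    IsClosed (g '' Set.range (emb L)) := by
  rw [← Set.range_comp]
  exact (g.isometry.comp (isometry_emb L)).isClosedEmbedding.isClosed_range

/-- A proper totally geodesic submanifold is its own boundary, since there are normal vectors at
each point. -/
theorem frontier_totallyGeodesic {L' : Euc (j + 1) →ₗᵢ[ℝ] Euc n}
    (hLL : ∀ u w, inner ℝ (L u) (L' w) = 0)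
    (hsup : ∀ x, ∃ u w, x = L u + L' w) :
    frontier (g '' Set.range (emb L)) = g '' Set.range (emb L) := by
  refine Set.Subset.antisymm (isClosed_image_emb g L).frontier_subset ?_
  rintro _ ⟨_, ⟨y, rfl⟩, rfl⟩
  let e : Bdry (j + 1) := ⟨EuclideanSpace.single 0 1, by simp⟩
  have hv : normalVec g L L' (y, e) ∈ outerNormal (g '' Set.range (emb L)) := by
    have h := normalBundle_totallyGeodesic (g := g) hLL hsup .plus
    change outerNormal _ = _ at h
    rw [h]
    exact ⟨_, rfl⟩
  have := base_mem_frontier hv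
  rwa [base_normalVec] at this

end

section

variable {g : Hyp (k + j + 1) ≃ᵢ Hyp (k + j + 1)} {L : Euc k →ₗᵢ[ℝ] Euc (k + j + 1)}
  {L' : Euc (j + 1) →ₗᵢ[ℝ] Euc (k + j + 1)}

theorem measurableEmbedding_normalEnd (hLL : ∀ u w, inner ℝ (L u) (L' w) = 0) :
    MeasurableEmbedding (normalEnd L L') :=
  (continuous_normalEnd L L').measurable.measurableEmbedding (normalEnd_injective hLL)

/-- The unit normal bundle of a hyperbolic subspace is parametrised by its positive endpoints. -/
theorem exists_isEndParam_emb (hLL : ∀ u w, inner ℝ (L u) (L' w) = 0)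
    (hsup : ∀ x, ∃ u w, x = L u + L' w) : ∃ ν : Bdry (k + j + 1) → UnitTangent (k + j + 1),
      IsEndParam .plus (Set.range (emb L)) ν (Set.range (normalEnd L L')) ∧
      (visualAlong ν (Set.range (normalEnd L L'))).map ν =
        ((μHE[k] : Measure (Hyp k)).prod (μHE[j] : Measure (Bdry (j + 1)))).map
          fun z => UnitTangent.ofDir (emb L z.1) (mapBdry L' z.2) := by
  let N : Hyp k × Bdry (j + 1) → UnitTangent (k + j + 1) := fun z =>
    UnitTangent.ofDir (emb L z.1) (mapBdry L' z.2)
  have hN : Measurable N := (continuous_normalVec 1 L L').measurable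
  have hE := measurableEmbedding_normalEnd hLL
  let e : Bdry (j + 1) := ⟨EuclideanSpace.single 0 1, by simp⟩
  let ν : Bdry (k + j + 1) → UnitTangent (k + j + 1) :=
    Function.extend (normalEnd L L') N fun _ => N (origin, e)
  have hν : Measurable ν := hE.measurable_extend hN measurable_const
  have hνN : ∀ z, ν (normalEnd L L' z) = N z := fun z => hE.injective.extend_apply _ _ _
  refine ⟨ν, ⟨hν, hE.measurableSet_range, ?_, ?_⟩, ?_⟩
  · rintro _ ⟨z, rfl⟩
    rw [hνN]
    exact UnitTangent.plusEnd_ofDir _ _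
  · change outerNormal _ = _
    rw [outerNormal_range_emb hLL hsup, ← Set.range_comp]
    congr 1
    funext z
    exact (hνN z).symm
  · have hp : Measurable fun η => ENNReal.ofReal (poisson (ν η).base η ^ (k + j)) :=
      ((measurable_poisson_base hν).pow_const _).ennreal_ofReal
    have hf : Measurable fun z : Hyp k × Bdry (j + 1) =>
        ENNReal.ofReal (normalFactor z.1 ^ (k + j)) :=
      ((continuous_normalFactor.comp continuous_fst).measurable.pow_const _).ennreal_ofReal
    have hpE : Measurable fun z => ENNReal.ofReal
        (poisson (ν (normalEnd L L' z)).base (normalEnd L L' z) ^ (k + j)) :=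
      hp.comp hE.measurable
    rw [visualAlong, ← map_normalEnd hLL, ← map_withDensity_comp _ hE.measurable hp,
      ← withDensity_mul _ hf hpE, Measure.map_map hν hE.measurable]
    have h1 : ((fun z : Hyp k × Bdry (j + 1) => ENNReal.ofReal (normalFactor z.1 ^ (k + j))) *
        fun z => ENNReal.ofReal
          (poisson (ν (normalEnd L L' z)).base (normalEnd L L' z) ^ (k + j))) = 1 := by
      funext z
      have h2 : (ν (normalEnd L L' z)).base = emb L z.1 := by
        rw [hνN]
        exact UnitTangent.base_ofDir _ _
      have h3 := normalFactor_pos z.1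
      rw [Pi.mul_apply, h2, poisson_normalEnd_self hLL, ← ENNReal.ofReal_mul (by positivity),
        ← mul_pow, mul_inv_cancel₀ h3.ne', one_pow, ENNReal.ofReal_one]
      rfl
    have h4 : ν ∘ normalEnd L L' = N := funext hνN
    rw [h1, withDensity_one, h4]

theorem exists_isEndParam_totallyGeodesic (hLL : ∀ u w, inner ℝ (L u) (L' w) = 0)
    (hsup : ∀ x, ∃ u w, x = L u + L' w) (s : Sgn) :
    ∃ ν Ω, IsEndParam s (g '' Set.range (emb L)) ν Ω := by
  obtain ⟨ν, hν, -⟩ := exists_isEndParam_emb hLL hsup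
  cases s
  · exact ⟨_, _, hν.smul g⟩
  · exact ⟨_, _, (hν.smul g).flip⟩

/-- The skinning measure of a totally geodesic submanifold is the product of its Riemannian measure
and of the spherical measures of its normal directions. -/
theorem skinning_totallyGeodesic {Γ : Subgroup (Hyp (k + j + 1) ≃ᵢ Hyp (k + j + 1))}
    {μ : Hyp (k + j + 1) → Measure (Bdry (k + j + 1))} (hδ : critExp Γ = ((k + j : ℕ) : ℝ))
    (hμ : ∀ x, μ x = visual x) (x₀ : Hyp (k + j + 1)) (s : Sgn)
    (hLL : ∀ u w, inner ℝ (L u) (L' w) = 0) (hsup : ∀ x, ∃ u w, x = L u + L' w) :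
    skinning Γ μ x₀ s (g '' Set.range (emb L)) =
      ((μHE[k] : Measure (Hyp k)).prod (μHE[j] : Measure (Bdry (j + 1)))).map
        (normalVec g L L') := by
  obtain ⟨ν, hν, hmap⟩ := exists_isEndParam_emb hLL hsup
  have hN1 : (fun z : Hyp k × Bdry (j + 1) => UnitTangent.ofDir (emb L z.1) (mapBdry L' z.2)) =
      normalVec 1 L L' := funext fun z => (one_smul _ _).symm
  have hsm : Measurable fun v : UnitTangent (k + j + 1) => g • v :=
    (UnitTangent.continuous_smul g).measurable
  have hgN : (fun v : UnitTangent (k + j + 1) => g • v) ∘ normalVec 1 L L' = normalVec g L L' := by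
    rw [← hN1]
    rfl
  have hplus : skinning Γ μ x₀ .plus (g '' Set.range (emb L)) =
      ((μHE[k] : Measure (Hyp k)).prod (μHE[j] : Measure (Bdry (j + 1)))).map
        (normalVec g L L') := by
    rw [hν.skinning_image hδ hμ, hν.skinning_eq hδ hμ, hmap, hN1,
      Measure.map_map hsm (continuous_normalVec 1 L L').measurable, hgN]
  cases s
  · exact hplus
  · have hνg := hν.smul g
    have h1 := hνg.flip.skinning_eq hδ hμ x₀ (Γ := Γ) (μ := μ)
    have h2 := hνg.skinning_eq hδ hμ x₀ (Γ := Γ) (μ := μ)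
    -- the inner skinning measure is the image of the outer one by the flip, which acts on normal
    -- directions by the antipodal map
    have h3 : visualAlong (fun η => (g • ν (bdryMap g⁻¹ η)).flip)
        (bdryMap g '' Set.range (normalEnd L L')) =
        visualAlong (fun η => g • ν (bdryMap g⁻¹ η))
          (bdryMap g '' Set.range (normalEnd L L')) := by
      simp only [visualAlong, UnitTangent.base_flip]
    have h4 : (fun η => (g • ν (bdryMap g⁻¹ η)).flip) =
        UnitTangent.flip ∘ fun η => g • ν (bdryMap g⁻¹ η) := rfl
    have hn : Measurable fun e : Bdry (j + 1) => -e :=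
      (by fun_prop : Continuous fun e : Bdry (j + 1) => -e).measurable
    have hneg : Measurable fun z : Hyp k × Bdry (j + 1) => (z.1, -z.2) :=
      measurable_fst.prodMk (hn.comp measurable_snd)
    have hnegm : ((μHE[k] : Measure (Hyp k)).prod (μHE[j] : Measure (Bdry (j + 1)))).map
        (fun z => (z.1, -z.2)) = (μHE[k] : Measure (Hyp k)).prod μHE[j] := by
      have h5 : (μHE[j] : Measure (Bdry (j + 1))).map (fun e => -e) = μHE[j] := by
        have h6 := map_mapBdry (LinearIsometryEquiv.neg ℝ (E := Euc (j + 1))).toLinearIsometry j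
        exact h6
      have h7 := Measure.map_prod_map (μHE[k] : Measure (Hyp k)) (μHE[j] : Measure (Bdry (j + 1)))
        measurable_id hn
      rw [Measure.map_id, h5] at h7
      exact h7.symm
    have hfn : UnitTangent.flip ∘ normalVec g L L' = normalVec g L L' ∘ fun z => (z.1, -z.2) :=
      funext fun z => flip_normalVec g L L' z
    rw [h1, h3, h4, ← Measure.map_map UnitTangent.continuous_flip.measurable hνg.measurable, ← h2,
      hplus, Measure.map_map UnitTangent.continuous_flip.measurable
        (continuous_normalVec g L L').measurable, hfn,
      ← Measure.map_map (continuous_normalVec g L L').measurable hneg, hnegm]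

theorem riemVol_image_emb : riemVol k (g '' Set.range (emb L)) =
    (μHE[k] : Measure (Hyp k)).map fun y => g (emb L y) := by
  have h := (g.isometry.comp (isometry_emb L)).map_euclideanHausdorffMeasure (d := k)
  rw [Set.range_comp] at h
  exact h.symm

theorem fibreVol_totallyGeodesic (hLL : ∀ u w, inner ℝ (L u) (L' w) = 0)
    (hsup : ∀ x, ∃ u w, x = L u + L' w) (s : Sgn) (y : Hyp k) :
    fibreVol j (normalBundle s (g '' Set.range (emb L))) (g (emb L y)) =
      (μHE[j] : Measure (Bdry (j + 1))).map fun e => normalVec g L L' (y, e) := by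
  obtain ⟨A, hA⟩ := UnitTangent.exists_smul_ofDir' g (emb L y)
  have hι : Isometry fun e : Bdry (j + 1) => mapBdry A (mapBdry L' e) :=
    (isometry_mapBdry A).comp (isometry_mapBdry L')
  have hnv : ∀ e, normalVec g L L' (y, e) =
      UnitTangent.ofDir (g (emb L y)) (mapBdry A (mapBdry L' e)) := fun e => hA _
  have hset : {e | UnitTangent.ofDir (g (emb L y)) e ∈ normalBundle s (g '' Set.range (emb L))} =
      Set.range fun e : Bdry (j + 1) => mapBdry A (mapBdry L' e) := by
    ext e
    change UnitTangent.ofDir (g (emb L y)) e ∈ normalBundle s (g '' Set.range (emb L)) ↔ _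
    rw [normalBundle_totallyGeodesic hLL hsup]
    constructor
    · rintro ⟨z, hz⟩
      have h1 : z.1 = y := by
        have := congrArg UnitTangent.base hz
        rw [base_normalVec, UnitTangent.base_ofDir] at this
        exact (isometry_emb L).injective (g.injective this)
      obtain ⟨z1, z2⟩ := z
      subst h1
      rw [hnv] at hz
      exact ⟨z2, (UnitTangent.ofDir_injective hz).2⟩
    · rintro ⟨e', rfl⟩
      exact ⟨(y, e'), hnv e'⟩
  have hcont : Continuous (UnitTangent.ofDir (g (emb L y))) := by
    have h : Continuous fun e : Bdry (k + j + 1) => (g (emb L y), e) :=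
      continuous_const.prodMk continuous_id
    have := UnitTangent.continuous_ofDir.comp h
    exact this
  have hcomp : UnitTangent.ofDir (g (emb L y)) ∘ (fun e : Bdry (j + 1) => mapBdry A (mapBdry L' e)) =
      fun e => normalVec g L L' (y, e) := funext fun e => (hnv e).symm
  rw [fibreVol, hset, ← hι.map_euclideanHausdorffMeasure,
    Measure.map_map hcont.measurable hι.continuous.measurable, hcomp]

theorem normalVol_totallyGeodesic (hLL : ∀ u w, inner ℝ (L u) (L' w) = 0)
    (hsup : ∀ x, ∃ u w, x = L u + L' w) (s : Sgn) :
    normalVol k s (g '' Set.range (emb L)) =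
      ((μHE[k] : Measure (Hyp k)).prod (μHE[j] : Measure (Bdry (j + 1)))).map
        (normalVec g L L') := by
  have hf : k + j + 1 - 1 - k = j := by omega
  have hν := (continuous_normalVec g L L').measurable
  have hνy : ∀ y, Measurable fun e => normalVec g L L' (y, e) := fun y =>
    hν.comp measurable_prodMk_left
  have hemb : MeasurableEmbedding fun y => g (emb L y) :=
    (g.isometry.comp (isometry_emb L)).isClosedEmbedding.measurableEmbedding
  have hker : Measurable fun y : Hyp k =>
      (μHE[j] : Measure (Bdry (j + 1))).map fun e => normalVec g L L' (y, e) := by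
    refine Measure.measurable_of_measurable_coe _ fun A hA => ?_
    have h1 : ∀ y, ((μHE[j] : Measure (Bdry (j + 1))).map fun e => normalVec g L L' (y, e)) A =
        (μHE[j] : Measure (Bdry (j + 1))) (Prod.mk y ⁻¹' (normalVec g L L' ⁻¹' A)) := fun y => by
      rw [Measure.map_apply (hνy y) hA]
      rfl
    simp only [h1]
    exact measurable_measure_prodMk_left (hν hA)
  have hfib : (fun x => fibreVol j (normalBundle s (g '' Set.range (emb L))) x) ∘
      (fun y => g (emb L y)) = fun y =>
      (μHE[j] : Measure (Bdry (j + 1))).map fun e => normalVec g L L' (y, e) :=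
    funext fun y => fibreVol_totallyGeodesic hLL hsup s y
  have hae : AEMeasurable (fibreVol j (normalBundle s (g '' Set.range (emb L))))
      ((μHE[k] : Measure (Hyp k)).map fun y => g (emb L y)) := by
    rw [hemb.aemeasurable_map_iff]
    have := hker.aemeasurable (μ := (μHE[k] : Measure (Hyp k)))
    rw [← hfib] at this
    exact this
  rw [normalVol, hf, frontier_totallyGeodesic hLL hsup, riemVol_image_emb]
  ext A hA
  rw [Measure.bind_apply hA hae, hemb.lintegral_map, Measure.map_apply hν hA,
    Measure.prod_apply (hν hA)]
  refine lintegral_congr fun y => ?_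
  rw [fibreVol_totallyGeodesic hLL hsup s y, Measure.map_apply (hνy y) hA]
  rfl

theorem map_base_totallyGeodesic (g : Hyp (k + j + 1) ≃ᵢ Hyp (k + j + 1))
    (L : Euc k →ₗᵢ[ℝ] Euc (k + j + 1)) (L' : Euc (j + 1) →ₗᵢ[ℝ] Euc (k + j + 1)) :
    (((μHE[k] : Measure (Hyp k)).prod (μHE[j] : Measure (Bdry (j + 1)))).map
      (normalVec g L L')).map UnitTangent.base =
      sphereVol j • riemVol k (g '' Set.range (emb L)) := by
  have hν := (continuous_normalVec g L L').measurable
  have hg : Measurable fun y : Hyp k => g (emb L y) :=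
    (g.isometry.comp (isometry_emb L)).continuous.measurable
  have hcomp : UnitTangent.base ∘ normalVec g L L' = (fun y => g (emb L y)) ∘ Prod.fst :=
    funext fun z => base_normalVec g L L' z
  rw [Measure.map_map UnitTangent.continuous_base.measurable hν, hcomp,
    ← Measure.map_map hg measurable_fst, Measure.map_fst_prod, Measure.map_smul, riemVol_image_emb]
  rfl

end

end Hyp

namespace Hyp

variable {n k j m : ℕ}

/-! ### Fixed points of isometries -/

/-- A set which is negligible in the ball is negligible for the Riemannian measure, as the inverse
of the ball model is Lipschitz on smaller balls. -/
theorem measure_zero_of_volume_image_val {S : Set (Hyp n)} (h : volume (val '' S) = 0) :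
    (μHE[n] : Measure (Hyp n)) S = 0 := by
  have hcover : S ⊆ ⋃ i : ℕ, S ∩ {x | 1 / ((i : ℝ) + 1) < 1 - ‖x.val‖ ^ 2} := by
    intro x hx
    obtain ⟨i, hi⟩ := exists_nat_one_div_lt (one_sub_pos' x)
    exact Set.mem_iUnion.2 ⟨i, hx, hi⟩
  refine measure_mono_null hcover (measure_iUnion_null fun i => ?_)
  have hi : (0 : ℝ) < (i : ℝ) + 1 := by positivity
  have hle := euclideanHausdorffMeasure_image_le_image (f := (val : Hyp n → Euc n))
    (g := fun x : Hyp n => x) (s := S ∩ {x | 1 / ((i : ℝ) + 1) < 1 - ‖x.val‖ ^ 2})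
    (C := 2 * ((i : ℝ) + 1)) (by positivity) (fun x hx y hy => ?_) n
  · rw [EuclideanSpace.euclideanHausdorffMeasure_eq_volume, Set.image_id'] at hle
    refine le_antisymm (hle.trans ?_) zero_le
    rw [measure_mono_null (Set.image_mono Set.inter_subset_left) h, mul_zero]
  · have h1 := sinh_dist_sq x y
    have hx' : 1 / ((i : ℝ) + 1) < 1 - ‖x.val‖ ^ 2 := hx.2
    have hy' : 1 / ((i : ℝ) + 1) < 1 - ‖y.val‖ ^ 2 := hy.2
    have h2 : dist x y ≤ 2 * Real.sinh (dist x y / 2) := by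
      have := Real.self_le_sinh_iff.2 (by positivity : 0 ≤ dist x y / 2)
      linarith
    have h3 : (1 / ((i : ℝ) + 1)) ^ 2 ≤ (1 - ‖x.val‖ ^ 2) * (1 - ‖y.val‖ ^ 2) := by
      rw [sq]
      exact mul_le_mul hx'.le hy'.le (by positivity) (one_sub_pos' x).le
    refine h2.trans (le_of_sq_le_sq ?_ (by positivity))
    rw [h1, dist_eq_norm]
    calc 4 * ‖x.val - y.val‖ ^ 2 / ((1 - ‖x.val‖ ^ 2) * (1 - ‖y.val‖ ^ 2))
        ≤ 4 * ‖x.val - y.val‖ ^ 2 / (1 / ((i : ℝ) + 1)) ^ 2 := by gcongr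
      _ = (2 * ((i : ℝ) + 1) * ‖x.val - y.val‖) ^ 2 := by field_simp; ring

/-- The fixed point set of a non-trivial isometry is, up to a translation, a proper linear subspace,
hence is negligible. -/
theorem measure_fixedPoints {f : Hyp n → Hyp n} (hf : Isometry f) (hne : ∃ x, f x ≠ x) :
    (μHE[n] : Measure (Hyp n)) {x | f x = x} = 0 := by
  by_cases hex : ∃ x₀, f x₀ = x₀
  swap
  · have : {x | f x = x} = ∅ := Set.eq_empty_of_forall_notMem fun x hx => hex ⟨x, hx⟩
    rw [this, measure_empty]
  obtain ⟨x₀, hx₀⟩ := hex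
  obtain ⟨A, hA⟩ := exists_linearIsometry hf x₀
  rw [hx₀] at hA
  let V : Submodule ℝ (Euc n) := LinearMap.ker (A.toLinearMap - LinearMap.id)
  have hV : ∀ u, u ∈ V ↔ A u = u := fun u => by
    rw [LinearMap.mem_ker, LinearMap.sub_apply, sub_eq_zero]
    rfl
  have hiff : ∀ u : Hyp n, f (transl x₀ u) = transl x₀ u ↔ u.val ∈ V := by
    intro u
    rw [hV]
    constructor
    · intro h
      have h1 := hA u
      rw [h, transl_val] at h1
      have h2 := congrArg (mob (-x₀.val)) h1
      rw [mob_neg_mob x₀.norm_lt u.norm_lt.le, mob_neg_mob x₀.norm_lt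
        (by rw [A.norm_map]; exact u.norm_lt.le)] at h2
      exact h2.symm
    · intro h
      exact ext (by rw [hA u, h, transl_val])
  have hVne : V ≠ ⊤ := by
    intro hV'
    obtain ⟨x, hx⟩ := hne
    apply hx
    have := (hiff ((transl x₀).symm x)).2 (by rw [hV']; trivial)
    rwa [(transl x₀).apply_symm_apply] at this
  have himg : {x | f x = x} = transl x₀ '' {u | u.val ∈ V} := by
    ext x
    constructor
    · intro hx
      refine ⟨(transl x₀).symm x, (hiff _).1 ?_, (transl x₀).apply_symm_apply x⟩
      rwa [(transl x₀).apply_symm_apply]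
    · rintro ⟨u, hu, rfl⟩
      exact (hiff u).2 hu
  rw [himg, (transl x₀).isometry.euclideanHausdorffMeasure_image]
  refine measure_zero_of_volume_image_val (measure_mono_null ?_
    (Measure.addHaar_submodule volume V hVne))
  rintro _ ⟨u, hu, rfl⟩
  exact hu

theorem exists_ne_of_ne_one {g : Hyp n ≃ᵢ Hyp n} (h : g ≠ 1) : ∃ x, g x ≠ x := by
  by_contra hcon
  push Not at hcon
  exact h (IsometryEquiv.ext hcon)

theorem neg_ne_self (ξ : Bdry n) : -ξ ≠ ξ := by
  intro h
  have h1 : -(ξ : Euc n) = ξ := congrArg Subtype.val h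
  have h2 := norm_bdry ξ
  have h3 : (2 : ℝ) • (ξ : Euc n) = 0 := by rw [two_smul]; nth_rewrite 1 [← h1]; exact neg_add_cancel _
  rw [(smul_eq_zero.1 h3).resolve_left two_ne_zero, norm_zero] at h2
  exact zero_ne_one h2

/-- A non-trivial isometry that preserves the horospheres centred at `ξ` has a negligible set of
fixed points at infinity, since it fixes pointwise the geodesics from `ξ` to these. -/
theorem measure_fixedPoints_bdry (hm : 1 ≤ m) {g : Hyp (m + 1) ≃ᵢ Hyp (m + 1)} (hg : g ≠ 1)
    {ξ : Bdry (m + 1)} (hξ : bdryMap g ξ = ξ) (hp : ∀ x, poisson (g x) ξ = poisson x ξ) :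
    (μHE[m] : Measure (Bdry (m + 1))) {η | bdryMap g η = η} = 0 := by
  have hF : MeasurableSet {x : Hyp (m + 1) | g x = x} :=
    (isClosed_eq g.continuous continuous_id).measurableSet
  have h0 := measure_fixedPoints g.isometry (exists_ne_of_ne_one hg)
  have hho := measurable_horo_right ξ
  have hd : Measurable fun z : Bdry (m + 1) × ℝ =>
      ENNReal.ofReal ((2 * Real.exp (-z.2) / ‖(z.1 : Euc (m + 1)) - ξ‖ ^ 2) ^ m) *
        ({x : Hyp (m + 1) | g x = x}.indicator 1 (horo ξ z.1 z.2) : ℝ≥0∞) :=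
    (by fun_prop : Measurable fun z : Bdry (m + 1) × ℝ =>
      ENNReal.ofReal ((2 * Real.exp (-z.2) / ‖(z.1 : Euc (m + 1)) - ξ‖ ^ 2) ^ m)).mul
      ((measurable_one.indicator hF).comp hho)
  rw [← lintegral_indicator_one hF, lintegral_horo hm ξ (measurable_one.indicator hF),
    lintegral_eq_zero_iff hd.lintegral_prod_right] at h0
  have hne : (μHE[m] : Measure (Bdry (m + 1))) {ξ} = 0 := euclideanHausdorffMeasure_singleton hm ξ
  refine measure_mono_null (t := {ξ} ∪ {η : Bdry (m + 1) | ¬ (∫⁻ s : ℝ,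
    ENNReal.ofReal ((2 * Real.exp (-s) / ‖(η : Euc (m + 1)) - ξ‖ ^ 2) ^ m) *
      ({x : Hyp (m + 1) | g x = x}.indicator 1 (horo ξ η s) : ℝ≥0∞)) = 0}) ?_
    (measure_union_null hne (ae_iff.1 h0))
  intro η hη
  by_cases hηξ : η = ξ
  · exact Or.inl hηξ
  right
  have hη' : bdryMap g η = η := hη
  -- the geodesic line from `η` to `ξ` and the Poisson kernel of `ξ` are preserved, hence its points
  -- are fixed
  have hfix : ∀ s, g (horo ξ η s) = horo ξ η s := by
    intro s
    have h1 := smul_toward g (horo ξ η s) ξ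
    have h2 := congrArg UnitTangent.minusEnd h1
    rw [UnitTangent.minusEnd_smul, minusEnd_toward_horo hηξ, hη', hξ] at h2
    obtain ⟨η', hη'ξ, hgx⟩ := exists_eq_horo ξ (g (horo ξ η s))
    rw [hp, poisson_horo hηξ, Real.log_exp] at hgx
    rw [hgx, minusEnd_toward_horo hη'ξ] at h2
    rw [hgx, h2]
  have hq := norm_bdry_sub_pos hηξ
  change ¬ _ = _
  simp only [Set.indicator_of_mem (show horo ξ η _ ∈ {x : Hyp (m + 1) | g x = x} from hfix _),
    Pi.one_apply, mul_one]
  rw [lintegral_eq_zero_iff (by fun_prop)]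
  intro hcon
  have hfalse : ∀ᵐ s : ℝ, False := by
    filter_upwards [hcon] with s hs
    have : 0 < ENNReal.ofReal ((2 * Real.exp (-s) / ‖(η : Euc (m + 1)) - ξ‖ ^ 2) ^ m) :=
      ENNReal.ofReal_pos.2 (by positivity)
    exact this.ne' hs
  rw [ae_iff] at hfalse
  simp at hfalse

/-- The sphere meets a proper linear subspace in a negligible set. -/
theorem measure_sphere_submodule {V : Submodule ℝ (Euc (j + 1))} (hV : V ≠ ⊤) :
    (μHE[j] : Measure (Bdry (j + 1))) {e | (e : Euc (j + 1)) ∈ V} = 0 := by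
  by_cases hex : ∃ e : Bdry (j + 1), (e : Euc (j + 1)) ∈ V
  swap
  · have : {e : Bdry (j + 1) | (e : Euc (j + 1)) ∈ V} = ∅ :=
      Set.eq_empty_of_forall_notMem fun x hx => hex ⟨x, hx⟩
    rw [this, measure_empty]
  obtain ⟨e₀, he₀⟩ := hex
  have he₀0 : (e₀ : Euc (j + 1)) ≠ 0 := norm_pos_iff.1 (by rw [norm_bdry]; exact one_pos)
  rcases Nat.eq_zero_or_pos j with rfl | hj
  · exfalso
    apply hV
    refine Submodule.eq_top_of_finrank_eq ?_
    have h1 : Module.finrank ℝ V ≤ Module.finrank ℝ (Euc (0 + 1)) := Submodule.finrank_le V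
    have h2 : 0 < Module.finrank ℝ V :=
      Module.finrank_pos_iff_exists_ne_zero.2 ⟨⟨e₀, he₀⟩, fun h => he₀0 (congrArg Subtype.val h)⟩
    have h3 : Module.finrank ℝ (Euc (0 + 1)) = 1 := by simp
    omega
  · -- the reflection in `V`, as a hyperbolic isometry that fixes the centre and `e₀`
    let A : Euc (j + 1) →ₗᵢ[ℝ] Euc (j + 1) := V.reflection.toLinearIsometry
    have hAA : ∀ u, A (A u) = u := fun u => V.reflection_reflection u
    let g : Hyp (j + 1) ≃ᵢ Hyp (j + 1) :=
      ⟨⟨emb A, emb A, fun x => ext (hAA x.val), fun x => ext (hAA x.val)⟩, isometry_emb A⟩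
    have hgo : g origin = origin := ext (by
      change A (origin : Hyp (j + 1)).val = _
      rw [origin_val, map_zero])
    have hbd : ∀ η, bdryMap g η = mapBdry A η := fun η => by
      rw [bdryMap_eq (A := A) (fun u => by
        rw [hgo, origin_val, zero_mob]
        rfl), hgo]
      exact Subtype.ext (by rw [mobBdry_val, origin_val, zero_mob])
    have hfix : ∀ η : Bdry (j + 1), bdryMap g η = η ↔ (η : Euc (j + 1)) ∈ V := fun η => by
      rw [hbd, ← Submodule.reflection_eq_self_iff]
      exact ⟨fun h => congrArg Subtype.val h, fun h => Subtype.ext h⟩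
    have hg : g ≠ 1 := by
      intro h1
      apply hV
      refine Submodule.eq_top_iff'.2 fun u => ?_
      by_cases hu : u = 0
      · rw [hu]; exact V.zero_mem
      have h2 := (hfix ⟨‖u‖⁻¹ • u, by simp [norm_smul, hu]⟩).1 (by rw [h1, bdryMap_one])
      have h3 := V.smul_mem ‖u‖ h2
      rwa [smul_smul, mul_inv_cancel₀ (norm_ne_zero_iff.2 hu), one_smul] at h3
    have hξ : bdryMap g e₀ = e₀ := (hfix e₀).2 he₀
    have hp : ∀ x, poisson (g x) e₀ = poisson x e₀ := fun x => by
      have := poisson_smul g x e₀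
      rwa [hξ, hgo, poisson_origin, mul_one] at this
    have := measure_fixedPoints_bdry hj hg hξ hp
    simpa only [hfix] using this

/-! ### Stabilisers of horoballs and of totally geodesic submanifolds -/

theorem bdryMap_eq_of_image_hball {g : Hyp n ≃ᵢ Hyp n} {ξ : Bdry n} {t : ℝ}
    (h : g '' hball ξ t = hball ξ t) : bdryMap g ξ = ξ := by
  have h1 := bdryMap_mem_bdryAtInfinity g (mem_bdryAtInfinity_hball ξ t)
  rw [h] at h1
  exact eq_of_mem_bdryAtInfinity_hball h1

/-- An isometry that preserves a horoball multiplies the Poisson kernel of its centre by a constant,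
which is `1` because the boundary of the horoball is preserved. -/
theorem poisson_eq_of_image_hball {g : Hyp n ≃ᵢ Hyp n} {ξ : Bdry n} {t : ℝ}
    (h : g '' hball ξ t = hball ξ t) (x : Hyp n) : poisson (g x) ξ = poisson x ξ := by
  have hξ := bdryMap_eq_of_image_hball h
  have hp : ∀ y, poisson (g y) ξ = poisson y ξ * poisson (g origin) ξ := fun y => by
    have := poisson_smul g y ξ
    rwa [hξ] at this
  have hz := poisson_horo (neg_ne_self ξ) t
  have ht := Real.exp_pos t
  have h1 : g (horo ξ (-ξ) t) ∈ hball ξ t := by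
    rw [← h]
    exact ⟨_, hz.ge, rfl⟩
  have h1' : Real.exp t ≤ poisson (g (horo ξ (-ξ) t)) ξ := h1
  rw [hp, hz] at h1'
  obtain ⟨y, hy, hyz⟩ : horo ξ (-ξ) t ∈ g '' hball ξ t := by
    rw [h]
    exact hz.ge
  have hy' : Real.exp t ≤ poisson y ξ := hy
  have h2 := hp y
  rw [hyz, hz] at h2
  have hc := poisson_pos (g origin) ξ
  have : poisson (g origin) ξ = 1 := by
    refine le_antisymm ?_ ?_
    · by_contra hcon
      push Not at hcon
      nlinarith
    · by_contra hcon
      push Not at hcon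
      nlinarith
  rw [hp, this, mul_one]

/-- The stabiliser of a horoball acts on the horosphere with negligible fixed points. -/
theorem measure_fixedPoints_horosphere (hm : 1 ≤ m) {g : Hyp (m + 1) ≃ᵢ Hyp (m + 1)} (hg : g ≠ 1)
    {ξ : Bdry (m + 1)} {t : ℝ} (h : g '' hball ξ t = hball ξ t) :
    riemVol m (frontier (hball ξ t)) {x | g x = x} = 0 := by
  have hξ := bdryMap_eq_of_image_hball h
  have hnull := measure_fixedPoints_bdry hm hg hξ (poisson_eq_of_image_hball h)
  have hΩ : MeasurableSet {η : Bdry (m + 1) | η ≠ ξ} :=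
    (isOpen_ne_fun continuous_id continuous_const).measurableSet
  have hF : MeasurableSet {x : Hyp (m + 1) | g x = x} :=
    (isClosed_eq g.continuous continuous_id).measurableSet
  rw [frontier_hball, riemVol, ← map_horosphere_eq, Measure.map_apply (measurable_horo_mid ξ t) hF]
  refine withDensity_absolutelyContinuous _ _ ?_
  rw [Measure.restrict_apply' hΩ]
  refine measure_mono_null ?_ hnull
  rintro η ⟨h1, hη⟩
  have h1' : g (horo ξ η t) = horo ξ η t := h1
  have hη' : η ≠ ξ := hη
  have h2 := congrArg UnitTangent.minusEnd (smul_toward g (horo ξ η t) ξ)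
  rwa [UnitTangent.minusEnd_smul, h1', hξ, minusEnd_toward_horo hη'] at h2

theorem exists_isometry_of_image_emb {g h : Hyp n ≃ᵢ Hyp n} {L : Euc k →ₗᵢ[ℝ] Euc n}
    (hD : h '' (g '' Set.range (emb L)) = g '' Set.range (emb L)) :
    ∃ f : Hyp k → Hyp k, Isometry f ∧ ∀ y, h (g (emb L y)) = g (emb L (f y)) := by
  have h1 : ∀ y, ∃ z, h (g (emb L y)) = g (emb L z) := fun y => by
    have : h (g (emb L y)) ∈ g '' Set.range (emb L) := by
      rw [← hD]
      exact ⟨_, ⟨_, ⟨y, rfl⟩, rfl⟩, rfl⟩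
    obtain ⟨_, ⟨z, rfl⟩, hz⟩ := this
    exact ⟨z, hz.symm⟩
  choose f hf using h1
  refine ⟨f, Isometry.of_dist_eq fun x y => ?_, hf⟩
  rw [← (isometry_emb L).dist_eq, ← g.isometry.dist_eq, ← hf, ← hf, h.isometry.dist_eq,
    g.isometry.dist_eq, (isometry_emb L).dist_eq]

/-- An isometry that preserves a totally geodesic submanifold but does not fix it pointwise has a
negligible set of fixed points on it. -/
theorem measure_fixedPoints_emb {g h : Hyp n ≃ᵢ Hyp n} {L : Euc k →ₗᵢ[ℝ] Euc n}
    (hD : h '' (g '' Set.range (emb L)) = g '' Set.range (emb L))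
    (hne : ∃ y, h (g (emb L y)) ≠ g (emb L y)) :
    (μHE[k] : Measure (Hyp k)) {y | h (g (emb L y)) = g (emb L y)} = 0 := by
  obtain ⟨f, hf, hfh⟩ := exists_isometry_of_image_emb hD
  have hiff : ∀ y, h (g (emb L y)) = g (emb L y) ↔ f y = y := fun y => by
    rw [hfh, g.injective.eq_iff, (isometry_emb L).injective.eq_iff]
  simp only [hiff] at hne ⊢
  exact measure_fixedPoints hf (by simpa only [ne_eq, hiff] using hne)

/-- An isometry that fixes pointwise a totally geodesic submanifold fixes no generic normal vector,
since it acts linearly on the normal directions. -/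
theorem measure_fixed_normalVec {g h : Hyp n ≃ᵢ Hyp n} {L : Euc k →ₗᵢ[ℝ] Euc n}
    {L' : Euc (j + 1) →ₗᵢ[ℝ] Euc n} (hLL : ∀ u w, inner ℝ (L u) (L' w) = 0)
    (hsup : ∀ x, ∃ u w, x = L u + L' w) (hh : h ≠ 1)
    (hD : h '' (g '' Set.range (emb L)) = g '' Set.range (emb L)) :
    ((μHE[k] : Measure (Hyp k)).prod (μHE[j] : Measure (Bdry (j + 1))))
      {z | h • normalVec g L L' z = normalVec g L L' z} = 0 := by
  by_cases hfix : ∃ y, h (g (emb L y)) ≠ g (emb L y)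
  · have h0 := measure_fixedPoints_emb hD hfix
    refine measure_mono_null (t := {y | h (g (emb L y)) = g (emb L y)} ×ˢ Set.univ) ?_ ?_
    · intro z hz
      have := congrArg UnitTangent.base (show h • normalVec g L L' z = normalVec g L L' z from hz)
      rw [UnitTangent.base_smul, base_normalVec] at this
      exact ⟨this, trivial⟩
    · rw [Measure.prod_prod, h0, zero_mul]
  · push Not at hfix
    -- conjugate to an isometry that fixes the centre and is linear
    let h' : Hyp n ≃ᵢ Hyp n := g⁻¹ * h * g
    have hh' : ∀ y, h' (emb L y) = emb L y := fun y => by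
      change g.symm (h (g (emb L y))) = _
      rw [hfix, g.symm_apply_apply]
    have ho : h' origin = origin := by
      have h1 : emb L (origin : Hyp k) = origin := ext (by rw [emb_val, origin_val, map_zero]; rfl)
      have := hh' origin
      rwa [h1] at this
    obtain ⟨A, hA⟩ := exists_linearIsometry_of_map_origin h'.isometry ho
    have hbd : ∀ η, bdryMap h' η = mapBdry A η := fun η => by
      rw [bdryMap_eq (A := A) (fun u => by rw [ho, origin_val, zero_mob, hA]), ho]
      exact Subtype.ext (by rw [mobBdry_val, origin_val, zero_mob])
    have hAL : ∀ y : Hyp k, A (L y.val) = L y.val := fun y => by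
      have := hA (emb L y)
      rw [hh' y, emb_val] at this
      exact this.symm
    let V : Submodule ℝ (Euc (j + 1)) :=
      LinearMap.ker ((A.comp L').toLinearMap - L'.toLinearMap)
    have hV : ∀ w, w ∈ V ↔ A (L' w) = L' w := fun w => by
      rw [LinearMap.mem_ker, LinearMap.sub_apply, sub_eq_zero]
      rfl
    have hVne : V ≠ ⊤ := by
      intro hVt
      have hALu : ∀ u, A (L u) = L u := by
        intro u
        have hu : ‖(1 + ‖u‖)⁻¹ • u‖ < 1 := by
          rw [norm_smul, norm_inv, Real.norm_of_nonneg (by positivity), inv_mul_lt_one₀ (by positivity)]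
          linarith
        have h1 := hAL ⟨(1 + ‖u‖)⁻¹ • u, hu⟩
        simp only [map_smul] at h1
        have h2 : (1 + ‖u‖)⁻¹ ≠ 0 := by positivity
        exact smul_right_injective _ h2 h1
      have hA1 : ∀ x, A x = x := fun x => by
        obtain ⟨u, w, rfl⟩ := hsup x
        rw [map_add, hALu, (hV w).1 (by rw [hVt]; trivial)]
      have h1 : h' = 1 := IsometryEquiv.ext fun x => ext (by rw [hA, hA1]; rfl)
      apply hh
      have h2 : h = g * h' * g⁻¹ := by simp only [h']; group
      rw [h2, h1, mul_one, mul_inv_cancel]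
    have h0 := measure_sphere_submodule hVne
    refine measure_mono_null (t := Set.univ ×ˢ {e : Bdry (j + 1) | (e : Euc (j + 1)) ∈ V}) ?_ ?_
    · intro z hz
      have hz1 : h • normalVec g L L' z = normalVec g L L' z := hz
      have hz2 : h' • UnitTangent.ofDir (emb L z.1) (mapBdry L' z.2) =
          UnitTangent.ofDir (emb L z.1) (mapBdry L' z.2) := by
        change (g⁻¹ * h * g) • _ = _
        rw [mul_smul, mul_smul]
        exact inv_smul_eq_iff.2 hz1
      have hz3 := congrArg UnitTangent.plusEnd hz2
      rw [UnitTangent.plusEnd_smul, UnitTangent.plusEnd_ofDir, hbd] at hz3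
      have hz4 : A (normalEnd L L' z : Euc n) = normalEnd L L' z := congrArg Subtype.val hz3
      refine ⟨trivial, (hV _).2 ?_⟩
      have h3 : (1 + ‖z.1.val‖ ^ 2)⁻¹ ≠ 0 := by positivity
      rw [normalEnd_val hLL, map_smul, map_add, map_smul, map_smul, hAL] at hz4
      have h4 := add_left_cancel (smul_right_injective _ h3 hz4)
      exact smul_right_injective _ (one_sub_pos' z.1).ne' h4
    · rw [Measure.prod_prod, h0, mul_zero]

end Hyp

namespace Hyp

/-! ### Quotients by properly discontinuous actions -/

section Quotient

variable {G X : Type*} [Group G] [MulAction G X]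

variable (G) in
/-- The projection to the quotient. -/
def qmk (x : X) : MulAction.orbitRel.Quotient G X := Quotient.mk'' x

theorem qmk_eq_iff {x y : X} : qmk G x = qmk G y ↔ ∃ γ : G, γ • y = x :=
  Quotient.eq''

theorem qmk_smul (γ : G) (x : X) : qmk G (γ • x) = qmk G x := qmk_eq_iff.2 ⟨γ, rfl⟩

variable (G) in
/-- The order of the stabiliser of a point, as an extended real number. -/
def stabCard (x : X) : ℝ≥0∞ := (Nat.card (MulAction.stabilizer G x) : ℝ≥0∞)

variable (G X) in
/-- The function `h` is proper modulo the action: its sublevel sets contain finitely many points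
(counted with multiplicity) of each orbit. -/
def IsProperOn (h : X → ℝ) : Prop := ∀ (x : X) (c : ℝ), {γ : G | h (γ • x) ≤ c}.Finite

theorem IsProperOn.finite_stabilizer {h : X → ℝ} (hp : IsProperOn G X h) (x : X) :
    Finite (MulAction.stabilizer G x) := by
  refine ((hp x (h x)).subset fun γ hγ => ?_ : (MulAction.stabilizer G x : Set G).Finite).to_subtype
  have : γ • x = x := hγ
  change h (γ • x) ≤ h x
  rw [this]

theorem stabCard_ne_zero {h : X → ℝ} (hp : IsProperOn G X h) (x : X) : stabCard G x ≠ 0 := by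
  have := hp.finite_stabilizer x
  exact Nat.cast_ne_zero.2 Nat.card_pos.ne'

theorem stabCard_ne_top (x : X) : stabCard G x ≠ ∞ := ENNReal.natCast_ne_top _

/-- If `S` meets the orbit of `x` in one point, then the number of group elements that send `x` to
`S` is the order of the stabiliser. -/
theorem tsum_eq_stabCard {h : X → ℝ} (hp : IsProperOn G X h) (x : X) {S : Set X}
    (hS : ∃ γ₀ : G, ∀ γ : G, γ • x ∈ S ↔ γ • x = γ₀ • x) :
    ∑' γ : G, S.indicator (1 : X → ℝ≥0∞) (γ • x) = stabCard G x := by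
  obtain ⟨γ₀, hγ₀⟩ := hS
  have := hp.finite_stabilizer x
  let e : MulAction.stabilizer G x ≃ {γ : G | γ • x ∈ S} :=
    { toFun := fun γ => ⟨γ₀ * γ.1, (hγ₀ _).2 (by rw [mul_smul]; congr 1; exact γ.2)⟩
      invFun := fun γ => ⟨γ₀⁻¹ * γ.1, by
        have := (hγ₀ _).1 γ.2
        change (γ₀⁻¹ * γ.1) • x = x
        rw [mul_smul, this, inv_smul_smul]⟩
      left_inv := fun γ => Subtype.ext (inv_mul_cancel_left _ _)
      right_inv := fun γ => Subtype.ext (mul_inv_cancel_left _ _) }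
  have h1 : ∀ γ : G, S.indicator (1 : X → ℝ≥0∞) (γ • x) =
      {γ : G | γ • x ∈ S}.indicator (fun _ => (1 : ℝ≥0∞)) γ := fun γ => rfl
  simp only [h1]
  rw [← tsum_subtype, ENNReal.tsum_one, ← ENat.card_congr e, ENat.card_eq_coe_natCard]
  rfl

theorem stabCard_eq_tsum {h : X → ℝ} (hp : IsProperOn G X h) (x : X) :
    stabCard G x = ∑' γ : G, {y : X | γ • y = y}.indicator (1 : X → ℝ≥0∞) x := by
  rw [← tsum_eq_stabCard hp x (S := {x}) ⟨1, fun γ => by rw [one_smul]; rfl⟩]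
  rfl

theorem stabCard_smul {h : X → ℝ} (hp : IsProperOn G X h) (γ : G) (x : X) :
    stabCard G (γ • x) = stabCard G x := by
  rw [← tsum_eq_stabCard hp x (S := {γ • x}) ⟨γ, fun γ' => Iff.rfl⟩,
    ← tsum_eq_stabCard hp (γ • x) (S := {γ • x}) ⟨1, fun γ' => by rw [one_smul]; rfl⟩]
  have := (Equiv.mulRight γ).tsum_eq fun c : G => ({γ • x} : Set X).indicator (1 : X → ℝ≥0∞) (c • x)
  simp only [Equiv.coe_mulRight, mul_smul] at this
  exact this

variable [MeasurableSpace X]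

variable (G) in
/-- A weight: a function whose sum over each orbit (counted with multiplicity) is `1`. -/
structure IsWeight (w : X → ℝ≥0∞) : Prop where
  measurable : Measurable w
  tsum_eq : ∀ x, ∑' γ : G, w (γ • x) = 1

/-- A measurable set of representatives of the orbits. -/
structure IsTransversal (G : Type*) {X : Type*} [Group G] [MulAction G X] [MeasurableSpace X]
    (F : Set X) : Prop where
  measurableSet : MeasurableSet F
  exists_smul_mem : ∀ x, ∃ γ : G, γ • x ∈ F
  smul_eq : ∀ x ∈ F, ∀ γ : G, γ • x ∈ F → γ • x = x

variable [Countable G]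

/-- Each orbit has finitely many points that minimise `h`; a measurable embedding in the real line
selects one of these. -/
theorem exists_isTransversal [StandardBorelSpace X] (hG : ∀ γ : G, Measurable fun x : X => γ • x)
    {h : X → ℝ} (hp : IsProperOn G X h) (hh : Measurable h) : ∃ F : Set X, IsTransversal G F := by
  obtain ⟨ι, hι⟩ := exists_measurableEmbedding_real X
  refine ⟨{x | ∀ γ : G, h x < h (γ • x) ∨ (h x = h (γ • x) ∧ ι x ≤ ι (γ • x))}, ?_, ?_, ?_⟩
  · have : {x | ∀ γ : G, h x < h (γ • x) ∨ (h x = h (γ • x) ∧ ι x ≤ ι (γ • x))} =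
        ⋂ γ : G, ({x | h x < h (γ • x)} ∪ ({x | h x = h (γ • x)} ∩ {x | ι x ≤ ι (γ • x)})) := by
      ext x
      rw [Set.mem_iInter]
      rfl
    rw [this]
    exact MeasurableSet.iInter fun γ => (measurableSet_lt hh (hh.comp (hG γ))).union
      ((measurableSet_eq_fun hh (hh.comp (hG γ))).inter
        (measurableSet_le hι.measurable (hι.measurable.comp (hG γ))))
  · intro x
    obtain ⟨γ₀, hγ₀, hmin⟩ := (hp x (h x)).exists_minimalFor
      (fun γ : G => toLex (h (γ • x), ι (γ • x))) _ ⟨1, by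
        change h ((1 : G) • x) ≤ h x
        rw [one_smul]⟩
    have hγ₀' : h (γ₀ • x) ≤ h x := hγ₀
    refine ⟨γ₀, fun γ => ?_⟩
    rw [← mul_smul]
    by_cases hle : h ((γ * γ₀) • x) ≤ h x
    · have h1 := (le_total (toLex (h (γ₀ • x), ι (γ₀ • x)))
        (toLex (h ((γ * γ₀) • x), ι ((γ * γ₀) • x)))).elim id fun h2 => hmin hle h2
      exact Prod.Lex.toLex_le_toLex.1 h1
    · exact Or.inl (by linarith)
  · intro x hx γ hγ
    have h1 := hx γ
    have h2 := hγ γ⁻¹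
    rw [inv_smul_smul] at h2
    rcases h1 with h1 | ⟨h1, h1'⟩
    · rcases h2 with h2 | ⟨h2, -⟩ <;> linarith
    · rcases h2 with h2 | ⟨-, h2'⟩
      · linarith
      · exact hι.injective (le_antisymm h2' h1')

/-- Double counting: unfolding the sum over the group by the invariance of the measure. -/
theorem lintegral_mul_tsum_smul (hG : ∀ γ : G, Measurable fun x : X => γ • x) {m' : Measure X}
    (hm : ∀ γ : G, m'.map (fun x => γ • x) = m') {w₁ w₂ f : X → ℝ≥0∞} (h₁ : Measurable w₁)
    (h₂ : Measurable w₂) (hf : Measurable f) (hinv : ∀ (γ : G) x, f (γ • x) = f x) :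
    ∫⁻ x, f x * w₁ x * ∑' γ : G, w₂ (γ • x) ∂m' = ∫⁻ x, f x * w₂ x * ∑' γ : G, w₁ (γ • x) ∂m' := by
  have e₁ : ∀ γ : G, Measurable fun x => f x * w₁ x * w₂ (γ • x) := fun γ =>
    (hf.mul h₁).mul (h₂.comp (hG γ))
  have e₂ : ∀ γ : G, Measurable fun x => f x * w₂ x * w₁ (γ • x) := fun γ =>
    (hf.mul h₂).mul (h₁.comp (hG γ))
  simp only [← ENNReal.tsum_mul_left]
  rw [lintegral_tsum fun γ => (e₁ γ).aemeasurable, lintegral_tsum fun γ => (e₂ γ).aemeasurable,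
    ← (Equiv.inv G).tsum_eq]
  congr 1
  funext γ
  change ∫⁻ x, f x * w₁ x * w₂ (γ⁻¹ • x) ∂m' = _
  conv_lhs => rw [← hm γ]
  rw [lintegral_map (e₁ γ⁻¹) (hG γ)]
  simp only [inv_smul_smul, hinv]
  refine lintegral_congr fun x => ?_
  ring

/-- The integral of an invariant function against a weight does not depend on the weight. -/
theorem lintegral_isWeight (hG : ∀ γ : G, Measurable fun x : X => γ • x) {m' : Measure X}
    (hm : ∀ γ : G, m'.map (fun x => γ • x) = m') {w₁ w₂ f : X → ℝ≥0∞} (h₁ : IsWeight G w₁)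
    (h₂ : IsWeight G w₂) (hf : Measurable f) (hinv : ∀ (γ : G) x, f (γ • x) = f x) :
    ∫⁻ x, f x * w₁ x ∂m' = ∫⁻ x, f x * w₂ x ∂m' := by
  have := lintegral_mul_tsum_smul hG hm h₁.measurable h₂.measurable hf hinv
  simpa only [h₁.tsum_eq, h₂.tsum_eq, mul_one] using this

theorem measurable_stabCard {h : X → ℝ} (hp : IsProperOn G X h)
    (hfix : ∀ γ : G, MeasurableSet {x : X | γ • x = x}) : Measurable fun x : X => stabCard G x := by
  simp only [stabCard_eq_tsum hp]
  exact Measurable.tsum fun γ => measurable_one.indicator (hfix γ)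

omit [Countable G] [MeasurableSpace X] in
theorem tsum_indicator_injOn {h : X → ℝ} (hp : IsProperOn G X h) {A : Set X}
    (hA : Set.InjOn (qmk G) A) {x : X} (hx : qmk G x ∈ qmk G '' A) :
    ∑' γ : G, A.indicator (1 : X → ℝ≥0∞) (γ • x) = stabCard G x := by
  obtain ⟨a, ha, hax⟩ := hx
  obtain ⟨γ₀, rfl⟩ := qmk_eq_iff.1 hax
  refine tsum_eq_stabCard hp x ⟨γ₀, fun γ => ⟨fun h1 => hA h1 ha ?_, fun h1 => by rwa [h1]⟩⟩
  rw [qmk_smul, qmk_smul]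

omit [Countable G] in
theorem IsTransversal.injOn {F : Set X} (hF : IsTransversal G F) : Set.InjOn (qmk G) F := by
  intro x hx y hy hxy
  obtain ⟨γ, rfl⟩ := qmk_eq_iff.1 hxy
  exact hF.smul_eq y hy γ hx

theorem IsTransversal.isWeight {F : Set X} (hF : IsTransversal G F) {h : X → ℝ}
    (hp : IsProperOn G X h) (hfix : ∀ γ : G, MeasurableSet {x : X | γ • x = x}) :
    IsWeight G fun x => F.indicator (1 : X → ℝ≥0∞) x * (stabCard G x)⁻¹ := by
  refine ⟨(measurable_one.indicator hF.measurableSet).mul (measurable_stabCard hp hfix).inv,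
    fun x => ?_⟩
  simp only [stabCard_smul hp]
  rw [ENNReal.tsum_mul_right, tsum_indicator_injOn hp hF.injOn, ENNReal.mul_inv_cancel
    (stabCard_ne_zero hp x) (stabCard_ne_top x)]
  obtain ⟨γ, hγ⟩ := hF.exists_smul_mem x
  exact ⟨_, hγ, qmk_smul γ x⟩

/-- Two sets that inject to the quotient with the same image have the same measure, also for
an invariant density. -/
theorem setLIntegral_eq_of_injOn (hG : ∀ γ : G, Measurable fun x : X => γ • x) {m' : Measure X}
    (hm : ∀ γ : G, m'.map (fun x => γ • x) = m') {h : X → ℝ} (hp : IsProperOn G X h)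
    (hfix : ∀ γ : G, MeasurableSet {x : X | γ • x = x}) {A B : Set X} (hA : MeasurableSet A)
    (hB : MeasurableSet B) (hAi : Set.InjOn (qmk G) A) (hBi : Set.InjOn (qmk G) B)
    (hAB : qmk G '' A = qmk G '' B) {f : X → ℝ≥0∞} (hf : Measurable f)
    (hinv : ∀ (γ : G) x, f (γ • x) = f x) : ∫⁻ x in A, f x ∂m' = ∫⁻ x in B, f x ∂m' := by
  have key := lintegral_mul_tsum_smul hG hm (measurable_one.indicator hA)
    (measurable_one.indicator hB) (f := fun x => f x * (stabCard G x)⁻¹)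
    (hf.mul (measurable_stabCard hp hfix).inv)
    (fun γ x => by rw [hinv, stabCard_smul hp])
  have hgen : ∀ {A B : Set X}, MeasurableSet A → Set.InjOn (qmk G) B →
      qmk G '' A = qmk G '' B → ∫⁻ x, f x * (stabCard G x)⁻¹ *
        A.indicator (1 : X → ℝ≥0∞) x * ∑' γ : G, B.indicator (1 : X → ℝ≥0∞) (γ • x) ∂m' =
        ∫⁻ x in A, f x ∂m' := by
    intro A B hA hBi hAB
    rw [← lintegral_indicator hA]
    refine lintegral_congr fun x => ?_
    by_cases hx : x ∈ A
    · rw [tsum_indicator_injOn hp hBi (by rw [← hAB]; exact ⟨x, hx, rfl⟩), Set.indicator_of_mem hx,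
        Set.indicator_of_mem hx, Pi.one_apply, mul_one, mul_assoc,
        ENNReal.inv_mul_cancel (stabCard_ne_zero hp x) (stabCard_ne_top x), mul_one]
    · rw [Set.indicator_of_notMem hx, Set.indicator_of_notMem hx, mul_zero, zero_mul]
  rw [← hgen hA hBi hAB, key, hgen hB hAi hAB.symm]

omit [Countable G] in
theorem measurable_qmk : Measurable (qmk G : X → MulAction.orbitRel.Quotient G X) :=
  measurable_quotient_mk''

theorem measurableSet_image_qmk (hG : ∀ γ : G, Measurable fun x : X => γ • x) {A : Set X}
    (hA : MeasurableSet A) : MeasurableSet (qmk G '' A) := by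
  rw [measurableSet_quotient]
  have : (Quotient.mk'' : X → MulAction.orbitRel.Quotient G X) ⁻¹' (qmk G '' A) =
      ⋃ γ : G, (fun x => γ • x) ⁻¹' A := by
    ext x
    rw [Set.mem_iUnion]
    constructor
    · rintro ⟨a, ha, hax⟩
      obtain ⟨γ, rfl⟩ := qmk_eq_iff.1 hax
      exact ⟨γ, ha⟩
    · rintro ⟨γ, hγ⟩
      exact ⟨_, hγ, qmk_smul γ x⟩
  rw [this]
  exact MeasurableSet.iUnion fun γ => hG γ hA

omit [Countable G] in
theorem IsTransversal.image_inter_preimage {F : Set X} (hF : IsTransversal G F)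
    (B : Set (MulAction.orbitRel.Quotient G X)) : qmk G '' (F ∩ qmk G ⁻¹' B) = B := by
  ext b
  constructor
  · rintro ⟨x, ⟨-, hx⟩, rfl⟩
    exact hx
  · intro hb
    induction b using Quotient.inductionOn' with
    | h x =>
      obtain ⟨γ, hγ⟩ := hF.exists_smul_mem x
      exact ⟨γ • x, ⟨hγ, by rw [Set.mem_preimage, qmk_smul]; exact hb⟩, qmk_smul γ x⟩

/-- A measure on the quotient is determined by an invariant density `f` on sets that inject; it exists
and is the image of the restriction to a transversal. -/
theorem eq_map_restrict_of_transversal (hG : ∀ γ : G, Measurable fun x : X => γ • x)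
    {m' : Measure X} (hm : ∀ γ : G, m'.map (fun x => γ • x) = m') {h : X → ℝ}
    (hp : IsProperOn G X h) (hfix : ∀ γ : G, MeasurableSet {x : X | γ • x = x}) {F : Set X}
    (hF : IsTransversal G F) {f : X → ℝ≥0∞} (hf : Measurable f)
    (hinv : ∀ (γ : G) x, f (γ • x) = f x) (m : Measure (MulAction.orbitRel.Quotient G X)) :
    (∀ A : Set X, MeasurableSet A → Set.InjOn (qmk G) A →
      m (qmk G '' A) = ∫⁻ x in A, f x ∂m') ↔ m = ((m'.withDensity f).restrict F).map (qmk G) := by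
  constructor
  · intro hA
    ext B hB
    have hpre := measurable_qmk (G := G) (X := X) hB
    rw [Measure.map_apply measurable_qmk hB, Measure.restrict_apply hpre, Set.inter_comm,
      withDensity_apply _ (hF.measurableSet.inter hpre),
      ← hA _ (hF.measurableSet.inter hpre) (hF.injOn.mono Set.inter_subset_left),
      hF.image_inter_preimage]
  · rintro rfl A hA hAi
    have hB := measurableSet_image_qmk hG hA
    have hpre := measurable_qmk (G := G) (X := X) hB
    rw [Measure.map_apply measurable_qmk hB, Measure.restrict_apply hpre, Set.inter_comm,
      withDensity_apply _ (hF.measurableSet.inter hpre)]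
    exact setLIntegral_eq_of_injOn hG hm hp hfix (hF.measurableSet.inter hpre) hA
      (hF.injOn.mono Set.inter_subset_left) hAi (hF.image_inter_preimage _) hf hinv

section

variable (hG : ∀ γ : G, Measurable fun x : X => γ • x) {m' : Measure X}
  (hm : ∀ γ : G, m'.map (fun x => γ • x) = m') {h : X → ℝ} (hp : IsProperOn G X h)
  (hfix : ∀ γ : G, MeasurableSet {x : X | γ • x = x}) {F : Set X} (hF : IsTransversal G F)

include hG hm hp hfix hF

/-- The induced measure is chosen among the measures with the defining property, of which there is
exactly one. -/
theorem inducedMeasure_eq : inducedMeasure G m' =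
    ((m'.withDensity fun x => (stabCard G x)⁻¹).restrict F).map (qmk G) := by
  have key := eq_map_restrict_of_transversal hG hm hp hfix hF (measurable_stabCard hp hfix).inv
    (fun γ x => by rw [Pi.inv_apply, Pi.inv_apply, stabCard_smul hp])
  have hspec : IsInducedMeasure m' (inducedMeasure G m') :=
    Classical.epsilon_spec (p := fun m => IsInducedMeasure (G := G) m' m) ⟨_, (key _).2 rfl⟩
  exact (key _).1 hspec

/-- As for the induced measure, the defining property has exactly one solution. -/
theorem quotientMeasure_eq : quotientMeasure G m' = (m'.restrict F).map (qmk G) := by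
  have key := eq_map_restrict_of_transversal hG hm hp hfix hF (f := 1) measurable_one
    (fun γ x => rfl)
  have hiff : ∀ m, IsQuotientMeasure (G := G) m' m ↔
      ∀ A : Set X, MeasurableSet A → Set.InjOn (qmk G) A →
        m (qmk G '' A) = ∫⁻ x in A, (1 : X → ℝ≥0∞) x ∂m' := fun m => by
    simp only [Pi.one_apply, setLIntegral_one]
    rfl
  have hspec : IsQuotientMeasure m' (quotientMeasure G m') :=
    Classical.epsilon_spec (p := fun m => IsQuotientMeasure (G := G) m' m)
      ⟨_, (hiff _).2 ((key _).2 rfl)⟩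
  have := (key _).1 ((hiff _).1 hspec)
  rwa [withDensity_one] at this

/-- The mass of the induced measure: the weight from a transversal carries the inverses of the
orders of the stabilisers, as the induced measure does. -/
theorem inducedMeasure_univ {w : X → ℝ≥0∞} (hw : IsWeight G w) :
    inducedMeasure G m' Set.univ = ∫⁻ x, w x ∂m' := by
  have h1 := lintegral_isWeight hG hm (hF.isWeight hp hfix) hw measurable_one (fun γ x => rfl)
  simp only [Pi.one_apply, one_mul] at h1
  rw [inducedMeasure_eq hG hm hp hfix hF, Measure.map_apply measurable_qmk MeasurableSet.univ,
    Set.preimage_univ, Measure.restrict_apply_univ, withDensity_apply _ hF.measurableSet,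
    ← lintegral_indicator hF.measurableSet, ← h1]
  refine lintegral_congr fun x => ?_
  by_cases hx : x ∈ F
  · rw [Set.indicator_of_mem hx, Set.indicator_of_mem hx, Pi.one_apply, one_mul]
  · rw [Set.indicator_of_notMem hx, Set.indicator_of_notMem hx, zero_mul]

theorem quotientMeasure_apply {w : X → ℝ≥0∞} (hw : IsWeight G w)
    {B : Set (MulAction.orbitRel.Quotient G X)} (hB : MeasurableSet B) :
    quotientMeasure G m' B = ∫⁻ x in qmk G ⁻¹' B, stabCard G x * w x ∂m' := by
  have hpre := measurable_qmk (G := G) (X := X) hB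
  have h1 := lintegral_isWeight hG hm (hF.isWeight hp hfix) hw
    (f := fun x => stabCard G x * (qmk G ⁻¹' B).indicator 1 x)
    ((measurable_stabCard hp hfix).mul (measurable_one.indicator hpre))
    (fun γ x => by
      have h2 : γ • x ∈ qmk G ⁻¹' B ↔ x ∈ qmk G ⁻¹' B := by
        rw [Set.mem_preimage, qmk_smul, Set.mem_preimage]
      rw [stabCard_smul hp]
      congr 1
      by_cases hx : x ∈ qmk G ⁻¹' B
      · rw [Set.indicator_of_mem hx, Set.indicator_of_mem (h2.2 hx)]
        rfl
      · rw [Set.indicator_of_notMem hx, Set.indicator_of_notMem fun h => hx (h2.1 h)])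
  rw [quotientMeasure_eq hG hm hp hfix hF, Measure.map_apply measurable_qmk hB,
    Measure.restrict_apply hpre, ← lintegral_indicator_one (hpre.inter hF.measurableSet),
    ← lintegral_indicator hpre]
  refine Eq.trans (lintegral_congr fun x => ?_) (h1.trans (lintegral_congr fun x => ?_))
  · by_cases hx : x ∈ qmk G ⁻¹' B
    · by_cases hxF : x ∈ F
      · rw [Set.indicator_of_mem (show x ∈ qmk G ⁻¹' B ∩ F from ⟨hx, hxF⟩), Set.indicator_of_mem hx, Set.indicator_of_mem hxF,
          Pi.one_apply, mul_one, one_mul,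
          ENNReal.mul_inv_cancel (stabCard_ne_zero hp x) (stabCard_ne_top x)]
      · rw [Set.indicator_of_notMem (fun h => hxF h.2), Set.indicator_of_notMem hxF, zero_mul,
          mul_zero]
    · rw [Set.indicator_of_notMem (fun h => hx h.1), Set.indicator_of_notMem hx, mul_zero, zero_mul]
  · by_cases hx : x ∈ qmk G ⁻¹' B
    · rw [Set.indicator_of_mem hx, Set.indicator_of_mem hx, Pi.one_apply, mul_one]
    · rw [Set.indicator_of_notMem hx, Set.indicator_of_notMem hx, mul_zero, zero_mul]

theorem quotientVol_eq {w : X → ℝ≥0∞} (hw : IsWeight G w) :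
    quotientVol G m' = ∫⁻ x, stabCard G x * w x ∂m' := by
  rw [quotientVol, quotientMeasure_apply hG hm hp hfix hF hw MeasurableSet.univ, Set.preimage_univ,
    setLIntegral_univ]

end

omit [MeasurableSpace X] [Countable G] in
theorem stabCard_eq_one {x : X} (h : ∀ γ : G, γ ≠ 1 → γ • x ≠ x) : stabCard G x = 1 := by
  have : MulAction.stabilizer G x = ⊥ := by
    refine (Subgroup.eq_bot_iff_forall _).2 fun γ hγ => ?_
    by_contra hne
    exact h γ hne hγ
  rw [stabCard, this]
  simp

theorem ae_stabCard_eq_one {m' : Measure X}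
    (h0 : ∀ γ : G, γ ≠ 1 → m' {x : X | γ • x = x} = 0) : ∀ᵐ x ∂m', stabCard G x = 1 := by
  have h1 : ∀ᵐ x ∂m', ∀ γ : G, γ ≠ 1 → γ • x ≠ x := by
    rw [ae_all_iff]
    intro γ
    by_cases hγ : γ = 1
    · exact Eventually.of_forall fun x h => absurd hγ h
    · have : ∀ᵐ x ∂m', ¬ γ • x = x := by
        rw [ae_iff]
        simpa only [not_not] using h0 γ hγ
      filter_upwards [this] with x hx _ using hx
  filter_upwards [h1] with x hx using stabCard_eq_one hx

omit [Countable G] in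
/-- Weights pull back along equivariant maps. -/
theorem IsWeight.comp {Y : Type*} [MulAction G Y] [MeasurableSpace Y] {w : Y → ℝ≥0∞}
    (hw : IsWeight G w) {q : X → Y} (hq : Measurable q) (hq' : ∀ (γ : G) x, q (γ • x) = γ • q x) :
    IsWeight G fun x => w (q x) :=
  ⟨hw.measurable.comp hq, fun x => by simp only [hq', hw.tsum_eq]⟩

/-! ### Families of measures indexed by an orbit -/

section Family

variable {Z : Type*} [MulAction G Z] {D : Z} {σ : Z → Measure X}

omit [Countable G] in
theorem map_sum_orbit (hG : ∀ γ : G, Measurable fun x : X => γ • x)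
    (hσ : ∀ (γ : G), ∀ D' ∈ MulAction.orbit G D, σ (γ • D') = (σ D').map fun x => γ • x) (γ : G) :
    (Measure.sum fun D' : MulAction.orbit G D => σ D'.1).map (fun x => γ • x) =
      Measure.sum fun D' : MulAction.orbit G D => σ D'.1 := by
  ext A hA
  rw [Measure.map_apply (hG γ) hA, Measure.sum_apply _ (hG γ hA), Measure.sum_apply _ hA,
    ← (MulAction.toPerm γ : Equiv.Perm (MulAction.orbit G D)).tsum_eq fun D' => σ D'.1 A]
  congr 1
  funext D'
  change _ = σ (((MulAction.toPerm γ : Equiv.Perm (MulAction.orbit G D)) D').1) A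
  change _ = σ (γ • D'.1) A
  rw [hσ γ _ D'.2, Measure.map_apply (hG γ) hA]

/-- The mass in the quotient of the sum of the measures of an orbit is computed on one of these by
means of a weight for the stabiliser. -/
theorem lintegral_sum_orbit (hG : ∀ γ : G, Measurable fun x : X => γ • x)
    (hσ : ∀ (γ : G), ∀ D' ∈ MulAction.orbit G D, σ (γ • D') = (σ D').map fun x => γ • x)
    {w w' : X → ℝ≥0∞} (hw : IsWeight G w) (hw' : IsWeight (MulAction.stabilizer G D) w') :
    ∫⁻ x, w x ∂(Measure.sum fun D' : MulAction.orbit G D => σ D'.1) = ∫⁻ x, w' x ∂σ D := by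
  have hmeas : ∀ γ : G, Measurable fun x => w' x * w (γ • x) := fun γ =>
    hw'.measurable.mul (hw.measurable.comp (hG γ))
  have hmeas' : ∀ γ : G, Measurable fun x => w' (γ⁻¹ • x) * w x := fun γ =>
    (hw'.measurable.comp (hG γ⁻¹)).mul hw.measurable
  -- insert the sum of `w` over the orbit, equal to `1`, and transport each term to the measure `σ
  -- (γ • D)`
  have h1 : ∫⁻ x, w' x ∂σ D = ∑' γ : G, ∫⁻ x, w' (γ⁻¹ • x) * w x ∂σ (γ • D) := by
    calc ∫⁻ x, w' x ∂σ D = ∫⁻ x, ∑' γ : G, w' x * w (γ • x) ∂σ D := by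
          refine lintegral_congr fun x => ?_
          rw [ENNReal.tsum_mul_left, hw.tsum_eq, mul_one]
      _ = ∑' γ : G, ∫⁻ x, w' x * w (γ • x) ∂σ D := lintegral_tsum fun γ => (hmeas γ).aemeasurable
      _ = _ := by
          congr 1
          funext γ
          rw [hσ γ D (MulAction.mem_orbit_self D), lintegral_map (hmeas' γ) (hG γ)]
          simp only [inv_smul_smul]
  let φ : G → MulAction.orbit G D := fun γ => ⟨γ • D, MulAction.mem_orbit D γ⟩
  rw [h1, lintegral_sum_measure, ← (Equiv.sigmaFiberEquiv φ).tsum_eq, ENNReal.tsum_sigma']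
  congr 1
  funext D'
  obtain ⟨_, γ₀, rfl⟩ := D'
  have hfib : ∀ γ : {γ : G // φ γ = ⟨γ₀ • D, MulAction.mem_orbit D γ₀⟩}, γ.1 • D = γ₀ • D :=
    fun γ => congrArg Subtype.val γ.2
  -- the elements that send `D` to `γ₀ • D` are a coset of the stabiliser, over which `w'` sums to
  -- `1`
  let e : MulAction.stabilizer G D ≃ {γ : G // φ γ = ⟨γ₀ • D, MulAction.mem_orbit D γ₀⟩} :=
    { toFun := fun α => ⟨γ₀ * α.1⁻¹, Subtype.ext (by
        change (γ₀ * α.1⁻¹) • D = γ₀ • D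
        rw [mul_smul, inv_smul_eq_iff.2 (show D = α.1 • D from α.2.symm)])⟩
      invFun := fun γ => ⟨γ.1⁻¹ * γ₀, by
        change (γ.1⁻¹ * γ₀) • D = D
        rw [mul_smul]
        exact inv_smul_eq_iff.2 (hfib γ).symm⟩
      left_inv := fun α => Subtype.ext (by simp)
      right_inv := fun γ => Subtype.ext (by simp) }
  calc ∫⁻ x, w x ∂σ (γ₀ • D)
      = ∫⁻ x, ∑' α : MulAction.stabilizer G D, w' ((γ₀ * α.1⁻¹)⁻¹ • x) * w x ∂σ (γ₀ • D) := by
        refine lintegral_congr fun x => ?_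
        rw [ENNReal.tsum_mul_right]
        have h2 : ∀ α : MulAction.stabilizer G D, w' ((γ₀ * α.1⁻¹)⁻¹ • x) = w' (α • γ₀⁻¹ • x) :=
          fun α => by
            congr 1
            rw [mul_inv_rev, inv_inv, mul_smul]
            rfl
        simp only [h2, hw'.tsum_eq, one_mul]
    _ = ∑' α : MulAction.stabilizer G D, ∫⁻ x, w' ((γ₀ * α.1⁻¹)⁻¹ • x) * w x ∂σ (γ₀ • D) :=
        lintegral_tsum fun α => (hmeas' _).aemeasurable
    _ = _ := by
        rw [← e.tsum_eq]
        congr 1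
        funext α
        change _ = ∫⁻ x, w' ((γ₀ * α.1⁻¹)⁻¹ • x) * w x ∂σ ((γ₀ * α.1⁻¹) • D)
        rw [show (γ₀ * (α.1)⁻¹) • D = γ₀ • D from hfib (e α)]

end Family

end Quotient

end Hyp

namespace Hyp

variable {n k j m : ℕ}

/-! ### Proper actions -/

/-- A measurable action of a countable group for which some measurable function is proper modulo the
action. -/
structure IsProperAction (G X : Type*) [Group G] [MulAction G X] [MeasurableSpace X] : Prop where
  countable : Countable G
  measurable_smul : ∀ γ : G, Measurable fun x : X => γ • x
  measurableSet_fixed : ∀ γ : G, MeasurableSet {x : X | γ • x = x}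
  exists_isProperOn : ∃ h : X → ℝ, Measurable h ∧ IsProperOn G X h

section

variable {G X : Type*} [Group G] [MulAction G X] [MeasurableSpace X] [StandardBorelSpace X]

theorem IsProperAction.exists_isWeight (ha : IsProperAction G X) :
    ∃ w : X → ℝ≥0∞, IsWeight G w := by
  have := ha.countable
  obtain ⟨h, hh, hp⟩ := ha.exists_isProperOn
  obtain ⟨F, hF⟩ := exists_isTransversal ha.measurable_smul hp hh
  exact ⟨_, hF.isWeight hp ha.measurableSet_fixed⟩

section

variable (ha : IsProperAction G X) {m' : Measure X} (hm : ∀ γ : G, m'.map (fun x => γ • x) = m')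

include ha hm

theorem IsProperAction.inducedMeasure_univ {w : X → ℝ≥0∞} (hw : IsWeight G w) :
    inducedMeasure G m' Set.univ = ∫⁻ x, w x ∂m' := by
  have := ha.countable
  obtain ⟨h, hh, hp⟩ := ha.exists_isProperOn
  obtain ⟨F, hF⟩ := exists_isTransversal ha.measurable_smul hp hh
  exact Hyp.inducedMeasure_univ ha.measurable_smul hm hp ha.measurableSet_fixed hF hw

theorem IsProperAction.quotientMeasure_apply {w : X → ℝ≥0∞} (hw : IsWeight G w)
    (h0 : ∀ γ : G, γ ≠ 1 → m' {x : X | γ • x = x} = 0)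
    {B : Set (MulAction.orbitRel.Quotient G X)} (hB : MeasurableSet B) :
    quotientMeasure G m' B = ∫⁻ x in qmk G ⁻¹' B, w x ∂m' := by
  have := ha.countable
  obtain ⟨h, hh, hp⟩ := ha.exists_isProperOn
  obtain ⟨F, hF⟩ := exists_isTransversal ha.measurable_smul hp hh
  rw [Hyp.quotientMeasure_apply ha.measurable_smul hm hp ha.measurableSet_fixed hF hw hB]
  refine lintegral_congr_ae (ae_restrict_of_ae ?_)
  filter_upwards [ae_stabCard_eq_one h0] with x hx
  rw [hx, one_mul]

theorem IsProperAction.quotientVol_eq {w : X → ℝ≥0∞} (hw : IsWeight G w) {N : ℕ}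
    (hN : ∀ᵐ x ∂m', stabCard G x = N) : quotientVol G m' = N * ∫⁻ x, w x ∂m' := by
  have := ha.countable
  obtain ⟨h, hh, hp⟩ := ha.exists_isProperOn
  obtain ⟨F, hF⟩ := exists_isTransversal ha.measurable_smul hp hh
  rw [Hyp.quotientVol_eq ha.measurable_smul hm hp ha.measurableSet_fixed hF hw,
    ← lintegral_const_mul _ hw.measurable]
  refine lintegral_congr_ae ?_
  filter_upwards [hN] with x hx
  rw [hx]

theorem IsProperAction.quotientVol_eq_of_free {w : X → ℝ≥0∞} (hw : IsWeight G w)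
    (h0 : ∀ γ : G, γ ≠ 1 → m' {x : X | γ • x = x} = 0) : quotientVol G m' = ∫⁻ x, w x ∂m' := by
  have := ha.countable
  have h1 : ∀ᵐ x ∂m', stabCard G x = (1 : ℕ) := by
    simpa only [Nat.cast_one] using ae_stabCard_eq_one h0
  rw [ha.quotientVol_eq hm hw h1, Nat.cast_one, one_mul]

/-- When almost all stabilisers are trivial, the weights in the induced measure play no role. -/
theorem IsProperAction.inducedMeasure_smul_eq (c : ℝ≥0∞)
    (h0 : ∀ γ : G, γ ≠ 1 → m' {x : X | γ • x = x} = 0) :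
    inducedMeasure G (c • m') = c • quotientMeasure G m' := by
  have := ha.countable
  obtain ⟨h, hh, hp⟩ := ha.exists_isProperOn
  obtain ⟨F, hF⟩ := exists_isTransversal ha.measurable_smul hp hh
  have hc : ∀ γ : G, (c • m').map (fun x => γ • x) = c • m' := fun γ => by
    rw [Measure.map_smul, hm]
  have h1 : ((c • m').withDensity fun x => (stabCard G x)⁻¹) = c • m' := by
    have : (fun x => (stabCard G x)⁻¹) =ᵐ[c • m'] 1 := by
      refine Measure.ae_smul_measure ?_ c
      filter_upwards [ae_stabCard_eq_one h0] with x hx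
      rw [hx, inv_one, Pi.one_apply]
    rw [withDensity_congr_ae this, withDensity_one]
  rw [inducedMeasure_eq ha.measurable_smul hc hp ha.measurableSet_fixed hF,
    quotientMeasure_eq ha.measurable_smul hm hp ha.measurableSet_fixed hF, h1,
    Measure.restrict_smul, Measure.map_smul]

end

omit [StandardBorelSpace X] in
theorem IsProperAction.subgroup (ha : IsProperAction G X) (H : Subgroup G) :
    IsProperAction H X := by
  have := ha.countable
  obtain ⟨h, hh, hp⟩ := ha.exists_isProperOn
  refine ⟨inferInstance, fun γ => ha.measurable_smul γ.1, fun γ => ha.measurableSet_fixed γ.1,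
    h, hh, fun x c => ?_⟩
  exact (hp x c).preimage (f := ((↑) : H → G)) Subtype.val_injective.injOn

end

/-! ### Discrete groups of isometries -/

section

variable {Γ : Subgroup (Hyp n ≃ᵢ Hyp n)}

theorem smul_eq_apply (γ : Γ) (x : Hyp n) : γ • x = (γ : Hyp n ≃ᵢ Hyp n) x := rfl

/-- In the topology of pointwise convergence, the identity is isolated: a basic neighbourhood
constrains finitely many points. -/
theorem IsDiscreteGroup.exists_separated (hΓ : IsDiscreteGroup Γ) :
    ∃ (I : Finset (Hyp n)) (ε : ℝ), 0 < ε ∧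
      ∀ γ : Γ, (∀ x ∈ I, dist (γ • x) x < ε) → γ = 1 := by
  let _ : TopologicalSpace Γ := TopologicalSpace.induced
    (fun g x => (g : Hyp n ≃ᵢ Hyp n) x) (inferInstance : TopologicalSpace (Hyp n → Hyp n))
  have : DiscreteTopology Γ := hΓ
  obtain ⟨U, hU, hU1⟩ := isOpen_induced_iff.1 (isOpen_discrete ({1} : Set Γ))
  have h1 : (fun x : Hyp n => x) ∈ U := by
    have : (1 : Γ) ∈ (fun (g : Γ) (x : Hyp n) => (g : Hyp n ≃ᵢ Hyp n) x) ⁻¹' U := by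
      rw [hU1]; rfl
    exact this
  obtain ⟨I, u, hu, hIu⟩ := isOpen_pi_iff.1 hU _ h1
  have h2 : ∀ x ∈ I, ∀ᶠ ε in 𝓝[>] (0 : ℝ), Metric.ball x ε ⊆ u x := fun x hx => by
    obtain ⟨ε, hε, hb⟩ := Metric.isOpen_iff.1 (hu x hx).1 x (hu x hx).2
    filter_upwards [Ioo_mem_nhdsGT hε] with δ hδ
    exact (Metric.ball_subset_ball hδ.2.le).trans hb
  have h3 : ∀ᶠ ε in 𝓝[>] (0 : ℝ), 0 < ε := eventually_mem_nhdsWithin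
  obtain ⟨ε, hε, hε0⟩ := (((eventually_all_finset I).2 h2).and h3).exists
  refine ⟨I, ε, hε0, fun γ hγ => ?_⟩
  have : γ ∈ (fun (g : Γ) (x : Hyp n) => (g : Hyp n ≃ᵢ Hyp n) x) ⁻¹' U :=
    hIu fun x hx => hε x hx (hγ x hx)
  rwa [hU1] at this

/-- By pigeonhole in a product of compact balls, finitely many elements of a discrete group displace
the centre by a bounded amount. -/
theorem IsDiscreteGroup.finite_dist_le (hΓ : IsDiscreteGroup Γ) (R : ℝ) :
    {γ : Γ | dist (γ • (origin : Hyp n)) origin ≤ R}.Finite := by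
  obtain ⟨I, ε, hε, hI⟩ := hΓ.exists_separated
  by_contra hinf
  let f : Γ → I → Hyp n := fun γ x => γ • x.1
  let K : Set (I → Hyp n) := Set.pi Set.univ fun x => Metric.closedBall origin (R + dist x.1 origin)
  have hK : IsCompact K := isCompact_univ_pi fun x => isCompact_closedBall _ _
  have hfK : ∀ γ ∈ {γ : Γ | dist (γ • (origin : Hyp n)) origin ≤ R}, f γ ∈ K := by
    intro γ hγ x _
    have h1 : dist (γ • x.1) (γ • (origin : Hyp n)) = dist x.1 origin :=
      (γ : Hyp n ≃ᵢ Hyp n).isometry.dist_eq _ _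
    have h2 := dist_triangle (γ • x.1) (γ • (origin : Hyp n)) origin
    have h3 : dist (γ • (origin : Hyp n)) origin ≤ R := hγ
    exact Metric.mem_closedBall.2 (by change dist (γ • x.1) origin ≤ _; linarith)
  obtain ⟨t, -, htf, ht⟩ := hK.finite_cover_balls (half_pos hε)
  have hch : ∀ γ ∈ {γ : Γ | dist (γ • (origin : Hyp n)) origin ≤ R},
      ∃ y ∈ t, f γ ∈ Metric.ball y (ε / 2) := fun γ hγ => by
    simpa using ht (hfK γ hγ)
  have : Nonempty (I → Hyp n) := ⟨fun _ => origin⟩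
  choose! y hyt hy using hch
  obtain ⟨γ, hγ, γ', hγ', hne, heq⟩ :=
    Set.Infinite.exists_ne_map_eq_of_mapsTo hinf (fun γ hγ => hyt γ hγ) htf
  apply hne
  have h1 : γ'⁻¹ * γ = 1 := by
    refine hI _ fun x hx => ?_
    have h2 : dist (f γ) (f γ') < ε := by
      have e1 := hy γ hγ
      have e2 := hy γ' hγ'
      rw [heq] at e1
      have := dist_triangle_right (f γ) (f γ') (y γ')
      rw [Metric.mem_ball] at e1 e2
      linarith
    have h3 : dist (γ • x) (γ' • x) < ε := (dist_le_pi_dist (f γ) (f γ') ⟨x, hx⟩).trans_lt h2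
    have h4 : dist ((γ'⁻¹ * γ) • x) x = dist (γ • x) (γ' • x) := by
      rw [mul_smul]
      have := ((γ' : Γ) : Hyp n ≃ᵢ Hyp n).isometry.dist_eq (γ'⁻¹ • γ • x) x
      rw [← this, ← smul_eq_apply, ← smul_eq_apply, smul_inv_smul]
    rwa [h4]
  exact (inv_mul_eq_one.1 h1).symm

theorem IsDiscreteGroup.countable (hΓ : IsDiscreteGroup Γ) : Countable Γ := by
  have h : (Set.univ : Set Γ) = ⋃ i : ℕ, {γ : Γ | dist (γ • (origin : Hyp n)) origin ≤ i} := by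
    refine (Set.eq_univ_of_forall fun γ => ?_).symm
    obtain ⟨i, hi⟩ := exists_nat_ge (dist (γ • (origin : Hyp n)) origin)
    exact Set.mem_iUnion.2 ⟨i, hi⟩
  rw [← Set.countable_univ_iff, h]
  exact Set.countable_iUnion fun i => (hΓ.finite_dist_le i).countable

theorem IsDiscreteGroup.isProperOn (hΓ : IsDiscreteGroup Γ) :
    IsProperOn Γ (Hyp n) fun x => dist x origin := by
  intro x c
  refine (hΓ.finite_dist_le (c + dist x origin)).subset fun γ hγ => ?_
  have h1 : dist (γ • x) (γ • (origin : Hyp n)) = dist x origin :=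
    (γ : Hyp n ≃ᵢ Hyp n).isometry.dist_eq _ _
  have h2 := dist_triangle_left (γ • (origin : Hyp n)) origin (γ • x)
  have h3 : dist (γ • x) origin ≤ c := hγ
  change dist (γ • (origin : Hyp n)) origin ≤ _
  linarith

theorem IsDiscreteGroup.isProperAction (hΓ : IsDiscreteGroup Γ) : IsProperAction Γ (Hyp n) where
  countable := hΓ.countable
  measurable_smul γ := (γ : Hyp n ≃ᵢ Hyp n).continuous.measurable
  measurableSet_fixed γ :=
    (isClosed_eq (γ : Hyp n ≃ᵢ Hyp n).continuous continuous_id).measurableSet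
  exists_isProperOn := ⟨_, (continuous_id.dist continuous_const).measurable, hΓ.isProperOn⟩

theorem IsDiscreteGroup.isProperAction_unitTangent (hΓ : IsDiscreteGroup Γ) :
    IsProperAction Γ (UnitTangent n) where
  countable := hΓ.countable
  measurable_smul γ := (UnitTangent.continuous_smul (γ : Hyp n ≃ᵢ Hyp n)).measurable
  measurableSet_fixed γ :=
    (isClosed_eq (UnitTangent.continuous_smul (γ : Hyp n ≃ᵢ Hyp n)) continuous_id).measurableSet
  exists_isProperOn := ⟨fun v => dist v.base origin,
    (UnitTangent.continuous_base.dist continuous_const).measurable,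
    fun v c => hΓ.isProperOn v.base c⟩

end

/-! ### Invariance of the Riemannian measures -/

theorem map_isometry_volume (g : Hyp n ≃ᵢ Hyp n) :
    (μHE[n] : Measure (Hyp n)).map g = (μHE[n] : Measure (Hyp n)) := by
  rw [g.isometry.map_euclideanHausdorffMeasure, g.surjective.range_eq, Measure.restrict_univ]

theorem map_riemVol (g : Hyp n ≃ᵢ Hyp n) (d : ℕ) (S : Set (Hyp n)) :
    (riemVol d S).map g = riemVol d (g '' S) := by
  ext A hA
  rw [Measure.map_apply g.continuous.measurable hA, riemVol, riemVol,
    Measure.restrict_apply (g.continuous.measurable hA), Measure.restrict_apply hA,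
    ← g.isometry.euclideanHausdorffMeasure_image]
  congr 1
  rw [Set.image_preimage_inter]

/-- The ball model is conformal. -/
theorem map_val_volume : ((μHE[n] : Measure (Hyp n)).withDensity
    fun x => ENNReal.ofReal (((1 - ‖x.val‖ ^ 2) / 2) ^ n)).map val =
      (volume : Measure (Euc n)).restrict (Metric.ball 0 1) := by
  have hc : Continuous fun x : Hyp n => (1 - ‖x.val‖ ^ 2) / 2 := by
    have := continuous_val (n := n)
    fun_prop
  have key := map_conformal_euclideanHausdorffMeasure (F := (val : Hyp n → Euc n)) (Ω := Set.univ)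
    (a := fun x => (1 - ‖x.val‖ ^ 2) / 2) isGauge_sinh isGauge_id MeasurableSet.univ
    continuous_val.measurable continuous_val.continuousOn (fun x _ y _ h => ext h) hc.continuousOn
    (fun x _ => half_pos (one_sub_pos' x)) (fun x _ y _ => by
      have h1 := one_sub_pos' x
      have h2 := one_sub_pos' y
      rw [sinh_dist_sq, dist_eq_norm]
      field_simp
      ring) n
  rwa [Measure.restrict_univ, Set.image_univ, range_val,
    EuclideanSpace.euclideanHausdorffMeasure_eq_volume] at key

theorem volume_ne_zero : (μHE[n] : Measure (Hyp n)) ≠ 0 := by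
  intro h
  have h1 := map_val_volume (n := n)
  rw [h, withDensity_zero_left, Measure.map_zero] at h1
  have h2 := congrArg (fun μ => μ Set.univ) h1
  simp only [Measure.coe_zero, Pi.zero_apply, Measure.restrict_apply_univ] at h2
  exact (Metric.measure_ball_pos volume (0 : Euc n) one_pos).ne h2

theorem sphereVol_ne_top : sphereVol m ≠ ∞ := measure_ne_top _ _

theorem sphereVol_ne_zero (hm : 1 ≤ m) : sphereVol m ≠ 0 := by
  intro h
  have h0 : (μHE[m] : Measure (Bdry (m + 1))) = 0 := Measure.measure_univ_eq_zero.1 h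
  have hne : Nonempty (Bdry (m + 1)) := ⟨⟨EuclideanSpace.single 0 1, by simp⟩⟩
  have h1 := lintegral_horo hm (Classical.arbitrary (Bdry (m + 1)))
    (f := fun _ => 1) measurable_const
  rw [h0, lintegral_zero_measure, lintegral_one, Measure.measure_univ_eq_zero] at h1
  exact volume_ne_zero h1

end Hyp

namespace Hyp

variable {n k j m : ℕ}

/-! ### Measures on the unit tangent bundle given by measures at infinity -/

/-- The measure on the unit tangent bundle which is the integral over hyperbolic space of the measures
`P(x, ξ) ^ d dκ(ξ)`, where the unit tangent sphere at `x` is identified with the sphere at infinity. -/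
def dirMeasure (κ : Measure (Bdry n)) (d : ℝ) : Measure (UnitTangent n) :=
  (((μHE[n] : Measure (Hyp n)).prod κ).withDensity
    fun z => ENNReal.ofReal (poisson z.1 z.2 ^ d)).map fun z => toward z.1 z.2

theorem measurable_poisson_rpow (d : ℝ) :
    Measurable fun z : Hyp n × Bdry n => ENNReal.ofReal (poisson z.1 z.2 ^ d) :=
  (continuous_poisson.measurable.pow_const d).ennreal_ofReal

theorem measurable_toward : Measurable fun z : Hyp n × Bdry n => toward z.1 z.2 :=
  continuous_toward.measurable

theorem measurable_toward_right (x : Hyp n) : Measurable fun ξ : Bdry n => toward x ξ := by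
  have h : Measurable fun ξ : Bdry n => (x, ξ) := measurable_prodMk_left
  have := measurable_toward.comp h
  exact this

theorem lintegral_dirMeasure' (κ : Measure (Bdry n)) (d : ℝ) {f : UnitTangent n → ℝ≥0∞}
    (hf : Measurable f) : ∫⁻ v, f v ∂dirMeasure κ d =
      ∫⁻ z, ENNReal.ofReal (poisson z.1 z.2 ^ d) * f (toward z.1 z.2)
        ∂((μHE[n] : Measure (Hyp n)).prod κ) := by
  have hft : Measurable fun z : Hyp n × Bdry n => f (toward z.1 z.2) := hf.comp measurable_toward
  rw [dirMeasure, lintegral_map hf measurable_toward,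
    lintegral_withDensity_eq_lintegral_mul _ (measurable_poisson_rpow d) hft]
  rfl

theorem lintegral_withDensity_poisson (κ : Measure (Bdry n)) (d : ℝ) (x : Hyp n)
    {f : Bdry n → ℝ≥0∞} (hf : Measurable f) :
    ∫⁻ ξ, f ξ ∂(κ.withDensity fun ξ => ENNReal.ofReal (poisson x ξ ^ d)) =
      ∫⁻ ξ, ENNReal.ofReal (poisson x ξ ^ d) * f ξ ∂κ := by
  have hP : Measurable fun ξ : Bdry n => ENNReal.ofReal (poisson x ξ ^ d) := by
    have h : Measurable fun ξ : Bdry n => (x, ξ) := measurable_prodMk_left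
    have := (measurable_poisson_rpow d).comp h
    exact this
  rw [lintegral_withDensity_eq_lintegral_mul _ hP hf]
  rfl

theorem lintegral_dirMeasure (κ : Measure (Bdry n)) [SFinite κ] (d : ℝ) {f : UnitTangent n → ℝ≥0∞}
    (hf : Measurable f) : ∫⁻ v, f v ∂dirMeasure κ d =
      ∫⁻ x : Hyp n, (∫⁻ ξ, f (toward x ξ)
        ∂(κ.withDensity fun ξ => ENNReal.ofReal (poisson x ξ ^ d))) ∂(μHE[n] : Measure (Hyp n)) := by
  have hft : Measurable fun z : Hyp n × Bdry n => f (toward z.1 z.2) := hf.comp measurable_toward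
  have hPf : Measurable fun z : Hyp n × Bdry n =>
      ENNReal.ofReal (poisson z.1 z.2 ^ d) * f (toward z.1 z.2) :=
    (measurable_poisson_rpow d).mul hft
  rw [lintegral_dirMeasure' κ d hf, lintegral_prod _ hPf.aemeasurable]
  refine lintegral_congr fun x => ?_
  have hfx : Measurable fun ξ : Bdry n => f (toward x ξ) := hf.comp (measurable_toward_right x)
  rw [lintegral_withDensity_poisson κ d x hfx]

/-- Integration first along the geodesics that end at `ξ`, in horospherical coordinates. -/
theorem lintegral_dirMeasure_horo (hm : 1 ≤ m) (κ : Measure (Bdry (m + 1))) [SFinite κ] (d : ℝ)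
    {f : UnitTangent (m + 1) → ℝ≥0∞} (hf : Measurable f) : ∫⁻ v, f v ∂dirMeasure κ d =
      ∫⁻ ξ : Bdry (m + 1), (∫⁻ η : Bdry (m + 1), (∫⁻ s : ℝ,
        ENNReal.ofReal ((2 * Real.exp (-s) / ‖(η : Euc (m + 1)) - ξ‖ ^ 2) ^ m) *
          (ENNReal.ofReal (Real.exp (s * d)) * f (toward (horo ξ η s) ξ)))
        ∂(μHE[m] : Measure (Bdry (m + 1)))) ∂κ := by
  have hft : Measurable fun z : Hyp (m + 1) × Bdry (m + 1) => f (toward z.1 z.2) :=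
    hf.comp measurable_toward
  have hPf : Measurable fun z : Hyp (m + 1) × Bdry (m + 1) =>
      ENNReal.ofReal (poisson z.1 z.2 ^ d) * f (toward z.1 z.2) :=
    (measurable_poisson_rpow d).mul hft
  rw [lintegral_dirMeasure' κ d hf, lintegral_prod_symm _ hPf.aemeasurable]
  refine lintegral_congr fun ξ => ?_
  have hx : Measurable fun x : Hyp (m + 1) =>
      ENNReal.ofReal (poisson x ξ ^ d) * f (toward x ξ) := by
    have h : Measurable fun x : Hyp (m + 1) => (x, ξ) := measurable_prodMk_right
    have := hPf.comp h
    exact this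
  change ∫⁻ x, ENNReal.ofReal (poisson x ξ ^ d) * f (toward x ξ) ∂_ = _
  rw [lintegral_horo hm ξ hx]
  have haene : ∀ᵐ η ∂(μHE[m] : Measure (Bdry (m + 1))), η ≠ ξ := by
    rw [ae_iff]
    have : {η : Bdry (m + 1) | ¬η ≠ ξ} = {ξ} := by ext; simp
    rw [this, euclideanHausdorffMeasure_singleton hm]
  refine lintegral_congr_ae ?_
  filter_upwards [haene] with η hη
  simp only [poisson_horo hη, Real.exp_mul]

/-- An isometry that preserves the density at infinity preserves the measure on the unit tangent
bundle. -/
theorem map_dirMeasure {κ : Measure (Bdry n)} [SFinite κ] {d : ℝ} {g : Hyp n ≃ᵢ Hyp n}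
    (hg : ∀ x, (κ.withDensity fun ξ => ENNReal.ofReal (poisson x ξ ^ d)).map (bdryMap g) =
      κ.withDensity fun ξ => ENNReal.ofReal (poisson (g x) ξ ^ d)) :
    (dirMeasure κ d).map (fun v => g • v) = dirMeasure κ d := by
  have hgm := (UnitTangent.continuous_smul g).measurable
  have hbm := (continuous_bdryMap g).measurable
  ext A hA
  have hf : Measurable (A.indicator (1 : UnitTangent n → ℝ≥0∞)) := measurable_one.indicator hA
  have hfg : Measurable fun v : UnitTangent n =>
      A.indicator (1 : UnitTangent n → ℝ≥0∞) (g • v) := hf.comp hgm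
  rw [← lintegral_indicator_one hA, lintegral_map hf hgm, ← lintegral_indicator_one hA,
    lintegral_dirMeasure κ d hfg, lintegral_dirMeasure κ d hf]
  have h1 : ∀ x, (∫⁻ ξ, A.indicator (1 : UnitTangent n → ℝ≥0∞) (g • toward x ξ)
      ∂(κ.withDensity fun ξ => ENNReal.ofReal (poisson x ξ ^ d))) =
      ∫⁻ ξ, A.indicator (1 : UnitTangent n → ℝ≥0∞) (toward (g x) ξ)
        ∂(κ.withDensity fun ξ => ENNReal.ofReal (poisson (g x) ξ ^ d)) := by
    intro x
    have hfx : Measurable fun ξ : Bdry n =>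
        A.indicator (1 : UnitTangent n → ℝ≥0∞) (toward (g x) ξ) :=
      hf.comp (measurable_toward_right (g x))
    rw [← hg, lintegral_map hfx hbm]
    simp only [smul_toward]
  simp only [h1]
  have hG : Measurable fun x => ∫⁻ ξ, A.indicator (1 : UnitTangent n → ℝ≥0∞) (toward x ξ)
      ∂(κ.withDensity fun ξ => ENNReal.ofReal (poisson x ξ ^ d)) := by
    have h2 : ∀ x, ∫⁻ ξ, A.indicator (1 : UnitTangent n → ℝ≥0∞) (toward x ξ)
        ∂(κ.withDensity fun ξ => ENNReal.ofReal (poisson x ξ ^ d)) =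
        ∫⁻ ξ, ENNReal.ofReal (poisson x ξ ^ d) *
          A.indicator (1 : UnitTangent n → ℝ≥0∞) (toward x ξ) ∂κ := by
      intro x
      have hfx : Measurable fun ξ : Bdry n =>
          A.indicator (1 : UnitTangent n → ℝ≥0∞) (toward x ξ) :=
        hf.comp (measurable_toward_right x)
      rw [lintegral_withDensity_poisson κ d x hfx]
    simp only [h2]
    have h3 : Measurable fun z : Hyp n × Bdry n => ENNReal.ofReal (poisson z.1 z.2 ^ d) *
        A.indicator (1 : UnitTangent n → ℝ≥0∞) (toward z.1 z.2) :=
      (measurable_poisson_rpow d).mul (hf.comp measurable_toward)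
    exact h3.lintegral_prod_right'
  have h4 := lintegral_map hG g.continuous.measurable (μ := (μHE[n] : Measure (Hyp n)))
  rw [map_isometry_volume] at h4
  exact h4.symm

/-- The geodesic flow at time `t` multiplies the measure by a constant: it is a translation of the third
horospherical coordinate, which multiplies `exp (-s) ^ m * exp (s * d)` by a constant. -/
theorem lintegral_dirMeasure_toFun (hm : 1 ≤ m) (κ : Measure (Bdry (m + 1))) [SFinite κ] (d : ℝ)
    {w : Hyp (m + 1) → ℝ≥0∞} (hw : Measurable w) (t : ℝ) :
    ∫⁻ v, w (v.toFun t) ∂dirMeasure κ d =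
      ENNReal.ofReal (Real.exp ((m - d) * t)) * ∫⁻ v, w v.base ∂dirMeasure κ d := by
  have h1 : Measurable fun v : UnitTangent (m + 1) => w (v.toFun t) :=
    hw.comp (UnitTangent.continuous_toFun t).measurable
  have h2 : Measurable fun v : UnitTangent (m + 1) => w v.base :=
    hw.comp UnitTangent.continuous_base.measurable
  have hmeas : Measurable fun z : Bdry (m + 1) × Bdry (m + 1) × ℝ =>
      ENNReal.ofReal ((2 * Real.exp (-z.2.2) / ‖(z.2.1 : Euc (m + 1)) - z.1‖ ^ 2) ^ m) *
        (ENNReal.ofReal (Real.exp (z.2.2 * d)) * w (horo z.1 z.2.1 z.2.2)) := by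
    refine Measurable.mul (by fun_prop) (Measurable.mul (by fun_prop) (hw.comp measurable_horo))
  rw [lintegral_dirMeasure_horo hm κ d h1, lintegral_dirMeasure_horo hm κ d h2]
  simp only [base_toward]
  have hm1 : ∀ ξ : Bdry (m + 1), Measurable fun z : Bdry (m + 1) × ℝ =>
      ENNReal.ofReal ((2 * Real.exp (-z.2) / ‖(z.1 : Euc (m + 1)) - ξ‖ ^ 2) ^ m) *
        (ENNReal.ofReal (Real.exp (z.2 * d)) * w (horo ξ z.1 z.2)) := fun ξ => by
    have h : Measurable fun z : Bdry (m + 1) × ℝ => (ξ, z) := measurable_prodMk_left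
    have := hmeas.comp h
    exact this
  have hm2 : ∀ ξ η : Bdry (m + 1), Measurable fun s : ℝ =>
      ENNReal.ofReal ((2 * Real.exp (-s) / ‖(η : Euc (m + 1)) - ξ‖ ^ 2) ^ m) *
        (ENNReal.ofReal (Real.exp (s * d)) * w (horo ξ η s)) := fun ξ η => by
    have h : Measurable fun s : ℝ => (η, s) := measurable_prodMk_left
    have := (hm1 ξ).comp h
    exact this
  have hm3 : Measurable fun ξ : Bdry (m + 1) => (∫⁻ η : Bdry (m + 1), (∫⁻ s : ℝ,
      ENNReal.ofReal ((2 * Real.exp (-s) / ‖(η : Euc (m + 1)) - ξ‖ ^ 2) ^ m) *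
        (ENNReal.ofReal (Real.exp (s * d)) * w (horo ξ η s)))
      ∂(μHE[m] : Measure (Bdry (m + 1)))) := by
    have h3 : Measurable fun p : (Bdry (m + 1) × Bdry (m + 1)) × ℝ =>
        ENNReal.ofReal ((2 * Real.exp (-p.2) / ‖(p.1.2 : Euc (m + 1)) - p.1.1‖ ^ 2) ^ m) *
        (ENNReal.ofReal (Real.exp (p.2 * d)) * w (horo p.1.1 p.1.2 p.2)) := by
      have h : Measurable fun p : (Bdry (m + 1) × Bdry (m + 1)) × ℝ => (p.1.1, p.1.2, p.2) := by
        fun_prop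
      have := hmeas.comp h
      exact this
    have h4 := h3.lintegral_prod_right' (ν := (volume : Measure ℝ))
    have h5 := h4.lintegral_prod_right' (ν := (μHE[m] : Measure (Bdry (m + 1))))
    exact h5
  rw [← lintegral_const_mul _ hm3]
  refine lintegral_congr fun ξ => ?_
  rw [← lintegral_const_mul _ (hm1 ξ).lintegral_prod_right']
  have haene : ∀ᵐ η ∂(μHE[m] : Measure (Bdry (m + 1))), η ≠ ξ := by
    rw [ae_iff]
    have : {η : Bdry (m + 1) | ¬η ≠ ξ} = {ξ} := by ext; simp
    rw [this, euclideanHausdorffMeasure_singleton hm]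
  refine lintegral_congr_ae ?_
  filter_upwards [haene] with η hη
  simp only [toward_horo_toFun hη]
  change _ = _ * ∫⁻ s : ℝ, _
  conv_rhs => rw [← lintegral_add_right_eq_self _ t]
  have hm4 : Measurable fun s : ℝ =>
      ENNReal.ofReal ((2 * Real.exp (-(s + t)) / ‖(η : Euc (m + 1)) - ξ‖ ^ 2) ^ m) *
        (ENNReal.ofReal (Real.exp ((s + t) * d)) * w (horo ξ η (s + t))) := by
    have h : Measurable fun s : ℝ => s + t := by fun_prop
    have := (hm2 ξ η).comp h
    exact this
  rw [← lintegral_const_mul _ hm4]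
  refine lintegral_congr fun s => ?_
  rw [← mul_assoc, ← mul_assoc, ← mul_assoc, ← ENNReal.ofReal_mul (by positivity),
    ← ENNReal.ofReal_mul (by positivity), ← ENNReal.ofReal_mul (by positivity)]
  congr 2
  have hq := norm_bdry_sub_pos hη
  rw [div_pow, div_pow, mul_pow, mul_pow, ← Real.exp_nat_mul, ← Real.exp_nat_mul]
  have e1 : Real.exp ((m - d) * t) * (2 ^ m * Real.exp (m * -(s + t)) /
      (‖(η : Euc (m + 1)) - ξ‖ ^ 2) ^ m) * Real.exp ((s + t) * d) =
      2 ^ m / (‖(η : Euc (m + 1)) - ξ‖ ^ 2) ^ m *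
        (Real.exp ((m - d) * t) * Real.exp (m * -(s + t)) * Real.exp ((s + t) * d)) := by ring
  have e2 : 2 ^ m * Real.exp (m * -s) / (‖(η : Euc (m + 1)) - ξ‖ ^ 2) ^ m * Real.exp (s * d) =
      2 ^ m / (‖(η : Euc (m + 1)) - ξ‖ ^ 2) ^ m * (Real.exp (m * -s) * Real.exp (s * d)) := by ring
  rw [e2, e1, ← Real.exp_add, ← Real.exp_add, ← Real.exp_add]
  congr 2
  ring

/-! ### The critical exponent of a lattice -/

section

variable {Γ : Subgroup (Hyp (m + 1) ≃ᵢ Hyp (m + 1))} {μ : Hyp (m + 1) → Measure (Bdry (m + 1))}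

/-- A Patterson density is determined by its value at the centre. -/
theorem IsPattersonDensity.eq_withDensity {Γ : Subgroup (Hyp n ≃ᵢ Hyp n)}
    {μ : Hyp n → Measure (Bdry n)} (hμ : IsPattersonDensity Γ μ) (x : Hyp n) :
    μ x = (μ origin).withDensity fun ξ => ENNReal.ofReal (poisson x ξ ^ critExp Γ) := by
  rw [hμ.density x origin]
  congr 1
  funext ξ
  rw [← neg_mul, exp_mul_busemann, poisson_origin, one_div, Real.inv_rpow (poisson_pos x ξ).le,
    Real.rpow_neg (poisson_pos x ξ).le, inv_inv]

theorem coe_ne_one {γ : Γ} (h : γ ≠ 1) : (γ : Hyp (m + 1) ≃ᵢ Hyp (m + 1)) ≠ 1 :=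
  fun h1 => h (Subtype.ext h1)

theorem measure_fixed_volume {γ : Γ} (h : γ ≠ 1) :
    (μHE[m + 1] : Measure (Hyp (m + 1))) {x | γ • x = x} = 0 :=
  measure_fixedPoints (γ : Hyp (m + 1) ≃ᵢ Hyp (m + 1)).isometry (exists_ne_of_ne_one (coe_ne_one h))

theorem quotientVol_volume (hΓ : IsDiscreteGroup Γ) {w : Hyp (m + 1) → ℝ≥0∞} (hw : IsWeight Γ w) :
    quotientVol Γ (riemVol (m + 1) (Set.univ : Set (Hyp (m + 1)))) =
      ∫⁻ x, w x ∂(μHE[m + 1] : Measure (Hyp (m + 1))) := by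
  rw [riemVol, Measure.restrict_univ]
  exact hΓ.isProperAction.quotientVol_eq_of_free
    (fun γ => map_isometry_volume (γ : Hyp (m + 1) ≃ᵢ Hyp (m + 1))) hw
    (fun γ h => measure_fixed_volume h)

/-- The covolume of a discrete group is not zero. -/
theorem lintegral_weight_ne_zero (hΓ : IsDiscreteGroup Γ) {w : Hyp (m + 1) → ℝ≥0∞}
    (hw : IsWeight Γ w) : ∫⁻ x, w x ∂(μHE[m + 1] : Measure (Hyp (m + 1))) ≠ 0 := by
  intro h0
  have := hΓ.countable
  rw [lintegral_eq_zero_iff hw.measurable] at h0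
  have h1 : ∀ᵐ x ∂(μHE[m + 1] : Measure (Hyp (m + 1))), ∀ γ : Γ, w (γ • x) = 0 := by
    rw [ae_all_iff]
    intro γ
    have h2 : Measurable fun x : Hyp (m + 1) => γ • x := hΓ.isProperAction.measurable_smul γ
    have h3 : (μHE[m + 1] : Measure (Hyp (m + 1))).map (fun x => γ • x) = μHE[m + 1] :=
      map_isometry_volume (γ : Hyp (m + 1) ≃ᵢ Hyp (m + 1))
    rw [← h3] at h0
    exact ae_of_ae_map h2.aemeasurable h0
  have h2 : ∀ᵐ x ∂(μHE[m + 1] : Measure (Hyp (m + 1))), False := by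
    filter_upwards [h1] with x hx
    have h3 := hw.tsum_eq x
    simp only [hx, tsum_zero] at h3
    exact zero_ne_one h3
  rw [ae_iff] at h2
  simp only [not_false_eq_true, Set.ofPred_true] at h2
  exact volume_ne_zero (Measure.measure_univ_eq_zero.1 h2)

/-- The critical exponent of a lattice is `m` in dimension `m + 1`: the measure on the unit tangent
bundle with conditional measures the Patterson density is invariant under `Γ` and finite modulo `Γ`,
while the geodesic flow at time `1` multiplies it by `exp (m - critExp Γ)`. -/
theorem critExp_eq (hm : 1 ≤ m) (hΓ : IsDiscreteGroup Γ)
    (hvol : quotientVol Γ (riemVol (m + 1) (Set.univ : Set (Hyp (m + 1)))) < ∞)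
    (hμ : IsPattersonDensity Γ μ) (hnorm : ∀ x, μ x Set.univ = sphereVol m) : critExp Γ = m := by
  have := hΓ.countable
  have hfin := hμ.finite origin
  have hact := hΓ.isProperAction_unitTangent
  obtain ⟨w, hw⟩ := hΓ.isProperAction.exists_isWeight
  have hb : IsWeight Γ fun v : UnitTangent (m + 1) => w v.base :=
    hw.comp UnitTangent.continuous_base.measurable fun γ v => rfl
  have ht : IsWeight Γ fun v : UnitTangent (m + 1) => w (v.toFun 1) :=
    hw.comp (UnitTangent.continuous_toFun 1).measurable fun γ v => rfl
  have hinv : ∀ γ : Γ, (dirMeasure (μ origin) (critExp Γ)).map (fun v => γ • v) =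
      dirMeasure (μ origin) (critExp Γ) := fun γ =>
    map_dirMeasure (g := (γ : Hyp (m + 1) ≃ᵢ Hyp (m + 1))) fun x => by
      rw [← hμ.eq_withDensity, ← hμ.eq_withDensity]
      exact hμ.equivariant γ γ.2 x
  -- the base point and its image by the flow both give weights on the unit tangent bundle, hence
  -- the same mass
  have h1 := lintegral_isWeight hact.measurable_smul hinv hb ht (f := 1) measurable_one
    fun γ x => rfl
  simp only [Pi.one_apply, one_mul] at h1
  rw [lintegral_dirMeasure_toFun hm _ _ hw.measurable] at h1
  have h2 : ∫⁻ v, w v.base ∂dirMeasure (μ origin) (critExp Γ) =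
      (∫⁻ x, w x ∂(μHE[m + 1] : Measure (Hyp (m + 1)))) * sphereVol m := by
    rw [lintegral_dirMeasure _ _ hb.measurable, ← lintegral_mul_const _ hw.measurable]
    refine lintegral_congr fun x => ?_
    simp only [base_toward]
    rw [lintegral_const, ← hμ.eq_withDensity, hnorm]
  have h3 : ∫⁻ v, w v.base ∂dirMeasure (μ origin) (critExp Γ) ≠ 0 := by
    rw [h2]
    exact mul_ne_zero (lintegral_weight_ne_zero hΓ hw) (sphereVol_ne_zero hm)
  have h4 : ∫⁻ v, w v.base ∂dirMeasure (μ origin) (critExp Γ) ≠ ∞ := by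
    rw [h2, ← quotientVol_volume hΓ hw]
    exact ENNReal.mul_ne_top hvol.ne sphereVol_ne_top
  have h5 : ENNReal.ofReal (Real.exp ((m - critExp Γ) * 1)) = 1 := by
    have h6 := (ENNReal.mul_left_inj h3 h4).1 (h1.symm.trans (one_mul _).symm)
    exact h6
  rw [ENNReal.ofReal_eq_one, Real.exp_eq_one_iff] at h5
  linarith

end

end Hyp

namespace Hyp

variable {n k j m : ℕ}

/-! ### The Patterson density of a lattice -/

theorem ray_val (ξ : Bdry n) (t : ℝ) : (ray ξ t).val = Real.tanh (t / 2) • (ξ : Euc n) := by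
  rw [ray, line_val, origin_val, zero_mob]

theorem continuous_ray (t : ℝ) : Continuous fun ξ : Bdry n => ray ξ t := by
  have h : Continuous fun ξ : Bdry n => ((origin : Hyp n), ξ) := by fun_prop
  exact (UnitTangent.continuous_toFun t).comp (UnitTangent.continuous_ofDir.comp h)

/-- The kernel is symmetric, as the reflection that exchanges `ξ` and `η` fixes the centre. -/
theorem poisson_ray_comm (ξ η : Bdry n) (t : ℝ) : poisson (ray η t) ξ = poisson (ray ξ t) η := by
  have h : ∀ ξ η : Bdry n, poisson (ray η t) ξ = (1 - Real.tanh (t / 2) ^ 2) /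
      (1 - 2 * Real.tanh (t / 2) * inner ℝ (ξ : Euc n) (η : Euc n) + Real.tanh (t / 2) ^ 2) := by
    intro ξ η
    rw [poisson, ray_val, norm_sub_sq_real, norm_smul, norm_bdry, norm_bdry, inner_smul_right,
      Real.norm_eq_abs, mul_one, sq_abs]
    congr 1
    ring
  rw [h, h, real_inner_comm]

theorem mobBdry_ray_self (ξ : Bdry n) {t : ℝ} (ht : 0 ≤ t) : mobBdry (ray ξ t) ξ = ξ := by
  have h0 : 0 ≤ Real.tanh (t / 2) := by
    rw [Real.tanh_eq_sinh_div_cosh]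
    exact div_nonneg (Real.sinh_nonneg_iff.2 (by linarith)) (Real.cosh_pos _).le
  apply Subtype.ext
  rw [mobBdry_val, mob, mobDenom, ray_val]
  generalize Real.tanh (t / 2) = τ at *
  rw [inner_smul_left, real_inner_self_eq_norm_sq, norm_smul, norm_bdry, Real.norm_eq_abs, mul_one,
    sq_abs, smul_smul, ← add_smul, smul_smul]
  have h1 : (1 + 2 * (τ * 1 ^ 2) + τ ^ 2 * 1 ^ 2)⁻¹ *
      ((1 + 2 * (τ * 1 ^ 2) + 1 ^ 2) * τ + (1 - τ ^ 2)) = 1 := by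
    have : (1 + 2 * (τ * 1 ^ 2) + τ ^ 2 * 1 ^ 2) ≠ 0 := by positivity
    field_simp
    ring
  simp only [conj_trivial]
  rw [h1, one_smul]

/-- The translations along a ray contract the complement of the point opposite to its endpoint. -/
theorem tendsto_mobBdry_ray {ξ η : Bdry n} (h : η ≠ -ξ) :
    Tendsto (fun t => mobBdry (ray ξ t) η) atTop (𝓝 ξ) := by
  have hne : (ξ : Euc n) + η ≠ 0 := fun h0 => h (Subtype.ext (by
    rw [show ((-ξ : Bdry n) : Euc n) = -(ξ : Euc n) from rfl]
    exact eq_neg_of_add_eq_zero_right h0))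
  have hlim : Tendsto (fun t : ℝ => dist (mobBdry (ray ξ t) ξ) (mobBdry (ray ξ t) η) ^ 2) atTop
      (𝓝 0) := by
    simp only [dist_mobBdry_sq, ray_val]
    have h1 : Tendsto (fun t : ℝ => 1 - ‖Real.tanh (t / 2) • (ξ : Euc n)‖ ^ 2) atTop (𝓝 0) := by
      have := ((tendsto_tanh_half.smul_const (ξ : Euc n)).norm.pow 2).const_sub 1
      simpa [norm_bdry] using this
    have hD : ∀ ζ : Bdry n, Tendsto (fun t : ℝ => mobDenom (Real.tanh (t / 2) • (ξ : Euc n)) ζ)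
        atTop (𝓝 (‖(ξ : Euc n) + ζ‖ ^ 2)) := by
      intro ζ
      have hc : Continuous fun u : Euc n => mobDenom u ζ :=
        continuous_mobDenom.comp (continuous_id.prodMk continuous_const)
      have := (hc.tendsto _).comp (tendsto_tanh_half.smul_const (ξ : Euc n))
      have e : mobDenom ((1 : ℝ) • (ξ : Euc n)) ζ = ‖(ξ : Euc n) + ζ‖ ^ 2 := by
        rw [one_smul, mobDenom, norm_add_sq_real, norm_bdry, norm_bdry]
        ring
      rwa [e] at this
    have h2 : ‖(ξ : Euc n) + ξ‖ ^ 2 ≠ 0 := by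
      rw [← two_smul ℝ, norm_smul, norm_bdry]
      norm_num
    have h3 : ‖(ξ : Euc n) + η‖ ^ 2 ≠ 0 := pow_ne_zero 2 (norm_ne_zero_iff.2 hne)
    have := ((h1.div (hD ξ) h2).mul (h1.div (hD η) h3)).mul_const (dist ξ η ^ 2)
    simpa using this
  rw [tendsto_iff_dist_tendsto_zero]
  have h4 := hlim.sqrt
  simp only [Real.sqrt_sq dist_nonneg, Real.sqrt_zero] at h4
  refine h4.congr' ?_
  filter_upwards [eventually_ge_atTop 0] with t ht
  rw [mobBdry_ray_self ξ ht, dist_comm]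

/-- A finite measure on the sphere at infinity all of whose Poisson integrals have the same mass as
the spherical measure is the spherical measure. Indeed, the Poisson integral of `f` at `ray ξ t`
converges to `f ξ`, while the kernel `P(ray ξ t, η)` is symmetric in `ξ` and `η`. -/
theorem eq_of_lintegral_poisson (hm : 1 ≤ m) {μ : Measure (Bdry (m + 1))} [IsFiniteMeasure μ]
    (h : ∀ x, ∫⁻ ξ, ENNReal.ofReal (poisson x ξ ^ m) ∂μ = sphereVol m) :
    μ = (μHE[m] : Measure (Bdry (m + 1))) := by
  refine ext_of_forall_lintegral_eq_of_IsFiniteMeasure fun f => ?_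
  have hf : Measurable fun ξ => (f ξ : ℝ≥0∞) :=
    (ENNReal.continuous_coe.comp f.continuous).measurable
  have hP : ∀ t : ℝ, Measurable fun z : Bdry (m + 1) × Bdry (m + 1) =>
      ENNReal.ofReal (poisson (ray z.1 t) z.2 ^ m) := fun t => by
    have h1 : Continuous fun z : Bdry (m + 1) × Bdry (m + 1) => (ray z.1 t, z.2) :=
      ((continuous_ray t).comp continuous_fst).prodMk continuous_snd
    have h2 := (continuous_poisson.comp h1).pow m
    exact h2.measurable.ennreal_ofReal
  have hF : ∀ t : ℝ, Measurable fun z : Bdry (m + 1) × Bdry (m + 1) =>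
      (f (mobBdry (ray z.1 t) z.2) : ℝ≥0∞) := fun t => by
    have h1 : Continuous fun z : Bdry (m + 1) × Bdry (m + 1) => (ray z.1 t, z.2) :=
      ((continuous_ray t).comp continuous_fst).prodMk continuous_snd
    exact hf.comp (continuous_mobBdry.comp h1).measurable
  -- the integrals do not depend on `t`
  have key : ∀ t : ℝ, ∫⁻ z, (f (mobBdry (ray z.1 t) z.2) : ℝ≥0∞)
      ∂(μ.prod (μHE[m] : Measure (Bdry (m + 1)))) =
      sphereVol m * ∫⁻ η, (f η : ℝ≥0∞) ∂(μHE[m] : Measure (Bdry (m + 1))) := by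
    intro t
    rw [lintegral_prod _ (hF t).aemeasurable]
    have h1 : ∀ ξ : Bdry (m + 1), ∫⁻ η : Bdry (m + 1), (f (mobBdry (ray ξ t) η) : ℝ≥0∞)
        ∂(μHE[m] : Measure (Bdry (m + 1))) =
        ∫⁻ η, ENNReal.ofReal (poisson (ray ξ t) η ^ m) * (f η : ℝ≥0∞)
          ∂(μHE[m] : Measure (Bdry (m + 1))) := fun ξ => lintegral_mobBdry (ray ξ t) hf
    simp only [h1]
    rw [lintegral_lintegral_swap, ← lintegral_const_mul _ hf]
    · refine lintegral_congr fun η => ?_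
      have h2 : Measurable fun ξ : Bdry (m + 1) => ENNReal.ofReal (poisson (ray ξ t) η ^ m) := by
        have h3 : Measurable fun ξ : Bdry (m + 1) => (ξ, η) := measurable_prodMk_right
        have := (hP t).comp h3
        exact this
      rw [lintegral_mul_const _ h2]
      simp only [← poisson_ray_comm _ η t]
      rw [h]
    · exact ((hP t).mul (hf.comp measurable_snd)).aemeasurable
  have hae : ∀ᵐ z ∂(μ.prod (μHE[m] : Measure (Bdry (m + 1)))), z.2 ≠ -z.1 := by
    have hms : MeasurableSet {z : Bdry (m + 1) × Bdry (m + 1) | z.2 ≠ -z.1} :=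
      (isOpen_ne_fun continuous_snd (by fun_prop)).measurableSet
    rw [Measure.ae_prod_iff_ae_ae hms]
    refine Eventually.of_forall fun ξ => ?_
    rw [ae_iff]
    have : {η : Bdry (m + 1) | ¬η ≠ -ξ} = {-ξ} := by ext; simp
    exact this ▸ euclideanHausdorffMeasure_singleton hm _
  -- as `t` tends to infinity, the translation along the ray to `ξ` concentrates the spherical
  -- measure at `ξ`
  have hlim := tendsto_lintegral_filter_of_dominated_convergence (l := atTop)
    (μ := μ.prod (μHE[m] : Measure (Bdry (m + 1))))
    (F := fun (t : ℝ) z => (f (mobBdry (ray z.1 t) z.2) : ℝ≥0∞)) (f := fun z => (f z.1 : ℝ≥0∞))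
    (fun _ => (nndist 0 f : ℝ≥0∞)) (Eventually.of_forall hF)
    (Eventually.of_forall fun t => Eventually.of_forall fun z => by
      exact_mod_cast f.apply_le_nndist_zero (mobBdry (ray z.1 t) z.2))
    (by
      rw [lintegral_const]
      exact ENNReal.mul_ne_top ENNReal.coe_ne_top (measure_ne_top _ _))
    (by
      filter_upwards [hae] with z hz
      exact ((ENNReal.continuous_coe.comp f.continuous).tendsto _).comp (tendsto_mobBdry_ray hz))
  simp only [key] at hlim
  have h5 := tendsto_nhds_unique hlim tendsto_const_nhds
  have hf1 : Measurable fun z : Bdry (m + 1) × Bdry (m + 1) => (f z.1 : ℝ≥0∞) :=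
    hf.comp measurable_fst
  rw [lintegral_prod _ hf1.aemeasurable] at h5
  simp only [lintegral_const] at h5
  rw [lintegral_mul_const _ hf, mul_comm] at h5
  exact (ENNReal.mul_right_inj (sphereVol_ne_zero hm) sphereVol_ne_top).1 h5

/-- The Patterson density of a lattice, normalised by the mass of the unit sphere, consists of the
visual measures. -/
theorem IsPattersonDensity.eq_visual {Γ : Subgroup (Hyp (m + 1) ≃ᵢ Hyp (m + 1))}
    {μ : Hyp (m + 1) → Measure (Bdry (m + 1))} (hm : 1 ≤ m) (hδ : critExp Γ = m)
    (hμ : IsPattersonDensity Γ μ) (hnorm : ∀ x, μ x Set.univ = sphereVol m) (x : Hyp (m + 1)) :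
    μ x = visual x := by
  have hfin := hμ.finite origin
  have hd : ∀ x, μ x =
      (μ origin).withDensity fun ξ => ENNReal.ofReal (poisson x ξ ^ m) := fun x => by
    rw [hμ.eq_withDensity x, hδ]
    simp only [Real.rpow_natCast]
  have h0 : μ origin = (μHE[m] : Measure (Bdry (m + 1))) := eq_of_lintegral_poisson hm fun x => by
    rw [← hnorm x, hd x, withDensity_apply _ MeasurableSet.univ, Measure.restrict_univ]
  rw [hd x, h0, visual]

end Hyp

namespace Hyp

variable {n k j m : ℕ}

/-! ### Hopf's parametrisation -/

/-- The parameter `s` of the point `horo ξ η s` of the geodesic line from `η` to `ξ` closest to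
`x₀`. -/
def lineFoot (x₀ : Hyp n) (η ξ : Bdry n) : ℝ :=
  Real.log (4 * poisson x₀ ξ / (‖(η : Euc n) - ξ‖ ^ 2 * poisson x₀ η)) / 2

theorem four_mul_sinh_half_sq (d : ℝ) : (2 * Real.sinh (d / 2)) ^ 2 = 2 * Real.cosh d - 2 := by
  have h1 := Real.cosh_two_mul (d / 2)
  have h2 := Real.cosh_sq (d / 2)
  rw [mul_div_cancel₀ d (two_ne_zero)] at h1
  rw [h1, h2]
  ring

/-- The hyperbolic cosine of the distance to `x₀` along a geodesic line, in terms of Poisson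
kernels. -/
theorem cosh_dist_horo (x₀ : Hyp n) {ξ η : Bdry n} (h : η ≠ ξ) (s : ℝ) :
    2 * Real.cosh (dist x₀ (horo ξ η s)) = Real.exp s / poisson x₀ ξ +
      4 / (‖(η : Euc n) - ξ‖ ^ 2 * poisson x₀ η) * Real.exp (-s) := by
  obtain ⟨η', h', hx⟩ := exists_eq_horo ξ x₀
  set s' := Real.log (poisson x₀ ξ) with hs'
  have e1 := sinh_dist_horo h h' s s'
  rw [← hx, four_mul_sinh_half_sq, four_mul_sinh_half_sq, Real.dist_eq, Real.cosh_abs, dist_comm,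
    Real.cosh_eq (s - s'), Subtype.dist_eq, dist_eq_norm] at e1
  have e2 : poisson x₀ η = _ := (congrArg (fun x => poisson x η) hx).trans (poisson_horo' h' s' η)
  have e3 : poisson x₀ ξ = Real.exp s' := (Real.exp_log (poisson_pos _ _)).symm
  rw [e2, e3]
  have hq := norm_bdry_sub_pos h
  have hq' := norm_bdry_sub_pos h'
  have hE := Real.exp_pos s'
  have hF := Real.exp_pos s
  rw [norm_sub_rev (η : Euc n) (η' : Euc n), neg_sub, Real.exp_sub, Real.exp_sub, Real.exp_neg,
    Real.exp_neg] at e1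
  rw [Real.exp_neg]
  have e4 : 2 * Real.cosh (dist x₀ (horo ξ η s)) = 2 * (Real.exp s)⁻¹ / ‖(η : Euc n) - ξ‖ ^ 2 *
      (2 * (Real.exp s')⁻¹ / ‖(η' : Euc n) - ξ‖ ^ 2) * ‖(η' : Euc n) - η‖ ^ 2 +
      (Real.exp s / Real.exp s' + Real.exp s' / Real.exp s) := by linarith
  rw [e4]
  field_simp
  ring

/-- The distance to `x₀` along a geodesic line increases away from the foot, on both sides. -/
theorem dist_horo_le_iff (x₀ : Hyp n) {ξ η : Bdry n} (h : η ≠ ξ) (s s' : ℝ) :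
    dist x₀ (horo ξ η s) ≤ dist x₀ (horo ξ η s') ↔
      |s - lineFoot x₀ η ξ| ≤ |s' - lineFoot x₀ η ξ| := by
  have hq := norm_bdry_sub_pos h
  have h1 := poisson_pos x₀ ξ
  have h2 := poisson_pos x₀ η
  set u := lineFoot x₀ η ξ with hu
  have e1 : Real.exp u * Real.exp u =
      4 * poisson x₀ ξ / (‖(η : Euc n) - ξ‖ ^ 2 * poisson x₀ η) := by
    rw [← Real.exp_add, hu, lineFoot, add_halves, Real.exp_log (by positivity)]
  have key : ∀ s, 2 * Real.cosh (dist x₀ (horo ξ η s)) =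
      2 * (Real.exp u / poisson x₀ ξ) * Real.cosh (s - u) := by
    intro s
    have e2 : 4 / (‖(η : Euc n) - ξ‖ ^ 2 * poisson x₀ η) =
        Real.exp u * Real.exp u / poisson x₀ ξ := by
      rw [e1]; field_simp
    rw [cosh_dist_horo x₀ h, e2, Real.cosh_eq, neg_sub, Real.exp_sub, Real.exp_sub, Real.exp_neg]
    have := Real.exp_pos u
    have := Real.exp_pos s
    field_simp
  rw [← abs_of_nonneg (dist_nonneg (x := x₀) (y := horo ξ η s)),
    ← abs_of_nonneg (dist_nonneg (x := x₀) (y := horo ξ η s')), ← Real.cosh_le_cosh,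
    ← Real.cosh_le_cosh, ← mul_le_mul_iff_right₀ (two_pos (α := ℝ)), key, key,
    mul_le_mul_iff_right₀ (by positivity)]

/-- The time of Hopf is defined by a choice of a closest point to `x₀` on the geodesic line; this
point is unique, so the choice is determined. -/
theorem hopfTime_eq (x₀ : Hyp n) (v : UnitTangent n) : hopfTime x₀ v =
    Real.log (poisson v.base v.plusEnd) - lineFoot x₀ v.minusEnd v.plusEnd := by
  obtain ⟨hne, hv⟩ := exists_eq_toward_horo v
  set r := Real.log (poisson v.base v.plusEnd)
  set u := lineFoot x₀ v.minusEnd v.plusEnd with hu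
  have ht : ∀ t, v.toFun t = horo v.plusEnd v.minusEnd (r + t) := fun t =>
    (congrArg (fun w => w.toFun t) hv).trans (toward_horo_toFun hne r t)
  have key : ∀ t, (∀ s, dist x₀ (v.toFun (-t)) ≤ dist x₀ (v.toFun s)) ↔ t = r - u := by
    intro t
    simp only [ht, dist_horo_le_iff x₀ hne, ← hu]
    constructor
    · intro h
      have h1 := h (u - r)
      rw [add_sub_cancel, sub_self, abs_zero] at h1
      have := abs_eq_zero.1 (le_antisymm h1 (abs_nonneg _))
      linarith
    · rintro rfl s
      have : r + -(r - u) - u = 0 := by ring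
      rw [this, abs_zero]
      exact abs_nonneg _
  have hex : ∃ t, ∀ s, dist x₀ (v.toFun (-t)) ≤ dist x₀ (v.toFun s) := ⟨r - u, (key _).2 rfl⟩
  exact (key _).1 (Classical.epsilon_spec hex)

/-- The inverse of Hopf's parametrisation. -/
def hopfInv (x₀ : Hyp n) (z : (Bdry n × Bdry n) × ℝ) : UnitTangent n :=
  toward (horo z.1.2 z.1.1 (z.2 + lineFoot x₀ z.1.1 z.1.2)) z.1.2

theorem hopfInv_hopf (x₀ : Hyp n) (v : UnitTangent n) : hopfInv x₀ (hopf x₀ v) = v := by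
  conv_rhs => rw [(exists_eq_toward_horo v).2]
  simp only [hopfInv, hopf, hopfTime_eq, sub_add_cancel]

theorem hopf_hopfInv (x₀ : Hyp n) {z : (Bdry n × Bdry n) × ℝ} (h : z.1.1 ≠ z.1.2) :
    hopf x₀ (hopfInv x₀ z) = z := by
  rw [hopf, hopfTime_eq, hopfInv]
  simp only [minusEnd_toward_horo h, plusEnd_toward, base_toward, poisson_horo h, Real.log_exp,
    add_sub_cancel_right]

theorem measurable_lineFoot (x₀ : Hyp n) :
    Measurable fun z : Bdry n × Bdry n => lineFoot x₀ z.1 z.2 := by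
  have h := (continuous_poisson_right x₀).measurable
  unfold lineFoot
  have h1 : Measurable fun z : Bdry n × Bdry n => poisson x₀ z.2 := h.comp measurable_snd
  have h2 : Measurable fun z : Bdry n × Bdry n => poisson x₀ z.1 := h.comp measurable_fst
  fun_prop

theorem measurable_hopf (x₀ : Hyp n) : Measurable (hopf x₀) := by
  have h1 := (UnitTangent.continuous_minusEnd (n := n)).measurable
  have h2 := (UnitTangent.continuous_plusEnd (n := n)).measurable
  have h0 : Measurable fun v : UnitTangent n => (v.minusEnd, v.plusEnd) := h1.prodMk h2
  have h3 : Measurable fun v : UnitTangent n => poisson v.base v.plusEnd := by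
    have h : Continuous fun v : UnitTangent n => (v.base, v.plusEnd) :=
      UnitTangent.continuous_base.prodMk UnitTangent.continuous_plusEnd
    have := continuous_poisson.comp h
    exact this.measurable
  have h4 : Measurable fun v : UnitTangent n => lineFoot x₀ v.minusEnd v.plusEnd := by
    have := (measurable_lineFoot x₀).comp h0
    exact this
  have h5 : Measurable (hopfTime (n := n) x₀) := by
    have h6 : Measurable fun v : UnitTangent n =>
        Real.log (poisson v.base v.plusEnd) - lineFoot x₀ v.minusEnd v.plusEnd := h3.log.sub h4
    exact (funext (hopfTime_eq x₀)) ▸ h6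
  exact h0.prodMk h5

theorem measurableEmbedding_hopf (x₀ : Hyp n) : MeasurableEmbedding (hopf x₀) :=
  (measurable_hopf x₀).measurableEmbedding (Function.LeftInverse.injective (hopfInv_hopf x₀))

theorem measurable_hopfInv (x₀ : Hyp n) : Measurable (hopfInv x₀) := by
  have h1 : Measurable fun z : (Bdry n × Bdry n) × ℝ => lineFoot x₀ z.1.1 z.1.2 :=
    (measurable_lineFoot x₀).comp measurable_fst
  have h4 : Measurable fun z : (Bdry n × Bdry n) × ℝ => z.1.2 :=
    measurable_snd.comp measurable_fst
  have h5 : Measurable fun z : (Bdry n × Bdry n) × ℝ => z.1.1 :=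
    measurable_fst.comp measurable_fst
  have h6 : Measurable fun z : (Bdry n × Bdry n) × ℝ => z.2 + lineFoot x₀ z.1.1 z.1.2 :=
    measurable_snd.add h1
  have h2 : Measurable fun z : (Bdry n × Bdry n) × ℝ =>
      (z.1.2, z.1.1, z.2 + lineFoot x₀ z.1.1 z.1.2) := h4.prodMk (h5.prodMk h6)
  have h3 : Measurable fun z : (Bdry n × Bdry n) × ℝ =>
      horo z.1.2 z.1.1 (z.2 + lineFoot x₀ z.1.1 z.1.2) := by
    have := measurable_horo.comp h2
    exact this
  have h7 := h3.prodMk h4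
  have := measurable_toward.comp h7
  exact this

/-- The image of Hopf's parametrisation misses only the pairs of equal endpoints. -/
theorem comap_hopf (x₀ : Hyp n) {ν : Measure ((Bdry n × Bdry n) × ℝ)}
    (hν : ∀ᵐ z ∂ν, z.1.1 ≠ z.1.2) : ν.comap (hopf x₀) = ν.map (hopfInv x₀) := by
  ext A hA
  rw [(measurableEmbedding_hopf x₀).comap_apply, Measure.map_apply (measurable_hopfInv x₀) hA]
  refine measure_congr ?_
  filter_upwards [hν] with z hz
  refine propext ⟨?_, fun h => ⟨_, h, hopf_hopfInv x₀ hz⟩⟩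
  rintro ⟨v, hv, rfl⟩
  change hopfInv x₀ (hopf x₀ v) ∈ A
  rwa [hopfInv_hopf]

end Hyp

namespace Hyp

variable {n k j m : ℕ}

/-! ### The Liouville and Bowen-Margulis measures -/

theorem fibreVol_univ (x : Hyp n) (d : ℕ) : fibreVol d Set.univ x =
    (μHE[d] : Measure (Bdry n)).map (UnitTangent.ofDir x) := by
  simp [fibreVol]

theorem continuous_ofDir_right (x : Hyp n) : Continuous fun e => UnitTangent.ofDir x e := by
  have h : Continuous fun e : Bdry n => (x, e) := by fun_prop
  have := UnitTangent.continuous_ofDir.comp h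
  exact this

theorem measurable_fibreVol_univ :
    Measurable (fibreVol m (Set.univ : Set (UnitTangent (m + 1)))) := by
  refine Measure.measurable_of_measurable_coe _ fun A hA => ?_
  have hS : MeasurableSet {z : Hyp (m + 1) × Bdry (m + 1) | UnitTangent.ofDir z.1 z.2 ∈ A} := by
    have h := (UnitTangent.continuous_ofDir (n := m + 1)).measurable
    have := h hA
    exact this
  have h := measurable_measure_prodMk_left (ν := (μHE[m] : Measure (Bdry (m + 1)))) hS
  have e : (fun x : Hyp (m + 1) => fibreVol m (Set.univ : Set (UnitTangent (m + 1))) x A) =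
      fun x => (μHE[m] : Measure (Bdry (m + 1))) {e | UnitTangent.ofDir x e ∈ A} := by
    funext x
    rw [fibreVol_univ, Measure.map_apply (continuous_ofDir_right x).measurable hA]
    rfl
  rw [e]
  exact h

theorem lintegral_liouville {f : UnitTangent (m + 1) → ℝ≥0∞} (hf : Measurable f) :
    ∫⁻ v, f v ∂liouville = ∫⁻ x : Hyp (m + 1), (∫⁻ e : Bdry (m + 1), f (UnitTangent.ofDir x e)
      ∂(μHE[m] : Measure (Bdry (m + 1)))) ∂(μHE[m + 1] : Measure (Hyp (m + 1))) := by
  rw [liouville, riemVol, Measure.restrict_univ, show m + 1 - 1 = m from rfl,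
    Measure.lintegral_bind measurable_fibreVol_univ.aemeasurable hf.aemeasurable]
  refine lintegral_congr fun x => ?_
  rw [fibreVol_univ, lintegral_map hf (continuous_ofDir_right x).measurable]

theorem visual_eq_withDensity (x : Hyp (m + 1)) : visual x =
    (μHE[m] : Measure (Bdry (m + 1))).withDensity fun ξ => ENNReal.ofReal (poisson x ξ ^ (m : ℝ)) := by
  simp only [Real.rpow_natCast]
  rfl

/-- The Liouville measure has the visual measures as conditional measures, since the sphere of
directions at `x` is identified with the sphere at infinity by `mobBdry x`. -/
theorem liouville_eq_dirMeasure : (liouville : Measure (UnitTangent (m + 1))) =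
    dirMeasure (μHE[m] : Measure (Bdry (m + 1))) m := by
  refine Measure.ext_of_lintegral _ fun f hf => ?_
  rw [lintegral_liouville hf, lintegral_dirMeasure _ _ hf]
  refine lintegral_congr fun x => ?_
  have hfx : Measurable fun ξ => f (toward x ξ) := hf.comp (measurable_toward_right x)
  rw [← visual_eq_withDensity, ← map_mobBdry_eq_visual,
    lintegral_map hfx (continuous_mobBdry_right x).measurable]
  simp only [toward_mobBdry]

theorem map_smul_liouville (g : Hyp (m + 1) ≃ᵢ Hyp (m + 1)) :
    (liouville : Measure (UnitTangent (m + 1))).map (fun v => g • v) = liouville := by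
  rw [liouville_eq_dirMeasure]
  refine map_dirMeasure fun x => ?_
  rw [← visual_eq_withDensity, ← visual_eq_withDensity, map_bdryMap_visual]

theorem lintegral_liouville_base {w : Hyp (m + 1) → ℝ≥0∞} (hw : Measurable w) :
    ∫⁻ v, w v.base ∂liouville =
      sphereVol m * ∫⁻ x, w x ∂(μHE[m + 1] : Measure (Hyp (m + 1))) := by
  have hb : Measurable fun v : UnitTangent (m + 1) => w v.base :=
    hw.comp UnitTangent.continuous_base.measurable
  rw [lintegral_liouville hb, ← lintegral_const_mul _ hw]
  refine lintegral_congr fun x => ?_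
  simp only [UnitTangent.base_ofDir]
  rw [lintegral_const, mul_comm]
  rfl

/-- Integral of a function on the unit tangent bundle over the geodesic line from `η` to `ξ`. -/
def lineIntegral (f : UnitTangent n → ℝ≥0∞) (η ξ : Bdry n) : ℝ≥0∞ :=
  ∫⁻ s : ℝ, f (toward (horo ξ η s) ξ)

theorem measurable_toward_horo : Measurable fun z : (Bdry n × Bdry n) × ℝ =>
    toward (horo z.1.2 z.1.1 z.2) z.1.2 := by
  have h1 : Measurable fun z : (Bdry n × Bdry n) × ℝ => z.1.2 := measurable_snd.comp measurable_fst
  have h2 : Measurable fun z : (Bdry n × Bdry n) × ℝ => z.1.1 := measurable_fst.comp measurable_fst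
  have h3 : Measurable fun z : (Bdry n × Bdry n) × ℝ => (z.1.2, z.1.1, z.2) :=
    h1.prodMk (h2.prodMk measurable_snd)
  have h4 : Measurable fun z : (Bdry n × Bdry n) × ℝ => horo z.1.2 z.1.1 z.2 := by
    have := measurable_horo.comp h3
    exact this
  have h5 := h4.prodMk h1
  have := measurable_toward.comp h5
  exact this

theorem measurable_lineIntegral {f : UnitTangent n → ℝ≥0∞} (hf : Measurable f) :
    Measurable fun z : Bdry n × Bdry n => lineIntegral f z.1 z.2 := by
  have h : Measurable fun z : (Bdry n × Bdry n) × ℝ => f (toward (horo z.1.2 z.1.1 z.2) z.1.2) := by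
    have := hf.comp measurable_toward_horo
    exact this
  exact h.lintegral_prod_right' (ν := (volume : Measure ℝ))

theorem ae_ne (hm : 1 ≤ m) (ξ : Bdry (m + 1)) : ∀ᵐ η ∂(μHE[m] : Measure (Bdry (m + 1))), η ≠ ξ := by
  rw [ae_iff]
  have : {η : Bdry (m + 1) | ¬η ≠ ξ} = {ξ} := by ext; simp
  rw [this, euclideanHausdorffMeasure_singleton hm]

/-- The Liouville measure in terms of the endpoints. -/
theorem lintegral_liouville_endpoints (hm : 1 ≤ m) {f : UnitTangent (m + 1) → ℝ≥0∞}
    (hf : Measurable f) : ∫⁻ v, f v ∂liouville =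
      ∫⁻ ξ : Bdry (m + 1), (∫⁻ η : Bdry (m + 1),
        ENNReal.ofReal ((2 / ‖(η : Euc (m + 1)) - ξ‖ ^ 2) ^ m) * lineIntegral f η ξ
        ∂(μHE[m] : Measure (Bdry (m + 1)))) ∂(μHE[m] : Measure (Bdry (m + 1))) := by
  rw [liouville_eq_dirMeasure, lintegral_dirMeasure_horo hm _ _ hf]
  refine lintegral_congr fun ξ => lintegral_congr fun η => ?_
  have h1 : Measurable fun s : ℝ => f (toward (horo ξ η s) ξ) := by
    have h2 : Measurable fun s : ℝ => ((η, ξ), s) := measurable_prodMk_left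
    have := (hf.comp measurable_toward_horo).comp h2
    exact this
  rw [lineIntegral, ← lintegral_const_mul _ h1]
  refine lintegral_congr fun s => ?_
  rw [← mul_assoc, ← ENNReal.ofReal_mul (by positivity)]
  congr 2
  rw [mul_comm s, mul_comm (m : ℝ) s, mul_comm s, Real.exp_nat_mul, ← mul_pow, Real.exp_neg]
  have := Real.exp_pos s
  congr 1
  field_simp

theorem lintegral_visual (x : Hyp (m + 1)) {f : Bdry (m + 1) → ℝ≥0∞} (hf : Measurable f) :
    ∫⁻ ξ, f ξ ∂visual x = ∫⁻ ξ, ENNReal.ofReal (poisson x ξ ^ m) * f ξ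
      ∂(μHE[m] : Measure (Bdry (m + 1))) := by
  rw [visual, lintegral_withDensity_eq_lintegral_mul _ (measurable_poisson_pow x m) hf]
  rfl

/-- The density of the Bowen-Margulis measure along the geodesic line from `η` to `ξ`. -/
theorem exp_busemann_horo (x₀ : Hyp n) {ξ η : Bdry n} (h : η ≠ ξ) (s : ℝ) :
    Real.exp ((m : ℝ) * busemann η x₀ (horo ξ η s) + m * busemann ξ x₀ (horo ξ η s)) =
      (4 / (‖(η : Euc n) - ξ‖ ^ 2 * (poisson x₀ η * poisson x₀ ξ))) ^ m := by
  rw [Real.exp_add, exp_mul_busemann, exp_mul_busemann, poisson_horo h, poisson_horo_self h,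
    Real.rpow_natCast, Real.rpow_natCast, ← mul_pow]
  have := Real.exp_pos s
  have := norm_bdry_sub_pos h
  have := poisson_pos x₀ ξ
  have := poisson_pos x₀ η
  congr 1
  field_simp

/-- The Bowen-Margulis measure in terms of the endpoints. -/
theorem lintegral_bowenMargulis {Γ : Subgroup (Hyp (m + 1) ≃ᵢ Hyp (m + 1))}
    {μ : Hyp (m + 1) → Measure (Bdry (m + 1))} (hm : 1 ≤ m) (hδ : critExp Γ = m)
    (hμ : ∀ x, μ x = visual x) (x₀ : Hyp (m + 1)) {f : UnitTangent (m + 1) → ℝ≥0∞}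
    (hf : Measurable f) : ∫⁻ v, f v ∂bowenMargulis Γ μ x₀ =
      ∫⁻ ξ : Bdry (m + 1), (∫⁻ η : Bdry (m + 1),
        ENNReal.ofReal ((4 / ‖(η : Euc (m + 1)) - ξ‖ ^ 2) ^ m) * lineIntegral f η ξ
        ∂(μHE[m] : Measure (Bdry (m + 1)))) ∂(μHE[m] : Measure (Bdry (m + 1))) := by
  set D : UnitTangent (m + 1) → ℝ≥0∞ := fun v =>
    ENNReal.ofReal (Real.exp ((m : ℝ) * busemann v.minusEnd x₀ v.base +
      m * busemann v.plusEnd x₀ v.base)) with hD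
  have hDm : Measurable D := by
    have h1 : Continuous fun v : UnitTangent (m + 1) => (v.base, v.minusEnd) :=
      UnitTangent.continuous_base.prodMk UnitTangent.continuous_minusEnd
    have h2 : Continuous fun v : UnitTangent (m + 1) => (v.base, v.plusEnd) :=
      UnitTangent.continuous_base.prodMk UnitTangent.continuous_plusEnd
    have h3 : Measurable fun v : UnitTangent (m + 1) => poisson v.base v.minusEnd := by
      have := continuous_poisson.comp h1
      exact this.measurable
    have h4 : Measurable fun v : UnitTangent (m + 1) => poisson v.base v.plusEnd := by
      have := continuous_poisson.comp h2
      exact this.measurable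
    have h5 : Measurable fun v : UnitTangent (m + 1) => poisson x₀ v.minusEnd :=
      ((continuous_poisson_right x₀).comp UnitTangent.continuous_minusEnd).measurable
    have h6 : Measurable fun v : UnitTangent (m + 1) => poisson x₀ v.plusEnd :=
      ((continuous_poisson_right x₀).comp UnitTangent.continuous_plusEnd).measurable
    simp only [hD, busemann_eq]
    exact ((((h3.log.sub h5.log).const_mul _).add
      ((h4.log.sub h6.log).const_mul _)).exp).ennreal_ofReal
  have hae : ∀ᵐ z ∂((visual x₀).prod (visual x₀)).prod (volume : Measure ℝ), z.1.1 ≠ z.1.2 := by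
    have hms : MeasurableSet {z : Bdry (m + 1) × Bdry (m + 1) | z.1 ≠ z.2} :=
      (isOpen_ne_fun continuous_fst continuous_snd).measurableSet
    have h1 : ∀ᵐ z ∂(visual x₀).prod (visual x₀), z.1 ≠ z.2 := by
      rw [Measure.ae_prod_iff_ae_ae hms]
      refine Eventually.of_forall fun ξ => ?_
      have h2 : visual x₀ ≪ (μHE[m] : Measure (Bdry (m + 1))) := withDensity_absolutelyContinuous _ _
      filter_upwards [h2 (ae_ne hm ξ)] with η hη using Ne.symm hη
    exact Measure.quasiMeasurePreserving_fst.ae h1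
  have hDf : Measurable fun z => D (hopfInv x₀ z) * f (hopfInv x₀ z) :=
    (hDm.comp (measurable_hopfInv x₀)).mul (hf.comp (measurable_hopfInv x₀))
  have hDf' : Measurable fun v => D v * f v := hDm.mul hf
  have hI := measurable_lineIntegral hf
  -- along a geodesic line the density is constant
  have hline : ∀ z : Bdry (m + 1) × Bdry (m + 1), z.1 ≠ z.2 →
      ∫⁻ t : ℝ, D (hopfInv x₀ (z, t)) * f (hopfInv x₀ (z, t)) =
        ENNReal.ofReal ((4 / (‖(z.1 : Euc (m + 1)) - z.2‖ ^ 2 *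
          (poisson x₀ z.1 * poisson x₀ z.2))) ^ m) * lineIntegral f z.1 z.2 := by
    intro z hz
    have h1 : Measurable fun s : ℝ => f (toward (horo z.2 z.1 s) z.2) := by
      have h2 : Measurable fun s : ℝ => (z, s) := measurable_prodMk_left
      have := (hf.comp measurable_toward_horo).comp h2
      exact this
    rw [lineIntegral, ← lintegral_const_mul _ h1]
    conv_rhs => rw [← lintegral_add_right_eq_self _ (lineFoot x₀ z.1 z.2)]
    refine lintegral_congr fun t => ?_
    simp only [hD, hopfInv, minusEnd_toward_horo hz, plusEnd_toward, base_toward,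
      exp_busemann_horo x₀ hz]
  have hM : Measurable fun z : Bdry (m + 1) × Bdry (m + 1) =>
      ENNReal.ofReal ((4 / (‖(z.1 : Euc (m + 1)) - z.2‖ ^ 2 *
          (poisson x₀ z.1 * poisson x₀ z.2))) ^ m) * lineIntegral f z.1 z.2 := by
    have h1 : Measurable fun z : Bdry (m + 1) × Bdry (m + 1) => poisson x₀ z.1 :=
      ((continuous_poisson_right x₀).comp continuous_fst).measurable
    have h2 : Measurable fun z : Bdry (m + 1) × Bdry (m + 1) => poisson x₀ z.2 :=
      ((continuous_poisson_right x₀).comp continuous_snd).measurable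
    exact Measurable.mul (by fun_prop) hI
  have h1 : bowenMargulis Γ μ x₀ =
      ((((visual x₀).prod (visual x₀)).prod volume).map (hopfInv x₀)).withDensity D := by
    rw [bowenMargulis, hμ, hδ, comap_hopf x₀ hae]
  rw [h1, lintegral_withDensity_eq_lintegral_mul _ hDm hf]
  change ∫⁻ v, D v * f v ∂_ = _
  rw [lintegral_map hDf' (measurable_hopfInv x₀), lintegral_prod _ hDf.aemeasurable]
  have h2 : ∀ᵐ z ∂(visual x₀).prod (visual x₀), z.1 ≠ z.2 := by
    have h3 := Measure.ae_ae_of_ae_prod hae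
    filter_upwards [h3] with z hz
    obtain ⟨t, ht⟩ := hz.exists
    exact ht
  rw [lintegral_congr_ae (h2.mono hline), lintegral_prod_symm _ hM.aemeasurable]
  have hM1 : ∀ ξ : Bdry (m + 1), Measurable fun η : Bdry (m + 1) =>
      ENNReal.ofReal ((4 / (‖(η : Euc (m + 1)) - ξ‖ ^ 2 *
          (poisson x₀ η * poisson x₀ ξ))) ^ m) * lineIntegral f η ξ := fun ξ => by
    have h : Measurable fun η : Bdry (m + 1) => (η, ξ) := measurable_prodMk_right
    have := hM.comp h
    exact this
  rw [lintegral_visual _ (hM.lintegral_prod_left' (μ := visual x₀))]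
  refine lintegral_congr fun ξ => ?_
  rw [lintegral_visual _ (hM1 ξ), ← lintegral_const_mul' _ _ ENNReal.ofReal_ne_top]
  refine lintegral_congr fun η => ?_
  rw [← mul_assoc, ← mul_assoc, ← ENNReal.ofReal_mul (by have := poisson_pos x₀ ξ; positivity),
    ← ENNReal.ofReal_mul
      (by have := poisson_pos x₀ ξ; have := poisson_pos x₀ η; positivity), ← mul_pow, ← mul_pow]
  congr 3
  have h3 := poisson_pos x₀ ξ
  have h4 := poisson_pos x₀ η
  rw [← div_div, mul_div_assoc', mul_comm (poisson x₀ η), mul_div_cancel_left₀ _ (by positivity)]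

/-- In terms of the endpoints the two measures have densities `(4 / ‖η - ξ‖ ^ 2) ^ m` and `(2 / ‖η -
ξ‖ ^ 2) ^ m`. -/
theorem bowenMargulis_eq {Γ : Subgroup (Hyp (m + 1) ≃ᵢ Hyp (m + 1))}
    {μ : Hyp (m + 1) → Measure (Bdry (m + 1))} (hm : 1 ≤ m) (hδ : critExp Γ = m)
    (hμ : ∀ x, μ x = visual x) (x₀ : Hyp (m + 1)) :
    bowenMargulis Γ μ x₀ = (2 : ℝ≥0∞) ^ m • liouville := by
  refine Measure.ext_of_lintegral _ fun f hf => ?_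
  rw [lintegral_bowenMargulis hm hδ hμ x₀ hf, lintegral_smul_measure,
    lintegral_liouville_endpoints hm hf, smul_eq_mul,
    ← lintegral_const_mul' _ _ (ENNReal.pow_ne_top ENNReal.ofNat_ne_top)]
  refine lintegral_congr fun ξ => ?_
  rw [← lintegral_const_mul' _ _ (ENNReal.pow_ne_top ENNReal.ofNat_ne_top)]
  refine lintegral_congr fun η => ?_
  rw [← mul_assoc]
  congr 1
  have h2 : (2 : ℝ≥0∞) ^ m = ENNReal.ofReal (2 ^ m) := by
    rw [ENNReal.ofReal_pow zero_le_two, ENNReal.ofReal_ofNat]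
  rw [h2, ← ENNReal.ofReal_mul (by positivity), ← mul_pow]
  congr 2
  ring

end Hyp

namespace Hyp

variable {n k j m : ℕ}

/-! ### The Bowen-Margulis measure of the quotient -/

section

variable {Γ : Subgroup (Hyp (m + 1) ≃ᵢ Hyp (m + 1))} {μ : Hyp (m + 1) → Measure (Bdry (m + 1))}

theorem measurable_quotientBase : Measurable (quotientBase Γ) := by
  refine measurable_from_quotient.2 ?_
  have h := (measurable_qmk (G := Γ)).comp (UnitTangent.continuous_base (n := m + 1)).measurable
  exact h

theorem map_gamma_liouville (γ : Γ) :
    (liouville : Measure (UnitTangent (m + 1))).map (fun v => γ • v) = liouville :=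
  map_smul_liouville (γ : Hyp (m + 1) ≃ᵢ Hyp (m + 1))

theorem map_gamma_volume (γ : Γ) :
    (μHE[m + 1] : Measure (Hyp (m + 1))).map (fun x => γ • x) = μHE[m + 1] :=
  map_isometry_volume (γ : Hyp (m + 1) ≃ᵢ Hyp (m + 1))

theorem map_base_liouville : (liouville : Measure (UnitTangent (m + 1))).map UnitTangent.base =
    sphereVol m • (μHE[m + 1] : Measure (Hyp (m + 1))) := by
  refine Measure.ext_of_lintegral _ fun f hf => ?_
  rw [lintegral_map hf UnitTangent.continuous_base.measurable, lintegral_liouville_base hf,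
    lintegral_smul_measure, smul_eq_mul]

theorem measure_fixed_liouville {γ : Γ} (h : γ ≠ 1) :
    (liouville : Measure (UnitTangent (m + 1))) {v | γ • v = v} = 0 := by
  have h0 := measure_fixed_volume h
  have hS : MeasurableSet {x : Hyp (m + 1) | γ • x = x} :=
    (isClosed_eq (γ : Hyp (m + 1) ≃ᵢ Hyp (m + 1)).continuous continuous_id).measurableSet
  have h1 : (liouville : Measure (UnitTangent (m + 1))).map UnitTangent.base
      {x : Hyp (m + 1) | γ • x = x} = 0 := by
    rw [map_base_liouville, Measure.smul_apply, h0, smul_zero]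
  rw [Measure.map_apply UnitTangent.continuous_base.measurable hS] at h1
  refine measure_mono_null (fun v hv => ?_) h1
  exact congrArg UnitTangent.base (show γ • v = v from hv)

theorem map_quotientBase_liouville (hΓ : IsDiscreteGroup Γ) :
    (quotientMeasure Γ (liouville : Measure (UnitTangent (m + 1)))).map (quotientBase Γ) =
      sphereVol m • quotientMeasure Γ (riemVol (m + 1) (Set.univ : Set (Hyp (m + 1)))) := by
  obtain ⟨w, hw⟩ := hΓ.isProperAction.exists_isWeight
  have hb : IsWeight Γ fun v : UnitTangent (m + 1) => w v.base :=
    hw.comp UnitTangent.continuous_base.measurable fun γ v => rfl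
  ext B hB
  have hq : MeasurableSet (qmk Γ ⁻¹' B : Set (Hyp (m + 1))) := measurable_qmk hB
  rw [Measure.map_apply measurable_quotientBase hB,
    hΓ.isProperAction_unitTangent.quotientMeasure_apply map_gamma_liouville hb
      (fun γ h => measure_fixed_liouville h) (measurable_quotientBase hB), riemVol,
    Measure.restrict_univ, Measure.smul_apply,
    hΓ.isProperAction.quotientMeasure_apply map_gamma_volume hw
      (fun γ h => measure_fixed_volume h) hB, smul_eq_mul, ← lintegral_indicator hq,
    ← lintegral_liouville_base (hw.measurable.indicator hq),
    ← lintegral_indicator (measurable_qmk (measurable_quotientBase hB))]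
  rfl

theorem quotientMeasure_liouville_univ (hΓ : IsDiscreteGroup Γ) :
    quotientMeasure Γ (liouville : Measure (UnitTangent (m + 1))) Set.univ =
      sphereVol m * quotientVol Γ (riemVol (m + 1) (Set.univ : Set (Hyp (m + 1)))) := by
  have h := congrArg (fun ν => ν Set.univ) (map_quotientBase_liouville hΓ)
  simp only [Measure.map_apply measurable_quotientBase MeasurableSet.univ, Set.preimage_univ,
    Measure.smul_apply, smul_eq_mul] at h
  exact h

/-- Almost all unit tangent vectors have a trivial stabiliser, so that the induced measure and the
quotient measure agree. -/
theorem inducedMeasure_bowenMargulis (hm : 1 ≤ m) (hΓ : IsDiscreteGroup Γ) (hδ : critExp Γ = m)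
    (hμ : ∀ x, μ x = visual x) (x₀ : Hyp (m + 1)) :
    inducedMeasure Γ (bowenMargulis Γ μ x₀) = (2 : ℝ≥0∞) ^ m • quotientMeasure Γ liouville := by
  rw [bowenMargulis_eq hm hδ hμ]
  exact hΓ.isProperAction_unitTangent.inducedMeasure_smul_eq map_gamma_liouville _
    fun γ h => measure_fixed_liouville h

/-! ### Families of skinning measures -/

theorem mem_stabilizer_image {D : Set (Hyp (m + 1))} (γ : MulAction.stabilizer Γ D) :
    (γ.1 : Hyp (m + 1) ≃ᵢ Hyp (m + 1)) '' D = D := γ.2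

/-- The mass of the skinning measure of a family, computed on one member of the family by means of a
weight for its stabiliser. -/
theorem inducedMeasure_familySkinning (hΓ : IsDiscreteGroup Γ) (hδ : critExp Γ = m)
    (hμ : ∀ x, μ x = visual x) (x₀ : Hyp (m + 1)) {s : Sgn} {D : Set (Hyp (m + 1))}
    {ν : Bdry (m + 1) → UnitTangent (m + 1)} {Ω : Set (Bdry (m + 1))} (h : IsEndParam s D ν Ω)
    {w : Hyp (m + 1) → ℝ≥0∞} (hw : IsWeight (MulAction.stabilizer Γ D) w) :
    inducedMeasure Γ (familySkinning Γ μ x₀ s D) Set.univ =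
      ∫⁻ x, w x ∂((skinning Γ μ x₀ s D).map UnitTangent.base) := by
  have := hΓ.countable
  have hact := hΓ.isProperAction_unitTangent
  have hσ : ∀ (γ : Γ), ∀ D' ∈ MulAction.orbit Γ D, skinning Γ μ x₀ s (γ • D') =
      (skinning Γ μ x₀ s D').map fun v => γ • v := by
    rintro γ _ ⟨γ', rfl⟩
    exact (h.smul (γ' : Hyp (m + 1) ≃ᵢ Hyp (m + 1))).skinning_image hδ hμ x₀
      (γ : Hyp (m + 1) ≃ᵢ Hyp (m + 1))
  obtain ⟨w', hw'⟩ := hact.exists_isWeight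
  have hb : IsWeight (MulAction.stabilizer Γ D) fun v : UnitTangent (m + 1) => w v.base :=
    hw.comp UnitTangent.continuous_base.measurable fun γ v => rfl
  rw [familySkinning, hact.inducedMeasure_univ
    (map_sum_orbit (σ := skinning Γ μ x₀ s) hact.measurable_smul hσ) hw',
    lintegral_sum_orbit (σ := skinning Γ μ x₀ s) hact.measurable_smul hσ hw' hb,
    lintegral_map hw.measurable UnitTangent.continuous_base.measurable]

theorem IsDiscreteGroup.exists_isWeight_stabilizer (hΓ : IsDiscreteGroup Γ)
    (D : Set (Hyp (m + 1))) : ∃ w : Hyp (m + 1) → ℝ≥0∞, IsWeight (MulAction.stabilizer Γ D) w :=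
  (hΓ.isProperAction.subgroup _).exists_isWeight

theorem map_stabilizer_riemVol (d : ℕ) {D : Set (Hyp (m + 1))} (γ : MulAction.stabilizer Γ D) :
    (riemVol d D).map (fun x => γ • x) = riemVol d D := by
  have h := map_riemVol (γ.1 : Hyp (m + 1) ≃ᵢ Hyp (m + 1)) d D
  rwa [mem_stabilizer_image γ] at h

theorem coe_coe_ne_one {D : Set (Hyp (m + 1))} {γ : MulAction.stabilizer Γ D} (h : γ ≠ 1) :
    (γ.1 : Hyp (m + 1) ≃ᵢ Hyp (m + 1)) ≠ 1 := coe_ne_one fun h1 => h (Subtype.ext h1)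

/-- The volume modulo its stabiliser of the unit normal bundle of a convex set, by means of a weight
on the set itself. -/
theorem quotientVol_normal (hΓ : IsDiscreteGroup Γ) {D : Set (Hyp (m + 1))}
    {ν : Measure (UnitTangent (m + 1))}
    (hν : ∀ γ : MulAction.stabilizer Γ D, ν.map (fun v => γ • v) = ν)
    (h0 : ∀ γ : MulAction.stabilizer Γ D, γ ≠ 1 → ν {v | γ • v = v} = 0)
    {w : Hyp (m + 1) → ℝ≥0∞} (hw : IsWeight (MulAction.stabilizer Γ D) w) :
    quotientVol (MulAction.stabilizer Γ D) ν = ∫⁻ x, w x ∂(ν.map UnitTangent.base) := by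
  have hb : IsWeight (MulAction.stabilizer Γ D) fun v : UnitTangent (m + 1) => w v.base :=
    hw.comp UnitTangent.continuous_base.measurable fun γ v => rfl
  rw [(hΓ.isProperAction_unitTangent.subgroup _).quotientVol_eq_of_free hν hb h0,
    lintegral_map hw.measurable UnitTangent.continuous_base.measurable]

/-! ### Horoballs -/

theorem map_normalVol_hball (s : Sgn) {ξ : Bdry (m + 1)} {t : ℝ}
    (γ : MulAction.stabilizer Γ (hball ξ t)) :
    (normalVol m s (hball ξ t)).map (fun v => γ • v) = normalVol m s (hball ξ t) := by
  set g := (γ.1 : Hyp (m + 1) ≃ᵢ Hyp (m + 1)) with hg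
  have him : g '' hball ξ t = hball ξ t := mem_stabilizer_image γ
  have hfr : g '' frontier (hball ξ t) = frontier (hball ξ t) := by
    rw [← IsometryEquiv.coe_toHomeomorph, Homeomorph.image_frontier]
    exact congrArg frontier him
  have hc := (continuous_horoNormal s ξ).measurable
  have hsm : Measurable fun v : UnitTangent (m + 1) => g • v :=
    (UnitTangent.continuous_smul g).measurable
  have hcomp : (fun v : UnitTangent (m + 1) => g • v) ∘ horoNormal s ξ = horoNormal s ξ ∘ g := by
    funext x
    rw [Function.comp_apply, smul_horoNormal, bdryMap_eq_of_image_hball him]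
    rfl
  have h1 : ((riemVol m (frontier (hball ξ t))).map (horoNormal s ξ)).map (fun v => g • v) =
      (riemVol m (frontier (hball ξ t))).map (horoNormal s ξ) := by
    rw [Measure.map_map hsm hc, hcomp, ← Measure.map_map hc g.continuous.measurable, map_riemVol,
      hfr]
  rw [normalVol_hball]
  exact h1

theorem quotientVol_normalVol_hball (hm : 1 ≤ m) (hΓ : IsDiscreteGroup Γ) (s : Sgn)
    (ξ : Bdry (m + 1)) (t : ℝ) {w : Hyp (m + 1) → ℝ≥0∞}
    (hw : IsWeight (MulAction.stabilizer Γ (hball ξ t)) w) :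
    quotientVol (MulAction.stabilizer Γ (hball ξ t)) (normalVol m s (hball ξ t)) =
      ∫⁻ x, w x ∂riemVol m (frontier (hball ξ t)) := by
  rw [quotientVol_normal hΓ (map_normalVol_hball s) (fun γ h => ?_) hw, normalVol_hball,
    map_base_horoNormal]
  have hF : MeasurableSet {v : UnitTangent (m + 1) | γ • v = v} :=
    (hΓ.isProperAction_unitTangent.subgroup _).measurableSet_fixed γ
  rw [normalVol_hball, Measure.map_apply (continuous_horoNormal s ξ).measurable hF]
  refine measure_mono_null (fun x hx => ?_)
    (measure_fixedPoints_horosphere hm (coe_coe_ne_one h) (mem_stabilizer_image γ))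
  have h1 : γ • horoNormal s ξ x = horoNormal s ξ x := hx
  have h2 := congrArg UnitTangent.base h1
  rw [base_horoNormal] at h2
  exact (congrArg (γ.1 : Hyp (m + 1) ≃ᵢ Hyp (m + 1)) (base_horoNormal s ξ x).symm).trans h2

/-- The stabiliser commutes with the projection of the horoball to its boundary, so a weight on the
horosphere gives one on the horoball which is constant on the fibres of length `1 / m`. -/
theorem quotientVol_riemVol_hball (hm : 1 ≤ m) (hΓ : IsDiscreteGroup Γ)
    (ξ : Bdry (m + 1)) (t : ℝ) {w : Hyp (m + 1) → ℝ≥0∞}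
    (hw : IsWeight (MulAction.stabilizer Γ (hball ξ t)) w) :
    quotientVol (MulAction.stabilizer Γ (hball ξ t)) (riemVol (m + 1) (hball ξ t)) =
      (m : ℝ≥0∞)⁻¹ * ∫⁻ x, w x ∂riemVol m (frontier (hball ξ t)) := by
  have := hΓ.countable
  have hact := hΓ.isProperAction.subgroup (MulAction.stabilizer Γ (hball ξ t))
  have hw' : IsWeight (MulAction.stabilizer Γ (hball ξ t)) fun x => w (horoProj ξ t x) :=
    hw.comp (measurable_horoProj ξ t) fun γ x =>
      (smul_horoProj _ (bdryMap_eq_of_image_hball (mem_stabilizer_image γ))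
        (poisson_eq_of_image_hball (mem_stabilizer_image γ)) t x).symm
  have h1 := lintegral_isWeight hact.measurable_smul (map_stabilizer_riemVol (m + 1)) hw hw' (f := 1)
    measurable_one fun γ x => rfl
  simp only [Pi.one_apply, one_mul] at h1
  rw [hact.quotientVol_eq_of_free (map_stabilizer_riemVol (m + 1)) hw (fun γ h => ?_), h1,
    ← lintegral_map hw.measurable (measurable_horoProj ξ t), map_horoProj hm,
    lintegral_smul_measure, smul_eq_mul]
  exact Measure.restrict_le_self.absolutelyContinuous
    (measure_fixed_volume fun h1 => h (Subtype.ext h1))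

end

/-! ### Totally geodesic submanifolds -/

section

variable {Γ : Subgroup (Hyp (k + j + 1) ≃ᵢ Hyp (k + j + 1))}
  {μ : Hyp (k + j + 1) → Measure (Bdry (k + j + 1))}
  {g : Hyp (k + j + 1) ≃ᵢ Hyp (k + j + 1)} {L : Euc k →ₗᵢ[ℝ] Euc (k + j + 1)}
  {L' : Euc (j + 1) →ₗᵢ[ℝ] Euc (k + j + 1)}

/-- Only the trivial element of the stabiliser fixes a set of normal vectors of positive measure,
even if some elements fix the submanifold pointwise. -/
theorem quotientVol_normalVol_totallyGeodesic (hΓ : IsDiscreteGroup Γ)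
    (hδ : critExp Γ = ((k + j : ℕ) : ℝ)) (hμ : ∀ x, μ x = visual x) (x₀ : Hyp (k + j + 1)) (s : Sgn)
    (hLL : ∀ u w, inner ℝ (L u) (L' w) = 0) (hsup : ∀ x, ∃ u w, x = L u + L' w)
    {w : Hyp (k + j + 1) → ℝ≥0∞}
    (hw : IsWeight (MulAction.stabilizer Γ (g '' Set.range (emb L))) w) :
    quotientVol (MulAction.stabilizer Γ (g '' Set.range (emb L)))
      (normalVol k s (g '' Set.range (emb L))) =
      sphereVol j * ∫⁻ x, w x ∂riemVol k (g '' Set.range (emb L)) := by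
  obtain ⟨ν, Ω, h⟩ := exists_isEndParam_totallyGeodesic (g := g) hLL hsup s
  have heq : normalVol k s (g '' Set.range (emb L)) = skinning Γ μ x₀ s (g '' Set.range (emb L)) :=
    (normalVol_totallyGeodesic hLL hsup s).trans (skinning_totallyGeodesic hδ hμ x₀ s hLL hsup).symm
  rw [quotientVol_normal hΓ (fun γ => ?_) (fun γ hγ => ?_) hw, normalVol_totallyGeodesic hLL hsup,
    map_base_totallyGeodesic, lintegral_smul_measure, smul_eq_mul]
  · rw [heq]
    have := h.skinning_image hδ hμ x₀ (γ.1 : Hyp (k + j + 1) ≃ᵢ Hyp (k + j + 1))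
    rw [mem_stabilizer_image γ] at this
    exact this.symm
  · have hF : MeasurableSet {v : UnitTangent (k + j + 1) | γ • v = v} :=
      (hΓ.isProperAction_unitTangent.subgroup _).measurableSet_fixed γ
    rw [normalVol_totallyGeodesic hLL hsup,
      Measure.map_apply (continuous_normalVec g L L').measurable hF]
    exact measure_fixed_normalVec hLL hsup (coe_coe_ne_one hγ) (mem_stabilizer_image γ)

/-- At almost every point of a totally geodesic submanifold, the stabiliser consists of the elements
that fix the submanifold pointwise. -/
theorem ae_stabCard_totallyGeodesic (hΓ : IsDiscreteGroup Γ) :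
    ∀ᵐ x ∂riemVol k (g '' Set.range (emb L)),
      stabCard (MulAction.stabilizer Γ (g '' Set.range (emb L))) x =
        (Nat.card {γ : Γ // ∀ x ∈ g '' Set.range (emb L), γ • x = x} : ℕ) := by
  have := hΓ.countable
  set D := g '' Set.range (emb L) with hD
  have hemb : MeasurableEmbedding fun y => g (emb L y) :=
    (g.isometry.comp (isometry_emb L)).isClosedEmbedding.measurableEmbedding
  rw [hD, riemVol_image_emb, ← hD, hemb.ae_map_iff]
  have h1 : ∀ᵐ y ∂(μHE[k] : Measure (Hyp k)), ∀ γ : MulAction.stabilizer Γ D,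
      γ • g (emb L y) = g (emb L y) → ∀ x ∈ D, γ.1 • x = x := by
    rw [ae_all_iff]
    intro γ
    by_cases hne : ∃ y, (γ.1 : Hyp (k + j + 1) ≃ᵢ Hyp (k + j + 1)) (g (emb L y)) ≠ g (emb L y)
    · have h2 : ∀ᵐ y ∂(μHE[k] : Measure (Hyp k)), ¬γ • g (emb L y) = g (emb L y) := by
        rw [ae_iff]
        simp only [not_not]
        exact measure_fixedPoints_emb (mem_stabilizer_image γ) hne
      filter_upwards [h2] with y hy h3 using absurd h3 hy
    · push Not at hne
      refine Eventually.of_forall fun y _ => ?_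
      rintro _ ⟨_, ⟨z, rfl⟩, rfl⟩
      exact hne z
  filter_upwards [h1] with y hy
  have hyD : g (emb L y) ∈ D := ⟨_, ⟨y, rfl⟩, rfl⟩
  let e : MulAction.stabilizer (MulAction.stabilizer Γ D) (g (emb L y)) ≃
      {γ : Γ // ∀ x ∈ D, γ • x = x} :=
    { toFun := fun γ => ⟨γ.1.1, hy γ.1 γ.2⟩
      invFun := fun γ => ⟨⟨γ.1, by
        rw [MulAction.mem_stabilizer_iff]
        refine Set.Subset.antisymm ?_ fun x hx => ⟨x, hx, γ.2 x hx⟩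
        rintro _ ⟨x, hx, rfl⟩
        change γ.1 • x ∈ D
        rw [γ.2 x hx]
        exact hx⟩, γ.2 _ hyD⟩
      left_inv := fun _ => rfl
      right_inv := fun _ => rfl }
  rw [stabCard, Nat.card_congr e]

theorem card_fixing_ne_zero (hΓ : IsDiscreteGroup Γ) :
    Nat.card {γ : Γ // ∀ x ∈ g '' Set.range (emb L), γ • x = x} ≠ 0 := by
  have hfin := hΓ.isProperOn.finite_stabilizer (g (emb L origin))
  have : Finite {γ : Γ // ∀ x ∈ g '' Set.range (emb L), γ • x = x} := by
    refine Finite.of_injective (β := MulAction.stabilizer Γ (g (emb L origin)))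
      (fun γ => ⟨γ.1, γ.2 _ ⟨_, ⟨_, rfl⟩, rfl⟩⟩) fun a b h => ?_
    exact Subtype.ext (congrArg (fun c => c.1) h)
  have : Nonempty {γ : Γ // ∀ x ∈ g '' Set.range (emb L), γ • x = x} :=
    ⟨⟨1, fun x _ => one_smul _ _⟩⟩
  exact Nat.card_pos.ne'

/-- Unlike the unit normal bundle, the submanifold may have the same non-trivial stabiliser at
almost every point, which the unweighted volume of the quotient does not see. -/
theorem quotientVol_riemVol_totallyGeodesic (hΓ : IsDiscreteGroup Γ) {w : Hyp (k + j + 1) → ℝ≥0∞}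
    (hw : IsWeight (MulAction.stabilizer Γ (g '' Set.range (emb L))) w) :
    quotientVol (MulAction.stabilizer Γ (g '' Set.range (emb L)))
      (riemVol k (g '' Set.range (emb L))) =
      (Nat.card {γ : Γ // ∀ x ∈ g '' Set.range (emb L), γ • x = x} : ℕ) *
        ∫⁻ x, w x ∂riemVol k (g '' Set.range (emb L)) :=
  (hΓ.isProperAction.subgroup _).quotientVol_eq (map_stabilizer_riemVol k) hw
    (ae_stabCard_totallyGeodesic hΓ)

end

end Hyp

end

theorem mainTheorem11 (n : ℕ) (hn : 2 ≤ n)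
    (Γ : Subgroup (Hyp n ≃ᵢ Hyp n)) (hΓ : Hyp.IsDiscreteGroup Γ)
    (hvol : Hyp.quotientVol Γ (Hyp.riemVol n (Set.univ : Set (Hyp n))) < ∞)
    (μ : Hyp n → Measure (Bdry n)) (hμ : Hyp.IsPattersonDensity Γ μ)
    (hnorm : ∀ x, μ x Set.univ = Hyp.sphereVol (n - 1)) (x₀ : Hyp n) :
    -- the Bowen-Margulis measure
    (Hyp.inducedMeasure Γ (Hyp.bowenMargulis Γ μ x₀) =
        (2 : ℝ≥0∞) ^ (n - 1) • Hyp.quotientMeasure Γ Hyp.liouville ∧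
      Hyp.inducedMeasure Γ (Hyp.bowenMargulis Γ μ x₀) Set.univ =
        2 ^ (n - 1) * Hyp.sphereVol (n - 1) *
          Hyp.quotientVol Γ (Hyp.riemVol n (Set.univ : Set (Hyp n))) ∧
      (Hyp.inducedMeasure Γ (Hyp.bowenMargulis Γ μ x₀)).map (Hyp.quotientBase Γ) =
        (2 ^ (n - 1) * Hyp.sphereVol (n - 1)) •
          Hyp.quotientMeasure Γ (Hyp.riemVol n (Set.univ : Set (Hyp n)))) ∧
    -- horoballs
    (∀ (ξ : Bdry n) (p : Hyp n) (D : Set (Hyp n)), D = Hyp.horoball ξ p → ∀ s : Hyp.Sgn,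
      Hyp.skinning Γ μ x₀ s D = (2 : ℝ≥0∞) ^ (n - 1) • Hyp.normalVol (n - 1) s D ∧
      (Hyp.skinning Γ μ x₀ s D).map Hyp.UnitTangent.base =
        (2 : ℝ≥0∞) ^ (n - 1) • Hyp.riemVol (n - 1) (frontier D) ∧
      (Hyp.IsParabolicFixedPoint Γ ξ →
        Hyp.inducedMeasure Γ (Hyp.familySkinning Γ μ x₀ s D) Set.univ =
            2 ^ (n - 1) * Hyp.quotientVol (MulAction.stabilizer Γ D) (Hyp.normalVol (n - 1) s D) ∧
          Hyp.inducedMeasure Γ (Hyp.familySkinning Γ μ x₀ s D) Set.univ =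
            2 ^ (n - 1) * ((n - 1 : ℕ) : ℝ≥0∞) *
              Hyp.quotientVol (MulAction.stabilizer Γ D) (Hyp.riemVol n D))) ∧
    -- totally geodesic submanifolds
    (∀ (k : ℕ) (D : Set (Hyp n)), 1 ≤ k → k ≤ n - 1 → Hyp.IsTotallyGeodesic k D →
      Hyp.skinning Γ μ x₀ .plus D = Hyp.skinning Γ μ x₀ .minus D ∧
      ∀ s : Hyp.Sgn,
        Hyp.skinning Γ μ x₀ s D = Hyp.normalVol k s D ∧
        (Hyp.skinning Γ μ x₀ s D).map Hyp.UnitTangent.base =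
          Hyp.sphereVol (n - k - 1) • Hyp.riemVol k D ∧
        (Hyp.IsProperlyImmersed Γ D →
          Hyp.quotientVol (MulAction.stabilizer Γ D) (Hyp.riemVol k D) < ∞ →
          Hyp.inducedMeasure Γ (Hyp.familySkinning Γ μ x₀ s D) Set.univ =
              Hyp.quotientVol (MulAction.stabilizer Γ D) (Hyp.normalVol k s D) ∧
            ∀ m : ℕ, m = Nat.card {γ : Γ // ∀ x ∈ D, γ • x = x} →
              Hyp.inducedMeasure Γ (Hyp.familySkinning Γ μ x₀ s D) Set.univ =
                (m : ℝ≥0∞)⁻¹ * Hyp.sphereVol (n - k - 1) *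
                  Hyp.quotientVol (MulAction.stabilizer Γ D) (Hyp.riemVol k D))) := by
  obtain ⟨m, rfl⟩ : ∃ m, n = m + 1 := ⟨n - 1, by omega⟩
  have hm : 1 ≤ m := by omega
  simp only [Nat.add_sub_cancel] at hnorm ⊢
  have hδ : Hyp.critExp Γ = m := Hyp.critExp_eq hm hΓ hvol hμ hnorm
  -- from here on the Patterson density is the density of visual measures
  have hvis := hμ.eq_visual hm hδ hnorm
  have hbm := Hyp.inducedMeasure_bowenMargulis hm hΓ hδ hvis x₀
  refine ⟨⟨hbm, ?_, ?_⟩, ?_, ?_⟩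
  · rw [hbm, Measure.smul_apply, Hyp.quotientMeasure_liouville_univ hΓ, smul_eq_mul, mul_assoc]
  · rw [hbm, Measure.map_smul, Hyp.map_quotientBase_liouville hΓ, smul_smul]
  · rintro ξ p _ rfl s
    rw [Hyp.horoball_eq_hball]
    generalize Real.log (Hyp.poisson p ξ) = t
    have hsk : Hyp.skinning Γ μ x₀ s (Hyp.hball ξ t) =
        (2 : ℝ≥0∞) ^ m • Hyp.normalVol m s (Hyp.hball ξ t) := by
      rw [Hyp.skinning_hball hδ hvis, Hyp.normalVol_hball]
    have hbase : (Hyp.skinning Γ μ x₀ s (Hyp.hball ξ t)).map Hyp.UnitTangent.base =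
        (2 : ℝ≥0∞) ^ m • Hyp.riemVol m (frontier (Hyp.hball ξ t)) := by
      rw [hsk, Measure.map_smul, Hyp.normalVol_hball, Hyp.map_base_horoNormal]
    -- all the masses are integrals over the horosphere of one weight for the stabiliser
    obtain ⟨w, hw⟩ := hΓ.exists_isWeight_stabilizer (Hyp.hball ξ t)
    have hfam := Hyp.inducedMeasure_familySkinning hΓ hδ hvis x₀ (Hyp.isEndParam_hball s ξ t) hw
    rw [hbase, lintegral_smul_measure, smul_eq_mul] at hfam
    refine ⟨hsk, hbase, fun _ => ⟨?_, ?_⟩⟩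
    · rw [hfam, Hyp.quotientVol_normalVol_hball hm hΓ s ξ t hw]
    · have hm0 : (m : ℝ≥0∞) ≠ 0 := by exact_mod_cast (by omega : m ≠ 0)
      rw [hfam, Hyp.quotientVol_riemVol_hball hm hΓ ξ t hw, ← mul_assoc, mul_assoc (2 ^ m),
        ENNReal.mul_inv_cancel hm0 (ENNReal.natCast_ne_top m), mul_one]
  · intro k D _ hkm hD
    obtain ⟨j, rfl⟩ := Nat.exists_eq_add_of_le hkm
    obtain ⟨g, L, L', hLL, hsup, rfl⟩ := hD.exists_eq_image
    have hsk := fun s => Hyp.skinning_totallyGeodesic (g := g) hδ hvis x₀ s hLL hsup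
    have hbase : ∀ s, (Hyp.skinning Γ μ x₀ s (g '' Set.range (Hyp.emb L))).map
        Hyp.UnitTangent.base = Hyp.sphereVol j • Hyp.riemVol k (g '' Set.range (Hyp.emb L)) :=
      fun s => by rw [hsk s, Hyp.map_base_totallyGeodesic]
    have hj : k + j + 1 - k - 1 = j := by omega
    rw [hj]
    refine ⟨(hsk .plus).trans (hsk .minus).symm, fun s => ⟨?_, hbase s, fun _ _ => ?_⟩⟩
    · exact (hsk s).trans (Hyp.normalVol_totallyGeodesic hLL hsup s).symm
    -- all the masses are integrals over the submanifold of one weight for the stabiliser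
    obtain ⟨w, hw⟩ := hΓ.exists_isWeight_stabilizer (g '' Set.range (Hyp.emb L))
    obtain ⟨ν, Ω, hν⟩ := Hyp.exists_isEndParam_totallyGeodesic (g := g) hLL hsup s
    have hfam := Hyp.inducedMeasure_familySkinning hΓ hδ hvis x₀ hν hw
    rw [hbase s, lintegral_smul_measure, smul_eq_mul] at hfam
    refine ⟨?_, ?_⟩
    · rw [hfam, Hyp.quotientVol_normalVol_totallyGeodesic hΓ hδ hvis x₀ s hLL hsup hw]
    · rintro N rfl
      have hN : ((Nat.card {γ : Γ // ∀ x ∈ g '' Set.range (Hyp.emb L), γ • x = x} : ℕ) : ℝ≥0∞) ≠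
          0 := by
        exact_mod_cast Hyp.card_fixing_ne_zero hΓ
      rw [hfam, Hyp.quotientVol_riemVol_totallyGeodesic hΓ hw, mul_comm _ (Hyp.sphereVol j),
        mul_assoc, ← mul_assoc _ _ (∫⁻ x, w x ∂_), ENNReal.inv_mul_cancel hN
          (ENNReal.natCast_ne_top _), one_mul]
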